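/- For an even integer $m\ge 4$ let $Q_m\subset\mathbb R^3$ be a regular $m$-gon, and let $v_1v_2$ and $u_1u_2$ be two nondegenerate segments that are parallel to the plane of $Q_m$, orthogonal to each other, strictly on opposite sides of that plane, not parallel to any edge or diagonal of $Q_m$, and such that each of the four segments $v_iu_j$ meets the relative interior of $Q_m$. Let $P_m$ be the convex hull of $Q_m\cup v_1v_2\cup u_1u_2$. A dissection of $P_m$ is a set of tetrahedra with vertices among the vertices of $P_m$, no two having a common interior point, whose union is $P_m$; it is a triangulation if any two of its tetrahedra meet in a common (possibly empty) face, and mismatching otherwise. Its size is its number of tetrahedra. Such a configuration exists for every even $m\ge 4$, and for each such configuration: 1. $P_m$ is a simplicial $3$-polytope with exactly $m+4$ vertices, namely the vertices of $Q_m$ together with $v_1,v_2,u_1,u_2$. 2. No triangulation of $P_m$ has more than $\frac{7m}{2}+1$ tetrahedra. 3. $P_m$ has a mismatching dissection with exactly $4m-6$ tetrahedra. 4. Hence the maximal size of a dissection of $P_m$ is at least $4m-6$, the maximal size of a triangulation of $P_m$ is at most $\frac{7m}{2}+1$, and, with $n=m+4$ the number of vertices, the former exceeds the latter by at least $\frac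 n2-9$; so the gap grows at least linearly in the number of vertices. In particular, for $m>14$ the maximal dissections are strictly larger than the maximal triangulations, and every dissection of maximal size is mismatching. -/

import Mathlib

open Set

/-- Euclidean `d`-space. -/
abbrev Euc (d : ℕ) : Type := EuclideanSpace ℝ (Fin d)

/-- `σ` is the vertex set of a `d`-simplex in `d`-space all of whose vertices belong to `A`. -/
structure IsFullSimplexIn {d : ℕ} (A : Set (Euc d)) (σ : Finset (Euc d)) : Prop where
  subset : (σ : Set (Euc d)) ⊆ A
  card : σ.card = d + 1
  affineIndependent : AffineIndependent ℝ (fun x : σ => (x : Euc d))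

/-- A dissection of the point configuration `A`: a finite set of `d`-simplices (each given by its
vertex set) with vertices in `A`, no two of which have an interior point in common, and whose
union is the convex hull of `A`. -/
structure IsDissection {d : ℕ} (A : Set (Euc d)) (D : Finset (Finset (Euc d))) : Prop where
  simplex : ∀ σ ∈ D, IsFullSimplexIn A σ
  interior_disjoint : ∀ σ ∈ D, ∀ τ ∈ D, σ ≠ τ →
    Disjoint (interior (convexHull ℝ (σ : Set (Euc d))))
      (interior (convexHull ℝ (τ : Set (Euc d))))
  cover : (⋃ σ ∈ D, convexHull ℝ (σ : Set (Euc d))) = convexHull ℝ A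

/-- A triangulation: a dissection in which any two simplices meet in a common
(possibly empty) face. -/
structure IsTriangulation {d : ℕ} (A : Set (Euc d)) (D : Finset (Finset (Euc d))) : Prop
    extends IsDissection A D where
  face_to_face : ∀ σ ∈ D, ∀ τ ∈ D, ∃ ρ : Finset (Euc d), ρ ⊆ σ ∧ ρ ⊆ τ ∧
    convexHull ℝ (σ : Set (Euc d)) ∩ convexHull ℝ (τ : Set (Euc d)) =
      convexHull ℝ (ρ : Set (Euc d))

/-- A mismatching dissection: a dissection that is not a triangulation. -/
def IsMismatchingDissection {d : ℕ} (A : Set (Euc d)) (D : Finset (Finset (Euc d))) : Prop :=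
  IsDissection A D ∧ ¬ IsTriangulation A D

/-- The set of sizes of dissections of `A`. -/
def dissectionSizes {d : ℕ} (A : Set (Euc d)) : Set ℕ :=
  {k | ∃ D : Finset (Finset (Euc d)), IsDissection A D ∧ D.card = k}

/-- The set of sizes of triangulations of `A`. -/
def triangulationSizes {d : ℕ} (A : Set (Euc d)) : Set ℕ :=
  {k | ∃ D : Finset (Finset (Euc d)), IsTriangulation A D ∧ D.card = k}

/-- `P` is a full-dimensional simplicial polytope in `d`-space: the convex hull of finitely many
points, of dimension `d`, all of whose proper faces are simplices. -/
structure IsSimplicialPolytope {d : ℕ} (P : Set (Euc d)) : Prop where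
  polytope : ∃ S : Finset (Euc d), P = convexHull ℝ (S : Set (Euc d))
  dim : Module.finrank ℝ (vectorSpan ℝ P) = d
  simplicial : ∀ F : Set (Euc d), IsExposed ℝ P F → F ≠ P →
    ∃ S : Finset (Euc d), AffineIndependent ℝ (fun x : S => (x : Euc d)) ∧
      F = convexHull ℝ (S : Set (Euc d))

/-- `q` lists in cyclic order the vertices of a regular `m`-gon in some plane of 3-space, with
some centre `c` and some circumradius `r > 0`. -/
def IsRegularPolygon (m : ℕ) (q : Fin m → Euc 3) : Prop :=
  3 ≤ m ∧ ∃ (c a b : Euc 3) (r : ℝ), 0 < r ∧ Orthonormal ℝ ![a, b] ∧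
    ∀ k : Fin m, q k =
      c + (r * Real.cos (2 * Real.pi * (k : ℕ) / m)) • a
        + (r * Real.sin (2 * Real.pi * (k : ℕ) / m)) • b

/-- The configuration defining `P_m`: `m` is even, `q` is a regular `m`-gon `Q_m`, and
`v 0, v 1` and `u 0, u 1` are the ends of two edges parallel to the plane of `Q_m`, orthogonal to
each other, on opposite sides of that plane, not parallel to any edge or diagonal of `Q_m`, such
that the four segments from a `v i` to a `u j` meet the (relative) interior of `Q_m`. -/
structure IsPmConfiguration (m : ℕ) (q : Fin m → Euc 3) (v u : Fin 2 → Euc 3) : Prop where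
  even : Even m
  regular : IsRegularPolygon m q
  v_ne : v 0 ≠ v 1
  u_ne : u 0 ≠ u 1
  v_parallel : v 1 - v 0 ∈ (affineSpan ℝ (range q)).direction
  u_parallel : u 1 - u 0 ∈ (affineSpan ℝ (range q)).direction
  orthogonal : inner ℝ (v 1 - v 0) (u 1 - u 0) = 0
  opposite : ∀ i j, (affineSpan ℝ (range q)).SOppSide (v i) (u j)
  crossing : ∀ i j,
    (segment ℝ (v i) (u j) ∩ intrinsicInterior ℝ (convexHull ℝ (range q))).Nonempty
  v_generic : ∀ j k, j ≠ k →
    ¬ (affineSpan ℝ {v 0, v 1}).Parallel (affineSpan ℝ {q j, q k})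
  u_generic : ∀ j k, j ≠ k →
    ¬ (affineSpan ℝ {u 0, u 1}).Parallel (affineSpan ℝ {q j, q k})

/-- The polytope `P_m`: the convex hull of the `m`-gon and the two edges. -/
def polytopePm {m : ℕ} (q : Fin m → Euc 3) (v u : Fin 2 → Euc 3) : Set (Euc 3) :=
  convexHull ℝ (range q ∪ range v ∪ range u)

/-- The set of vertices of `P_m`. -/
def verticesPm {m : ℕ} (q : Fin m → Euc 3) (v u : Fin 2 → Euc 3) : Set (Euc 3) :=
  (polytopePm q v u).extremePoints ℝ

/-!
The polygon cuts the polytope into two halves, one with each of the two edges `v 0, v 1` and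
`u 0, u 1`. A dissection may treat the two halves independently, while the tetrahedra of a
triangulation must fit together along the polygon; this makes the difference.

In coordinates adapted to the configuration (`Frame`) the polygon lies in the plane `Z = 0`, the edge
`v` above it is parallel to the `X`-axis, and the edge `u` below is parallel to the `Y`-axis.
Exchanging the edges is the symmetry `Frame.swap`, so that most statements are needed for one edge
only. Sorted by their `Y`-coordinates, the vertices of the polygon alternate between its two sides,
and consecutive vertices form a zigzag of chords that are almost parallel to the edge `v`.

*A large dissection.* The `m - 1` chords of the zigzag together with the edge `v` span `m - 1`
tetrahedra; the remaining part of the upper half is filled by the `m - 2` tetrahedra over triples of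
consecutive vertices of the zigzag with an apex at one end of `v` (`Frame.exists_half`). Both halves
together have `4 * m - 6` tetrahedra. As the edges are orthogonal, the zigzag of `u` is that of `v`
turned by a right angle, and chords of the two zigzags cross near the centre (`Frame.exists_cross`),
so that the dissection is mismatching (`Frame.exists_mismatching`).

*The size of triangulations.* A tetrahedron either joins the two edges, or has one vertex on an edge
and a triangle in the polygon as a face, or consists of one of the edges and a chord.

The tetrahedra of the first two kinds have cells in the polygon with vertices among those of the
polygon and the at most four crossing points, in which the segments from `v i` to `u j` meet it. If
each cell is charged to its middle vertex with respect to a generic direction, a vertex of the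
polygon is charged at most once and a crossing point at most twice (`PlaneCoord.card_le`). So, if `k`
crossing points are used, there are at most `m - 2 + 2 * k` cells seen from above
(`Frame.card_mid_add_card_face`), while the triangles seen from below are at most `m - 2`, and at most
`m - 3` as soon as a cell of the first kind has a vertex of the polygon (`Frame.card_faceTets'`).

The tetrahedra of the third kind at the edge `v` are met one after the other by a half-plane turning
around this edge (`Frame.wedge_unique`). Each of them covers at least two of the `m - 1` gaps between
the `Y`-coordinates of the vertices, unless its chord belongs to the zigzag. Chords of the two
zigzags that cross exclude each other, and a matching argument (`Excl.card_add_card_le`) shows that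
at most `m + 2` zigzag chords occur for both edges together. This gives at most `3 * m / 2 - 1`
tetrahedra of the third kind (`Frame.card_edgeTets_le`).

The sum of these bounds is good enough except when all four crossing points are used; then it exceeds
`7 * m / 2 + 1` by one. One tetrahedron is saved if a chord in the triangulation separates two
crossing points, for then triangles are lost on both sides of the chord
(`Frame.card_faceTets_of_chord`); or if the tetrahedron spanned by the two edges occurs, whose
quadrangular cell counts twice (`Frame.card_mid_add_card_face'`). Otherwise the half-plane turning
around an edge meets, near the ends of the other edge, tetrahedra that are not of the third kind, and
these take up gaps (`Frame.card_edgeTets_of_crowded`).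

Finally, the maximal size of a triangulation is only defined if there is a triangulation at all.
One is obtained by projecting the lower hull of the vertices lifted to generic heights
(`exists_isTriangulation`).
-/

open Filter Topology

/-! ### Affine functions and barycentric coordinates -/

section Affine

variable {d : ℕ}

lemma affine_eq_linear_add (f : Euc d →ᵃ[ℝ] ℝ) (p : Euc d) : f p = f.linear p + f 0 :=
  congrFun f.decomp p

lemma affine_sum (f : Euc d →ᵃ[ℝ] ℝ) (s : Finset (Euc d)) (c : Euc d → ℝ)
    (hc : ∑ w ∈ s, c w = 1) : f (∑ w ∈ s, c w • w) = ∑ w ∈ s, c w * f w := by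
  rw [affine_eq_linear_add, map_sum]
  have : ∀ w ∈ s, c w * f w = f.linear (c w • w) + c w * f 0 := by
    intro w _
    rw [affine_eq_linear_add f w, map_smul, smul_eq_mul]; ring
  rw [Finset.sum_congr rfl this, Finset.sum_add_distrib, ← Finset.sum_mul, hc, one_mul]

lemma affine_comb₂ (f : Euc d →ᵃ[ℝ] ℝ) {a b : ℝ} (p q : Euc d) (h : a + b = 1) :
    f (a • p + b • q) = a * f p + b * f q := by
  simpa using Convex.combo_affine_apply (f := f) (x := p) (y := q) h

lemma affine_comb₃ (f : Euc d →ᵃ[ℝ] ℝ) {a b c : ℝ} (p q w : Euc d) (h : a + b + c = 1) :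
    f (a • p + b • q + c • w) = a * f p + b * f q + c * f w := by
  rw [affine_eq_linear_add f, affine_eq_linear_add f p, affine_eq_linear_add f q,
    affine_eq_linear_add f w]
  simp only [map_add, map_smul, smul_eq_mul]
  linear_combination (-(f 0)) * h

lemma affine_comb₃_zero (f : Euc d →ᵃ[ℝ] ℝ) {a b c : ℝ} {p q w : Euc d} (h : a + b + c = 0)
    (h0 : a • p + b • q + c • w = 0) : a * f p + b * f q + c * f w = 0 := by
  rw [affine_eq_linear_add f p, affine_eq_linear_add f q, affine_eq_linear_add f w]
  have := congrArg f.linear h0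
  simp only [map_add, map_smul, smul_eq_mul, map_zero] at this
  linear_combination this + (f 0) * h

lemma affine_comb₄_zero (f : Euc d →ᵃ[ℝ] ℝ) {a b c e : ℝ} {p q w z : Euc d}
    (h : a + b + c + e = 0) (h0 : a • p + b • q + c • w + e • z = 0) :
    a * f p + b * f q + c * f w + e * f z = 0 := by
  rw [affine_eq_linear_add f p, affine_eq_linear_add f q, affine_eq_linear_add f w,
    affine_eq_linear_add f z]
  have := congrArg f.linear h0
  simp only [map_add, map_smul, smul_eq_mul, map_zero] at this
  linear_combination this + (f 0) * h

lemma affine_add_smul (f : Euc d →ᵃ[ℝ] ℝ) (p e : Euc d) (t : ℝ) :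
    f (p + t • e) = f p + t * f.linear e := by
  rw [affine_eq_linear_add, affine_eq_linear_add f p]
  simp only [map_add, map_smul, smul_eq_mul]; ring

lemma affine_linear_sub (f : Euc d →ᵃ[ℝ] ℝ) (p q : Euc d) :
    f.linear (p - q) = f p - f q := by
  rw [affine_eq_linear_add f p, affine_eq_linear_add f q, map_sub]; ring

lemma affine_continuous (f : Euc d →ᵃ[ℝ] ℝ) : Continuous f :=
  f.continuous_of_finiteDimensional

lemma affine_convexHull_le (f : Euc d →ᵃ[ℝ] ℝ) {s : Set (Euc d)} {M : ℝ}
    (h : ∀ w ∈ s, f w ≤ M) {p : Euc d} (hp : p ∈ convexHull ℝ s) : f p ≤ M := by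
  have : convexHull ℝ s ⊆ f ⁻¹' (Iic M) :=
    convexHull_min (fun w hw => h w hw) ((convex_Iic M).affine_preimage f)
  exact this hp

lemma affine_le_convexHull (f : Euc d →ᵃ[ℝ] ℝ) {s : Set (Euc d)} {M : ℝ}
    (h : ∀ w ∈ s, M ≤ f w) {p : Euc d} (hp : p ∈ convexHull ℝ s) : M ≤ f p := by
  have : convexHull ℝ s ⊆ f ⁻¹' (Ici M) :=
    convexHull_min (fun w hw => h w hw) ((convex_Ici M).affine_preimage f)
  exact this hp

/-- A nonconstant affine function that is nonpositive on a set is negative on its interior. -/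
lemma affine_neg_of_mem_interior (g : Euc d →ᵃ[ℝ] ℝ) {s : Set (Euc d)} (h : ∀ w ∈ s, g w ≤ 0)
    {a b : Euc d} (hab : g a ≠ g b) {p : Euc d} (hp : p ∈ interior s) : g p < 0 := by
  rcases lt_or_eq_of_le (h p (interior_subset hp)) with h1 | h1
  · exact h1
  exfalso
  have hlin : g.linear (a - b) ≠ 0 := by rw [affine_linear_sub]; exact sub_ne_zero.2 hab
  have hcont : Continuous fun t : ℝ => p + (t * g.linear (a - b)) • (a - b) := by fun_prop
  have hnear : ∀ᶠ t in 𝓝 (0 : ℝ), p + (t * g.linear (a - b)) • (a - b) ∈ s := by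
    have := hcont.continuousAt (x := 0)
    refine this.eventually_mem ?_
    simpa using mem_interior_iff_mem_nhds.1 hp
  obtain ⟨ε, hε, hball⟩ := Metric.eventually_nhds_iff.1 hnear
  have h2 := h _ (hball (y := ε / 2) (by simp [abs_of_pos hε]; linarith))
  rw [affine_add_smul, h1] at h2
  have : 0 < ε / 2 * g.linear (a - b) * g.linear (a - b) := by
    rw [mul_assoc]; exact mul_pos (by linarith) (mul_self_pos.2 hlin)
  linarith

/-- Two simplices that are weakly separated by a plane have disjoint interiors. -/
lemma disjoint_interior_of_separated (g : Euc d →ᵃ[ℝ] ℝ) {σ τ : Set (Euc d)}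
    (hσ : ∀ w ∈ σ, g w ≤ 0) (hτ : ∀ w ∈ τ, 0 ≤ g w) {a b : Euc d} (hab : g a ≠ g b) :
    Disjoint (interior (convexHull ℝ σ)) (interior (convexHull ℝ τ)) := by
  rw [Set.disjoint_left]
  intro p hp hp'
  have h1 := affine_neg_of_mem_interior g (fun w hw => affine_convexHull_le g hσ hw) hab hp
  have h2 := affine_le_convexHull g hτ (interior_subset hp')
  linarith

/-- `lam` is the system of barycentric coordinates of the full-dimensional simplex with
vertex set `σ`; only the values `lam w` for `w ∈ σ` matter. -/
structure IsBary (σ : Finset (Euc d)) (lam : Euc d → Euc d →ᵃ[ℝ] ℝ) : Prop where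
  self : ∀ w ∈ σ, lam w w = 1
  other : ∀ w ∈ σ, ∀ w' ∈ σ, w' ≠ w → lam w w' = 0
  sum : ∀ p, ∑ w ∈ σ, lam w p = 1
  comb : ∀ p, ∑ w ∈ σ, lam w p • w = p
  hull : ∀ p, p ∈ convexHull ℝ (σ : Set (Euc d)) ↔ ∀ w ∈ σ, 0 ≤ lam w p
  int : ∀ p, p ∈ interior (convexHull ℝ (σ : Set (Euc d))) ↔ ∀ w ∈ σ, 0 < lam w p

lemma IsFullSimplexIn.exists_bary {A : Set (Euc d)} {σ : Finset (Euc d)}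
    (h : IsFullSimplexIn A σ) : ∃ lam, IsBary σ lam := by
  classical
  have htop : affineSpan ℝ (range (fun x : σ => (x : Euc d))) = ⊤ := by
    rw [h.affineIndependent.affineSpan_eq_top_iff_card_eq_finrank_add_one]
    simp [h.card]
  let B : AffineBasis σ ℝ (Euc d) := ⟨fun x => (x : Euc d), h.affineIndependent, htop⟩
  have hB : ∀ x : σ, B x = (x : Euc d) := fun x => rfl
  have hr : range B = (σ : Set (Euc d)) := by
    ext x; simp [hB]
  let lam : Euc d → Euc d →ᵃ[ℝ] ℝ := fun w => if hw : w ∈ σ then B.coord ⟨w, hw⟩ else 0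
  have hl : ∀ w (hw : w ∈ σ), lam w = B.coord ⟨w, hw⟩ := fun w hw => by simp [lam, hw]
  refine ⟨lam, ?_, ?_, ?_, ?_, ?_, ?_⟩
  · intro w hw
    rw [hl w hw]
    exact B.coord_apply_eq ⟨w, hw⟩
  · intro w hw w' hw' hne
    rw [hl w hw]
    exact B.coord_apply_ne (i := ⟨w, hw⟩) (j := ⟨w', hw'⟩) (fun h => hne (by simpa using h.symm))
  · intro p
    rw [← B.sum_coord_apply_eq_one p, ← Finset.sum_coe_sort σ]
    exact Finset.sum_congr rfl fun w _ => by rw [hl w w.2]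
  · intro p
    conv_rhs => rw [← B.linear_combination_coord_eq_self p]
    rw [← Finset.sum_coe_sort σ]
    exact Finset.sum_congr rfl fun w _ => by rw [hl w w.2, hB]
  · intro p
    rw [← hr, B.convexHull_eq_nonneg_coord]
    constructor
    · intro hp w hw
      rw [hl w hw]; exact hp ⟨w, hw⟩
    · intro hp w
      have := hp w w.2
      rwa [hl w w.2] at this
  · intro p
    rw [← hr, B.interior_convexHull]
    constructor
    · intro hp w hw
      rw [hl w hw]; exact hp ⟨w, hw⟩
    · intro hp w
      have := hp w w.2
      rwa [hl w w.2] at this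

namespace IsBary

variable {σ : Finset (Euc d)} {lam : Euc d → Euc d →ᵃ[ℝ] ℝ}

lemma affine_eq (h : IsBary σ lam) (f : Euc d →ᵃ[ℝ] ℝ) (p : Euc d) :
    f p = ∑ w ∈ σ, lam w p * f w := by
  conv_lhs => rw [← h.comb p]
  exact affine_sum f σ _ (h.sum p)

lemma interior_nonempty (h : IsBary σ lam) (hσ : σ.Nonempty) :
    (interior (convexHull ℝ (σ : Set (Euc d)))).Nonempty := by
  have hc : (0 : ℝ) < σ.card := by exact_mod_cast hσ.card_pos
  refine ⟨∑ w ∈ σ, (σ.card : ℝ)⁻¹ • w, (h.int _).2 fun w hw => ?_⟩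
  rw [affine_sum (lam w) σ (fun _ => (σ.card : ℝ)⁻¹) (by simp [hc.ne'])]
  rw [Finset.sum_eq_single_of_mem w hw (fun w' hw' hne => by rw [h.other w hw w' hw' hne, mul_zero]),
    h.self w hw]
  positivity

/-- A point of the hull of `ρ ⊆ σ` has vanishing coordinates outside `ρ`. -/
lemma mem_of_pos (h : IsBary σ lam) {ρ : Finset (Euc d)} (hρ : ρ ⊆ σ) {p : Euc d}
    (hp : p ∈ convexHull ℝ (ρ : Set (Euc d))) {w : Euc d} (hw : w ∈ σ) (hpos : 0 < lam w p) :
    w ∈ ρ := by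
  by_contra hn
  have := affine_convexHull_le (lam w) (M := 0) (s := ρ) (fun w' hw' => by
    rw [h.other w hw w' (hρ hw') (fun h => hn (h ▸ hw'))]) hp
  linarith

/-- Moving off a point of the closed simplex in a direction that increases all vanishing
coordinates leads into the interior. -/
lemma eventually_mem_interior (h : IsBary σ lam) {p e : Euc d}
    (hp : ∀ w ∈ σ, 0 < lam w p ∨ (lam w p = 0 ∧ 0 < (lam w).linear e)) :
    ∀ᶠ t in 𝓝[>] (0 : ℝ), p + t • e ∈ interior (convexHull ℝ (σ : Set (Euc d))) := by
  have : ∀ w ∈ σ, ∀ᶠ t in 𝓝[>] (0 : ℝ), 0 < lam w (p + t • e) := by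
    intro w hw
    rcases hp w hw with h1 | ⟨h1, h2⟩
    · have hc : Continuous fun t : ℝ => lam w (p + t • e) :=
        (affine_continuous (lam w)).comp (by fun_prop)
      have := hc.continuousAt (x := 0)
      refine (this.eventually (lt_mem_nhds ?_)).filter_mono nhdsWithin_le_nhds
      simpa using h1
    · filter_upwards [self_mem_nhdsWithin] with t ht
      rw [affine_add_smul, h1, zero_add]
      exact mul_pos ht h2
  filter_upwards [(eventually_all_finset σ).2 this] with t ht
  exact (h.int _).2 ht

end IsBary

/-- A point in the relative interior of an edge of a triangulation lies only in those simplices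
that have this edge. This is the only consequence of the face-to-face condition that the bounds
use: it keeps edges of a triangulation from crossing each other. -/
lemma IsTriangulation.mem_of_openSegment {A : Set (Euc d)} {T : Finset (Finset (Euc d))}
    (hT : IsTriangulation A T) {σ τ : Finset (Euc d)} (hσ : σ ∈ T) (hτ : τ ∈ T) {a b s : Euc d}
    (ha : a ∈ σ) (hb : b ∈ σ) (hs : s ∈ openSegment ℝ a b)
    (hsτ : s ∈ convexHull ℝ (τ : Set (Euc d))) : a ∈ τ ∧ b ∈ τ := by
  obtain ⟨ρ, h1, h2, h3⟩ := hT.face_to_face σ hσ τ hτ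
  obtain ⟨lam, hl⟩ := (hT.simplex σ hσ).exists_bary
  have hsσ : s ∈ convexHull ℝ (σ : Set (Euc d)) :=
    (convex_convexHull ℝ _).segment_subset (subset_convexHull ℝ _ ha) (subset_convexHull ℝ _ hb)
      (openSegment_subset_segment ℝ a b hs)
  have hsρ : s ∈ convexHull ℝ (ρ : Set (Euc d)) := by rw [← h3]; exact ⟨hsσ, hsτ⟩
  obtain ⟨x, y, hx, hy, hxy, rfl⟩ := hs
  have hnn : ∀ w ∈ σ, ∀ z ∈ σ, 0 ≤ lam w z := by
    intro w hw z hz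
    by_cases h : z = w
    · subst h; rw [hl.self z hz]; norm_num
    · rw [hl.other w hw z hz h]
  constructor
  · refine h2 (hl.mem_of_pos h1 hsρ ha ?_)
    rw [affine_comb₂ _ _ _ hxy, hl.self a ha]
    have := hnn a ha b hb
    nlinarith
  · refine h2 (hl.mem_of_pos h1 hsρ hb ?_)
    rw [affine_comb₂ _ _ _ hxy, hl.self b hb]
    have := hnn b hb a ha
    nlinarith

/-- Four points of 3-space satisfying no nontrivial affine relation span a tetrahedron. -/
lemma isFullSimplexIn_of_indep {A : Set (Euc 3)} {a b c e : Euc 3} (ha : a ∈ A) (hb : b ∈ A)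
    (hc : c ∈ A) (he : e ∈ A)
    (h : ∀ x y z t : ℝ, x + y + z + t = 0 → x • a + y • b + z • c + t • e = 0 →
      x = 0 ∧ y = 0 ∧ z = 0 ∧ t = 0) : IsFullSimplexIn A ({a, b, c, e} : Finset (Euc 3)) := by
  classical
  have hind : AffineIndependent ℝ ![a, b, c, e] := by
    rw [affineIndependent_iff]
    intro s w hw0 hw i hi
    classical
    let w' : Fin 4 → ℝ := fun i => if i ∈ s then w i else 0
    have e1 : ∑ i, w' i = 0 := by
      rw [← hw0]; simp [w', Finset.sum_ite_mem]
    have e2 : ∑ i, w' i • (![a, b, c, e] i) = 0 := by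
      rw [← hw]; simp only [w', ite_smul, zero_smul, Finset.sum_ite_mem, Finset.univ_inter]
    simp only [Fin.sum_univ_four] at e1 e2
    have := h _ _ _ _ e1 e2
    have hi' : w i = w' i := by simp [w', hi]
    rw [hi']
    fin_cases i
    · exact this.1
    · exact this.2.1
    · exact this.2.2.1
    · exact this.2.2.2
  have hrange : range ![a, b, c, e] = (({a, b, c, e} : Finset (Euc 3)) : Set (Euc 3)) := by
    ext x; simp [Matrix.range_cons]; tauto
  refine ⟨?_, ?_, ?_⟩
  · intro x hx
    simp only [Finset.coe_insert, Finset.coe_singleton, mem_insert_iff, mem_singleton_iff] at hx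
    rcases hx with rfl | rfl | rfl | rfl <;> assumption
  · have : ({a, b, c, e} : Finset (Euc 3)) = Finset.univ.image ![a, b, c, e] := by
      apply Finset.coe_injective
      rw [← hrange]; simp
    rw [this, Finset.card_image_of_injective _ hind.injective]; simp
  · have := hind.range
    have h2 : ∀ S : Set (Euc 3), S = range ![a, b, c, e] →
        AffineIndependent ℝ (fun x : S => (x : Euc 3)) := by
      intro S hS; subst hS; exact this
    exact h2 _ hrange.symm

end Affine

/-! ### Existence of triangulations -/

section Existence

variable {d : ℕ}

/-- The affine function interpolating the heights `ω` at the vertices of a simplex. -/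
noncomputable def interp (lam : Euc d → Euc d →ᵃ[ℝ] ℝ) (σ : Finset (Euc d)) (ω : Euc d → ℝ) :
    Euc d →ᵃ[ℝ] ℝ := ∑ w ∈ σ, ω w • lam w

lemma interp_apply (lam : Euc d → Euc d →ᵃ[ℝ] ℝ) (σ : Finset (Euc d)) (ω : Euc d → ℝ)
    (p : Euc d) : interp lam σ ω p = ∑ w ∈ σ, lam w p * ω w := by
  classical
  unfold interp
  induction σ using Finset.induction_on with
  | empty => simp
  | insert a s ha ih =>
    rw [Finset.sum_insert ha, Finset.sum_insert ha, AffineMap.coe_add, Pi.add_apply, ih]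
    simp [mul_comm]

lemma IsBary.interp_vertex {σ : Finset (Euc d)} {lam : Euc d → Euc d →ᵃ[ℝ] ℝ} (h : IsBary σ lam)
    (ω : Euc d → ℝ) {w : Euc d} (hw : w ∈ σ) : interp lam σ ω w = ω w := by
  rw [interp_apply, Finset.sum_eq_single_of_mem w hw, h.self w hw, one_mul]
  intro b hb hne
  rw [h.other b hb w hw hne.symm, zero_mul]

/-- Heights for which no point of `A` outside a simplex is lifted to the hyperplane through its
lifted vertices: each such incidence is a proper linear condition on the heights. -/
lemma exists_generic_heights (A : Finset (Euc d)) (S : Finset (Finset (Euc d)))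
    (lam : Finset (Euc d) → Euc d → Euc d →ᵃ[ℝ] ℝ) :
    ∃ ω : Euc d → ℝ, ∀ σ ∈ S, ∀ a ∈ A, a ∉ σ → ω a ≠ interp (lam σ) σ ω a := by
  classical
  let L : Finset (Euc d) → Euc d → (Euc d → ℝ) →ₗ[ℝ] ℝ := fun σ a =>
    LinearMap.proj a - ∑ w ∈ σ, lam σ w a • LinearMap.proj (R := ℝ) (φ := fun _ : Euc d => ℝ) w
  have hL : ∀ σ a ω, L σ a ω = ω a - interp (lam σ) σ ω a := by
    intro σ a ω
    simp [L, interp_apply]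
  let F : Finset (Subspace ℝ (Euc d → ℝ)) :=
    ((S ×ˢ A).filter fun x => x.2 ∉ x.1).image fun x => LinearMap.ker (L x.1 x.2)
  have hF : (⊤ : Subspace ℝ (Euc d → ℝ)) ∉ F := by
    intro h
    simp only [F, Finset.mem_image, Finset.mem_filter] at h
    obtain ⟨⟨σ, a⟩, ⟨_, h2⟩, h3⟩ := h
    have : Pi.single a (1 : ℝ) ∈ LinearMap.ker (L σ a) := by
      simp only at h3; rw [h3]; trivial
    rw [LinearMap.mem_ker, hL, interp_apply, Finset.sum_eq_zero] at this
    · simp at this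
    · intro w hw
      have hwa : w ≠ a := by rintro rfl; exact h2 hw
      rw [Pi.single_eq_of_ne hwa, mul_zero]
  have hne := Subspace.biUnion_ne_univ_of_top_notMem hF
  obtain ⟨ω, hω⟩ := (Set.ne_univ_iff_exists_notMem _).1 hne
  refine ⟨ω, fun σ hσ a ha has heq => hω ?_⟩
  simp only [mem_iUnion]
  refine ⟨LinearMap.ker (L σ a), ?_, ?_⟩
  · simp only [F, Finset.mem_image, Finset.mem_filter, Finset.mem_product]
    exact ⟨(σ, a), ⟨⟨hσ, ha⟩, has⟩, rfl⟩
  · change ω ∈ LinearMap.ker (L σ a)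
    rw [LinearMap.mem_ker, hL, heq, sub_self]

/-- A nonempty open set has a point in no affine span of at most `d` points of `A`: these spans are
finitely many null sets. -/
lemma exists_generic_point (A : Finset (Euc d)) {V : Set (Euc d)} (hV : IsOpen V)
    (hne : V.Nonempty) :
    ∃ y ∈ V, ∀ B ⊆ A, B.card ≤ d → y ∉ affineSpan ℝ (B : Set (Euc d)) := by
  classical
  let F := A.powerset.filter fun B => B.card ≤ d
  have hz : ∀ B ∈ F, MeasureTheory.volume ((affineSpan ℝ (B : Set (Euc d)) : Set (Euc d))) = 0 := by
    intro B hB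
    refine MeasureTheory.Measure.addHaar_affineSubspace _ _ fun htop => ?_
    have hBc : B.card ≤ d := (Finset.mem_filter.1 hB).2
    rcases B.eq_empty_or_nonempty with rfl | hBn
    · simp only [Finset.coe_empty, AffineSubspace.span_empty] at htop
      exact bot_ne_top htop
    · have h1 : Module.finrank ℝ (vectorSpan ℝ (B : Set (Euc d))) = d := by
        rw [← direction_affineSpan, htop, AffineSubspace.direction_top, finrank_top]; simp
      have hr : (B : Set (Euc d)) = (B.image id : Finset (Euc d)) := by simp
      have h2 := finrank_vectorSpan_image_finset_le ℝ (id : Euc d → Euc d) B (n := B.card - 1)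
        (by have := hBn.card_pos; omega)
      rw [← hr, h1] at h2
      have := hBn.card_pos
      omega
  have hz' : MeasureTheory.volume
      (⋃ B ∈ F, (affineSpan ℝ (B : Set (Euc d)) : Set (Euc d))) = 0 :=
    (MeasureTheory.measure_biUnion_null_iff F.countable_toSet).2 hz
  have hpos := hV.measure_pos MeasureTheory.volume hne
  obtain ⟨y, hyV, hy⟩ : (V \ ⋃ B ∈ F, (affineSpan ℝ (B : Set (Euc d)) : Set (Euc d))).Nonempty := by
    rw [Set.nonempty_iff_ne_empty]
    intro h
    rw [Set.sdiff_eq_empty] at h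
    have := MeasureTheory.measure_mono_null h hz'
    exact hpos.ne' this
  refine ⟨y, hyV, fun B hB hc hyB => hy ?_⟩
  simp only [mem_iUnion]
  exact ⟨B, Finset.mem_filter.2 ⟨Finset.mem_powerset.2 hB, hc⟩, hyB⟩

/-- The vertices of a simplex of minimal height above a generic point `y`: no vertex of `A` lies
below the simplex, since exchanging it for a vertex of the simplex would lower the height. -/
lemma exists_lower_simplex (A : Finset (Euc d)) (S : Finset (Finset (Euc d)))
    (hS : ∀ σ, σ ∈ S ↔ IsFullSimplexIn (A : Set (Euc d)) σ)
    (lam : Finset (Euc d) → Euc d → Euc d →ᵃ[ℝ] ℝ) (hlam : ∀ σ ∈ S, IsBary σ (lam σ))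
    (ω : Euc d → ℝ) {y : Euc d} (hy : y ∈ convexHull ℝ (A : Set (Euc d)))
    (hgen : ∀ B ⊆ A, B.card ≤ d → y ∉ affineSpan ℝ (B : Set (Euc d))) :
    ∃ σ ∈ S, y ∈ convexHull ℝ (σ : Set (Euc d)) ∧
      ∀ a ∈ A, a ∉ σ → interp (lam σ) σ ω a ≤ ω a := by
  classical
  -- by genericity of `y`, Carathéodory's theorem yields full-dimensional simplices
  have carath : ∀ B ⊆ A, y ∈ convexHull ℝ (B : Set (Euc d)) →
      ∃ t ⊆ B, t ∈ S ∧ y ∈ convexHull ℝ (t : Set (Euc d)) := by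
    intro B hB hyB
    rw [convexHull_eq_union] at hyB
    simp only [mem_iUnion] at hyB
    obtain ⟨t, ht1, ht2, ht3⟩ := hyB
    have htB : t ⊆ B := by exact_mod_cast ht1
    refine ⟨t, htB, (hS t).2 ⟨fun x hx => hB (htB hx), ?_, ht2⟩, ht3⟩
    have h1 : t.card ≤ d + 1 := by
      have := ht2.card_le_finrank_succ
      simp only [Fintype.card_coe] at this
      refine this.trans (Nat.succ_le_succ ?_)
      refine (Submodule.finrank_le _).trans ?_
      simp
    by_contra hne
    exact hgen t (htB.trans hB) (by omega) (convexHull_subset_affineSpan _ ht3)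
  have hne : (Finset.filter (fun σ : Finset (Euc d) => y ∈ convexHull ℝ (σ : Set (Euc d))) S).Nonempty := by
    obtain ⟨t, _, h2, h3⟩ := carath A subset_rfl hy
    exact ⟨t, Finset.mem_filter.2 ⟨h2, h3⟩⟩
  obtain ⟨σ, hσ, hmin⟩ := Finset.exists_min_image _ (fun σ => interp (lam σ) σ ω y) hne
  obtain ⟨hσS, hyσ⟩ := Finset.mem_filter.1 hσ
  refine ⟨σ, hσS, hyσ, fun a ha has => ?_⟩
  by_contra! hlt
  have hb := hlam σ hσS
  have hfull := (hS σ).1 hσS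
  have hc := (hb.hull y).1 hyσ
  -- the exchange ratio is minimised over the vertices with a positive coordinate of `a`
  have hP : (σ.filter fun w => 0 < lam σ w a).Nonempty := by
    by_contra hem
    rw [Finset.not_nonempty_iff_eq_empty, Finset.filter_eq_empty_iff] at hem
    have := hb.sum a
    have h2 : ∑ w ∈ σ, lam σ w a ≤ 0 := Finset.sum_nonpos fun w hw => not_lt.1 (hem hw)
    linarith
  obtain ⟨w₀, hw₀, hmin₀⟩ := Finset.exists_min_image _ (fun w => lam σ w y / lam σ w a) hP
  obtain ⟨hw₀σ, hw₀pos⟩ := Finset.mem_filter.1 hw₀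
  set ε := lam σ w₀ y / lam σ w₀ a with hε
  have hεnn : 0 ≤ ε := div_nonneg (hc _ hw₀σ) hw₀pos.le
  -- `y` is the combination of `a`, with weight `ε`, and of the vertices other than `w₀`, with
  -- weights `c`
  let c : Euc d → ℝ := fun w => lam σ w y - ε * lam σ w a
  have hcnn : ∀ w ∈ σ, 0 ≤ c w := by
    intro w hw
    by_cases hp : 0 < lam σ w a
    · have := hmin₀ w (Finset.mem_filter.2 ⟨hw, hp⟩)
      rw [le_div_iff₀ hp] at this
      simp only [c]; linarith
    · simp only [c]
      have := hc w hw
      nlinarith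
  have hc₀ : c w₀ = 0 := by simp only [c, hε]; field_simp; ring
  let σ' := insert a (σ.erase w₀)
  have haσ' : a ∉ σ.erase w₀ := fun h => has (Finset.mem_of_mem_erase h)
  have hσ'A : σ' ⊆ A := by
    intro x hx
    rcases Finset.mem_insert.1 hx with rfl | hx
    · exact ha
    · exact hfull.subset (Finset.mem_of_mem_erase hx)
  let c' : Euc d → ℝ := fun w => if w = a then ε else c w
  have hc' : ∀ w ∈ σ.erase w₀, c' w = c w := by
    intro w hw
    simp [c', show w ≠ a from fun h => haσ' (h ▸ hw)]
  have hc'a : c' a = ε := by simp [c']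
  have hsum : ∑ w ∈ σ', c' w = 1 := by
    rw [Finset.sum_insert haσ', hc'a, Finset.sum_congr rfl hc',
      Finset.sum_erase _ hc₀]
    simp only [c, Finset.sum_sub_distrib, ← Finset.mul_sum, hb.sum]; ring
  have hcomb : ∑ w ∈ σ', c' w • w = y := by
    rw [Finset.sum_insert haσ', hc'a,
      Finset.sum_congr rfl (fun w hw => by rw [hc' w hw]),
      Finset.sum_erase (f := fun w => c w • w) _ (by rw [hc₀, zero_smul])]
    simp only [c, sub_smul, mul_smul, Finset.sum_sub_distrib, ← Finset.smul_sum, hb.comb]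
    abel
  have hyσ' : y ∈ convexHull ℝ (σ' : Set (Euc d)) := by
    rw [Finset.mem_convexHull']
    refine ⟨c', fun w hw => ?_, hsum, hcomb⟩
    rcases Finset.mem_insert.1 hw with rfl | hw
    · rw [hc'a]; exact hεnn
    · rw [hc' w hw]; exact hcnn w (Finset.mem_of_mem_erase hw)
  have hcard : σ'.card = d + 1 := by
    rw [Finset.card_insert_of_notMem haσ', Finset.card_erase_of_mem hw₀σ, hfull.card]; simp
  have hσ'S : σ' ∈ S := by
    obtain ⟨t, ht1, ht2, _⟩ := carath σ' hσ'A hyσ'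
    have : t = σ' := Finset.eq_of_subset_of_card_le ht1 (by rw [hcard, ((hS t).1 ht2).card])
    rwa [← this]
  -- if `ε` vanished, `y` would be in the span of the `d` remaining vertices
  have hεpos : 0 < ε := by
    rcases hεnn.lt_or_eq with h | h
    · exact h
    exfalso
    have : y ∈ convexHull ℝ ((σ.erase w₀ : Finset (Euc d)) : Set (Euc d)) := by
      rw [Finset.mem_convexHull']
      refine ⟨c, fun w hw => hcnn w (Finset.mem_of_mem_erase hw), ?_, ?_⟩
      · rw [Finset.sum_insert haσ', hc'a, Finset.sum_congr rfl hc', ← h, zero_add] at hsum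
        exact hsum
      · rw [Finset.sum_insert haσ', hc'a, Finset.sum_congr rfl (fun w hw => by rw [hc' w hw]),
          ← h, zero_smul, zero_add] at hcomb
        exact hcomb
    refine hgen (σ.erase w₀) (fun x hx => hfull.subset (Finset.mem_of_mem_erase hx)) ?_
      (convexHull_subset_affineSpan _ this)
    rw [Finset.card_erase_of_mem hw₀σ, hfull.card]; simp
  -- the exchange lowers the height above `y` by `ε` times the defect at `a`
  have hval : interp (lam σ') σ' ω y = interp (lam σ) σ ω y + ε * (ω a - interp (lam σ) σ ω a) := by
    have e1 : interp (lam σ') σ' ω y = ∑ w ∈ σ', c' w * ω w := by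
      conv_lhs => rw [← hcomb]
      rw [affine_sum _ _ _ hsum]
      exact Finset.sum_congr rfl fun w hw => by rw [(hlam σ' hσ'S).interp_vertex ω hw]
    rw [e1, Finset.sum_insert haσ', hc'a, Finset.sum_congr rfl (fun w hw => by rw [hc' w hw]),
      Finset.sum_erase (f := fun w => c w * ω w) _ (by rw [hc₀, zero_mul]), interp_apply,
      interp_apply]
    simp only [c, sub_mul, Finset.sum_sub_distrib, mul_assoc, ← Finset.mul_sum]
    ring
  have := hmin σ' (Finset.mem_filter.2 ⟨hσ'S, hyσ'⟩)
  rw [hval] at this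
  nlinarith

/-- Every finite full-dimensional point configuration has a triangulation: lift the points to
generic heights and project the lower hull. -/
theorem exists_isTriangulation (A : Finset (Euc d))
    (hA : (interior (convexHull ℝ (A : Set (Euc d)))).Nonempty) :
    ∃ T, IsTriangulation (A : Set (Euc d)) T := by
  classical
  let S := A.powerset.filter fun σ => IsFullSimplexIn (A : Set (Euc d)) σ
  have hS : ∀ σ, σ ∈ S ↔ IsFullSimplexIn (A : Set (Euc d)) σ := by
    intro σ
    simp only [S, Finset.mem_filter, Finset.mem_powerset, and_iff_right_iff_imp]
    intro h; exact_mod_cast h.subset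
  have hex : ∀ σ : Finset (Euc d), ∃ lam, σ ∈ S → IsBary σ lam := by
    intro σ
    by_cases h : σ ∈ S
    · obtain ⟨l, hl⟩ := ((hS σ).1 h).exists_bary
      exact ⟨l, fun _ => hl⟩
    · exact ⟨fun _ => 0, fun h' => absurd h' h⟩
  choose lam hlam using hex
  obtain ⟨ω, hω⟩ := exists_generic_heights A S lam
  let T := S.filter fun σ => ∀ a ∈ A, a ∉ σ → interp (lam σ) σ ω a < ω a
  have hTmem : ∀ σ, σ ∈ T ↔ σ ∈ S ∧ ∀ a ∈ A, a ∉ σ → interp (lam σ) σ ω a < ω a := by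
    intro σ; simp only [T, Finset.mem_filter]
  have hT : ∀ σ ∈ T, σ ∈ S ∧ ∀ a ∈ A, a ∉ σ → interp (lam σ) σ ω a < ω a :=
    fun σ => (hTmem σ).1
  have hle : ∀ σ ∈ T, ∀ a ∈ A, interp (lam σ) σ ω a ≤ ω a := by
    intro σ hσ a ha
    by_cases h : a ∈ σ
    · exact ((hlam σ (hT σ hσ).1).interp_vertex ω h).le
    · exact ((hT σ hσ).2 a ha h).le
  -- the lifted hyperplane of `τ` is below the lifted simplex of `σ`, and meets it only above the
  -- common vertices
  have hval : ∀ σ ∈ T, ∀ τ ∈ T, ∀ x ∈ convexHull ℝ (σ : Set (Euc d)),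
      interp (lam τ) τ ω x ≤ interp (lam σ) σ ω x ∧
      (interp (lam τ) τ ω x = interp (lam σ) σ ω x →
        x ∈ convexHull ℝ ((σ ∩ τ : Finset (Euc d)) : Set (Euc d))) := by
    intro σ hσ τ hτ x hx
    have hb := hlam σ (hT σ hσ).1
    have hA' := ((hS σ).1 (hT σ hσ).1).subset
    have hnn := (hb.hull x).1 hx
    have e1 : interp (lam τ) τ ω x = ∑ w ∈ σ, lam σ w x * interp (lam τ) τ ω w := hb.affine_eq _ x
    have hterm : ∀ w ∈ σ, lam σ w x * interp (lam τ) τ ω w ≤ lam σ w x * ω w := fun w hw =>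
      mul_le_mul_of_nonneg_left (hle τ hτ w (hA' hw)) (hnn w hw)
    refine ⟨?_, fun heq => ?_⟩
    · rw [e1, interp_apply]
      exact Finset.sum_le_sum hterm
    · rw [e1, interp_apply, Finset.sum_eq_sum_iff_of_le hterm] at heq
      have hzero : ∀ w ∈ σ, w ∉ σ ∩ τ → lam σ w x = 0 := by
        intro w hw hn
        have hwτ : w ∉ τ := fun h => hn (Finset.mem_inter.2 ⟨hw, h⟩)
        have h1 := heq w hw
        have h2 := (hT τ hτ).2 w (hA' hw) hwτ
        by_contra h0
        exact h2.ne (mul_left_cancel₀ h0 h1)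
      rw [Finset.mem_convexHull']
      refine ⟨fun w => lam σ w x, fun w hw => hnn w (Finset.mem_inter.1 hw).1, ?_, ?_⟩
      · rw [← hb.sum x]
        exact Finset.sum_subset Finset.inter_subset_left hzero
      · conv_rhs => rw [← hb.comb x]
        exact Finset.sum_subset Finset.inter_subset_left fun w hw hn => by
          simp only [hzero w hw hn, zero_smul]
  have hface : ∀ σ ∈ T, ∀ τ ∈ T, ∀ x ∈ convexHull ℝ (σ : Set (Euc d)),
      x ∈ convexHull ℝ (τ : Set (Euc d)) →
      x ∈ convexHull ℝ ((σ ∩ τ : Finset (Euc d)) : Set (Euc d)) := by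
    intro σ hσ τ hτ x hx hx'
    exact (hval σ hσ τ hτ x hx).2
      (le_antisymm (hval σ hσ τ hτ x hx).1 (hval τ hτ σ hσ x hx').1)
  refine ⟨T, ⟨⟨fun σ hσ => (hS σ).1 (hT σ hσ).1, ?_, ?_⟩, ?_⟩⟩
  · intro σ hσ τ hτ hne
    rw [Set.disjoint_left]
    intro p hp hp'
    have hin := hface σ hσ τ hτ p (interior_subset hp) (interior_subset hp')
    have hb := hlam σ (hT σ hσ).1
    have hsub : σ ⊆ τ := fun w hw => (Finset.mem_inter.1
      (hb.mem_of_pos Finset.inter_subset_left hin hw ((hb.int p).1 hp w hw))).2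
    refine hne (Finset.eq_of_subset_of_card_le hsub ?_)
    rw [((hS σ).1 (hT σ hσ).1).card, ((hS τ).1 (hT τ hτ).1).card]
  · apply Subset.antisymm
    · intro x hx
      simp only [mem_iUnion] at hx
      obtain ⟨σ, hσ, hx⟩ := hx
      exact convexHull_mono ((hS σ).1 (hT σ hσ).1).subset hx
    · by_contra hcov
      -- an uncovered point would have uncovered generic points of the interior near it
      obtain ⟨x, hx, hxU⟩ := Set.not_subset.1 hcov
      have hclosed : IsClosed (⋃ σ ∈ T, convexHull ℝ (σ : Set (Euc d))) :=
        isClosed_biUnion_finset fun σ _ => (Set.Finite.isClosed_convexHull (𝕜 := ℝ) σ.finite_toSet)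
      have hxc : x ∈ closure (interior (convexHull ℝ (A : Set (Euc d)))) := by
        rw [(convex_convexHull ℝ _).closure_interior_eq_closure_of_nonempty_interior hA]
        exact subset_closure hx
      obtain ⟨z, hz1, hz2⟩ := mem_closure_iff.1 hxc _ hclosed.isOpen_compl hxU
      obtain ⟨y, hyV, hgen⟩ := exists_generic_point A (hclosed.isOpen_compl.inter isOpen_interior)
        ⟨z, hz1, hz2⟩
      obtain ⟨σ, hσS, hyσ, hlow⟩ := exists_lower_simplex A S hS lam (fun σ => hlam σ) ω
        (interior_subset hyV.2) hgen
      refine hyV.1 ?_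
      simp only [mem_iUnion]
      refine ⟨σ, (hTmem σ).2 ⟨hσS, fun a ha has => ?_⟩, hyσ⟩
      exact lt_of_le_of_ne (hlow a ha has) (hω σ hσS a ha has).symm
  · intro σ hσ τ hτ
    refine ⟨σ ∩ τ, Finset.inter_subset_left, Finset.inter_subset_right, ?_⟩
    apply Subset.antisymm
    · rintro x ⟨hx, hx'⟩
      exact hface σ hσ τ hτ x hx hx'
    · intro x hx
      exact ⟨convexHull_mono (by simp) hx, convexHull_mono (by simp) hx⟩

end Existence

/-! ### Adapted coordinates -/

/-- The point of the segment from `v i` to `u j` with weight `κ` on `u j`. -/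
noncomputable def crossPt (κ : ℝ) (v u : Fin 2 → Euc 3) (i j : Fin 2) : Euc 3 :=
  (1 - κ) • v i + κ • u j

/-- Orthogonal coordinates `X`, `Y`, `Z` adapted to a configuration: the `m`-gon lies on a circle
in the plane `Z = 0`, the edge `v 0, v 1` is parallel to the `X`-axis and lies above the plane,
the edge `u 0, u 1` is parallel to the `Y`-axis and lies below. The number `κ` is the common ratio
in which the plane cuts the four segments from `v i` to `u j`, and `cross_lt` expresses that the
four points of intersection are in the relative interior of the polygon. Since neither edge is
parallel to an edge or diagonal of the polygon, the vertices have distinct `X`- and distinct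
`Y`-coordinates. -/
structure Frame (m : ℕ) (q : Fin m → Euc 3) (v u : Fin 2 → Euc 3) (X Y Z : Euc 3 →ᵃ[ℝ] ℝ)
    (r φ κ : ℝ) : Prop where
  even : Even m
  four_le : 4 ≤ m
  r_pos : 0 < r
  inj : ∀ p p', X p = X p' → Y p = Y p' → Z p = Z p' → p = p'
  qX : ∀ k : Fin m, X (q k) = r * Real.cos (φ + (k : ℕ) * (2 * Real.pi / m))
  qY : ∀ k : Fin m, Y (q k) = r * Real.sin (φ + (k : ℕ) * (2 * Real.pi / m))
  qZ : ∀ k, Z (q k) = 0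
  vZ_pos : 0 < Z (v 0)
  vZ : Z (v 1) = Z (v 0)
  uZ_neg : Z (u 0) < 0
  uZ : Z (u 1) = Z (u 0)
  vY : Y (v 1) = Y (v 0)
  vX : X (v 0) ≠ X (v 1)
  uX : X (u 1) = X (u 0)
  uY : Y (u 0) ≠ Y (u 1)
  Xinj : Function.Injective fun k => X (q k)
  Yinj : Function.Injective fun k => Y (q k)
  κ_pos : 0 < κ
  κ_lt_one : κ < 1
  κZ : (1 - κ) * Z (v 0) + κ * Z (u 0) = 0
  cross_mem : ∀ i j, crossPt κ v u i j ∈ convexHull ℝ (range q)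
  cross_lt : ∀ i j (f : Euc 3 →ᵃ[ℝ] ℝ) (M : ℝ), (∀ k, f (q k) ≤ M) →
    (∃ k l, f (q k) ≠ f (q l)) → f (crossPt κ v u i j) < M

lemma crossPt_swap (κ : ℝ) (v u : Fin 2 → Euc 3) (i j : Fin 2) :
    crossPt (1 - κ) u v j i = crossPt κ v u i j := by
  unfold crossPt; rw [add_comm]; congr 2; ring

/-- Rotating by a quarter turn and reflecting in the plane of the polygon exchanges the roles of
the two edges. -/
lemma Frame.swap {m : ℕ} {q : Fin m → Euc 3} {v u : Fin 2 → Euc 3} {X Y Z : Euc 3 →ᵃ[ℝ] ℝ}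
    {r φ κ : ℝ} (h : Frame m q v u X Y Z r φ κ) :
    Frame m q u v Y (-X) (-Z) r (φ - Real.pi / 2) (1 - κ) where
  even := h.even
  four_le := h.four_le
  r_pos := h.r_pos
  inj p p' h1 h2 h3 := h.inj p p' (by simpa using h2) h1 (by simpa using h3)
  qX k := by
    rw [h.qY, show φ - Real.pi / 2 + (k : ℕ) * (2 * Real.pi / m) =
      φ + (k : ℕ) * (2 * Real.pi / m) - Real.pi / 2 by ring, Real.cos_sub_pi_div_two]
  qY k := by
    rw [show φ - Real.pi / 2 + (k : ℕ) * (2 * Real.pi / m) =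
      φ + (k : ℕ) * (2 * Real.pi / m) - Real.pi / 2 by ring, Real.sin_sub_pi_div_two]
    simp [h.qX]
  qZ k := by simp [h.qZ]
  vZ_pos := by simpa using h.uZ_neg
  vZ := by simp [h.uZ]
  uZ_neg := by simpa using h.vZ_pos
  uZ := by simp [h.vZ]
  vY := by simp [h.uX]
  vX := h.uY
  uX := h.vY
  uY := by simpa using h.vX
  Xinj := h.Yinj
  Yinj k l hkl := h.Xinj (by simpa using hkl)
  κ_pos := by linarith [h.κ_lt_one]
  κ_lt_one := by linarith [h.κ_pos]
  κZ := by
    have := h.κZ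
    simp only [AffineMap.coe_neg, Pi.neg_apply]; linarith
  cross_mem i j := by rw [crossPt_swap]; exact h.cross_mem j i
  cross_lt i j := by rw [crossPt_swap]; exact h.cross_lt j i

lemma eventually_mem_intrinsicInterior {d : ℕ} {K : Set (Euc d)} {x e : Euc d}
    (hx : x ∈ intrinsicInterior ℝ K) (he : e ∈ (affineSpan ℝ K).direction) :
    ∀ᶠ t in 𝓝 (0 : ℝ), x + t • e ∈ intrinsicInterior ℝ K := by
  obtain ⟨y, hy, rfl⟩ := mem_intrinsicInterior.1 hx
  have hmem : ∀ t : ℝ, (y : Euc d) + t • e ∈ affineSpan ℝ K := fun t => by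
    rw [add_comm]
    exact AffineSubspace.vadd_mem_of_mem_direction (Submodule.smul_mem _ t he) y.2
  have hc : Continuous fun t : ℝ => (⟨(y : Euc d) + t • e, hmem t⟩ : affineSpan ℝ K) := by
    fun_prop
  have h0 : (⟨(y : Euc d) + (0 : ℝ) • e, hmem 0⟩ : affineSpan ℝ K) = y := by
    ext1; simp
  have := hc.continuousAt.eventually_mem (x := 0) (isOpen_interior.mem_nhds (by rw [h0]; exact hy))
  filter_upwards [this] with t ht
  exact mem_intrinsicInterior.2 ⟨_, ht, rfl⟩

/-- An affine function that is not constant on the polygon has no maximum at a relative interior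
point: such a point can be moved a little in any direction of the plane. -/
lemma lt_of_mem_intrinsicInterior {ι : Type*} {q : ι → Euc 3} {p : Euc 3}
    (hp : p ∈ intrinsicInterior ℝ (convexHull ℝ (range q))) (f : Euc 3 →ᵃ[ℝ] ℝ) {M : ℝ}
    (hM : ∀ k, f (q k) ≤ M) (hne : ∃ k l, f (q k) ≠ f (q l)) : f p < M := by
  obtain ⟨k, l, hkl⟩ := hne
  have hmem : ∀ k, q k ∈ affineSpan ℝ (convexHull ℝ (range q)) := fun k =>
    subset_affineSpan ℝ _ (subset_convexHull ℝ _ (mem_range_self k))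
  have hd : q k - q l ∈ (affineSpan ℝ (convexHull ℝ (range q))).direction :=
    AffineSubspace.vsub_mem_direction (hmem k) (hmem l)
  have hlin : f.linear (q k - q l) ≠ 0 := by rw [affine_linear_sub]; exact sub_ne_zero.2 hkl
  obtain ⟨ε, hε, hball⟩ := Metric.eventually_nhds_iff.1
    (eventually_mem_intrinsicInterior hp
      (Submodule.smul_mem _ (f.linear (q k - q l)) hd))
  have h2 := affine_convexHull_le f (s := range q) (M := M)
    (by rintro _ ⟨k, rfl⟩; exact hM k) (intrinsicInterior_subset
      (hball (y := ε / 2) (by simp [abs_of_pos hε]; linarith)))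
  rw [affine_add_smul, map_smul, smul_eq_mul] at h2
  have : 0 < ε / 2 * (f.linear (q k - q l) * f.linear (q k - q l)) :=
    mul_pos (by linarith) (mul_self_pos.2 hlin)
  linarith

/-- The coordinate of `p - c` in the direction `e`. -/
noncomputable def coordAff (e c : Euc 3) : Euc 3 →ᵃ[ℝ] ℝ :=
  (innerSL ℝ e).toLinearMap.toAffineMap - AffineMap.const ℝ (Euc 3) (inner ℝ e c)

lemma coordAff_apply (e c p : Euc 3) : coordAff e c p = inner ℝ e (p - c) := by
  simp [coordAff, inner_sub_right]

lemma affine_eq_zero_of_mem_affineSpan {ι : Type*} {q : ι → Euc 3} (f : Euc 3 →ᵃ[ℝ] ℝ)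
    (hf : ∀ k, f (q k) = 0) {p : Euc 3} (hp : p ∈ affineSpan ℝ (range q)) : f p = 0 := by
  have h1 : affineSpan ℝ (range q) ≤
      (AffineSubspace.mk' (0 : ℝ) ⊥).comap f := by
    rw [affineSpan_le]
    rintro _ ⟨k, rfl⟩
    simp [hf]
  simpa using h1 hp

lemma cos_sin_injOn {m : ℕ} {φ : ℝ} {j k : Fin m}
    (hc : Real.cos (φ + (j : ℕ) * (2 * Real.pi / m)) = Real.cos (φ + (k : ℕ) * (2 * Real.pi / m)))
    (hs : Real.sin (φ + (j : ℕ) * (2 * Real.pi / m)) = Real.sin (φ + (k : ℕ) * (2 * Real.pi / m))) :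
    j = k := by
  have hm : (0 : ℝ) < m := by exact_mod_cast (Nat.zero_le _).trans_lt j.2
  have hpi := Real.pi_pos
  have h1 : Real.cos (((j : ℕ) - (k : ℕ) : ℝ) * (2 * Real.pi / m)) = 1 := by
    have := Real.cos_sub (φ + (j : ℕ) * (2 * Real.pi / m)) (φ + (k : ℕ) * (2 * Real.pi / m))
    rw [show ((j : ℕ) - (k : ℕ) : ℝ) * (2 * Real.pi / m) =
      (φ + (j : ℕ) * (2 * Real.pi / m)) - (φ + (k : ℕ) * (2 * Real.pi / m)) by ring, this, hc, hs]
    have := Real.sin_sq_add_cos_sq (φ + (k : ℕ) * (2 * Real.pi / m))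
    linarith
  have hj : ((j : ℕ) : ℝ) < m := by exact_mod_cast j.2
  have hk : ((k : ℕ) : ℝ) < m := by exact_mod_cast k.2
  have hj0 : (0 : ℝ) ≤ (j : ℕ) := by positivity
  have hk0 : (0 : ℝ) ≤ (k : ℕ) := by positivity
  have hd : 0 < 2 * Real.pi / m := by positivity
  have hdm : (m : ℝ) * (2 * Real.pi / m) = 2 * Real.pi := by field_simp
  have h2 := (Real.cos_eq_one_iff_of_lt_of_lt (x := ((j : ℕ) - (k : ℕ) : ℝ) * (2 * Real.pi / m))
    (by nlinarith) (by nlinarith)).1 h1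
  have h3 : ((j : ℕ) : ℝ) - (k : ℕ) = 0 := by
    rcases mul_eq_zero.1 h2 with h | h
    · exact h
    · exact absurd h hd.ne'
  have h4 : ((j : ℕ) : ℝ) = ((k : ℕ) : ℝ) := by linarith
  exact Fin.ext (by exact_mod_cast h4)

lemma parallel_of_smul {a b c e : Euc 3} {s : ℝ} (hs : s ≠ 0) (h : c - e = s • (b - a)) :
    (affineSpan ℝ {a, b}).Parallel (affineSpan ℝ {c, e}) := by
  rw [AffineSubspace.affineSpan_pair_parallel_iff_vectorSpan_eq, vectorSpan_pair_rev,
    vectorSpan_pair, vsub_eq_sub, vsub_eq_sub, h]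
  rw [Submodule.span_singleton_smul_eq (isUnit_iff_ne_zero.2 hs)]

/-- Every configuration has adapted coordinates. -/
lemma IsPmConfiguration.exists_frame {m : ℕ} {q : Fin m → Euc 3} {v u : Fin 2 → Euc 3}
    (h : IsPmConfiguration m q v u) :
    ∃ (X Y Z : Euc 3 →ᵃ[ℝ] ℝ) (r φ κ : ℝ), Frame m q v u X Y Z r φ κ := by
  obtain ⟨hm3, c, a, b, r, hr, hab, hq⟩ := h.regular
  have hm4 : 4 ≤ m := by
    obtain ⟨k, hk⟩ := h.even; omega
  have hmpos : (0 : ℝ) < m := by positivity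
  -- complete `a`, `b` to an orthonormal basis
  obtain ⟨B, hB⟩ : ∃ B : OrthonormalBasis (Fin 3) ℝ (Euc 3), B 0 = a ∧ B 1 = b := by
    have hv : Orthonormal ℝ (({0, 1} : Set (Fin 3)).domRestrict ![a, b, 0]) := by
      rw [orthonormal_iff_ite]
      rintro ⟨i, hi⟩ ⟨j, hj⟩
      have haa : inner ℝ a a = (1 : ℝ) := (orthonormal_iff_ite.1 hab 0 0).trans (if_pos rfl)
      have hbb : inner ℝ b b = (1 : ℝ) := (orthonormal_iff_ite.1 hab 1 1).trans (if_pos rfl)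
      have h01 : inner ℝ a b = (0 : ℝ) :=
        (orthonormal_iff_ite.1 hab 0 1).trans (if_neg (by decide))
      have h10 : inner ℝ b a = (0 : ℝ) :=
        (orthonormal_iff_ite.1 hab 1 0).trans (if_neg (by decide))
      simp only [mem_insert_iff, mem_singleton_iff] at hi hj
      rcases hi with rfl | rfl <;> rcases hj with rfl | rfl
      · exact haa.trans (if_pos rfl).symm
      · exact h01.trans (if_neg (by simp)).symm
      · exact h10.trans (if_neg (by simp)).symm
      · exact hbb.trans (if_pos rfl).symm
    obtain ⟨B, hB⟩ := hv.exists_orthonormalBasis_extension_of_card_eq (by simp)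
    exact ⟨B, by simpa using hB 0 (by simp), by simpa using hB 1 (by simp)⟩
  obtain ⟨hB0, hB1⟩ := hB
  have hBin : ∀ i j, inner ℝ (B i) (B j) = if i = j then (1 : ℝ) else 0 :=
    orthonormal_iff_ite.1 B.orthonormal
  have hrep : ∀ p : Euc 3, p = (inner ℝ (B 0) p : ℝ) • B 0 + (inner ℝ (B 1) p : ℝ) • B 1
      + (inner ℝ (B 2) p : ℝ) • B 2 := by
    intro p
    conv_lhs => rw [← B.sum_repr' p]
    rw [Fin.sum_univ_three]
  have hqk : ∀ k, q k - c = (r * Real.cos (2 * Real.pi * (k : ℕ) / m)) • B 0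
      + (r * Real.sin (2 * Real.pi * (k : ℕ) / m)) • B 1 := by
    intro k; rw [hq, hB0, hB1]; abel
  let N := coordAff (B 2) c
  have hqN : ∀ k, N (q k) = 0 := by
    intro k
    simp only [N, coordAff_apply]
    rw [hqk, inner_add_right, inner_smul_right, inner_smul_right, hBin, hBin]; simp
  have hspanN : ∀ p ∈ affineSpan ℝ (range q), N p = 0 := fun p hp =>
    affine_eq_zero_of_mem_affineSpan N hqN hp
  let k0 : Fin m := ⟨0, by omega⟩
  have hq0 : q k0 ∈ affineSpan ℝ (range q) := subset_affineSpan ℝ _ (mem_range_self _)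
  have hdirN : ∀ w ∈ (affineSpan ℝ (range q)).direction, inner ℝ (B 2) w = (0 : ℝ) := by
    intro w hw
    have h1 := hspanN _ (AffineSubspace.vadd_mem_of_mem_direction hw hq0)
    have h2 := hqN k0
    simp only [N, coordAff_apply, vadd_eq_add] at h1 h2
    rw [show w + q k0 - c = w + (q k0 - c) by abel, inner_add_right, h2, add_zero] at h1
    exact h1
  -- the direction of `v 0, v 1`
  obtain ⟨ρ, γ, hργ⟩ : ∃ ρ γ : ℝ, v 1 - v 0 = ρ • (Real.cos γ • B 0 + Real.sin γ • B 1) := by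
    let z : ℂ := ⟨inner ℝ (B 0) (v 1 - v 0), inner ℝ (B 1) (v 1 - v 0)⟩
    refine ⟨‖z‖, Complex.arg z, ?_⟩
    conv_lhs => rw [hrep (v 1 - v 0), hdirN _ h.v_parallel]
    rw [smul_add, smul_smul, smul_smul, Complex.norm_mul_cos_arg, Complex.norm_mul_sin_arg]
    simp [z]
  have hρ : ρ ≠ 0 := by
    rintro rfl
    rw [zero_smul, sub_eq_zero] at hργ
    exact h.v_ne hργ.symm
  set e₁ := Real.cos γ • B 0 + Real.sin γ • B 1 with he₁
  set e₂ := (-Real.sin γ) • B 0 + Real.cos γ • B 1 with he₂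
  have hcs := Real.sin_sq_add_cos_sq γ
  have hin1 : ∀ p : Euc 3, inner ℝ e₁ p = Real.cos γ * inner ℝ (B 0) p
      + Real.sin γ * inner ℝ (B 1) p := by
    intro p; simp only [he₁, inner_add_left, inner_smul_left]; simp
  have hin2 : ∀ p : Euc 3, inner ℝ e₂ p = (-Real.sin γ) * inner ℝ (B 0) p
      + Real.cos γ * inner ℝ (B 1) p := by
    intro p; simp only [he₂, inner_add_left, inner_smul_left]; simp
  have hrep' : ∀ p : Euc 3, p = (inner ℝ e₁ p : ℝ) • e₁ + (inner ℝ e₂ p : ℝ) • e₂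
      + (inner ℝ (B 2) p : ℝ) • B 2 := by
    intro p
    conv_lhs => rw [hrep p]
    rw [hin1, hin2, he₁, he₂]
    congr 1
    simp only [smul_add, smul_smul]
    have e1 : ∀ x y : ℝ, (Real.cos γ * x + Real.sin γ * y) * Real.cos γ
      + (-Real.sin γ * x + Real.cos γ * y) * (-Real.sin γ) = x := by
      intro x y; linear_combination x * hcs
    have e2 : ∀ x y : ℝ, (Real.cos γ * x + Real.sin γ * y) * Real.sin γ
      + (-Real.sin γ * x + Real.cos γ * y) * (Real.cos γ) = y := by
      intro x y; linear_combination y * hcs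
    have e3 : ∀ x y : ℝ, ((Real.cos γ * x + Real.sin γ * y) * Real.cos γ
      + (-Real.sin γ * x + Real.cos γ * y) * (-Real.sin γ)) • B 0
      + ((Real.cos γ * x + Real.sin γ * y) * Real.sin γ
      + (-Real.sin γ * x + Real.cos γ * y) * (Real.cos γ)) • B 1 = x • B 0 + y • B 1 := by
      intro x y; rw [e1, e2]
    rw [← e3]
    module
  have hB02 : inner ℝ (B 0) (B 2) = (0 : ℝ) := by rw [hBin]; simp
  have hB12 : inner ℝ (B 1) (B 2) = (0 : ℝ) := by rw [hBin]; simp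
  have hB20 : inner ℝ (B 2) (B 0) = (0 : ℝ) := by rw [hBin]; simp
  have hB21 : inner ℝ (B 2) (B 1) = (0 : ℝ) := by rw [hBin]; simp
  have hB00 : inner ℝ (B 0) (B 0) = (1 : ℝ) := by rw [hBin]; simp
  have hB11 : inner ℝ (B 1) (B 1) = (1 : ℝ) := by rw [hBin]; simp
  have hB01 : inner ℝ (B 0) (B 1) = (0 : ℝ) := by rw [hBin]; simp
  have hB10 : inner ℝ (B 1) (B 0) = (0 : ℝ) := by rw [hBin]; simp
  have hang : ∀ k : Fin m, -γ + (k : ℕ) * (2 * Real.pi / m) = 2 * Real.pi * (k : ℕ) / m - γ := by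
    intro k; ring
  have hqX : ∀ k : Fin m, coordAff e₁ c (q k) =
      r * Real.cos (-γ + (k : ℕ) * (2 * Real.pi / m)) := by
    intro k
    rw [coordAff_apply, hqk, hin1, hang, Real.cos_sub]
    simp only [inner_add_right, inner_smul_right, hB00, hB01, hB10, hB11]
    ring
  have hqY : ∀ k : Fin m, coordAff e₂ c (q k) =
      r * Real.sin (-γ + (k : ℕ) * (2 * Real.pi / m)) := by
    intro k
    rw [coordAff_apply, hqk, hin2, hang, Real.sin_sub]
    simp only [inner_add_right, inner_smul_right, hB00, hB01, hB10, hB11]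
    ring
  have hqne : ∀ j k : Fin m, coordAff e₁ c (q j) = coordAff e₁ c (q k) →
      coordAff e₂ c (q j) = coordAff e₂ c (q k) → j = k := by
    intro j k h1 h2
    rw [hqX, hqX] at h1
    rw [hqY, hqY] at h2
    exact cos_sin_injOn (mul_left_cancel₀ hr.ne' h1) (mul_left_cancel₀ hr.ne' h2)
  have hqdiff : ∀ j k, q j - q k = (coordAff e₁ c (q j) - coordAff e₁ c (q k)) • e₁ +
      (coordAff e₂ c (q j) - coordAff e₂ c (q k)) • e₂ := by
    intro j k
    conv_lhs => rw [hrep' (q j - q k)]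
    have h1 : inner ℝ (B 2) (q j - q k) = (0 : ℝ) := by
      have h1 := hqN j
      have h2 := hqN k
      simp only [N, coordAff_apply] at h1 h2
      rw [show q j - q k = (q j - c) - (q k - c) by abel, inner_sub_right, h1, h2, sub_zero]
    rw [h1, zero_smul, add_zero, coordAff_apply, coordAff_apply, coordAff_apply, coordAff_apply,
      ← inner_sub_right, ← inner_sub_right]
    simp
  -- the plane of the polygon contains the centre, hence is all of `N = 0`
  have hplane : ∀ p, N p = 0 → p ∈ affineSpan ℝ (range q) := by
    intro p hp
    obtain ⟨n, hn⟩ := h.even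
    let kh : Fin m := ⟨n, by omega⟩
    let k1 : Fin m := ⟨1, by omega⟩
    have hd := fun k => AffineSubspace.vsub_mem_direction
      (subset_affineSpan ℝ (range q) (mem_range_self k)) hq0
    simp only [vsub_eq_sub] at hd
    have hn2 : (2 * Real.pi * (n : ℝ) / m) = Real.pi := by
      have : (m : ℝ) = n + n := by exact_mod_cast hn
      have hn0 : (n : ℝ) ≠ 0 := by
        rintro h0; rw [this, h0] at hmpos; simp at hmpos
      rw [this]
      field_simp; ring
    have hqh : q kh - q k0 = (-(2 * r)) • B 0 := by
      rw [show q kh - q k0 = (q kh - c) - (q k0 - c) by abel, hqk, hqk]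
      simp only [kh, k0, hn2]
      simp
      module
    have hB0d : B 0 ∈ (affineSpan ℝ (range q)).direction := by
      have := Submodule.smul_mem _ (-(2 * r))⁻¹ (hd kh)
      rwa [hqh, smul_smul, inv_mul_cancel₀ (by linarith), one_smul] at this
    have hs : 0 < Real.sin (2 * Real.pi * ((1 : ℕ) : ℝ) / m) := by
      have hmR : (4 : ℝ) ≤ m := by exact_mod_cast hm4
      apply Real.sin_pos_of_pos_of_lt_pi
      · have := Real.pi_pos; positivity
      · rw [div_lt_iff₀ hmpos]
        push_cast
        nlinarith [Real.pi_pos]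
    have hB1d : B 1 ∈ (affineSpan ℝ (range q)).direction := by
      have h1 : q k1 - q k0 = (r * Real.cos (2 * Real.pi * ((1 : ℕ) : ℝ) / m) - r) • B 0
          + (r * Real.sin (2 * Real.pi * ((1 : ℕ) : ℝ) / m)) • B 1 := by
        rw [show q k1 - q k0 = (q k1 - c) - (q k0 - c) by abel, hqk, hqk]
        simp only [k1, k0]
        simp
        module
      have h2 := Submodule.smul_mem _ (r * Real.sin (2 * Real.pi * ((1 : ℕ) : ℝ) / m))⁻¹
        (Submodule.sub_mem _ (hd k1)
        (Submodule.smul_mem _ (r * Real.cos (2 * Real.pi * ((1 : ℕ) : ℝ) / m) - r) hB0d))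
      rwa [h1, add_sub_cancel_left, smul_smul, inv_mul_cancel₀ (mul_pos hr hs).ne', one_smul] at h2
    have h3 : p = ((inner ℝ (B 0) (p - q k0) : ℝ) • B 0 + (inner ℝ (B 1) (p - q k0) : ℝ) • B 1)
        +ᵥ q k0 := by
      have h4 : inner ℝ (B 2) (p - q k0) = (0 : ℝ) := by
        have h1 := hqN k0
        simp only [N, coordAff_apply] at h1 hp
        rw [show p - q k0 = (p - c) - (q k0 - c) by abel, inner_sub_right, h1, hp, sub_zero]
      have h5 := hrep (p - q k0)
      rw [h4, zero_smul, add_zero] at h5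
      rw [← h5]; simp
    rw [h3]
    exact AffineSubspace.vadd_mem_of_mem_direction
      (Submodule.add_mem _ (Submodule.smul_mem _ _ hB0d) (Submodule.smul_mem _ _ hB1d)) hq0
  have hN10 : ∀ p p' : Euc 3, N p - N p' = inner ℝ (B 2) (p - p') := by
    intro p p'
    simp only [N, coordAff_apply]; rw [← inner_sub_right]; simp
  have hvN : N (v 1) = N (v 0) := by
    have := hN10 (v 1) (v 0); rw [hdirN _ h.v_parallel] at this; linarith
  have huN : N (u 1) = N (u 0) := by
    have := hN10 (u 1) (u 0); rw [hdirN _ h.u_parallel] at this; linarith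
  have hv0 : N (v 0) ≠ 0 := fun h0 => (h.opposite 0 0).2.1 (hplane _ h0)
  have hu0 : N (u 0) ≠ 0 := fun h0 => (h.opposite 0 0).2.2 (hplane _ h0)
  obtain ⟨Z, hZ⟩ : ∃ Z : Euc 3 →ᵃ[ℝ] ℝ, ((∀ p, Z p = N p) ∨ (∀ p, Z p = - N p)) ∧ 0 < Z (v 0) := by
    rcases lt_or_gt_of_ne hv0 with h1 | h1
    · exact ⟨-N, Or.inr fun p => by simp, by simpa using h1⟩
    · exact ⟨N, Or.inl fun p => rfl, h1⟩
  obtain ⟨hZN, hZv⟩ := hZ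
  have hZinj : ∀ p p', N p = N p' ↔ Z p = Z p' := by
    intro p p'
    rcases hZN with h1 | h1 <;> rw [h1, h1] <;> simp
  have hZ0 : ∀ p, N p = 0 ↔ Z p = 0 := by
    intro p
    rcases hZN with h1 | h1 <;> rw [h1] <;> simp
  have hZv1 : Z (v 1) = Z (v 0) := (hZinj _ _).1 hvN
  have hZu1 : Z (u 1) = Z (u 0) := (hZinj _ _).1 huN
  have hZq : ∀ k, Z (q k) = 0 := fun k => (hZ0 _).1 (hqN k)
  have hZvi : ∀ i, Z (v i) = Z (v 0) := by intro i; fin_cases i; exacts [rfl, hZv1]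
  have hZuj : ∀ j, Z (u j) = Z (u 0) := by intro j; fin_cases j; exacts [rfl, hZu1]
  have hcr : ∀ i j, ∃ t : ℝ, 0 ≤ t ∧ t ≤ 1 ∧ (1 - t) * Z (v 0) + t * Z (u 0) = 0 ∧
      (1 - t) • v i + t • u j ∈ intrinsicInterior ℝ (convexHull ℝ (range q)) := by
    intro i j
    obtain ⟨x, hx1, hx2⟩ := h.crossing i j
    obtain ⟨s, t, hs, ht, hst, rfl⟩ := hx1
    have hs' : s = 1 - t := by linarith
    subst hs'
    refine ⟨t, ht, by linarith, ?_, hx2⟩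
    have h1 := (hZ0 _).1 (hspanN _ (by
      rw [← affineSpan_convexHull (𝕜 := ℝ) (s := range q)]
      exact subset_affineSpan ℝ _ (intrinsicInterior_subset hx2)))
    rw [affine_comb₂ _ _ _ (by ring), hZvi, hZuj] at h1
    exact h1
  have hZu : Z (u 0) < 0 := by
    obtain ⟨t, ht0, ht1, ht, _⟩ := hcr 0 0
    have h1 : Z (u 0) ≠ 0 := fun h => hu0 ((hZ0 _).2 h)
    by_contra hn
    have h2 : 0 < Z (u 0) := lt_of_le_of_ne (not_lt.1 hn) h1.symm
    rcases ht0.lt_or_eq with h3 | h3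
    · nlinarith [mul_pos h3 h2, mul_nonneg (sub_nonneg.2 ht1) hZv.le]
    · rw [← h3] at ht; linarith
  have hκ : ∀ t : ℝ, (1 - t) * Z (v 0) + t * Z (u 0) = 0 →
      t = Z (v 0) / (Z (v 0) - Z (u 0)) := by
    intro t ht
    rw [eq_div_iff (by linarith)]; linarith
  have hcr' : ∀ i j, crossPt (Z (v 0) / (Z (v 0) - Z (u 0))) v u i j ∈
      intrinsicInterior ℝ (convexHull ℝ (range q)) := by
    intro i j
    obtain ⟨t, _, _, ht, hx⟩ := hcr i j
    rw [hκ t ht] at hx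
    exact hx
  have hden : 0 < Z (v 0) - Z (u 0) := by linarith
  have he12 : inner ℝ e₁ e₂ = (0 : ℝ) := by
    rw [hin1, he₂]
    simp only [inner_add_right, inner_smul_right, hB00, hB01, hB10, hB11]; ring
  have he11 : inner ℝ e₁ e₁ = (1 : ℝ) := by
    rw [hin1, he₁]
    simp only [inner_add_right, inner_smul_right, hB00, hB01, hB10, hB11]; linarith
  have he21 : inner ℝ e₂ e₁ = (0 : ℝ) := by rw [real_inner_comm]; exact he12
  have huv : inner ℝ e₁ (u 1 - u 0) = (0 : ℝ) := by
    have := h.orthogonal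
    rw [hργ, inner_smul_left] at this
    simpa [hρ] using this
  have hu2 : u 1 - u 0 = (inner ℝ e₂ (u 1 - u 0) : ℝ) • e₂ := by
    conv_lhs => rw [hrep' (u 1 - u 0), huv, hdirN _ h.u_parallel]
    simp
  have hu2ne : inner ℝ e₂ (u 1 - u 0) ≠ (0 : ℝ) := by
    intro h0
    rw [h0, zero_smul, sub_eq_zero] at hu2
    exact h.u_ne hu2.symm
  have hsubc : ∀ (e p p' : Euc 3), coordAff e c p - coordAff e c p' = inner ℝ e (p - p') := by
    intro e p p'
    rw [coordAff_apply, coordAff_apply, ← inner_sub_right]; simp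
  refine ⟨coordAff e₁ c, coordAff e₂ c, Z, r, -γ, Z (v 0) / (Z (v 0) - Z (u 0)),
    { even := h.even, four_le := hm4, r_pos := hr, inj := ?_, qX := hqX, qY := hqY, qZ := hZq,
      vZ_pos := hZv, vZ := hZv1, uZ_neg := hZu, uZ := hZu1, vY := ?_, vX := ?_, uX := ?_,
      uY := ?_, Xinj := ?_, Yinj := ?_, κ_pos := div_pos hZv hden,
      κ_lt_one := (div_lt_one hden).2 (by linarith), κZ := ?_,
      cross_mem := fun i j => intrinsicInterior_subset (hcr' i j),
      cross_lt := fun i j f M hf hne => lt_of_mem_intrinsicInterior (hcr' i j) f hf hne }⟩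
  · intro p p' h1 h2 h3
    have h4 := hsubc e₁ p p'
    have h5 := hsubc e₂ p p'
    have h6 := hN10 p p'
    rw [h1, sub_self] at h4
    rw [h2, sub_self] at h5
    rw [(hZinj p p').2 h3, sub_self] at h6
    have := hrep' (p - p')
    rw [← h4, ← h5, ← h6] at this
    rw [← sub_eq_zero, this]; simp
  · have := hsubc e₂ (v 1) (v 0)
    rw [hργ, inner_smul_right, he21] at this
    linarith
  · have := hsubc e₁ (v 1) (v 0)
    rw [hργ, inner_smul_right, he11] at this
    intro h0; rw [h0] at this; simp at this; exact hρ this.symm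
  · have := hsubc e₁ (u 1) (u 0)
    rw [huv] at this; linarith
  · have := hsubc e₂ (u 1) (u 0)
    intro h0; rw [h0] at this; simp only [sub_self] at this; exact hu2ne this.symm
  · intro j k hjk
    by_contra hne
    have h1 := hqdiff j k
    simp only at hjk
    rw [hjk, sub_self, zero_smul, zero_add] at h1
    refine h.u_generic j k hne (parallel_of_smul
      (s := (coordAff e₂ c (q j) - coordAff e₂ c (q k)) / inner ℝ e₂ (u 1 - u 0)) ?_ ?_)
    · refine div_ne_zero (fun h0 => hne (hqne j k hjk (by linarith))) hu2ne
    · rw [h1]; conv_rhs => rw [hu2]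
      rw [smul_smul]
      congr 1
      have h7 : inner ℝ e₂ (inner ℝ e₂ (u 1 - u 0) • e₂) = inner ℝ e₂ (u 1 - u 0) := by rw [← hu2]
      rw [h7]
      field_simp
  · intro j k hjk
    by_contra hne
    have h1 := hqdiff j k
    simp only at hjk
    rw [hjk, sub_self, zero_smul, add_zero] at h1
    refine h.v_generic j k hne (parallel_of_smul
      (s := (coordAff e₁ c (q j) - coordAff e₁ c (q k)) / ρ) ?_ ?_)
    · refine div_ne_zero (fun h0 => hne (hqne j k (by linarith) hjk)) hρ
    · rw [h1, hργ, smul_smul, div_mul_cancel₀ _ hρ]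
  · field_simp; ring

/-! ### The vertices and the faces of the polytope -/

/-- A point of a polytope at which an affine function is maximal is in the convex hull of the
vertices at which the function is maximal. -/
lemma mem_convexHull_filter {d : ℕ} (A : Finset (Euc d)) (f : Euc d →ᵃ[ℝ] ℝ) {M : ℝ}
    [DecidablePred fun w => f w = M]
    (hf : ∀ w ∈ A, f w ≤ M) {p : Euc d} (hp : p ∈ convexHull ℝ (A : Set (Euc d))) (hpM : f p = M) :
    p ∈ convexHull ℝ ((A.filter fun w => f w = M : Finset (Euc d)) : Set (Euc d)) := by
  rw [Finset.mem_convexHull'] at hp ⊢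
  obtain ⟨c, hc, hsum, rfl⟩ := hp
  rw [affine_sum f A c hsum] at hpM
  have h1 : ∑ w ∈ A, c w * f w = ∑ w ∈ A, c w * M := by
    rw [hpM, ← Finset.sum_mul, hsum, one_mul]
  rw [Finset.sum_eq_sum_iff_of_le fun w hw => mul_le_mul_of_nonneg_left (hf w hw) (hc w hw)] at h1
  have h0 : ∀ w ∈ A, w ∉ A.filter (fun w => f w = M) → c w = 0 := by
    intro w hw hn
    by_contra hne
    exact hn (Finset.mem_filter.2 ⟨hw, mul_left_cancel₀ hne (h1 w hw)⟩)
  refine ⟨c, fun w hw => hc w (Finset.mem_filter.1 hw).1, ?_, ?_⟩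
  · rw [← hsum]
    exact Finset.sum_subset (Finset.filter_subset _ _) h0
  · exact Finset.sum_subset (Finset.filter_subset _ _) fun w hw hn => by
      rw [h0 w hw hn, zero_smul]

lemma eq_of_convex_comb_eq_max {a b x y M : ℝ} (ha : 0 < a) (hb : 0 < b) (hab : a + b = 1)
    (hx : x ≤ M) (hy : y ≤ M) (h : M = a * x + b * y) : x = M := by
  have h1 := mul_nonneg hb.le (sub_nonneg.2 hy)
  have h2 : a * (M - x) = -(b * (M - y)) := by linear_combination M * hab + h
  have h3 := mul_nonneg ha.le (sub_nonneg.2 hx)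
  have h4 : a * (M - x) = 0 := by linarith
  linarith [(mul_eq_zero.1 h4).resolve_left ha.ne']

/-- A point that maximises lexicographically a pair of affine functions, strictly, is a vertex. -/
lemma mem_extremePoints_of_lex {d : ℕ} (A : Finset (Euc d)) (f g : Euc d →ᵃ[ℝ] ℝ) {w : Euc d}
    (hw : w ∈ A) (hf : ∀ w' ∈ A, w' ≠ w → f w' < f w ∨ (f w' = f w ∧ g w' < g w)) :
    w ∈ (convexHull ℝ (A : Set (Euc d))).extremePoints ℝ := by
  classical
  have hfle : ∀ w' ∈ A, f w' ≤ f w := by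
    intro w' h'
    by_cases h : w' = w
    · rw [h]
    · rcases hf w' h' h with h1 | h1
      · exact h1.le
      · exact h1.1.le
  have key : ∀ x ∈ convexHull ℝ (A : Set (Euc d)), f x = f w →
      g x ≤ g w ∧ (g x = g w → x = w) := by
    intro x hx hfx
    have h1 := mem_convexHull_filter A f hfle hx hfx
    have hg : ∀ w' ∈ A.filter (fun w' => f w' = f w), g w' ≤ g w := by
      intro w' h'
      obtain ⟨h2, h3⟩ := Finset.mem_filter.1 h'
      by_cases h : w' = w
      · rw [h]
      · rcases hf w' h2 h with h4 | h4
        · exact absurd h3 h4.ne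
        · exact h4.2.le
    refine ⟨affine_convexHull_le g (fun w' h' => hg w' h') h1, fun hgx => ?_⟩
    have h2 := mem_convexHull_filter _ g hg h1 hgx
    have h3 : (A.filter (fun w' => f w' = f w)).filter (fun w' => g w' = g w) ⊆ {w} := by
      intro w' h'
      obtain ⟨h4, h5⟩ := Finset.mem_filter.1 h'
      obtain ⟨h6, h7⟩ := Finset.mem_filter.1 h4
      by_contra hne
      rcases hf w' h6 (by simpa using hne) with h8 | h8
      · exact h8.ne h7
      · exact h8.2.ne h5
    have h4 := convexHull_mono (𝕜 := ℝ) (Finset.coe_subset.2 h3) h2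
    simpa using h4
  refine ⟨subset_convexHull ℝ _ hw, ?_⟩
  rintro x hx y hy ⟨a, b, ha, hb, hab, hxy⟩
  have hfw := affine_comb₂ f x y hab
  have hgw := affine_comb₂ g x y hab
  rw [hxy] at hfw hgw
  have hfx := affine_convexHull_le f (fun w' h' => hfle w' h') hx
  have hfy := affine_convexHull_le f (fun w' h' => hfle w' h') hy
  have e1 : f x = f w := eq_of_convex_comb_eq_max ha hb hab hfx hfy hfw
  have e2 : f y = f w :=
    eq_of_convex_comb_eq_max hb ha (by linarith) hfy hfx (by linarith)
  obtain ⟨h1, h2⟩ := key x hx e1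
  have h3 := (key y hy e2).1
  exact h2 (eq_of_convex_comb_eq_max ha hb hab h1 h3 hgw)

/-- The finite set of all points defining `P_m`. -/
noncomputable def vertexFinset {m : ℕ} (q : Fin m → Euc 3) (v u : Fin 2 → Euc 3) :
    Finset (Euc 3) := by
  classical exact Finset.univ.image q ∪ Finset.univ.image v ∪ Finset.univ.image u

lemma coe_vertexFinset {m : ℕ} (q : Fin m → Euc 3) (v u : Fin 2 → Euc 3) :
    (vertexFinset q v u : Set (Euc 3)) = range q ∪ range v ∪ range u := by
  simp [vertexFinset, union_assoc]

lemma mem_vertexFinset {m : ℕ} {q : Fin m → Euc 3} {v u : Fin 2 → Euc 3} {w : Euc 3} :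
    w ∈ vertexFinset q v u ↔ (∃ k, q k = w) ∨ (∃ i, v i = w) ∨ (∃ j, u j = w) := by
  rw [← Finset.mem_coe, coe_vertexFinset]; simp [or_assoc]

lemma vertexFinset_swap {m : ℕ} (q : Fin m → Euc 3) (v u : Fin 2 → Euc 3) :
    vertexFinset q u v = vertexFinset q v u := by
  ext w; simp only [mem_vertexFinset]; tauto

namespace Frame

variable {m : ℕ} {q : Fin m → Euc 3} {v u : Fin 2 → Euc 3} {X Y Z : Euc 3 →ᵃ[ℝ] ℝ}
  {r φ κ : ℝ}

lemma q_mem (k : Fin m) : q k ∈ vertexFinset q v u := mem_vertexFinset.2 (Or.inl ⟨k, rfl⟩)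

lemma v_mem (i : Fin 2) : v i ∈ vertexFinset q v u := mem_vertexFinset.2 (Or.inr (Or.inl ⟨i, rfl⟩))

lemma u_mem (j : Fin 2) : u j ∈ vertexFinset q v u := mem_vertexFinset.2 (Or.inr (Or.inr ⟨j, rfl⟩))

lemma q_inj (h : Frame m q v u X Y Z r φ κ) : Function.Injective q := fun j k hjk =>
  h.Xinj (by simp only [hjk])

lemma vZ' (h : Frame m q v u X Y Z r φ κ) (i : Fin 2) : Z (v i) = Z (v 0) := by
  fin_cases i; exacts [rfl, h.vZ]

lemma uZ' (h : Frame m q v u X Y Z r φ κ) (j : Fin 2) : Z (u j) = Z (u 0) := by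
  fin_cases j; exacts [rfl, h.uZ]

lemma vY' (h : Frame m q v u X Y Z r φ κ) (i : Fin 2) : Y (v i) = Y (v 0) := by
  fin_cases i; exacts [rfl, h.vY]

lemma uX' (h : Frame m q v u X Y Z r φ κ) (j : Fin 2) : X (u j) = X (u 0) := by
  fin_cases j; exacts [rfl, h.uX]

lemma vZ_pos' (h : Frame m q v u X Y Z r φ κ) (i : Fin 2) : 0 < Z (v i) := by
  rw [h.vZ']; exact h.vZ_pos

lemma uZ_neg' (h : Frame m q v u X Y Z r φ κ) (j : Fin 2) : Z (u j) < 0 := by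
  rw [h.uZ']; exact h.uZ_neg

lemma v_inj (h : Frame m q v u X Y Z r φ κ) : Function.Injective v := by
  intro i j hij
  have := h.vX
  fin_cases i <;> fin_cases j <;> simp_all

lemma u_inj (h : Frame m q v u X Y Z r φ κ) : Function.Injective u := h.swap.v_inj

lemma q_ne_v (h : Frame m q v u X Y Z r φ κ) (k i) : q k ≠ v i := fun he => by
  have := h.vZ_pos' i; rw [← he, h.qZ] at this; exact lt_irrefl _ this

lemma q_ne_u (h : Frame m q v u X Y Z r φ κ) (k i) : q k ≠ u i := h.swap.q_ne_v k i

lemma v_ne_u (h : Frame m q v u X Y Z r φ κ) (i j) : v i ≠ u j := fun he => by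
  have h1 := h.vZ_pos' i; have h2 := h.uZ_neg' j; rw [← he] at h2; linarith

lemma circle (h : Frame m q v u X Y Z r φ κ) (k : Fin m) : X (q k) ^ 2 + Y (q k) ^ 2 = r ^ 2 := by
  rw [h.qX, h.qY]
  linear_combination r ^ 2 * Real.sin_sq_add_cos_sq (φ + (k : ℕ) * (2 * Real.pi / m))

/-- The affine function defining the tangent of the circumcircle at `q k`. -/
noncomputable def tangent (q : Fin m → Euc 3) (X Y : Euc 3 →ᵃ[ℝ] ℝ) (r : ℝ) (k : Fin m) :
    Euc 3 →ᵃ[ℝ] ℝ := X (q k) • X + Y (q k) • Y - AffineMap.const ℝ (Euc 3) (r ^ 2)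

lemma tangent_apply (k : Fin m) (p : Euc 3) :
    tangent q X Y r k p = X (q k) * X p + Y (q k) * Y p - r ^ 2 := by
  simp [tangent]

lemma tangent_self (h : Frame m q v u X Y Z r φ κ) (k : Fin m) : tangent q X Y r k (q k) = 0 := by
  rw [tangent_apply, ← h.circle k]; ring

lemma tangent_neg (h : Frame m q v u X Y Z r φ κ) {k l : Fin m} (hkl : k ≠ l) :
    tangent q X Y r k (q l) < 0 := by
  rw [tangent_apply]
  have h1 := h.circle k
  have h2 := h.circle l
  have h3 : X (q k) - X (q l) ≠ 0 := sub_ne_zero.2 fun he => hkl (h.Xinj he)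
  have := pow_pos (abs_pos.2 h3) 2
  rw [sq_abs] at this
  nlinarith [sq_nonneg (Y (q k) - Y (q l))]

lemma tangent_le (h : Frame m q v u X Y Z r φ κ) (k l : Fin m) :
    tangent q X Y r k (q l) ≤ 0 := by
  by_cases hkl : k = l
  · subst hkl; rw [h.tangent_self]
  · exact (h.tangent_neg hkl).le

lemma exists_ne (h : Frame m q v u X Y Z r φ κ) (k : Fin m) : ∃ l, k ≠ l := by
  have := h.four_le
  by_cases hk : (k : ℕ) = 0
  · exact ⟨⟨1, by omega⟩, fun he => by rw [he] at hk; simp at hk⟩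
  · exact ⟨⟨0, by omega⟩, fun he => by rw [he] at hk; simp at hk⟩

lemma q_nonCol (h : Frame m q v u X Y Z r φ κ) {a b c : Fin m} (hab : a ≠ b) (hac : a ≠ c)
    (hbc : b ≠ c) {x y z : ℝ} (h0 : x + y + z = 0) (h1 : x • q a + y • q b + z • q c = 0) :
    x = 0 ∧ y = 0 ∧ z = 0 := by
  have e1 := affine_comb₃_zero (tangent q X Y r a) h0 h1
  have e2 := affine_comb₃_zero (tangent q X Y r b) h0 h1
  have e3 := affine_comb₃_zero (tangent q X Y r c) h0 h1
  rw [h.tangent_self, mul_zero, zero_add] at e1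
  rw [h.tangent_self, mul_zero, add_zero] at e2
  rw [h.tangent_self, mul_zero, add_zero] at e3
  have n1 := h.tangent_neg hab
  have n2 := h.tangent_neg hac
  have n3 := h.tangent_neg hbc
  have s1 : tangent q X Y r b (q a) = tangent q X Y r a (q b) := by simp only [tangent_apply]; ring
  have s2 : tangent q X Y r c (q a) = tangent q X Y r a (q c) := by simp only [tangent_apply]; ring
  have s3 : tangent q X Y r c (q b) = tangent q X Y r b (q c) := by simp only [tangent_apply]; ring
  rw [s1] at e2
  rw [s2, s3] at e3
  set α := tangent q X Y r a (q b)
  set β := tangent q X Y r a (q c)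
  set γ := tangent q X Y r b (q c)
  have hy : y = 0 := by
    have : y * (α * γ) = 0 := by linear_combination (α * e3 - β * e2 + γ * e1) / 2
    rcases mul_eq_zero.1 this with h | h
    · exact h
    · exact absurd h (mul_pos_of_neg_of_neg n1 n3).ne'
  have hz : z = 0 := by
    rw [hy, zero_mul, zero_add] at e1
    exact (mul_eq_zero.1 e1).resolve_right n2.ne
  exact ⟨by linarith, hy, hz⟩

lemma full_vvqq (h : Frame m q v u X Y Z r φ κ) {a b : Fin m} (hab : a ≠ b) :
    IsFullSimplexIn (vertexFinset q v u : Set (Euc 3)) {v 0, v 1, q a, q b} := by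
  refine isFullSimplexIn_of_indep (v_mem 0) (v_mem 1) (q_mem a) (q_mem b) ?_
  intro x y z t h0 h1
  have eZ := affine_comb₄_zero Z h0 h1
  have eX := affine_comb₄_zero X h0 h1
  have eY := affine_comb₄_zero Y h0 h1
  rw [h.qZ, h.qZ, h.vZ] at eZ
  have hxy : x + y = 0 := by
    have : (x + y) * Z (v 0) = 0 := by linear_combination eZ
    exact (mul_eq_zero.1 this).resolve_right h.vZ_pos.ne'
  rw [h.vY] at eY
  have hz : z = 0 := by
    have : z * (Y (q a) - Y (q b)) = 0 := by
      linear_combination eY - Y (q b) * h0 + (Y (q b) - Y (v 0)) * hxy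
    exact (mul_eq_zero.1 this).resolve_right (sub_ne_zero.2 fun he => hab (h.Yinj he))
  have ht : t = 0 := by linarith
  have hx : x = 0 := by
    have : x * (X (v 0) - X (v 1)) = 0 := by
      rw [hz, ht] at eX
      linear_combination eX - X (v 1) * hxy
    exact (mul_eq_zero.1 this).resolve_right (sub_ne_zero.2 h.vX)
  exact ⟨hx, by linarith, hz, ht⟩

lemma full_qqq (h : Frame m q v u X Y Z r φ κ) {a b c : Fin m} (hab : a ≠ b) (hac : a ≠ c)
    (hbc : b ≠ c) {w : Euc 3} (hw : w ∈ vertexFinset q v u) (hwZ : Z w ≠ 0) :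
    IsFullSimplexIn (vertexFinset q v u : Set (Euc 3)) {q a, q b, q c, w} := by
  refine isFullSimplexIn_of_indep (q_mem a) (q_mem b) (q_mem c) hw ?_
  intro x y z t h0 h1
  have eZ := affine_comb₄_zero Z h0 h1
  rw [h.qZ, h.qZ, h.qZ] at eZ
  have ht : t = 0 := by
    have : t * Z w = 0 := by linear_combination eZ
    exact (mul_eq_zero.1 this).resolve_right hwZ
  subst ht
  obtain ⟨h2, h3, h4⟩ := h.q_nonCol hab hac hbc (x := x) (y := y) (z := z) (by linarith)
    (by simpa using h1)
  exact ⟨h2, h3, h4, rfl⟩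

lemma cross_apply (f : Euc 3 →ᵃ[ℝ] ℝ) (i j : Fin 2) :
    f (crossPt κ v u i j) = (1 - κ) * f (v i) + κ * f (u j) :=
  affine_comb₂ f _ _ (by ring)

lemma q_mem_extremePoints (h : Frame m q v u X Y Z r φ κ) (k : Fin m) :
    q k ∈ (convexHull ℝ (vertexFinset q v u : Set (Euc 3))).extremePoints ℝ := by
  have hlt : ∀ i j, (1 - κ) * tangent q X Y r k (v i) + κ * tangent q X Y r k (u j) < 0 := by
    intro i j
    rw [← cross_apply]
    obtain ⟨l, hl⟩ := h.exists_ne k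
    refine h.cross_lt i j _ 0 (h.tangent_le k) ⟨l, k, ?_⟩
    rw [h.tangent_self]; exact (h.tangent_neg hl).ne
  obtain ⟨a, ha⟩ : ∃ i₀, ∀ i, tangent q X Y r k (v i) ≤ tangent q X Y r k (v i₀) :=
    Finite.exists_max _
  obtain ⟨b, hb⟩ : ∃ i₀, ∀ i, tangent q X Y r k (u i) ≤ tangent q X Y r k (u i₀) :=
    Finite.exists_max _
  -- tilt the tangent line so that it takes the value of a crossing point at both edges
  set α := tangent q X Y r k (v a)
  set β := tangent q X Y r k (u b)
  have hH : 0 < Z (v 0) - Z (u 0) := by linarith [h.vZ_pos, h.uZ_neg]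
  set s := (β - α) / (Z (v 0) - Z (u 0)) with hs
  have hsH : s * (Z (v 0) - Z (u 0)) = β - α := by rw [hs]; field_simp
  have hκ := h.κZ
  have hv : α + s * Z (v 0) = (1 - κ) * α + κ * β := by linear_combination s * hκ + κ * hsH
  have hu : β + s * Z (u 0) = (1 - κ) * α + κ * β := by
    linear_combination s * hκ - (1 - κ) * hsH
  have hab := hlt a b
  have hval : ∀ p, (tangent q X Y r k + s • Z) p = tangent q X Y r k p + s * Z p := by
    intro p; simp
  refine mem_extremePoints_of_lex _ (tangent q X Y r k + s • Z) 0 (q_mem k) ?_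
  intro w' hw' hne
  left
  rw [hval, hval, h.tangent_self, h.qZ]
  rcases mem_vertexFinset.1 hw' with ⟨l, rfl⟩ | ⟨i, rfl⟩ | ⟨j, rfl⟩
  · rw [h.qZ]
    have := h.tangent_neg (k := k) (l := l) (fun he => hne (by rw [he]))
    linarith
  · rw [h.vZ']
    have := ha i
    linarith
  · rw [h.uZ']
    have := hb j
    linarith

lemma v_mem_extremePoints (h : Frame m q v u X Y Z r φ κ) (i : Fin 2) :
    v i ∈ (convexHull ℝ (vertexFinset q v u : Set (Euc 3))).extremePoints ℝ := by
  obtain ⟨i', hi'⟩ : ∃ i' : Fin 2, i' ≠ i := ⟨1 - i, by fin_cases i <;> decide⟩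
  have hX : X (v i) - X (v i') ≠ 0 := by
    have := h.vX
    refine sub_ne_zero.2 fun he => ?_
    fin_cases i <;> fin_cases i' <;> simp_all
  refine mem_extremePoints_of_lex _ Z ((X (v i) - X (v i')) • X) (v_mem i) ?_
  intro w' hw' hne
  rcases mem_vertexFinset.1 hw' with ⟨l, rfl⟩ | ⟨j, rfl⟩ | ⟨j, rfl⟩
  · left; rw [h.qZ]; exact h.vZ_pos' i
  · right
    refine ⟨by rw [h.vZ', h.vZ' i], ?_⟩
    have hj : j = i' := by
      have : j ≠ i := fun he => hne (by rw [he])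
      omega
    rw [hj]
    have := mul_self_pos.2 hX
    simp only [AffineMap.coe_smul, Pi.smul_apply, smul_eq_mul]
    linarith
  · left; linarith [h.vZ_pos' i, h.uZ_neg' j]

lemma extremePoints_eq (h : Frame m q v u X Y Z r φ κ) :
    (convexHull ℝ (vertexFinset q v u : Set (Euc 3))).extremePoints ℝ = vertexFinset q v u := by
  refine Subset.antisymm extremePoints_convexHull_subset fun w hw => ?_
  rcases mem_vertexFinset.1 hw with ⟨l, rfl⟩ | ⟨i, rfl⟩ | ⟨j, rfl⟩
  · exact h.q_mem_extremePoints l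
  · exact h.v_mem_extremePoints i
  · have := h.swap.v_mem_extremePoints j
    rwa [vertexFinset_swap] at this

lemma polytopePm_eq : polytopePm q v u = convexHull ℝ (vertexFinset q v u : Set (Euc 3)) := by
  rw [polytopePm, coe_vertexFinset]

lemma verticesPm_eq (h : Frame m q v u X Y Z r φ κ) :
    verticesPm q v u = (vertexFinset q v u : Set (Euc 3)) := by
  rw [verticesPm, polytopePm_eq, h.extremePoints_eq]

lemma card_vertexFinset (h : Frame m q v u X Y Z r φ κ) : (vertexFinset q v u).card = m + 4 := by
  classical
  have e : vertexFinset q v u =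
      Finset.univ.image q ∪ Finset.univ.image v ∪ Finset.univ.image u := by
    ext w; simp [mem_vertexFinset, or_assoc]
  rw [e, Finset.card_union_of_disjoint, Finset.card_union_of_disjoint,
    Finset.card_image_of_injective _ h.q_inj, Finset.card_image_of_injective _ h.v_inj,
    Finset.card_image_of_injective _ h.u_inj]
  · simp
  · rw [Finset.disjoint_left]
    intro w h1 h2
    simp only [Finset.mem_image, Finset.mem_univ, true_and] at h1 h2
    obtain ⟨k, rfl⟩ := h1
    obtain ⟨i, hi⟩ := h2
    exact h.q_ne_v k i hi.symm
  · rw [Finset.disjoint_left]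
    intro w h1 h2
    simp only [Finset.mem_image, Finset.mem_univ, true_and, Finset.mem_union] at h1 h2
    obtain ⟨j, rfl⟩ := h2
    rcases h1 with ⟨k, hk⟩ | ⟨i, hi⟩
    · exact h.q_ne_u k j hk
    · exact h.v_ne_u i j hi

lemma interior_nonempty (h : Frame m q v u X Y Z r φ κ) :
    (interior (convexHull ℝ (vertexFinset q v u : Set (Euc 3)))).Nonempty := by
  have := h.four_le
  have hfull := h.full_vvqq (a := ⟨0, by omega⟩) (b := ⟨1, by omega⟩) (by simp)
  obtain ⟨lam, hl⟩ := hfull.exists_bary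
  obtain ⟨p, hp⟩ := hl.interior_nonempty ⟨_, Finset.mem_insert_self _ _⟩
  exact ⟨p, interior_mono (convexHull_mono hfull.subset) hp⟩

/-- A face that avoids the lower edge has at most two vertices on the polygon. -/
lemma face_affineIndependent (h : Frame m q v u X Y Z r φ κ) (f : Euc 3 →ᵃ[ℝ] ℝ) {M : ℝ}
    (hf : ∀ w ∈ vertexFinset q v u, f w ≤ M) (hne : ∃ w ∈ vertexFinset q v u, f w ≠ M)
    (hu : ∀ j, f (u j) ≠ M) {S : Finset (Euc 3)}
    (hS : ∀ w ∈ S, w ∈ vertexFinset q v u ∧ f w = M) :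
    AffineIndependent ℝ (fun x : S => (x : Euc 3)) := by
  classical
  have hcard : (Finset.univ.filter fun k => f (q k) = M).card ≤ 2 := by
    by_contra hc
    obtain ⟨a, b, c, ha, hb, hc, hab, hac, hbc⟩ := Finset.two_lt_card_iff.1 (not_le.1 hc)
    simp only [Finset.mem_filter, Finset.mem_univ, true_and] at ha hb hc
    have hfull := h.full_qqq hab hac hbc (v_mem 0) h.vZ_pos.ne'
    obtain ⟨lam, hl⟩ := hfull.exists_bary
    -- `f - M` is a multiple of `Z`, hence has opposite signs on the two edges
    have hlin : ∀ p, (f p - M) * Z (v 0) = (f (v 0) - M) * Z p := by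
      intro p
      have n1 : q a ≠ q b := fun he => hab (h.q_inj he)
      have n2 : q a ≠ q c := fun he => hac (h.q_inj he)
      have n3 : q b ≠ q c := fun he => hbc (h.q_inj he)
      have e1 := hl.affine_eq f p
      have e2 := hl.affine_eq Z p
      have e3 := hl.sum p
      rw [Finset.sum_insert (by simp [n1, n2, h.q_ne_v]), Finset.sum_insert
        (by simp [n3, h.q_ne_v]), Finset.sum_insert (by simp [h.q_ne_v]),
        Finset.sum_singleton] at e1 e2 e3
      rw [h.qZ, h.qZ, h.qZ] at e2
      rw [ha, hb, hc] at e1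
      rw [e1, e2]
      linear_combination (M * Z (v 0)) * e3
    have h1 := hf _ (v_mem 0)
    have h2 := hf _ (u_mem 0)
    have h3 := hlin (u 0)
    have h4 : f (v 0) = M := by
      by_contra hne
      have h5 : f (v 0) - M < 0 := by
        have := lt_of_le_of_ne h1 hne; linarith
      have := mul_pos_of_neg_of_neg h5 h.uZ_neg
      have : (f (u 0) - M) * Z (v 0) ≤ 0 :=
        mul_nonpos_of_nonpos_of_nonneg (by linarith) h.vZ_pos.le
      linarith
    obtain ⟨w, _, hw⟩ := hne
    have h6 := hlin w
    rw [h4, sub_self, zero_mul] at h6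
    exact hw (by linarith [(mul_eq_zero.1 h6).resolve_right h.vZ_pos.ne'])
  obtain ⟨K, hK1, hK2⟩ := Finset.exists_superset_card_eq hcard
    (by simpa using (by omega : 2 ≤ 4).trans h.four_le)
  obtain ⟨a, b, hab, rfl⟩ := Finset.card_eq_two.1 hK2
  have hsub : S ⊆ {v 0, v 1, q a, q b} := by
    intro w hw
    obtain ⟨hwA, hwM⟩ := hS w hw
    rcases mem_vertexFinset.1 hwA with ⟨l, rfl⟩ | ⟨i, rfl⟩ | ⟨j, rfl⟩
    · have := hK1 (Finset.mem_filter.2 ⟨Finset.mem_univ l, hwM⟩)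
      simp only [Finset.mem_insert, Finset.mem_singleton] at this
      rcases this with rfl | rfl <;> simp
    · fin_cases i <;> simp
    · exact absurd hwM (hu j)
  have := (h.full_vvqq hab).affineIndependent
  exact this.mono hsub

lemma isSimplicialPolytope (h : Frame m q v u X Y Z r φ κ) :
    IsSimplicialPolytope (polytopePm q v u) := by
  classical
  rw [polytopePm_eq]
  refine ⟨⟨_, rfl⟩, ?_, ?_⟩
  · have h1 : affineSpan ℝ (convexHull ℝ (vertexFinset q v u : Set (Euc 3))) = ⊤ := by
      rw [affineSpan_convexHull, ← interior_convexHull_nonempty_iff_affineSpan_eq_top]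
      exact h.interior_nonempty
    rw [← direction_affineSpan, h1, AffineSubspace.direction_top, finrank_top]
    simp
  intro F hF hFP
  rcases F.eq_empty_or_nonempty with rfl | hFn
  · exact ⟨∅, affineIndependent_of_subsingleton _ _, by simp⟩
  obtain ⟨l, hl⟩ := hF hFn
  obtain ⟨x₀, hx₀⟩ := hFn
  set A := vertexFinset q v u with hA
  set f : Euc 3 →ᵃ[ℝ] ℝ := l.toLinearMap.toAffineMap with hfdef
  have hfl : ∀ p, f p = l p := fun p => rfl
  have hx₀' := hx₀
  rw [hl] at hx₀'
  set M := f x₀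
  have hfM : ∀ w ∈ A, f w ≤ M := fun w hw => hx₀'.2 w (subset_convexHull ℝ _ hw)
  have hFeq : F = convexHull ℝ ((A.filter fun w => f w = M : Finset (Euc 3)) : Set (Euc 3)) := by
    apply Subset.antisymm
    · intro x hx
      rw [hl] at hx
      exact mem_convexHull_filter A f hfM hx.1 (le_antisymm (hx₀'.2 x hx.1) (hx.2 x₀ hx₀'.1))
    · intro x hx
      have hxP : x ∈ convexHull ℝ (A : Set (Euc 3)) :=
        convexHull_mono (Finset.coe_subset.2 (Finset.filter_subset _ _)) hx
      have hxM : M ≤ f x := affine_le_convexHull f (fun w hw => by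
        rw [(Finset.mem_filter.1 hw).2]) hx
      rw [hl]
      exact ⟨hxP, fun y hy => (affine_convexHull_le f hfM hy).trans hxM⟩
  have hne : ∃ w ∈ A, f w ≠ M := by
    by_contra! hall
    apply hFP
    rw [hFeq, Finset.filter_true_of_mem hall]
  refine ⟨A.filter fun w => f w = M, ?_, hFeq⟩
  have hmem : ∀ w ∈ A.filter (fun w => f w = M), w ∈ A ∧ f w = M :=
    fun w hw => Finset.mem_filter.1 hw
  -- a face meeting both edges would contain an interior point of the polygon
  have hcase : (∀ j, f (u j) ≠ M) ∨ (∀ i, f (v i) ≠ M) := by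
    by_contra! hcon
    obtain ⟨⟨j, hj⟩, ⟨i, hi⟩⟩ := hcon
    have hcr : f (crossPt κ v u i j) = M := by rw [cross_apply, hi, hj]; ring
    have hconst : ∀ k l, f (q k) = f (q l) := by
      by_contra! hc
      exact (h.cross_lt i j f M (fun k => hfM _ (q_mem k)) hc).ne hcr
    have hm := h.four_le
    have hqM : ∀ k, f (q k) = M := by
      intro k
      refine le_antisymm (hfM _ (q_mem k)) ?_
      rw [← hcr]
      refine affine_convexHull_le f ?_ (h.cross_mem i j)
      rintro _ ⟨l, rfl⟩
      exact (hconst l k).le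
    have hfull := h.full_qqq (a := ⟨0, by omega⟩) (b := ⟨1, by omega⟩) (c := ⟨2, by omega⟩)
      (by simp) (by simp) (by simp) (v_mem i) (h.vZ_pos' i).ne'
    obtain ⟨lam, hlam⟩ := hfull.exists_bary
    obtain ⟨w, _, hw⟩ := hne
    apply hw
    rw [hlam.affine_eq f w, ← one_mul M, ← hlam.sum w, Finset.sum_mul]
    refine Finset.sum_congr rfl fun x hx => ?_
    congr 1
    simp only [Finset.mem_insert, Finset.mem_singleton] at hx
    rcases hx with rfl | rfl | rfl | rfl
    exacts [hqM _, hqM _, hqM _, hi]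
  rcases hcase with h1 | h1
  · exact h.face_affineIndependent f hfM hne h1 hmem
  · refine h.swap.face_affineIndependent f ?_ ?_ h1 (S := A.filter fun w => f w = M) ?_
    all_goals rw [vertexFinset_swap]
    · exact hfM
    · exact hne
    · exact hmem

end Frame

/-! ### The zigzag order of the polygon -/

/-- The sequence `0, -1, 1, -2, 2, …`. -/
def zz (t : ℕ) : ℤ := if Even t then t / 2 else -((t + 1) / 2)

lemma zz_even (k : ℕ) : zz (2 * k) = k := by simp [zz]

lemma zz_odd (k : ℕ) : zz (2 * k + 1) = -(k + 1) := by
  have : ¬ Even (2 * k + 1) := by simp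
  simp only [zz, this, if_false]
  push_cast
  omega

/-- The angles of the vertices of a regular `m`-gon, measured from the `y`-axis and sorted by
absolute value: they are `α`, `α - δ`, `α + δ`, `α - 2 * δ`, … with `δ = 2 * π / m`. -/
noncomputable def zang (m : ℕ) (α : ℝ) (t : ℕ) : ℝ := α + zz t * (2 * Real.pi / m)

/-- `p` lists the vertices of the regular polygon `q` by decreasing `y`-coordinate; they alternate
between the two sides of the `y`-axis. -/
structure Zigzag (m : ℕ) (q : Fin m → Euc 3) (x y : Euc 3 →ᵃ[ℝ] ℝ) (r α : ℝ)
    (p : ℕ → Fin m) : Prop where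
  α_pos : 0 < α
  α_lt : α < Real.pi / m
  hx : ∀ t < m, x (q (p t)) = r * Real.sin (zang m α t)
  hy : ∀ t < m, y (q (p t)) = r * Real.cos (zang m α t)

/-- The integer `n` as an index modulo `m`. -/
def intIdx (m : ℕ) [NeZero m] (n : ℤ) : Fin m :=
  ⟨(n % m).toNat, by
    have h : (0 : ℤ) < m := by exact_mod_cast Nat.pos_of_neZero m
    have h1 := Int.emod_nonneg n h.ne'
    have h2 := Int.emod_lt_of_pos n h
    omega⟩

lemma intIdx_angle (m : ℕ) [NeZero m] (n : ℤ) (φ : ℝ) :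
    φ + ((intIdx m n : Fin m) : ℕ) * (2 * Real.pi / m) =
      φ + n * (2 * Real.pi / m) - ((n / m : ℤ) : ℝ) * (2 * Real.pi) := by
  have h : (0 : ℤ) < m := by exact_mod_cast Nat.pos_of_neZero m
  have h1 : (((intIdx m n : Fin m) : ℕ) : ℤ) = n - m * (n / m) := by
    have := Int.emod_nonneg n h.ne'
    simp only [intIdx]
    rw [Int.toNat_of_nonneg this, Int.emod_def]
  have h2 : ((((intIdx m n : Fin m) : ℕ) : ℤ) : ℝ) = n - m * ((n / m : ℤ) : ℝ) := by
    rw [h1]; push_cast; ring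
  have hm : (m : ℝ) ≠ 0 := by exact_mod_cast (NeZero.ne m)
  rw [Int.cast_natCast] at h2
  rw [h2]
  field_simp
  ring

namespace Frame

variable {m : ℕ} {q : Fin m → Euc 3} {v u : Fin 2 → Euc 3} {X Y Z : Euc 3 →ᵃ[ℝ] ℝ}
  {r φ κ : ℝ}

lemma qX_int [NeZero m] (h : Frame m q v u X Y Z r φ κ) (n : ℤ) :
    X (q (intIdx m n)) = r * Real.cos (φ + n * (2 * Real.pi / m)) := by
  rw [h.qX, intIdx_angle, Real.cos_sub_int_mul_two_pi]

lemma qY_int [NeZero m] (h : Frame m q v u X Y Z r φ κ) (n : ℤ) :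
    Y (q (intIdx m n)) = r * Real.sin (φ + n * (2 * Real.pi / m)) := by
  rw [h.qY, intIdx_angle, Real.sin_sub_int_mul_two_pi]

/-- The vertices can be listed in zigzag order once the direction of the `Y`-axis is known to lie
strictly inside a half-step of the polygon. -/
lemma exists_zigzag (h : Frame m q v u X Y Z r φ κ) {n : ℤ} {β ε : ℝ} (hε : ε = 1 ∨ ε = -1)
    (hβ : Real.pi / 2 - φ = (n + β) * (2 * Real.pi / m)) (h0 : 0 < ε * β) (h1 : ε * β < 1 / 2) :
    ∃ p, Zigzag m q (ε • X) Y r (ε * β * (2 * Real.pi / m)) p := by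
  have hm := h.four_le
  have : NeZero m := ⟨by omega⟩
  have hmR : (0 : ℝ) < m := by positivity
  have hpi := Real.pi_pos
  have hε' : ∃ e : ℤ, (e : ℝ) = ε := by
    rcases hε with rfl | rfl
    exacts [⟨1, by simp⟩, ⟨-1, by simp⟩]
  obtain ⟨e, he⟩ := hε'
  have hεε : ε * ε = 1 := by rcases hε with rfl | rfl <;> norm_num
  refine ⟨fun t => intIdx m (n - e * zz t), by positivity, ?_, ?_, ?_⟩
  · have : ε * β * (2 * Real.pi / m) < 1 / 2 * (2 * Real.pi / m) := by
      apply mul_lt_mul_of_pos_right h1; positivity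
    calc _ < _ := this
      _ = _ := by ring
  · intro t _
    simp only [AffineMap.coe_smul, Pi.smul_apply, smul_eq_mul]
    have hφ : φ = Real.pi / 2 - (n + β) * (2 * Real.pi / m) := by linarith
    rw [h.qX_int]
    have : φ + ((n - e * zz t : ℤ) : ℝ) * (2 * Real.pi / m) =
        Real.pi / 2 - ε * (ε * β * (2 * Real.pi / m) + zz t * (2 * Real.pi / m)) := by
      push_cast; rw [he, hφ]; linear_combination (β * (2 * Real.pi / m)) * hεε
    rw [this, Real.cos_pi_div_two_sub, zang]
    rcases hε with rfl | rfl
    · simp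
    · rw [show (-1 : ℝ) * (-1 * β * (2 * Real.pi / m) + (zz t) * (2 * Real.pi / m)) =
        -(-1 * β * (2 * Real.pi / m) + (zz t) * (2 * Real.pi / m)) by ring, Real.sin_neg]; ring
  · intro t _
    have hφ : φ = Real.pi / 2 - (n + β) * (2 * Real.pi / m) := by linarith
    rw [h.qY_int]
    have : φ + ((n - e * zz t : ℤ) : ℝ) * (2 * Real.pi / m) =
        Real.pi / 2 - ε * (ε * β * (2 * Real.pi / m) + zz t * (2 * Real.pi / m)) := by
      push_cast; rw [he, hφ]; linear_combination (β * (2 * Real.pi / m)) * hεε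
    rw [this, Real.sin_pi_div_two_sub, zang]
    rcases hε with rfl | rfl
    · simp
    · rw [show (-1 : ℝ) * (-1 * β * (2 * Real.pi / m) + (zz t) * (2 * Real.pi / m)) =
        -(-1 * β * (2 * Real.pi / m) + (zz t) * (2 * Real.pi / m)) by ring, Real.cos_neg]

/-- No vertex and no midpoint of an edge lies on the `Y`-axis, since the edge `v 0, v 1` is not
parallel to an edge or diagonal of the polygon. -/
lemma exists_offset (h : Frame m q v u X Y Z r φ κ) :
    ∃ (n : ℤ) (β : ℝ), Real.pi / 2 - φ = (n + β) * (2 * Real.pi / m) ∧ β ≠ 0 ∧ |β| < 1 / 2 := by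
  have hm := h.four_le
  have : NeZero m := ⟨by omega⟩
  have hmR : (0 : ℝ) < m := by positivity
  have hpi := Real.pi_pos
  set δ := 2 * Real.pi / m with hδ
  have hδpos : 0 < δ := by positivity
  have hδm : δ * m = 2 * Real.pi := by rw [hδ]; field_simp
  set c := (Real.pi / 2 - φ) / δ with hc
  have hcδ : Real.pi / 2 - φ = c * δ := by rw [hc]; field_simp
  -- two vertices symmetric about the `Y`-axis have the same height
  have hsym : ∀ a b : ℤ, 0 < a - b → a - b < m → (a : ℝ) + b ≠ 2 * c := by
    intro a b hab habm he
    have h1 : Y (q (intIdx m a)) = Y (q (intIdx m b)) := by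
      rw [h.qY_int, h.qY_int, ← hδ]
      have : φ + a * δ = Real.pi - (φ + b * δ) := by
        have : Real.pi - 2 * φ = 2 * c * δ := by linarith
        rw [← he] at this
        linarith
      rw [this, Real.sin_pi_sub]
    have h2 : intIdx m a = intIdx m b := h.Yinj h1
    have h3 : a % m = b % m := by
      have := congrArg (fun x : Fin m => ((x : ℕ) : ℤ)) h2
      have hm0 : (m : ℤ) ≠ 0 := by omega
      simp only [intIdx] at this
      rwa [Int.toNat_of_nonneg (Int.emod_nonneg _ hm0),
        Int.toNat_of_nonneg (Int.emod_nonneg _ hm0)] at this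
    have h4 := Int.emod_emod_of_dvd (a - b) (dvd_refl (m : ℤ))
    have h5 : (a - b) % m = 0 := by rw [Int.sub_emod, h3, sub_self, Int.zero_emod]
    have h6 := Int.eq_zero_of_dvd_of_nonneg_of_lt hab.le habm (Int.dvd_of_emod_eq_zero h5)
    omega
  refine ⟨round c, c - round c, by rw [hcδ]; ring, ?_, ?_⟩
  · intro h0
    refine hsym (round c + 1) (round c - 1) (by omega) (by omega) ?_
    push_cast; linarith
  · refine lt_of_le_of_ne (abs_sub_round c) fun h0 => ?_
    rcases abs_choice (c - round c) with h1 | h1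
    · refine hsym (round c + 1) (round c) (by omega) (by omega) ?_
      push_cast; linarith
    · refine hsym (round c) (round c - 1) (by omega) (by omega) ?_
      push_cast; linarith

/-- The zigzags belonging to the two edges; the second is the first turned by a right angle, and
also reflected if `m` is not divisible by `4`. -/
lemma exists_zigzags (h : Frame m q v u X Y Z r φ κ) :
    ∃ (ε ε' α α' : ℝ) (p p' : ℕ → Fin m), (ε = 1 ∨ ε = -1) ∧
      Zigzag m q (ε • X) Y r α p ∧ Zigzag m q (ε' • Y) (-X) r α' p' ∧
      ((Even (m / 2) ∧ ε' = ε ∧ α' = α) ∨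
        (¬ Even (m / 2) ∧ ε' = -ε ∧ α' = Real.pi / m - α)) := by
  obtain ⟨n, β, hn, hβ0, hβ⟩ := h.exists_offset
  have hm := h.four_le
  have hmR : (0 : ℝ) < m := by positivity
  obtain ⟨ε, hε, hpos, hlt⟩ : ∃ ε : ℝ, (ε = 1 ∨ ε = -1) ∧ 0 < ε * β ∧ ε * β < 1 / 2 := by
    rw [abs_lt] at hβ
    rcases lt_or_gt_of_ne hβ0 with h1 | h1
    · exact ⟨-1, Or.inr rfl, by linarith, by linarith⟩
    · exact ⟨1, Or.inl rfl, by linarith, by linarith⟩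
  obtain ⟨p, hp⟩ := h.exists_zigzag hε hn hpos hlt
  obtain ⟨k, hk⟩ := h.even
  have hk2 : m / 2 = k := by omega
  have hkR : (m : ℝ) = 2 * k := by rw [hk]; push_cast; ring
  have hk0 : (0 : ℝ) < k := by linarith
  have hn' : Real.pi / 2 - (φ - Real.pi / 2) = (n + β + k / 2) * (2 * Real.pi / m) := by
    have : (k / 2 : ℝ) * (2 * Real.pi / m) = Real.pi / 2 := by rw [hkR]; field_simp
    rw [add_mul, ← hn, this]; ring
  rw [hk2]
  rcases Nat.even_or_odd k with ⟨l, hl⟩ | ⟨l, hl⟩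
  · have e : Real.pi / 2 - (φ - Real.pi / 2) = (((n + l : ℤ) : ℝ) + β) * (2 * Real.pi / m) := by
      rw [hn', hl]; push_cast; ring
    obtain ⟨p', hp'⟩ := h.swap.exists_zigzag hε e hpos hlt
    exact ⟨ε, ε, _, _, p, p', hε, hp, hp', Or.inl ⟨⟨l, hl⟩, rfl, rfl⟩⟩
  · have hk' : ¬ Even k := by rw [Nat.not_even_iff_odd]; exact ⟨l, hl⟩
    have hεε : ε * ε = 1 := by rcases hε with rfl | rfl <;> norm_num
    have hα : -ε * (β - ε / 2) * (2 * Real.pi / m) =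
        Real.pi / m - ε * β * (2 * Real.pi / m) := by
      field_simp; linear_combination hεε
    obtain ⟨n', hn''⟩ : ∃ n' : ℤ, (n' : ℝ) = n + k / 2 + ε / 2 := by
      rcases hε with rfl | rfl
      · exact ⟨n + l + 1, by rw [hl]; push_cast; ring⟩
      · exact ⟨n + l, by rw [hl]; push_cast; ring⟩
    have e : Real.pi / 2 - (φ - Real.pi / 2) = ((n' : ℝ) + (β - ε / 2)) * (2 * Real.pi / m) := by
      rw [hn', hn'']; ring
    have e1 : -ε * (β - ε / 2) = 1 / 2 - ε * β := by linear_combination (1 / 2) * hεε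
    obtain ⟨p', hp'⟩ := h.swap.exists_zigzag (ε := -ε)
      (by rcases hε with rfl | rfl <;> simp) e (by rw [e1]; linarith) (by rw [e1]; linarith)
    rw [hα] at hp'
    exact ⟨ε, -ε, _, _, p, p', hε, hp, hp', Or.inr ⟨hk', rfl, rfl⟩⟩

end Frame

/-! ### Chords and edges of the zigzag -/

/-- The angle from the `y`-axis to the normal of the chord `t, t + 1` of the zigzag. -/
noncomputable def chordMid (m : ℕ) (α : ℝ) (t : ℕ) : ℝ :=
  if Even t then α - Real.pi / m else α

/-- The affine function vanishing on the chord from the `t`-th to the `(t + 1)`-st vertex of the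
zigzag. -/
noncomputable def chordSide (m : ℕ) (x y : Euc 3 →ᵃ[ℝ] ℝ) (r α : ℝ) (t : ℕ) : Euc 3 →ᵃ[ℝ] ℝ :=
  Real.sin (chordMid m α t) • x + Real.cos (chordMid m α t) • y -
    AffineMap.const ℝ (Euc 3) (r * Real.cos ((t + 1) * (Real.pi / m)))

/-- The direction of the outer normal of the polygon edge from the `t`-th to the `(t + 2)`-nd
vertex of the zigzag. -/
noncomputable def edgeMid (m : ℕ) (α : ℝ) (t : ℕ) : ℝ :=
  if Even t then α + (t + 1) * (Real.pi / m) else α - (t + 2) * (Real.pi / m)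

/-- The affine function vanishing on the polygon edge from the `t`-th to the `(t + 2)`-nd vertex
of the zigzag. -/
noncomputable def edgeSide (m : ℕ) (x y : Euc 3 →ᵃ[ℝ] ℝ) (r α : ℝ) (t : ℕ) : Euc 3 →ᵃ[ℝ] ℝ :=
  Real.sin (edgeMid m α t) • x + Real.cos (edgeMid m α t) • y -
    AffineMap.const ℝ (Euc 3) (r * Real.cos (Real.pi / m))

lemma chordSide_apply (m : ℕ) (x y : Euc 3 →ᵃ[ℝ] ℝ) (r α : ℝ) (t : ℕ) (w : Euc 3) :
    chordSide m x y r α t w = Real.sin (chordMid m α t) * x w + Real.cos (chordMid m α t) * y w -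
      r * Real.cos ((t + 1) * (Real.pi / m)) := by
  simp [chordSide]

lemma edgeSide_apply (m : ℕ) (x y : Euc 3 →ᵃ[ℝ] ℝ) (r α : ℝ) (t : ℕ) (w : Euc 3) :
    edgeSide m x y r α t w = Real.sin (edgeMid m α t) * x w + Real.cos (edgeMid m α t) * y w -
      r * Real.cos (Real.pi / m) := by
  simp [edgeSide]

/-- Measured from the direction of the outer normal of an edge of the regular `m`-gon, the vertices
are at odd multiples of `π / m`; hence they lie on one side of this edge. -/
lemma cos_odd_mul_le {m : ℕ} (hm : 0 < m) {n : ℤ} (hn : Odd n) (h1 : |n| < 2 * m) :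
    Real.cos (n * (Real.pi / m)) ≤ Real.cos (Real.pi / m) := by
  have hmR : (0 : ℝ) < m := by exact_mod_cast hm
  have hpi := Real.pi_pos
  have hd : 0 < Real.pi / m := by positivity
  have hmd : (m : ℝ) * (Real.pi / m) = Real.pi := by field_simp
  have hm1 : Real.pi / m ≤ Real.pi := by
    have : (1 : ℝ) ≤ m := by exact_mod_cast hm
    nlinarith
  have key : ∀ k : ℤ, 1 ≤ k → k ≤ m → Real.cos (k * (Real.pi / m)) ≤ Real.cos (Real.pi / m) := by
    intro k hk1 hk2
    have h1 : (1 : ℝ) ≤ k := by exact_mod_cast hk1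
    have h2 : (k : ℝ) ≤ m := by exact_mod_cast hk2
    apply Real.cos_le_cos_of_nonneg_of_le_pi hd.le
    · nlinarith
    · nlinarith
  have hn0 : n ≠ 0 := by rintro rfl; simp at hn
  have habs : Real.cos (n * (Real.pi / m)) = Real.cos ((|n| : ℤ) * (Real.pi / m)) := by
    rw [← Real.cos_abs, abs_mul, abs_of_pos hd, Int.cast_abs]
  rw [habs]
  rcases le_or_gt |n| m with h2 | h2
  · exact key _ (Int.one_le_abs hn0) h2
  · have : Real.cos ((|n| : ℤ) * (Real.pi / m)) = Real.cos ((2 * m - |n| : ℤ) * (Real.pi / m)) := by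
      rw [← Real.cos_two_pi_sub]
      congr 1
      push_cast
      linear_combination (-2) * hmd
    rw [this]
    exact key _ (by omega) (by omega)

namespace Zigzag

variable {m : ℕ} {q : Fin m → Euc 3} {x y : Euc 3 →ᵃ[ℝ] ℝ} {r α : ℝ} {p : ℕ → Fin m}

lemma abs_zang (h : Zigzag m q x y r α p) (t : ℕ) :
    |zang m α t| = t * (Real.pi / m) + (if Even t then α else Real.pi / m - α) := by
  have h1 := h.α_pos
  have h2 := h.α_lt
  have hd : 0 < Real.pi / m := h1.trans h2
  have e : 2 * Real.pi / m = 2 * (Real.pi / m) := by ring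
  rcases Nat.even_or_odd' t with ⟨k, rfl | rfl⟩
  · rw [zang, zz_even, e, if_pos (by simp), abs_of_pos (by positivity)]
    push_cast; ring
  · rw [zang, zz_odd, e, if_neg (by simp), abs_of_neg]
    · push_cast; ring
    · push_cast
      have : (0 : ℝ) ≤ k := by positivity
      nlinarith

lemma y_lt (h : Zigzag m q x y r α p) (hr : 0 < r) {s t : ℕ} (hst : s < t) (ht : t < m) :
    y (q (p t)) < y (q (p s)) := by
  have h1 := h.α_pos
  have h2 := h.α_lt
  have hd : 0 < Real.pi / m := h1.trans h2
  have hm : (0 : ℝ) < m := by exact_mod_cast (by omega : 0 < m)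
  have hmd : (m : ℝ) * (Real.pi / m) = Real.pi := by field_simp
  rw [h.hy t ht, h.hy s (hst.trans ht)]
  apply mul_lt_mul_of_pos_left _ hr
  rw [← Real.cos_abs, ← Real.cos_abs (zang m α s)]
  have e1 := h.abs_zang s
  have e2 := h.abs_zang t
  have b1 : (s : ℝ) + 1 ≤ t := by exact_mod_cast hst
  have b2 : (t : ℝ) + 1 ≤ m := by exact_mod_cast ht
  apply Real.cos_lt_cos_of_nonneg_of_le_pi (abs_nonneg _)
  · rw [e2]
    split_ifs <;> nlinarith
  · rw [e1, e2]
    split_ifs <;> nlinarith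

lemma p_inj (h : Zigzag m q x y r α p) (hr : 0 < r) {s t : ℕ} (hs : s < m) (ht : t < m)
    (he : p s = p t) : s = t := by
  rcases lt_trichotomy s t with h1 | h1 | h1
  · have := h.y_lt hr h1 ht; rw [he] at this; exact absurd this (lt_irrefl _)
  · exact h1
  · have := h.y_lt hr h1 hs; rw [he] at this; exact absurd this (lt_irrefl _)

lemma p_surj (h : Zigzag m q x y r α p) (hr : 0 < r) (k : Fin m) : ∃ t < m, p t = k := by
  have hinj : Function.Injective fun t : Fin m => p t := fun s t hst =>
    Fin.ext (h.p_inj hr s.2 t.2 hst)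
  obtain ⟨t, ht⟩ := (Finite.injective_iff_surjective.1 hinj) k
  exact ⟨t, t.2, ht⟩

lemma y_lt_iff (h : Zigzag m q x y r α p) (hr : 0 < r) {s t : ℕ} (hs : s < m) (ht : t < m) :
    y (q (p t)) < y (q (p s)) ↔ s < t := by
  refine ⟨fun hlt => ?_, fun hst => h.y_lt hr hst ht⟩
  by_contra hn
  rcases (not_lt.1 hn).lt_or_eq with h1 | h1
  · exact absurd hlt (h.y_lt hr h1 hs).le.not_gt
  · rw [h1] at hlt; exact lt_irrefl _ hlt

/-- The angular distance of the `s`-th vertex from the normal of the `t`-th chord, in units of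
`π / m`. -/
lemma chordSide_eq (h : Zigzag m q x y r α p) (t : ℕ) {s : ℕ} (hs : s < m) :
    chordSide m x y r α t (q (p s)) =
      r * (Real.cos ((if (Even t ↔ Even s) then s + 1 else s : ℕ) * (Real.pi / m)) -
        Real.cos ((t + 1) * (Real.pi / m))) := by
  have key : Real.sin (chordMid m α t) * x (q (p s)) + Real.cos (chordMid m α t) * y (q (p s)) =
      r * Real.cos (zang m α s - chordMid m α t) := by
    rw [h.hx s hs, h.hy s hs, Real.cos_sub]; ring
  rw [chordSide_apply, key, mul_sub]
  congr 2
  have e : 2 * Real.pi / m = 2 * (Real.pi / m) := by ring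
  rcases Nat.even_or_odd' s with ⟨k, rfl | rfl⟩ <;> by_cases ht : Even t
  · simp only [zang, zz_even, chordMid, ht, even_two, Even.mul_right, if_true, e]
    push_cast; congr 1; ring
  · simp only [zang, zz_even, chordMid, ht, even_two, Even.mul_right, if_false, e, iff_true]
    push_cast; congr 1; ring
  · have : ¬ Even (2 * k + 1) := by simp
    simp only [zang, zz_odd, chordMid, ht, this, if_true, if_false, e, iff_false, not_true_eq_false]
    push_cast; rw [← Real.cos_neg]; congr 1; ring
  · have : ¬ Even (2 * k + 1) := by simp
    simp only [zang, zz_odd, chordMid, ht, this, if_true, if_false, e]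
    push_cast; rw [← Real.cos_neg]; congr 1; ring

lemma chordSide_self (h : Zigzag m q x y r α p) {t : ℕ} (ht : t < m) :
    chordSide m x y r α t (q (p t)) = 0 := by
  rw [h.chordSide_eq t ht]; simp

lemma chordSide_succ (h : Zigzag m q x y r α p) {t : ℕ} (ht : t + 1 < m) :
    chordSide m x y r α t (q (p (t + 1))) = 0 := by
  have : ¬ (Even t ↔ Even (t + 1)) := by rw [Nat.even_add_one]; tauto
  rw [h.chordSide_eq t ht, if_neg this]; simp

lemma cos_nat_lt {m a b : ℕ} (hm : 0 < m) (hab : a < b) (hb : b ≤ m) :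
    Real.cos (b * (Real.pi / m)) < Real.cos (a * (Real.pi / m)) := by
  have hmR : (0 : ℝ) < m := by exact_mod_cast hm
  have hd : 0 < Real.pi / m := by have := Real.pi_pos; positivity
  have hmd : (m : ℝ) * (Real.pi / m) = Real.pi := by field_simp
  have h1 : (a : ℝ) < b := by exact_mod_cast hab
  have h2 : (b : ℝ) ≤ m := by exact_mod_cast hb
  apply Real.cos_lt_cos_of_nonneg_of_le_pi (by positivity)
  · nlinarith
  · nlinarith

lemma chordSide_pos (h : Zigzag m q x y r α p) (hr : 0 < r) {s t : ℕ} (hst : s < t) (ht : t < m) :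
    0 < chordSide m x y r α t (q (p s)) := by
  rw [h.chordSide_eq t (hst.trans ht)]
  refine mul_pos hr (sub_pos.2 ?_)
  have := cos_nat_lt (m := m) (a := if (Even t ↔ Even s) then s + 1 else s) (b := t + 1)
    (by omega) (by split_ifs <;> omega) ht
  push_cast at this ⊢
  exact this

lemma chordSide_neg (h : Zigzag m q x y r α p) (hr : 0 < r) {s t : ℕ}
    (hst : t + 1 < s) (hs : s < m) : chordSide m x y r α t (q (p s)) < 0 := by
  rw [h.chordSide_eq t hs]
  refine mul_neg_of_pos_of_neg hr (sub_neg.2 ?_)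
  have := cos_nat_lt (m := m) (a := t + 1) (b := if (Even t ↔ Even s) then s + 1 else s)
    (by omega) (by split_ifs <;> omega) (by split_ifs <;> omega)
  push_cast at this ⊢
  exact this

lemma sin_chordMid (h : Zigzag m q x y r α p) (hm : 0 < m) (t : ℕ) :
    (Even t → Real.sin (chordMid m α t) < 0) ∧ (¬ Even t → 0 < Real.sin (chordMid m α t)) := by
  have h1 := h.α_pos
  have h2 := h.α_lt
  have hmR : (1 : ℝ) ≤ m := by exact_mod_cast hm
  have hpi : Real.pi / m ≤ Real.pi := div_le_self Real.pi_pos.le hmR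
  constructor
  · intro ht
    rw [chordMid, if_pos ht]
    exact Real.sin_neg_of_neg_of_neg_pi_lt (by linarith) (by linarith)
  · intro ht
    rw [chordMid, if_neg ht]
    exact Real.sin_pos_of_pos_of_lt_pi h1 (by linarith)

lemma edgeSide_eq (h : Zigzag m q x y r α p) (t : ℕ) {s : ℕ} (hs : s < m) :
    edgeSide m x y r α t (q (p s)) =
      r * (Real.cos (((if Even t then 2 * zz s - (t + 1) else 2 * zz s + (t + 2) : ℤ) : ℝ) *
        (Real.pi / m)) - Real.cos (Real.pi / m)) := by
  have key : Real.sin (edgeMid m α t) * x (q (p s)) + Real.cos (edgeMid m α t) * y (q (p s)) =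
      r * Real.cos (zang m α s - edgeMid m α t) := by
    rw [h.hx s hs, h.hy s hs, Real.cos_sub]; ring
  rw [edgeSide_apply, key, mul_sub]
  congr 3
  have e : 2 * Real.pi / m = 2 * (Real.pi / m) := by ring
  by_cases ht : Even t
  · simp only [edgeMid, ht, if_true, zang, e]; push_cast; ring
  · simp only [edgeMid, ht, if_false, zang, e]; push_cast; ring

lemma zz_bounds (s : ℕ) : -(s : ℤ) - 1 ≤ 2 * zz s ∧ 2 * zz s ≤ s := by
  rcases Nat.even_or_odd' s with ⟨k, rfl | rfl⟩
  · rw [zz_even]; push_cast; omega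
  · rw [zz_odd]; push_cast; omega

lemma edgeSide_le (h : Zigzag m q x y r α p) (hr : 0 < r) {s t : ℕ} (hs : s < m)
    (ht : t + 2 < m) : edgeSide m x y r α t (q (p s)) ≤ 0 := by
  rw [h.edgeSide_eq t hs]
  refine mul_nonpos_of_nonneg_of_nonpos hr.le (sub_nonpos.2 ?_)
  obtain ⟨h1, h2⟩ := zz_bounds s
  have hpar : Odd (if Even t then 2 * zz s - (t + 1) else 2 * zz s + (t + 2) : ℤ) := by
    split_ifs with he
    · obtain ⟨k, hk⟩ := he
      exact ⟨zz s - k - 1, by rw [hk]; push_cast; ring⟩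
    · obtain ⟨k, hk⟩ := Nat.not_even_iff_odd.1 he
      exact ⟨zz s + k + 1, by rw [hk]; push_cast; ring⟩
  apply cos_odd_mul_le (by omega) hpar
  rw [abs_lt]
  split_ifs <;> constructor <;> omega

lemma edgeSide_self (h : Zigzag m q x y r α p) {t : ℕ} (ht : t < m) :
    edgeSide m x y r α t (q (p t)) = 0 := by
  rw [h.edgeSide_eq t ht]
  rcases Nat.even_or_odd' t with ⟨k, rfl | rfl⟩
  · rw [zz_even, if_pos (by simp)]
    push_cast
    rw [show (2 * (k : ℝ) - (2 * k + 1)) * (Real.pi / m) = -(Real.pi / m) by ring, Real.cos_neg]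
    ring
  · rw [zz_odd, if_neg (by simp)]
    push_cast
    rw [show (2 * (-((k : ℝ) + 1)) + (2 * k + 1 + 2)) * (Real.pi / m) = (Real.pi / m) by ring]
    ring

lemma edgeSide_succ_succ (h : Zigzag m q x y r α p) {t : ℕ} (ht : t + 2 < m) :
    edgeSide m x y r α t (q (p (t + 2))) = 0 := by
  rw [h.edgeSide_eq t ht]
  rcases Nat.even_or_odd' t with ⟨k, rfl | rfl⟩
  · rw [show 2 * k + 2 = 2 * (k + 1) by ring, zz_even, if_pos (by simp)]
    push_cast
    rw [show (2 * ((k : ℝ) + 1) - (2 * k + 1)) * (Real.pi / m) = (Real.pi / m) by ring]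
    ring
  · rw [show 2 * k + 1 + 2 = 2 * (k + 1) + 1 by ring, zz_odd, if_neg (by simp)]
    push_cast
    rw [show (2 * (-((k : ℝ) + 1 + 1)) + (2 * k + 1 + 2)) * (Real.pi / m) = -(Real.pi / m) by ring,
      Real.cos_neg]
    ring

lemma sin_edgeMid (h : Zigzag m q x y r α p) {t : ℕ} (ht : t + 2 < m) :
    (Even t → 0 < Real.sin (edgeMid m α t)) ∧ (¬ Even t → Real.sin (edgeMid m α t) < 0) := by
  have h1 := h.α_pos
  have h2 := h.α_lt
  have hm : (0 : ℝ) < m := by exact_mod_cast (by omega : 0 < m)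
  have hmd : (m : ℝ) * (Real.pi / m) = Real.pi := by field_simp
  have hd : 0 < Real.pi / m := h1.trans h2
  have hb : (t : ℝ) + 2 + 1 ≤ m := by exact_mod_cast ht
  have ht0 : (0 : ℝ) ≤ t := by positivity
  constructor
  · intro he
    rw [edgeMid, if_pos he]
    exact Real.sin_pos_of_pos_of_lt_pi (by positivity) (by nlinarith)
  · intro he
    rw [edgeMid, if_neg he]
    exact Real.sin_neg_of_neg_of_neg_pi_lt (by nlinarith) (by nlinarith)

end Zigzag

/-! ### Crossing chords of the two zigzags -/

/-- If `a` and `b` are together close to `m / 2`, a chord of half-length `sin (a π / m)` reaches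
beyond a perpendicular chord at distance `|cos (b π / m)|` from the centre. -/
lemma abs_cos_lt_sin {m a b : ℕ} (hm : 0 < m) (h1 : |2 * (a : ℤ) - m| + |2 * (b : ℤ) - m| < m) :
    |Real.cos (b * (Real.pi / m))| < Real.sin (a * (Real.pi / m)) := by
  have hmR : (0 : ℝ) < m := by exact_mod_cast hm
  have hpi := Real.pi_pos
  have hd : 0 < Real.pi / m := by positivity
  have hmd : (m : ℝ) * (Real.pi / m) = Real.pi := by field_simp
  set d := Real.pi / m
  have h2 : |2 * (a : ℝ) - m| + |2 * (b : ℝ) - m| < m := by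
    have : ((|2 * (a : ℤ) - m| + |2 * (b : ℤ) - m| : ℤ) : ℝ) < ((m : ℤ) : ℝ) := by
      exact_mod_cast h1
    push_cast at this; exact this
  have ea : |a * d - Real.pi / 2| = |2 * (a : ℝ) - m| * (d / 2) := by
    rw [← abs_of_pos (show 0 < d / 2 by linarith), ← abs_mul]; congr 1
    linear_combination (1 / 2) * hmd
  have eb : |Real.pi / 2 - b * d| = |2 * (b : ℝ) - m| * (d / 2) := by
    rw [abs_sub_comm, ← abs_of_pos (show 0 < d / 2 by linarith), ← abs_mul]; congr 1
    linear_combination (1 / 2) * hmd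
  have hsum : |a * d - Real.pi / 2| + |Real.pi / 2 - b * d| < Real.pi / 2 := by
    rw [ea, eb, ← add_mul]; nlinarith
  have e1 : Real.sin (a * d) = Real.cos |a * d - Real.pi / 2| := by
    rw [Real.cos_abs, Real.cos_sub_pi_div_two]
  have e2 : |Real.cos (b * d)| = Real.cos (Real.pi / 2 - |Real.pi / 2 - b * d|) := by
    rw [Real.cos_pi_div_two_sub]
    have hle : |Real.pi / 2 - b * d| ≤ Real.pi := by
      have := abs_nonneg (a * d - Real.pi / 2); linarith
    rw [← Real.abs_sin_eq_sin_abs_of_abs_le_pi hle, Real.sin_pi_div_two_sub]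
  rw [e1, e2]
  apply Real.cos_lt_cos_of_nonneg_of_le_pi (abs_nonneg _)
  · have := abs_nonneg (Real.pi / 2 - b * d); linarith
  · linarith

lemma exists_openSegment_eq (f : Euc 3 →ᵃ[ℝ] ℝ) {a b : Euc 3} {c : ℝ}
    (h : (f a < c ∧ c < f b) ∨ (f b < c ∧ c < f a)) :
    ∃ s ∈ openSegment ℝ a b, f s = c := by
  rcases h with ⟨h1, h2⟩ | ⟨h1, h2⟩
  · have hd : 0 < f b - f a := by linarith
    refine ⟨((f b - c) / (f b - f a)) • a + ((c - f a) / (f b - f a)) • b,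
      ⟨_, _, div_pos (by linarith) hd, div_pos (by linarith) hd, by field_simp; ring, rfl⟩, ?_⟩
    rw [affine_comb₂ _ _ _ (by field_simp; ring)]; field_simp; ring
  · have hd : 0 < f a - f b := by linarith
    refine ⟨((c - f b) / (f a - f b)) • a + ((f a - c) / (f a - f b)) • b,
      ⟨_, _, div_pos (by linarith) hd, div_pos (by linarith) hd, by field_simp; ring, rfl⟩, ?_⟩
    rw [affine_comb₂ _ _ _ (by field_simp; ring)]; field_simp; ring

lemma affine_eq_of_mem_openSegment (f : Euc 3 →ᵃ[ℝ] ℝ) {a b s : Euc 3} {c : ℝ}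
    (hs : s ∈ openSegment ℝ a b) (ha : f a = c) (hb : f b = c) : f s = c := by
  obtain ⟨x, y, _, _, hxy, rfl⟩ := hs
  rw [affine_comb₂ _ _ _ hxy, ha, hb, ← add_mul, hxy, one_mul]

set_option maxHeartbeats 400000 in
/-- Chords of the two zigzags cross if they are perpendicular and close enough to the centre. -/
lemma Frame.exists_cross {m : ℕ} {q : Fin m → Euc 3} {v u : Fin 2 → Euc 3}
    {X Y Z : Euc 3 →ᵃ[ℝ] ℝ} {r φ κ ε ε' α α' : ℝ} {p p' : ℕ → Fin m}
    (h : Frame m q v u X Y Z r φ κ) (hε : ε = 1 ∨ ε = -1) (hz : Zigzag m q (ε • X) Y r α p)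
    (hz' : Zigzag m q (ε' • Y) (-X) r α' p')
    (hrel : (Even (m / 2) ∧ ε' = ε ∧ α' = α) ∨
      (¬ Even (m / 2) ∧ ε' = -ε ∧ α' = Real.pi / m - α))
    {t t' : ℕ} (ht : t + 1 < m) (ht' : t' + 1 < m)
    (hpar : Even (t + t' + m / 2))
    (hlt : |2 * ((t + 1 : ℕ) : ℤ) - m| + |2 * ((t' + 1 : ℕ) : ℤ) - m| < m) :
    (∃ s, s ∈ openSegment ℝ (q (p t)) (q (p (t + 1))) ∧
      s ∈ openSegment ℝ (q (p' t')) (q (p' (t' + 1)))) ∧ p' t' ≠ p t ∧ p' t' ≠ p (t + 1) := by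
  have hm : 0 < m := by omega
  have hr := h.r_pos
  set μ := chordMid m α t with hμ
  set d := Real.pi / m with hd
  have hεε : ε * ε = 1 := by rcases hε with rfl | rfl <;> norm_num
  -- angles of the ends of the first chord
  have hang : ∃ s : ℝ, (s = 1 ∨ s = -1) ∧ zang m α t = μ + s * ((t + 1 : ℕ) * d) ∧
      zang m α (t + 1) = μ - s * ((t + 1 : ℕ) * d) := by
    rcases Nat.even_or_odd' t with ⟨k, rfl | rfl⟩
    · refine ⟨1, Or.inl rfl, ?_, ?_⟩
      · rw [hμ, zang, zz_even, chordMid, if_pos (by simp)]; push_cast; ring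
      · rw [hμ, zang, zz_odd, chordMid, if_pos (by simp)]; push_cast; ring
    · refine ⟨-1, Or.inr rfl, ?_, ?_⟩
      · rw [hμ, zang, zz_odd, chordMid, if_neg (by simp)]; push_cast; ring
      · rw [hμ, show 2 * k + 1 + 1 = 2 * (k + 1) by ring, zang, zz_even, chordMid,
          if_neg (by simp)]; push_cast; ring
  -- angles of the ends of the second chord, turned by a right angle
  have hang' : ∃ s σ : ℝ, (s = 1 ∨ s = -1) ∧ (σ = 1 ∨ σ = -1) ∧ ε' = σ * ε ∧
      zang m α' t' = σ * (μ + s * ((t' + 1 : ℕ) * d)) ∧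
      zang m α' (t' + 1) = σ * (μ - s * ((t' + 1 : ℕ) * d)) := by
    rcases hrel with ⟨he, rfl, rfl⟩ | ⟨he, rfl, rfl⟩
    · have hp : Even t ↔ Even t' := by
        rw [Nat.even_add, Nat.even_add] at hpar; tauto
      rcases Nat.even_or_odd' t' with ⟨k, rfl | rfl⟩
      · refine ⟨1, 1, Or.inl rfl, Or.inl rfl, by ring, ?_, ?_⟩
        · rw [hμ, zang, zz_even, chordMid, if_pos (hp.2 (by simp))]; push_cast; ring
        · rw [hμ, zang, zz_odd, chordMid, if_pos (hp.2 (by simp))]; push_cast; ring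
      · have hn : ¬ Even t := fun h => by simpa using hp.1 h
        refine ⟨-1, 1, Or.inr rfl, Or.inl rfl, by ring, ?_, ?_⟩
        · rw [hμ, zang, zz_odd, chordMid, if_neg hn]; push_cast; ring
        · rw [hμ, show 2 * k + 1 + 1 = 2 * (k + 1) by ring, zang, zz_even, chordMid,
            if_neg hn]; push_cast; ring
    · have hp : Even t ↔ ¬ Even t' := by
        rw [Nat.even_add, Nat.even_add] at hpar; tauto
      rcases Nat.even_or_odd' t' with ⟨k, rfl | rfl⟩
      · have hn : ¬ Even t := fun h => hp.1 h (by simp)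
        refine ⟨-1, -1, Or.inr rfl, Or.inr rfl, by ring, ?_, ?_⟩
        · rw [hμ, zang, zz_even, chordMid, if_neg hn]; push_cast; ring
        · rw [hμ, zang, zz_odd, chordMid, if_neg hn]; push_cast; ring
      · have hn : Even t := hp.2 (by simp)
        refine ⟨1, -1, Or.inl rfl, Or.inr rfl, by ring, ?_, ?_⟩
        · rw [hμ, zang, zz_odd, chordMid, if_pos hn]; push_cast; ring
        · rw [hμ, show 2 * k + 1 + 1 = 2 * (k + 1) by ring, zang, zz_even, chordMid,
            if_pos hn]; push_cast; ring
  obtain ⟨s, hs, a1, a2⟩ := hang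
  obtain ⟨s', σ, hs', hσ, rfl, b1, b2⟩ := hang'
  set β := ((t + 1 : ℕ) : ℝ) * d with hβ
  set β' := ((t' + 1 : ℕ) : ℝ) * d with hβ'
  have hsc := Real.sin_sq_add_cos_sq μ
  -- coordinates along and across the first chord
  set A := (Real.sin μ * ε) • X + Real.cos μ • Y with hA
  set B := (Real.cos μ * ε) • X + (-Real.sin μ) • Y with hB
  have hAa : ∀ w, A w = Real.sin μ * (ε * X w) + Real.cos μ * Y w := by
    intro w; simp [hA]; ring
  have hBa : ∀ w, B w = Real.cos μ * (ε * X w) - Real.sin μ * Y w := by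
    intro w; simp [hB]; ring
  have hAB : ∀ w w', A w = A w' → B w = B w' → Z w = Z w' → w = w' := by
    intro w w' h1 h2 h3
    rw [hAa, hAa] at h1
    rw [hBa, hBa] at h2
    refine h.inj w w' ?_ ?_ h3
    · have : ε * (ε * X w) = ε * (ε * X w') := by
        congr 1
        linear_combination Real.sin μ * h1 + Real.cos μ * h2 - (ε * X w - ε * X w') * hsc
      rwa [← mul_assoc, ← mul_assoc, hεε, one_mul, one_mul] at this
    · linear_combination Real.cos μ * h1 - Real.sin μ * h2 - (Y w - Y w') * hsc
  have first : ∀ k < m, ∀ c : ℝ, zang m α k = μ + c → A (q (p k)) = r * Real.cos c ∧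
      B (q (p k)) = r * Real.sin c := by
    intro k hk c hc
    have hx := hz.hx k hk
    have hy := hz.hy k hk
    simp only [AffineMap.coe_smul, Pi.smul_apply, smul_eq_mul] at hx
    rw [hAa, hBa, hx, hy, hc, Real.sin_add, Real.cos_add]
    constructor
    · linear_combination r * Real.cos c * hsc
    · linear_combination r * Real.sin c * hsc
  have second : ∀ k < m, ∀ c : ℝ, zang m α' k = σ * (μ + c) →
      A (q (p' k)) = ε * (r * Real.sin c) ∧ B (q (p' k)) = -(ε * (r * Real.cos c)) := by
    intro k hk c hc
    have hx := hz'.hx k hk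
    have hy := hz'.hy k hk
    simp only [AffineMap.coe_smul, Pi.smul_apply, smul_eq_mul, AffineMap.coe_neg,
      Pi.neg_apply] at hx hy
    have hX : X (q (p' k)) = -(r * Real.cos (μ + c)) := by
      rw [hc] at hy
      rcases hσ with rfl | rfl
      · rw [one_mul] at hy; linarith
      · rw [neg_one_mul, Real.cos_neg] at hy; linarith
    have hY : Y (q (p' k)) = ε * (r * Real.sin (μ + c)) := by
      rw [hc] at hx
      rcases hσ with rfl | rfl
      · rw [one_mul, one_mul] at hx
        rw [← hx, ← mul_assoc, hεε, one_mul]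
      · rw [neg_one_mul, neg_one_mul, Real.sin_neg] at hx
        have : ε * Y (q (p' k)) = r * Real.sin (μ + c) := by linarith
        rw [← this, ← mul_assoc, hεε, one_mul]
    rw [hAa, hBa, hX, hY, Real.sin_add, Real.cos_add]
    constructor
    · linear_combination ε * r * Real.sin c * hsc
    · linear_combination -ε * r * Real.cos c * hsc
  obtain ⟨A1, B1⟩ := first t (by omega) (s * β) a1
  obtain ⟨A2, B2⟩ := first (t + 1) ht (-(s * β)) (by rw [a2]; ring)
  obtain ⟨A3, B3⟩ := second t' (by omega) (s' * β') b1
  obtain ⟨A4, B4⟩ := second (t' + 1) ht' (-(s' * β')) (by rw [b2]; ring)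
  have c1 : Real.cos (s * β) = Real.cos β := by rcases hs with rfl | rfl <;> simp
  have c2 : Real.cos (s' * β') = Real.cos β' := by rcases hs' with rfl | rfl <;> simp
  have l1 := abs_lt.1 (abs_cos_lt_sin hm hlt)
  have l2 := abs_lt.1 (abs_cos_lt_sin (a := t' + 1) (b := t + 1) hm (by rw [add_comm]; exact hlt))
  rw [← hd, ← hβ, ← hβ'] at l1 l2
  have k1 := mul_lt_mul_of_pos_left l1.1 hr
  have k2 := mul_lt_mul_of_pos_left l1.2 hr
  have k3 := mul_lt_mul_of_pos_left l2.1 hr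
  have k4 := mul_lt_mul_of_pos_left l2.2 hr
  -- the first chord reaches both sides of the line of the second and conversely, and the two
  -- points of intersection with these lines coincide
  obtain ⟨w, hw, hwB⟩ := exists_openSegment_eq B (a := q (p t)) (b := q (p (t + 1)))
    (c := -(ε * (r * Real.cos β'))) (by
      rw [B1, B2, Real.sin_neg]
      rcases hs with rfl | rfl <;> rcases hε with rfl | rfl
      · right; simp only [one_mul]; constructor <;> linarith
      · right; simp only [one_mul]; constructor <;> linarith
      · left; simp only [neg_one_mul, Real.sin_neg]; constructor <;> linarith
      · left; simp only [neg_one_mul, Real.sin_neg]; constructor <;> linarith)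
  obtain ⟨w', hw', hwA⟩ := exists_openSegment_eq A (a := q (p' t')) (b := q (p' (t' + 1)))
    (c := r * Real.cos β) (by
      rw [A3, A4, Real.sin_neg]
      rcases hs' with rfl | rfl <;> rcases hε with rfl | rfl
      · right; simp only [one_mul]; constructor <;> linarith
      · left; simp only [one_mul]; constructor <;> linarith
      · left; simp only [neg_one_mul, Real.sin_neg]; constructor <;> linarith
      · right; simp only [neg_one_mul, Real.sin_neg]; constructor <;> linarith)
  have hwA' : A w = r * Real.cos β := affine_eq_of_mem_openSegment A hw (by rw [A1, c1])
    (by rw [A2, Real.cos_neg, c1])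
  have hwB' : B w' = -(ε * (r * Real.cos β')) := affine_eq_of_mem_openSegment B hw'
    (by rw [B3, c2]) (by rw [B4, Real.cos_neg, c2])
  have hwZ : Z w = 0 := affine_eq_of_mem_openSegment Z hw (h.qZ _) (h.qZ _)
  have hwZ' : Z w' = 0 := affine_eq_of_mem_openSegment Z hw' (h.qZ _) (h.qZ _)
  have : w = w' := hAB w w' (by rw [hwA, hwA']) (by rw [hwB, hwB']) (by rw [hwZ, hwZ'])
  subst this
  have hne : A (q (p' t')) ≠ r * Real.cos β := by
    rw [A3]
    rcases hs' with rfl | rfl <;> rcases hε with rfl | rfl <;>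
      simp only [neg_one_mul, one_mul, Real.sin_neg] <;> intro he <;> linarith
  refine ⟨⟨w, hw, hw'⟩, fun he => hne ?_, fun he => hne ?_⟩
  · rw [he, A1, c1]
  · rw [he, A2, Real.cos_neg, c1]

/-! ### Dissecting one half of the polytope -/

/-- A point is in a simplex if, for every vertex, some affine function that vanishes at the other
vertices and is positive at this one is nonnegative at the point. -/
lemma mem_convexHull_of_sides {d : ℕ} {A : Set (Euc d)} {σ : Finset (Euc d)}
    (hσ : IsFullSimplexIn A σ) {a : Euc d}
    (h : ∀ w ∈ σ, ∃ g : Euc d →ᵃ[ℝ] ℝ, (∀ w' ∈ σ, w' ≠ w → g w' = 0) ∧ 0 < g w ∧ 0 ≤ g a) :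
    a ∈ convexHull ℝ (σ : Set (Euc d)) := by
  obtain ⟨lam, hl⟩ := hσ.exists_bary
  refine (hl.hull a).2 fun w hw => ?_
  obtain ⟨g, h1, h2, h3⟩ := h w hw
  have e : g a = lam w a * g w := by
    rw [hl.affine_eq g a]
    exact Finset.sum_eq_single_of_mem w hw fun w' hw' hne => by rw [h1 w' hw' hne, mul_zero]
  rw [e] at h3
  exact nonneg_of_mul_nonneg_left h3 h2

/-- The value of `f` relative to the apex `w`: the affine function that agrees with `f` on the plane
`z = 0` and vanishes at `w`, provided that `z w ≠ 0`. -/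
noncomputable def relTo (z : Euc 3 →ᵃ[ℝ] ℝ) (w : Euc 3) (f : Euc 3 →ᵃ[ℝ] ℝ) : Euc 3 →ᵃ[ℝ] ℝ :=
  f - (f w / z w) • z

lemma relTo_apply (z : Euc 3 →ᵃ[ℝ] ℝ) (w : Euc 3) (f : Euc 3 →ᵃ[ℝ] ℝ) (a : Euc 3) :
    relTo z w f a = f a - f w / z w * z a := by simp [relTo]

/-- The affine function vanishing on the plane `y = c`. -/
noncomputable def level (y : Euc 3 →ᵃ[ℝ] ℝ) (c : ℝ) : Euc 3 →ᵃ[ℝ] ℝ :=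
  y - AffineMap.const ℝ (Euc 3) c

lemma level_apply (y : Euc 3 →ᵃ[ℝ] ℝ) (c : ℝ) (a : Euc 3) : level y c a = y a - c := by
  simp [level]

/-- The two ends `W 0 = W 2 = …` and `W 1 = W 3 = …` of the edge above the polygon, so ordered that
`W t` is the end on the same side of the `t`-th chord of the zigzag as the vertices after it. -/
structure Apexes (m : ℕ) (q : Fin m → Euc 3) (x y z : Euc 3 →ᵃ[ℝ] ℝ) (α : ℝ)
    (W : ℕ → Euc 3) : Prop where
  per : ∀ t, W (t + 2) = W t
  qz : ∀ k, z (q k) = 0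
  z_pos : 0 < z (W 0)
  z_eq : ∀ t, z (W t) = z (W 0)
  y_eq : ∀ t, y (W t) = y (W 0)
  side : ∀ t, 0 < Real.sin (chordMid m α t) * (x (W (t + 1)) - x (W t))
  edge : ∀ t, t + 2 < m → Real.sin (edgeMid m α t) * (x (W (t + 1)) - x (W t)) < 0

/-- The tetrahedron spanned by the edge `W 0, W 1` and the `t`-th chord of the zigzag. -/
noncomputable def tetEdge {m : ℕ} (q : Fin m → Euc 3) (p : ℕ → Fin m) (W : ℕ → Euc 3) (t : ℕ) :
    Finset (Euc 3) := by
  classical exact {W 0, W 1, q (p t), q (p (t + 1))}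

/-- The tetrahedron spanned by three consecutive vertices of the zigzag and the apex `W t`. -/
noncomputable def tetApex {m : ℕ} (q : Fin m → Euc 3) (p : ℕ → Fin m) (W : ℕ → Euc 3) (t : ℕ) :
    Finset (Euc 3) := by
  classical exact {q (p t), q (p (t + 1)), q (p (t + 2)), W t}

lemma mem_tetEdge {m : ℕ} {q : Fin m → Euc 3} {p : ℕ → Fin m} {W : ℕ → Euc 3} {t : ℕ}
    {w : Euc 3} : w ∈ tetEdge q p W t ↔
      w = W 0 ∨ w = W 1 ∨ w = q (p t) ∨ w = q (p (t + 1)) := by simp [tetEdge]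

lemma mem_tetApex {m : ℕ} {q : Fin m → Euc 3} {p : ℕ → Fin m} {W : ℕ → Euc 3} {t : ℕ}
    {w : Euc 3} : w ∈ tetApex q p W t ↔
      w = q (p t) ∨ w = q (p (t + 1)) ∨ w = q (p (t + 2)) ∨ w = W t := by simp [tetApex]

namespace Apexes

variable {m : ℕ} {q : Fin m → Euc 3} {x y z : Euc 3 →ᵃ[ℝ] ℝ} {r α : ℝ} {p : ℕ → Fin m}
  {W : ℕ → Euc 3}

lemma z_pos' (hW : Apexes m q x y z α W) (t : ℕ) : 0 < z (W t) := by
  rw [hW.z_eq]; exact hW.z_pos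

lemma mem_pair (hW : Apexes m q x y z α W) (t s : ℕ) : W s = W t ∨ W s = W (t + 1) := by
  have key : ∀ s, (Even s → W s = W 0) ∧ (¬ Even s → W s = W 1) := by
    intro s
    induction s using Nat.twoStepInduction with
    | zero => simp
    | one => simp
    | more n h1 _ =>
      rw [hW.per, Nat.even_add]
      simpa using h1
  by_cases h1 : Even s <;> by_cases h2 : Even t
  · left; rw [(key s).1 h1, (key t).1 h2]
  · right; rw [(key s).1 h1, (key (t + 1)).1 (by rw [Nat.even_add_one]; exact h2)]
  · right; rw [(key s).2 h1, (key (t + 1)).2 (by rw [Nat.even_add_one]; simpa using h2)]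
  · left; rw [(key s).2 h1, (key t).2 h2]

lemma mem_tetEdge' (hW : Apexes m q x y z α W) {t : ℕ} {w : Euc 3} (hw : w ∈ tetEdge q p W t)
    (s : ℕ) : w = W s ∨ w = W (s + 1) ∨ w = q (p t) ∨ w = q (p (t + 1)) := by
  rcases mem_tetEdge.1 hw with rfl | rfl | h | h
  · rcases hW.mem_pair s 0 with h | h <;> simp [h]
  · rcases hW.mem_pair s 1 with h | h <;> simp [h]
  · simp [h]
  · simp [h]

lemma relTo_q (hW : Apexes m q x y z α W) (w : Euc 3) (f : Euc 3 →ᵃ[ℝ] ℝ) (k : Fin m) :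
    relTo z w f (q k) = f (q k) := by rw [relTo_apply, hW.qz]; ring

lemma relTo_W (hW : Apexes m q x y z α W) (f : Euc 3 →ᵃ[ℝ] ℝ) (s t : ℕ) :
    relTo z (W s) f (W t) = f (W t) - f (W s) := by
  rw [relTo_apply, hW.z_eq t, hW.z_eq s, div_mul_cancel₀ _ hW.z_pos.ne']

lemma relTo_level (hW : Apexes m q x y z α W) (c : ℝ) (s t : ℕ) :
    relTo z (W s) (level y c) (W t) = 0 := by
  rw [hW.relTo_W, level_apply, level_apply, hW.y_eq t, hW.y_eq s]; ring

lemma chordSide_sub (hW : Apexes m q x y z α W) (t a b : ℕ) :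
    chordSide m x y r α t (W a) - chordSide m x y r α t (W b) =
      Real.sin (chordMid m α t) * (x (W a) - x (W b)) := by
  rw [chordSide_apply, chordSide_apply, hW.y_eq a, hW.y_eq b]; ring

lemma relTo_chord_pos (hW : Apexes m q x y z α W) (t : ℕ) :
    0 < relTo z (W t) (chordSide m x y r α t) (W (t + 1)) := by
  rw [hW.relTo_W, hW.chordSide_sub]; exact hW.side t

lemma relTo_chord_neg (hW : Apexes m q x y z α W) (t : ℕ) :
    relTo z (W t) (chordSide m x y r α (t + 1)) (W (t + 1)) < 0 := by
  rw [hW.relTo_W, hW.chordSide_sub]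
  have := hW.side (t + 1)
  rw [hW.per] at this
  linarith

/-- Tetrahedra of the two kinds are separated by the plane through the edge `W 0, W 1` and the
horizontal line through a vertex of the zigzag, if they are on different sides of it. -/
lemma disjoint_of_level (hz : Zigzag m q x y r α p) (hr : 0 < r) (hm : 2 ≤ m)
    (hW : Apexes m q x y z α W) {σ τ : Finset (Euc 3)} {k : ℕ} (hk : k < m)
    (hσ : ∀ w ∈ σ, (∃ s, w = W s) ∨ ∃ i ≤ k, w = q (p i))
    (hτ : ∀ w ∈ τ, (∃ s, w = W s) ∨ ∃ i, k ≤ i ∧ i < m ∧ w = q (p i)) :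
    Disjoint (interior (convexHull ℝ (σ : Set (Euc 3))))
      (interior (convexHull ℝ (τ : Set (Euc 3)))) := by
  have hmono : ∀ {i j : ℕ}, i ≤ j → j < m → y (q (p j)) ≤ y (q (p i)) := by
    intro i j hij hj
    rcases hij.lt_or_eq with h1 | rfl
    · exact (hz.y_lt hr h1 hj).le
    · exact le_rfl
  refine (disjoint_interior_of_separated (relTo z (W 0) (level y (y (q (p k)))))
    (a := q (p 0)) (b := q (p 1)) ?_ ?_ ?_).symm
  · intro w hw
    rcases hτ w hw with ⟨s, rfl⟩ | ⟨i, h1, h2, rfl⟩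
    · rw [hW.relTo_level]
    · rw [hW.relTo_q, level_apply]; linarith [hmono h1 h2]
  · intro w hw
    rcases hσ w hw with ⟨s, rfl⟩ | ⟨i, h1, rfl⟩
    · rw [hW.relTo_level]
    · rw [hW.relTo_q, level_apply]; linarith [hmono h1 hk]
  · rw [hW.relTo_q, hW.relTo_q, level_apply, level_apply]
    have := hz.y_lt hr (s := 0) (t := 1) (by omega) (by omega)
    intro h; linarith

lemma disjoint_edge_edge (hz : Zigzag m q x y r α p) (hr : 0 < r)
    (hW : Apexes m q x y z α W) {i j : ℕ} (hij : i < j) (hj : j + 1 < m) :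
    Disjoint (interior (convexHull ℝ (tetEdge q p W i : Set (Euc 3))))
      (interior (convexHull ℝ (tetEdge q p W j : Set (Euc 3)))) := by
  refine hW.disjoint_of_level hz hr (by omega) (k := i + 1) (by omega) ?_ ?_
  · intro w hw
    rcases mem_tetEdge.1 hw with h | h | h | h
    · exact Or.inl ⟨_, h⟩
    · exact Or.inl ⟨_, h⟩
    · exact Or.inr ⟨i, by omega, h⟩
    · exact Or.inr ⟨i + 1, by omega, h⟩
  · intro w hw
    rcases mem_tetEdge.1 hw with h | h | h | h
    · exact Or.inl ⟨_, h⟩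
    · exact Or.inl ⟨_, h⟩
    · exact Or.inr ⟨j, by omega, by omega, h⟩
    · exact Or.inr ⟨j + 1, by omega, by omega, h⟩

lemma disjoint_apex_apex (hz : Zigzag m q x y r α p) (hr : 0 < r)
    (hW : Apexes m q x y z α W) {i j : ℕ} (hij : i < j) (hj : j + 2 < m) :
    Disjoint (interior (convexHull ℝ (tetApex q p W i : Set (Euc 3))))
      (interior (convexHull ℝ (tetApex q p W j : Set (Euc 3)))) := by
  rcases (Nat.succ_le_of_lt hij).lt_or_eq with h1 | h1
  · refine hW.disjoint_of_level hz hr (by omega) (k := i + 2) (by omega) ?_ ?_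
    · intro w hw
      rcases mem_tetApex.1 hw with h | h | h | h
      · exact Or.inr ⟨i, by omega, h⟩
      · exact Or.inr ⟨i + 1, by omega, h⟩
      · exact Or.inr ⟨i + 2, by omega, h⟩
      · exact Or.inl ⟨_, h⟩
    · intro w hw
      rcases mem_tetApex.1 hw with h | h | h | h
      · exact Or.inr ⟨j, by omega, by omega, h⟩
      · exact Or.inr ⟨j + 1, by omega, by omega, h⟩
      · exact Or.inr ⟨j + 2, by omega, by omega, h⟩
      · exact Or.inl ⟨_, h⟩
  · obtain rfl : j = i + 1 := by omega
    have c1 := hz.chordSide_pos hr (s := i) (t := i + 1) (by omega) (by omega)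
    have c2 := hz.chordSide_neg hr (s := i + 1 + 2) (t := i + 1) (by omega) (by omega)
    have c3 := hz.chordSide_self (t := i + 1) (by omega)
    have c4 := hz.chordSide_succ (t := i + 1) (by omega)
    have c5 := hW.relTo_chord_neg (r := r) i
    refine (disjoint_interior_of_separated (relTo z (W i) (chordSide m x y r α (i + 1)))
      (a := q (p i)) (b := q (p (i + 1 + 2))) ?_ ?_ ?_).symm
    · intro w hw
      rcases mem_tetApex.1 hw with rfl | rfl | rfl | rfl
      · rw [hW.relTo_q, c3]
      · rw [hW.relTo_q, c4]
      · rw [hW.relTo_q]; exact c2.le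
      · exact c5.le
    · intro w hw
      rcases mem_tetApex.1 hw with rfl | rfl | rfl | rfl
      · rw [hW.relTo_q]; exact c1.le
      · rw [hW.relTo_q, c3]
      · rw [hW.relTo_q, c4]
      · rw [hW.relTo_W, sub_self]
    · rw [hW.relTo_q, hW.relTo_q]; intro h; linarith

lemma disjoint_edge_apex (hz : Zigzag m q x y r α p) (hr : 0 < r)
    (hW : Apexes m q x y z α W) {i j : ℕ} (hi : i + 1 < m) (hj : j + 2 < m) :
    Disjoint (interior (convexHull ℝ (tetEdge q p W i : Set (Euc 3))))
      (interior (convexHull ℝ (tetApex q p W j : Set (Euc 3)))) := by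
  rcases lt_or_ge i j with h1 | h1
  · refine hW.disjoint_of_level hz hr (by omega) (k := j) (by omega) ?_ ?_
    · intro w hw
      rcases mem_tetEdge.1 hw with h | h | h | h
      · exact Or.inl ⟨_, h⟩
      · exact Or.inl ⟨_, h⟩
      · exact Or.inr ⟨i, by omega, h⟩
      · exact Or.inr ⟨i + 1, by omega, h⟩
    · intro w hw
      rcases mem_tetApex.1 hw with h | h | h | h
      · exact Or.inr ⟨j, by omega, by omega, h⟩
      · exact Or.inr ⟨j + 1, by omega, by omega, h⟩
      · exact Or.inr ⟨j + 2, by omega, by omega, h⟩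
      · exact Or.inl ⟨_, h⟩
  rcases lt_or_ge (j + 1) i with h2 | h2
  · refine (hW.disjoint_of_level hz hr (by omega) (k := i) (by omega) ?_ ?_).symm
    · intro w hw
      rcases mem_tetApex.1 hw with h | h | h | h
      · exact Or.inr ⟨j, by omega, h⟩
      · exact Or.inr ⟨j + 1, by omega, h⟩
      · exact Or.inr ⟨j + 2, by omega, h⟩
      · exact Or.inl ⟨_, h⟩
    · intro w hw
      rcases mem_tetEdge.1 hw with h | h | h | h
      · exact Or.inl ⟨_, h⟩
      · exact Or.inl ⟨_, h⟩
      · exact Or.inr ⟨i, by omega, by omega, h⟩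
      · exact Or.inr ⟨i + 1, by omega, by omega, h⟩
  rcases h1.lt_or_eq with h3 | rfl
  · obtain rfl : i = j + 1 := by omega
    have c1 := hz.chordSide_pos hr (s := j) (t := j + 1) (by omega) (by omega)
    have c3 := hz.chordSide_self (t := j + 1) (by omega)
    have c4 := hz.chordSide_succ (t := j + 1) (by omega)
    have c5 := hW.relTo_chord_neg (r := r) j
    refine disjoint_interior_of_separated (relTo z (W j) (chordSide m x y r α (j + 1)))
      (a := q (p j)) (b := q (p (j + 1))) ?_ ?_ ?_
    · intro w hw
      rcases hW.mem_tetEdge' hw j with rfl | rfl | rfl | rfl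
      · rw [hW.relTo_W, sub_self]
      · exact c5.le
      · rw [hW.relTo_q, c3]
      · rw [hW.relTo_q, c4]
    · intro w hw
      rcases mem_tetApex.1 hw with rfl | rfl | rfl | rfl
      · rw [hW.relTo_q]; exact c1.le
      · rw [hW.relTo_q, c3]
      · rw [hW.relTo_q, c4]
      · rw [hW.relTo_W, sub_self]
    · rw [hW.relTo_q, hW.relTo_q]; intro h; linarith
  · have c1 := hz.chordSide_neg hr (s := j + 2) (t := j) (by omega) (by omega)
    have c3 := hz.chordSide_self (t := j) (by omega)
    have c4 := hz.chordSide_succ (t := j) (by omega)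
    have c5 := hW.relTo_chord_pos (r := r) j
    refine (disjoint_interior_of_separated (relTo z (W j) (chordSide m x y r α j))
      (a := q (p j)) (b := q (p (j + 2))) ?_ ?_ ?_).symm
    · intro w hw
      rcases mem_tetApex.1 hw with rfl | rfl | rfl | rfl
      · rw [hW.relTo_q, c3]
      · rw [hW.relTo_q, c4]
      · rw [hW.relTo_q]; exact c1.le
      · rw [hW.relTo_W, sub_self]
    · intro w hw
      rcases hW.mem_tetEdge' hw j with rfl | rfl | rfl | rfl
      · rw [hW.relTo_W, sub_self]
      · exact c5.le
      · rw [hW.relTo_q, c3]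
      · rw [hW.relTo_q, c4]
    · rw [hW.relTo_q, hW.relTo_q]; intro h; linarith

end Apexes

/-- A sequence passing from above `c` to below `c` does so in some step. -/
lemma exists_step (f : ℕ → ℝ) (c : ℝ) : ∀ n : ℕ, 0 < n → f n ≤ c → c ≤ f 0 →
    ∃ i < n, f (i + 1) ≤ c ∧ c ≤ f i := by
  intro n
  induction n with
  | zero => intro h; exact absurd h (lt_irrefl _)
  | succ n ih =>
    intro _ h1 h2
    by_cases h3 : c ≤ f n
    · exact ⟨n, by omega, h1, h3⟩
    · rcases Nat.eq_zero_or_pos n with rfl | hn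
      · exact absurd h2 h3
      · obtain ⟨i, hi, h4⟩ := ih hn (le_of_not_ge h3) h2
        exact ⟨i, by omega, h4⟩

namespace Apexes

variable {m : ℕ} {q : Fin m → Euc 3} {x y z : Euc 3 →ᵃ[ℝ] ℝ} {r α : ℝ} {p : ℕ → Fin m}
  {W : ℕ → Euc 3} {A : Set (Euc 3)}

/-- Consecutive chords of the zigzag slope in opposite directions. -/
lemma sin_mul_sin_neg (hW : Apexes m q x y z α W) (t : ℕ) :
    Real.sin (chordMid m α t) * Real.sin (chordMid m α (t + 1)) < 0 := by
  have h1 := hW.side t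
  have h2 := hW.side (t + 1)
  rw [hW.per] at h2
  have h3 := mul_pos h1 h2
  by_contra h4
  rw [not_lt] at h4
  have := mul_nonneg h4 (sq_nonneg (x (W (t + 1)) - x (W t)))
  nlinarith

/-- The vertex between two zigzag neighbours is not on the polygon edge joining them, as the
tetrahedron on the three vertices would be degenerate. -/
lemma edgeSide_mid_neg (hz : Zigzag m q x y r α p) (hr : 0 < r) (hW : Apexes m q x y z α W)
    {t : ℕ} (ht : t + 2 < m) (hA : IsFullSimplexIn A (tetApex q p W t)) :
    edgeSide m x y r α t (q (p (t + 1))) < 0 := by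
  refine lt_of_le_of_ne (hz.edgeSide_le hr (by omega) ht) fun h0 => ?_
  obtain ⟨lam, hl⟩ := hA.exists_bary
  have h1 := hl.affine_eq (relTo z (W t) (edgeSide m x y r α t)) (W (t + 1))
  rw [Finset.sum_eq_zero, hW.relTo_W, edgeSide_apply, edgeSide_apply, hW.y_eq t,
    hW.y_eq (t + 1)] at h1
  · have := hW.edge t ht
    linarith
  · intro w hw
    rcases mem_tetApex.1 hw with rfl | rfl | rfl | rfl
    · rw [hW.relTo_q, hz.edgeSide_self (by omega), mul_zero]
    · rw [hW.relTo_q, h0, mul_zero]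
    · rw [hW.relTo_q, hz.edgeSide_succ_succ ht, mul_zero]
    · rw [hW.relTo_W, sub_self, mul_zero]

/-- The coordinates of a point of a segment from the polygon to the edge `W 0, W 1`, relative to an
apex. -/
lemma relTo_comb (hW : Apexes m q x y z α W) {b c : Euc 3} {μ s : ℝ} (hμs : μ + s = 1)
    (hb : z b = 0) (hc : c ∈ segment ℝ (W 0) (W 1)) (f : Euc 3 →ᵃ[ℝ] ℝ) (t : ℕ) :
    relTo z (W t) f (μ • b + s • c) = μ * f b + s * (f c - f (W t)) := by
  have hzc : z c = z (W 0) := by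
    obtain ⟨a1, a2, _, _, h12, rfl⟩ := hc
    rw [affine_comb₂ _ _ _ h12, hW.z_eq 1, ← add_mul, h12, one_mul]
  rw [affine_comb₂ _ _ _ hμs, relTo_apply, relTo_apply, hb, hzc, hW.z_eq t,
    div_mul_cancel₀ _ hW.z_pos.ne', mul_zero, sub_zero]

lemma sub_between (hW : Apexes m q x y z α W) {c : Euc 3} (hc : c ∈ segment ℝ (W 0) (W 1))
    (t : ℕ) : ∃ θ : ℝ, 0 ≤ θ ∧ θ ≤ 1 ∧ x c - x (W t) = θ * (x (W (t + 1)) - x (W t)) ∧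
      y c = y (W 0) := by
  obtain ⟨a1, a2, h1, h2, h12, rfl⟩ := hc
  have hy : y (a1 • W 0 + a2 • W 1) = y (W 0) := by
    rw [affine_comb₂ _ _ _ h12, hW.y_eq 1, ← add_mul, h12, one_mul]
  rw [affine_comb₂ _ _ _ h12]
  have ha : a1 = 1 - a2 := by linarith
  rcases hW.mem_pair t 0 with h3 | h3 <;> rcases hW.mem_pair t 1 with h4 | h4
  · exact ⟨0, le_rfl, by norm_num, by rw [h3, h4, ha]; ring, hy⟩
  · exact ⟨a2, h2, by linarith, by rw [h3, h4, ha]; ring, hy⟩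
  · exact ⟨a1, h1, by linarith, by rw [h3, h4, ha]; ring, hy⟩
  · exact ⟨1, by norm_num, le_rfl, by rw [h3, h4, ha]; ring, hy⟩

/-- A point above the polygon lies in one of the two kinds of tetrahedra: consider the section by
the line parallel to the edge `W 0, W 1`. The tetrahedron over the chord of the zigzag met by the
projection takes the middle part, and the adjacent tetrahedra with apexes `W 0` and `W 1` the rest
on both sides. -/
lemma exists_mem (hz : Zigzag m q x y r α p) (hr : 0 < r) (hW : Apexes m q x y z α W)
    (hm : 2 ≤ m) (hE : ∀ t, t + 1 < m → IsFullSimplexIn A (tetEdge q p W t))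
    (hA : ∀ t, t + 2 < m → IsFullSimplexIn A (tetApex q p W t)) {b c : Euc 3} {μ s : ℝ}
    (hμ : 0 ≤ μ) (hs : 0 ≤ s) (hμs : μ + s = 1) (hb : b ∈ convexHull ℝ (range q))
    (hc : c ∈ segment ℝ (W 0) (W 1)) :
    (∃ t, t + 1 < m ∧ μ • b + s • c ∈ convexHull ℝ (tetEdge q p W t : Set (Euc 3))) ∨
    (∃ t, t + 2 < m ∧ μ • b + s • c ∈ convexHull ℝ (tetApex q p W t : Set (Euc 3))) := by
  have hzb : z b = 0 := le_antisymm
    (affine_convexHull_le z (by rintro _ ⟨k, rfl⟩; exact (hW.qz k).le) hb)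
    (affine_le_convexHull z (by rintro _ ⟨k, rfl⟩; exact (hW.qz k).ge) hb)
  have hp : ∀ w ∈ range q, ∃ t < m, w = q (p t) := by
    rintro _ ⟨k, rfl⟩
    obtain ⟨t, ht, rfl⟩ := hz.p_surj hr k
    exact ⟨t, ht, rfl⟩
  have hymono : ∀ {i j : ℕ}, i ≤ j → j < m → y (q (p j)) ≤ y (q (p i)) := by
    intro i j hij hj
    rcases hij.lt_or_eq with h1 | rfl
    · exact (hz.y_lt hr h1 hj).le
    · exact le_rfl
  obtain ⟨i, hi, hi1, hi2⟩ := exists_step (fun t => y (q (p t))) (y b) (m - 1) (by omega)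
    (affine_le_convexHull y (fun w hw => by
      obtain ⟨t, ht, rfl⟩ := hp w hw; exact hymono (by omega) (by omega)) hb)
    (affine_convexHull_le y (fun w hw => by
      obtain ⟨t, ht, rfl⟩ := hp w hw; exact hymono (by omega) (by omega)) hb)
  set a := μ • b + s • c with ha
  have hRel : ∀ (f : Euc 3 →ᵃ[ℝ] ℝ) (t : ℕ),
      relTo z (W t) f a = μ * f b + s * (f c - f (W t)) := hW.relTo_comb hμs hzb hc
  have hza : 0 ≤ z a := by
    have hzc : z (W 0) ≤ z c := by
      obtain ⟨a1, a2, _, _, h12, rfl⟩ := hc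
      rw [affine_comb₂ _ _ _ h12, hW.z_eq 1, ← add_mul, h12, one_mul]
    rw [ha, affine_comb₂ _ _ _ hμs, hzb, mul_zero, zero_add]
    exact mul_nonneg hs (hW.z_pos.le.trans hzc)
  obtain ⟨_, _, _, _, hyc⟩ := hW.sub_between hc 0
  have hlev : ∀ (k : ℝ) (t : ℕ), relTo z (W t) (level y k) a = μ * (y b - k) := by
    intro k t; rw [hRel, level_apply, level_apply, level_apply, hyc, hW.y_eq t]; ring
  have hch : ∀ t u : ℕ, relTo z (W u) (chordSide m x y r α t) a =
      μ * chordSide m x y r α t b + s * (Real.sin (chordMid m α t) * (x c - x (W u))) := by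
    intro t u; rw [hRel, chordSide_apply m x y r α t c, chordSide_apply m x y r α t (W u), hyc,
      hW.y_eq u]; ring
  -- the outer polygon edge never separates
  have hedge : ∀ t, t + 2 < m → relTo z (W t) (edgeSide m x y r α t) a ≤ 0 := by
    intro t ht
    obtain ⟨θ, h0, h1, h2, _⟩ := hW.sub_between hc t
    have e1 : edgeSide m x y r α t b ≤ 0 := affine_convexHull_le _ (fun w hw => by
      obtain ⟨j, hj, rfl⟩ := hp w hw; exact hz.edgeSide_le hr hj ht) hb
    rw [hRel, edgeSide_apply m x y r α t c, edgeSide_apply m x y r α t (W t), hyc, hW.y_eq t]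
    have e2 := mul_nonpos_of_nonneg_of_nonpos h0 (hW.edge t ht).le
    have e3 : Real.sin (edgeMid m α t) * (x c - x (W t)) =
      θ * (Real.sin (edgeMid m α t) * (x (W (t + 1)) - x (W t))) := by rw [h2]; ring
    have e4 := mul_nonpos_of_nonneg_of_nonpos hs (e3 ▸ e2)
    have e5 := mul_nonpos_of_nonneg_of_nonpos hμ e1
    linarith
  -- between the planes through an apex and two consecutive chords, the point is in the tetrahedron
  -- over these chords
  have hApex : ∀ t, t + 2 < m → 0 ≤ relTo z (W t) (chordSide m x y r α (t + 1)) a →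
      relTo z (W t) (chordSide m x y r α t) a ≤ 0 →
      a ∈ convexHull ℝ (tetApex q p W t : Set (Euc 3)) := by
    intro t ht h1 h2
    have c1 := hz.chordSide_pos hr (s := t) (t := t + 1) (by omega) (by omega)
    have c2 := hz.chordSide_neg hr (s := t + 2) (t := t) (by omega) (by omega)
    have c3 := hz.chordSide_self (t := t + 1) (by omega)
    have c4 := hz.chordSide_succ (t := t + 1) (by omega)
    have c5 := hz.chordSide_self (t := t) (by omega)
    have c6 := hz.chordSide_succ (t := t) (by omega)
    have c7 := hW.edgeSide_mid_neg hz hr ht (hA t ht)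
    have c8 := hz.edgeSide_self (t := t) (by omega)
    have c9 := hz.edgeSide_succ_succ ht
    refine mem_convexHull_of_sides (hA t ht) fun w hw => ?_
    rcases mem_tetApex.1 hw with rfl | rfl | rfl | rfl
    · refine ⟨relTo z (W t) (chordSide m x y r α (t + 1)), fun w' hw' hne => ?_, ?_, h1⟩
      · rcases mem_tetApex.1 hw' with rfl | rfl | rfl | rfl
        · exact absurd rfl hne
        · rw [hW.relTo_q, c3]
        · rw [hW.relTo_q, c4]
        · rw [hW.relTo_W, sub_self]
      · rw [hW.relTo_q]; exact c1
    · refine ⟨-relTo z (W t) (edgeSide m x y r α t), fun w' hw' hne => ?_, ?_, ?_⟩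
      · rcases mem_tetApex.1 hw' with rfl | rfl | rfl | rfl
        · simp [hW.relTo_q, c8]
        · exact absurd rfl hne
        · simp [hW.relTo_q, c9]
        · simp [hW.relTo_W]
      · simpa [hW.relTo_q] using c7
      · simpa using hedge t ht
    · refine ⟨-relTo z (W t) (chordSide m x y r α t), fun w' hw' hne => ?_, ?_, ?_⟩
      · rcases mem_tetApex.1 hw' with rfl | rfl | rfl | rfl
        · simp [hW.relTo_q, c5]
        · simp [hW.relTo_q, c6]
        · exact absurd rfl hne
        · simp [hW.relTo_W]
      · simpa [hW.relTo_q] using c2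
      · simpa using h2
    · refine ⟨z, fun w' hw' hne => ?_, hW.z_pos' t, hza⟩
      rcases mem_tetApex.1 hw' with rfl | rfl | rfl | rfl
      · exact hW.qz _
      · exact hW.qz _
      · exact hW.qz _
      · exact absurd rfl hne
  -- between the two planes through the chord and the apexes, the point is in the tetrahedron over
  -- the chord
  have hEdge : 0 ≤ relTo z (W i) (chordSide m x y r α i) a →
      relTo z (W (i + 1)) (chordSide m x y r α i) a ≤ 0 →
      a ∈ convexHull ℝ (tetEdge q p W i : Set (Euc 3)) := by
    intro h1 h2
    have c1 := hW.relTo_chord_pos (r := r) i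
    have c2 : relTo z (W (i + 1)) (chordSide m x y r α i) (W i) < 0 := by
      rw [hW.relTo_W] at c1 ⊢; linarith
    have c5 := hz.chordSide_self (t := i) (by omega)
    have c6 := hz.chordSide_succ (t := i) (by omega)
    have c7 := hz.y_lt hr (s := i) (t := i + 1) (by omega) (by omega)
    refine mem_convexHull_of_sides (hE i (by omega)) fun w hw => ?_
    rcases hW.mem_tetEdge' hw i with rfl | rfl | rfl | rfl
    · refine ⟨-relTo z (W (i + 1)) (chordSide m x y r α i), fun w' hw' hne => ?_, ?_, ?_⟩
      · rcases hW.mem_tetEdge' hw' i with rfl | rfl | rfl | rfl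
        · exact absurd rfl hne
        · simp [hW.relTo_W]
        · simp [hW.relTo_q, c5]
        · simp [hW.relTo_q, c6]
      · simpa using c2
      · simpa using h2
    · refine ⟨relTo z (W i) (chordSide m x y r α i), fun w' hw' hne => ?_, c1, h1⟩
      rcases hW.mem_tetEdge' hw' i with rfl | rfl | rfl | rfl
      · rw [hW.relTo_W, sub_self]
      · exact absurd rfl hne
      · rw [hW.relTo_q, c5]
      · rw [hW.relTo_q, c6]
    · refine ⟨relTo z (W 0) (level y (y (q (p (i + 1))))), fun w' hw' hne => ?_, ?_, ?_⟩
      · rcases hW.mem_tetEdge' hw' i with rfl | rfl | rfl | rfl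
        · exact hW.relTo_level _ _ _
        · exact hW.relTo_level _ _ _
        · exact absurd rfl hne
        · rw [hW.relTo_q, level_apply, sub_self]
      · rw [hW.relTo_q, level_apply]; linarith
      · rw [hlev]; exact mul_nonneg hμ (by linarith)
    · refine ⟨-relTo z (W 0) (level y (y (q (p i)))), fun w' hw' hne => ?_, ?_, ?_⟩
      · rcases hW.mem_tetEdge' hw' i with rfl | rfl | rfl | rfl
        · simp [hW.relTo_level]
        · simp [hW.relTo_level]
        · simp [hW.relTo_q, level_apply]
        · exact absurd rfl hne
      · simp only [AffineMap.coe_neg, Pi.neg_apply, hW.relTo_q, level_apply]; linarith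
      · simp only [AffineMap.coe_neg, Pi.neg_apply, hlev]
        have := mul_nonneg hμ (show 0 ≤ y (q (p i)) - y b by linarith)
        linarith
  -- consecutive chord functions and the height are linearly dependent
  have hdep : ∀ (t : ℕ) (w w' : Euc 3),
      Real.sin (chordMid m α t) * (chordSide m x y r α (t + 1) w -
        chordSide m x y r α (t + 1) w') =
      Real.sin (chordMid m α (t + 1)) * (chordSide m x y r α t w - chordSide m x y r α t w') +
        (Real.sin (chordMid m α t) * Real.cos (chordMid m α (t + 1)) -
          Real.sin (chordMid m α (t + 1)) * Real.cos (chordMid m α t)) * (y w - y w') := by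
    intro t w w'; simp only [chordSide_apply]; ring
  -- beyond the plane through the chord `i` and `W i`, the point is on the inner side of the plane
  -- through the chord `i + 1` and the same apex; beyond the last chord there is nothing
  rcases lt_or_ge (relTo z (W i) (chordSide m x y r α i) a) 0 with h1 | h1
  · obtain ⟨θ, t0, t1, t2, _⟩ := hW.sub_between hc i
    rcases lt_or_ge (i + 2) m with h2 | h2
    · refine Or.inr ⟨i, h2, hApex i h2 ?_ h1.le⟩
      have d1 := hdep i b (q (p (i + 1)))
      have d2 := hdep i (q (p i)) (q (p (i + 1)))
      rw [hz.chordSide_self (t := i + 1) (by omega), hz.chordSide_succ (t := i) (by omega)] at d1 d2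
      rw [hz.chordSide_self (t := i) (by omega)] at d2
      have c1 := hz.chordSide_pos hr (s := i) (t := i + 1) (by omega) (by omega)
      have c7 := hz.y_lt hr (s := i) (t := i + 1) (by omega) (by omega)
      have hn := hW.sin_mul_sin_neg i
      rw [hch] at h1 ⊢
      set S := Real.sin (chordMid m α i)
      set S' := Real.sin (chordMid m α (i + 1))
      set D := S * Real.cos (chordMid m α (i + 1)) - S' * Real.cos (chordMid m α i)
      set K := chordSide m x y r α i b
      set K' := chordSide m x y r α (i + 1) b
      set C := chordSide m x y r α (i + 1) (q (p i))
      set ξ := x c - x (W i)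
      have hS : 0 < S ^ 2 := by
        rcases (sq_nonneg S).lt_or_eq with h | h
        · exact h
        · rw [pow_eq_zero_iff two_ne_zero |>.1 h.symm, zero_mul] at hn; exact absurd hn (lt_irrefl _)
      have hD : 0 ≤ S * D := by
        have e : (S * D) * (y (q (p i)) - y (q (p (i + 1)))) = S ^ 2 * C := by
          linear_combination (-S) * d2
        have := mul_pos hS c1
        rw [← e] at this
        exact (pos_of_mul_pos_left this (by linarith)).le
      have e : S ^ 2 * (μ * K' + s * (S' * ξ)) = (S * S') * (μ * K + s * (S * ξ)) +
          μ * ((S * D) * (y b - y (q (p (i + 1))))) := by linear_combination S * μ * d1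
      have h3 := mul_pos_of_neg_of_neg hn h1
      have h4 := mul_nonneg hμ (mul_nonneg hD (show 0 ≤ y b - y (q (p (i + 1))) by linarith))
      exact (pos_of_mul_pos_right (a := S ^ 2) (by linarith) hS.le).le
    · exfalso
      have e1 : 0 ≤ chordSide m x y r α i b := affine_le_convexHull _ (fun w hw => by
        obtain ⟨j, hj, rfl⟩ := hp w hw
        rcases lt_trichotomy j i with h | rfl | h
        · exact (hz.chordSide_pos hr h (by omega)).le
        · rw [hz.chordSide_self hj]
        · obtain rfl : j = i + 1 := by omega
          rw [hz.chordSide_succ hj]) hb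
      rw [hch, t2] at h1
      have e2 := mul_nonneg hμ e1
      have e3 := mul_nonneg hs (mul_nonneg t0 (hW.side i).le)
      linarith
  -- symmetrically, beyond the plane through the chord `i` and `W (i + 1)` the point is on the inner
  -- side of the plane through the chord `i - 1` and the same apex
  rcases lt_or_ge 0 (relTo z (W (i + 1)) (chordSide m x y r α i) a) with h2 | h2
  · rcases Nat.eq_zero_or_pos i with rfl | hi0
    · exfalso
      have e1 : chordSide m x y r α 0 b ≤ 0 := affine_convexHull_le _ (fun w hw => by
        obtain ⟨j, hj, rfl⟩ := hp w hw
        rcases lt_trichotomy j 1 with h | rfl | h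
        · obtain rfl : j = 0 := by omega
          rw [hz.chordSide_self hj]
        · rw [hz.chordSide_succ hj]
        · exact (hz.chordSide_neg hr h hj).le) hb
      obtain ⟨θ, t0, t1, t2, _⟩ := hW.sub_between hc (0 + 1)
      rw [hW.per] at t2
      rw [hch, t2] at h2
      have e2 := mul_nonpos_of_nonneg_of_nonpos hμ e1
      have e3 := mul_nonneg hs (mul_nonneg t0 (hW.side 0).le)
      linarith
    · obtain ⟨j, rfl⟩ : ∃ j, i = j + 1 := ⟨i - 1, by omega⟩
      rw [show j + 1 + 1 = j + 2 by ring, hW.per] at h2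
      refine Or.inr ⟨j, by omega, hApex j (by omega) h2.le ?_⟩
      have d1 := hdep j b (q (p (j + 1)))
      have d2 := hdep j (q (p (j + 2))) (q (p (j + 1)))
      rw [hz.chordSide_self (t := j + 1) (by omega), hz.chordSide_succ (t := j) (by omega)] at d1 d2
      rw [hz.chordSide_succ (t := j + 1) (by omega)] at d2
      have c1 := hz.chordSide_neg hr (s := j + 2) (t := j) (by omega) (by omega)
      have c7 := hz.y_lt hr (s := j + 1) (t := j + 2) (by omega) (by omega)
      have hn := hW.sin_mul_sin_neg j
      rw [hch] at h2 ⊢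
      set S := Real.sin (chordMid m α j)
      set S' := Real.sin (chordMid m α (j + 1))
      set D := S * Real.cos (chordMid m α (j + 1)) - S' * Real.cos (chordMid m α j)
      set K := chordSide m x y r α j b
      set K' := chordSide m x y r α (j + 1) b
      set C := chordSide m x y r α j (q (p (j + 2)))
      set ξ := x c - x (W j)
      have hS : 0 < S' ^ 2 := by
        rcases (sq_nonneg S').lt_or_eq with h | h
        · exact h
        · rw [pow_eq_zero_iff two_ne_zero |>.1 h.symm, mul_zero] at hn; exact absurd hn (lt_irrefl _)
      have hD : S' * D ≤ 0 := by
        have e : (S' * D) * (y (q (p (j + 2))) - y (q (p (j + 1)))) = S' ^ 2 * (-C) := by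
          linear_combination (-S') * d2
        have := mul_pos hS (show 0 < -C by linarith)
        rw [← e] at this
        by_contra hcon
        have := mul_nonpos_of_nonneg_of_nonpos (not_le.1 hcon).le
          (show y (q (p (j + 2))) - y (q (p (j + 1))) ≤ 0 by linarith)
        linarith
      have e : S' ^ 2 * (μ * K + s * (S * ξ)) = (S * S') * (μ * K' + s * (S' * ξ)) -
          μ * ((S' * D) * (y b - y (q (p (j + 1))))) := by linear_combination (-S') * μ * d1
      have h3 := mul_neg_of_neg_of_pos hn h2
      have h4 := mul_nonneg hμ (mul_nonneg_of_nonpos_of_nonpos hD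
        (show y b - y (q (p (j + 1))) ≤ 0 by linarith))
      by_contra hcon
      have := mul_pos hS (not_le.1 hcon)
      linarith
  · exact Or.inl ⟨i, by omega, hEdge h1 h2⟩

end Apexes

/-! ### The mismatching dissection -/

/-- The interiors of two different members of the family are disjoint. -/
def InteriorDisjoint {d : ℕ} (D : Finset (Finset (Euc d))) : Prop :=
  ∀ σ ∈ D, ∀ τ ∈ D, σ ≠ τ → Disjoint (interior (convexHull ℝ (σ : Set (Euc d))))
    (interior (convexHull ℝ (τ : Set (Euc d))))

lemma IsFullSimplexIn.ne_of_disjoint {d : ℕ} {A : Set (Euc d)} {σ τ : Finset (Euc d)}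
    (hσ : IsFullSimplexIn A σ) (h : Disjoint (interior (convexHull ℝ (σ : Set (Euc d))))
      (interior (convexHull ℝ (τ : Set (Euc d))))) : σ ≠ τ := by
  rintro rfl
  obtain ⟨lam, hl⟩ := hσ.exists_bary
  obtain ⟨p, hp⟩ := hl.interior_nonempty (Finset.card_pos.1 (by rw [hσ.card]; omega))
  exact Set.disjoint_left.1 h hp hp

namespace Frame

variable {m : ℕ} {q : Fin m → Euc 3} {v u : Fin 2 → Euc 3} {X Y Z : Euc 3 →ᵃ[ℝ] ℝ}
  {r φ κ ε α : ℝ} {p : ℕ → Fin m}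

lemma exists_apexes (h : Frame m q v u X Y Z r φ κ) (hε : ε = 1 ∨ ε = -1)
    (hz : Zigzag m q (ε • X) Y r α p) : ∃ W : ℕ → Euc 3, Apexes m q (ε • X) Y Z α W ∧
      ((W 0 = v 0 ∧ W 1 = v 1) ∨ (W 0 = v 1 ∧ W 1 = v 0)) := by
  have key : ∀ a b : Fin 2, (ε • X) (v b) < (ε • X) (v a) →
      Apexes m q (ε • X) Y Z α (fun t => if Even t then v a else v b) := by
    intro a b hab
    refine ⟨fun t => ?_, h.qZ, ?_, fun t => ?_, fun t => ?_, fun t => ?_, fun t ht => ?_⟩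
    · simp [Nat.even_add]
    · exact h.vZ_pos' _
    · split_ifs <;> simp [h.vZ' a, h.vZ' b]
    · split_ifs <;> simp [h.vY' a, h.vY' b]
    · obtain ⟨h1, h2⟩ := hz.sin_chordMid (by have := h.four_le; omega) t
      by_cases ht : Even t
      · simp only [ht, Nat.even_add_one, not_true_eq_false, if_true, if_false]
        exact mul_pos_of_neg_of_neg (h1 ht) (by linarith)
      · simp only [ht, Nat.even_add_one, not_false_eq_true, if_true, if_false]
        exact mul_pos (h2 ht) (by linarith)
    · obtain ⟨h1, h2⟩ := hz.sin_edgeMid ht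
      by_cases ht : Even t
      · simp only [ht, Nat.even_add_one, not_true_eq_false, if_true, if_false]
        exact mul_neg_of_pos_of_neg (h1 ht) (by linarith)
      · simp only [ht, Nat.even_add_one, not_false_eq_true, if_true, if_false]
        exact mul_neg_of_neg_of_pos (h2 ht) (by linarith)
  have hne : (ε • X) (v 0) ≠ (ε • X) (v 1) := by
    have := h.vX
    rcases hε with rfl | rfl <;> simpa using this
  rcases lt_or_gt_of_ne hne with h1 | h1
  · exact ⟨_, key 1 0 h1, by simp⟩
  · exact ⟨_, key 0 1 h1, by simp⟩

/-- The half of the polytope above the plane of the polygon has a dissection of size `2 * m - 3`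
using all chords of the zigzag. -/
lemma exists_half (h : Frame m q v u X Y Z r φ κ) (hε : ε = 1 ∨ ε = -1)
    (hz : Zigzag m q (ε • X) Y r α p) : ∃ D : Finset (Finset (Euc 3)), D.card = 2 * m - 3 ∧
      (∀ σ ∈ D, IsFullSimplexIn (vertexFinset q v u : Set (Euc 3)) σ ∧ ∀ w ∈ σ, 0 ≤ Z w) ∧
      InteriorDisjoint D ∧
      (∀ a ∈ convexHull ℝ (range q ∪ range v), ∃ σ ∈ D, a ∈ convexHull ℝ (σ : Set (Euc 3))) ∧
      ∀ t, t + 1 < m → ∃ σ ∈ D, q (p t) ∈ σ ∧ q (p (t + 1)) ∈ σ ∧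
        ∀ w ∈ σ, Z w = 0 → w = q (p t) ∨ w = q (p (t + 1)) := by
  classical
  have hm := h.four_le
  have hr := h.r_pos
  obtain ⟨W, hW, hWv⟩ := h.exists_apexes hε hz
  have hset : ∀ t, tetEdge q p W t = {v 0, v 1, q (p t), q (p (t + 1))} := by
    intro t; ext w; rw [mem_tetEdge]
    rcases hWv with ⟨h1, h2⟩ | ⟨h1, h2⟩ <;> simp only [h1, h2, Finset.mem_insert,
      Finset.mem_singleton] <;> tauto
  have hWmem : ∀ t, ∃ i, W t = v i := by
    intro t
    rcases hW.mem_pair 0 t with h3 | h3 <;> rcases hWv with ⟨h1, h2⟩ | ⟨h1, h2⟩ <;> rw [h3]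
    exacts [⟨_, h1⟩, ⟨_, h1⟩, ⟨_, h2⟩, ⟨_, h2⟩]
  have hne : ∀ {s t : ℕ}, s < m → t < m → s ≠ t → p s ≠ p t := fun hs ht hst he =>
    hst (hz.p_inj hr hs ht he)
  have hE : ∀ t, t + 1 < m →
      IsFullSimplexIn (vertexFinset q v u : Set (Euc 3)) (tetEdge q p W t) := by
    intro t ht
    rw [hset]
    convert h.full_vvqq (hne (s := t) (t := t + 1) (by omega) ht (by omega))
  have hA : ∀ t, t + 2 < m →
      IsFullSimplexIn (vertexFinset q v u : Set (Euc 3)) (tetApex q p W t) := by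
    intro t ht
    obtain ⟨i, hi⟩ := hWmem t
    have := h.full_qqq (hne (s := t) (t := t + 1) (by omega) (by omega) (by omega))
      (hne (s := t) (t := t + 2) (by omega) (by omega) (by omega))
      (hne (s := t + 1) (t := t + 2) (by omega) (by omega) (by omega)) (w := W t)
      (by rw [hi]; exact v_mem i) (by rw [hi]; exact (h.vZ_pos' i).ne')
    unfold tetApex
    convert this
  have hEE : ∀ i j, i + 1 < m → j + 1 < m → i ≠ j →
      Disjoint (interior (convexHull ℝ (tetEdge q p W i : Set (Euc 3))))
        (interior (convexHull ℝ (tetEdge q p W j : Set (Euc 3)))) := by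
    intro i j hi hj hij
    rcases lt_or_gt_of_ne hij with h1 | h1
    · exact hW.disjoint_edge_edge hz hr h1 hj
    · exact (hW.disjoint_edge_edge hz hr h1 hi).symm
  have hAA : ∀ i j, i + 2 < m → j + 2 < m → i ≠ j →
      Disjoint (interior (convexHull ℝ (tetApex q p W i : Set (Euc 3))))
        (interior (convexHull ℝ (tetApex q p W j : Set (Euc 3)))) := by
    intro i j hi hj hij
    rcases lt_or_gt_of_ne hij with h1 | h1
    · exact hW.disjoint_apex_apex hz hr h1 hj
    · exact (hW.disjoint_apex_apex hz hr h1 hi).symm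
  have hEA : ∀ i j, i + 1 < m → j + 2 < m →
      Disjoint (interior (convexHull ℝ (tetEdge q p W i : Set (Euc 3))))
        (interior (convexHull ℝ (tetApex q p W j : Set (Euc 3)))) := fun i j hi hj =>
    hW.disjoint_edge_apex hz hr hi hj
  have hmem : ∀ σ, σ ∈ (Finset.range (m - 1)).image (tetEdge q p W) ∪
      (Finset.range (m - 2)).image (tetApex q p W) ↔
      (∃ t, t + 1 < m ∧ tetEdge q p W t = σ) ∨ ∃ t, t + 2 < m ∧ tetApex q p W t = σ := by
    intro σ
    simp only [Finset.mem_union, Finset.mem_image, Finset.mem_range]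
    constructor <;> rintro (⟨t, ht, rfl⟩ | ⟨t, ht, rfl⟩)
    · exact Or.inl ⟨t, by omega, rfl⟩
    · exact Or.inr ⟨t, by omega, rfl⟩
    · exact Or.inl ⟨t, by omega, rfl⟩
    · exact Or.inr ⟨t, by omega, rfl⟩
  refine ⟨(Finset.range (m - 1)).image (tetEdge q p W) ∪
    (Finset.range (m - 2)).image (tetApex q p W), ?_, ?_, ?_, ?_, ?_⟩
  · rw [Finset.card_union_of_disjoint, Finset.card_image_of_injOn, Finset.card_image_of_injOn,
      Finset.card_range, Finset.card_range]
    · omega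
    · intro i hi j hj hij
      simp only [Finset.coe_range, mem_Iio] at hi hj
      by_contra hne
      exact (hA i (by omega)).ne_of_disjoint (hAA i j (by omega) (by omega) hne) hij
    · intro i hi j hj hij
      simp only [Finset.coe_range, mem_Iio] at hi hj
      by_contra hne
      exact (hE i (by omega)).ne_of_disjoint (hEE i j (by omega) (by omega) hne) hij
    · rw [Finset.disjoint_left]
      rintro _ h1 h2
      obtain ⟨i, hi, rfl⟩ := Finset.mem_image.1 h1
      obtain ⟨j, hj, hij⟩ := Finset.mem_image.1 h2
      rw [Finset.mem_range] at hi hj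
      exact (hE i (by omega)).ne_of_disjoint (hEA i j (by omega) (by omega)) hij.symm
  · intro σ hσ
    rcases (hmem σ).1 hσ with ⟨t, ht, rfl⟩ | ⟨t, ht, rfl⟩
    · refine ⟨hE t ht, fun w hw => ?_⟩
      rcases mem_tetEdge.1 hw with rfl | rfl | rfl | rfl
      exacts [(hW.z_pos' _).le, (hW.z_pos' _).le, (h.qZ _).ge, (h.qZ _).ge]
    · refine ⟨hA t ht, fun w hw => ?_⟩
      rcases mem_tetApex.1 hw with rfl | rfl | rfl | rfl
      exacts [(h.qZ _).ge, (h.qZ _).ge, (h.qZ _).ge, (hW.z_pos' _).le]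
  · intro σ hσ τ hτ hne'
    rcases (hmem σ).1 hσ with ⟨t, ht, rfl⟩ | ⟨t, ht, rfl⟩ <;>
      rcases (hmem τ).1 hτ with ⟨s, hs, rfl⟩ | ⟨s, hs, rfl⟩
    · exact hEE t s ht hs fun he => hne' (by rw [he])
    · exact hEA t s ht hs
    · exact (hEA s t hs ht).symm
    · exact hAA t s ht hs fun he => hne' (by rw [he])
  · intro a ha
    have hseg : convexHull ℝ (range v) = segment ℝ (W 0) (W 1) := by
      have : range v = {v 0, v 1} := by
        ext w; simp [Fin.exists_fin_two, eq_comm]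
      rw [this, convexHull_pair]
      rcases hWv with ⟨h1, h2⟩ | ⟨h1, h2⟩
      · rw [h1, h2]
      · rw [h1, h2, segment_symm]
    rw [convexHull_union ⟨_, mem_range_self ⟨0, by omega⟩⟩ ⟨_, mem_range_self 0⟩,
      mem_convexJoin] at ha
    obtain ⟨b, hb, c, hc, μ, s, hμ, hs, hμs, rfl⟩ := ha
    rw [hseg] at hc
    rcases hW.exists_mem hz hr (by omega) hE hA hμ hs hμs hb hc with ⟨t, ht, hmem'⟩ | ⟨t, ht, hmem'⟩
    · exact ⟨_, (hmem _).2 (Or.inl ⟨t, ht, rfl⟩), hmem'⟩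
    · exact ⟨_, (hmem _).2 (Or.inr ⟨t, ht, rfl⟩), hmem'⟩
  · intro t ht
    refine ⟨tetEdge q p W t, (hmem _).2 (Or.inl ⟨t, ht, rfl⟩), mem_tetEdge.2 (by tauto),
      mem_tetEdge.2 (by tauto), fun w hw hw0 => ?_⟩
    rcases mem_tetEdge.1 hw with rfl | rfl | h1 | h1
    · exact absurd hw0 (hW.z_pos' _).ne'
    · exact absurd hw0 (hW.z_pos' _).ne'
    · exact Or.inl h1
    · exact Or.inr h1

/-- The part of the polytope above the plane of the polygon is the convex hull of the polygon and
the upper edge, since segments between the two edges meet the plane inside the polygon. -/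
lemma mem_upper (h : Frame m q v u X Y Z r φ κ) {a : Euc 3}
    (ha : a ∈ convexHull ℝ (vertexFinset q v u : Set (Euc 3))) (hZ : 0 ≤ Z a) :
    a ∈ convexHull ℝ (range q ∪ range v) := by
  have hm := h.four_le
  have hnq : (range q).Nonempty := ⟨_, mem_range_self ⟨0, by omega⟩⟩
  have hnv : (range v).Nonempty := ⟨_, mem_range_self 0⟩
  have hnu : (range u).Nonempty := ⟨_, mem_range_self 0⟩
  rw [coe_vertexFinset, convexHull_union (hnq.inl) hnu, mem_convexJoin] at ha
  obtain ⟨b, hb, c, hc, μ, s, hμ, hs, hμs, rfl⟩ := ha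
  rw [convexHull_union hnq hnv, mem_convexJoin] at hb
  obtain ⟨b1, hb1, b2, hb2, ν, t, hν, ht, hνt, rfl⟩ := hb
  have hκ0 := h.κ_pos
  have hκ1 := h.κ_lt_one
  -- the point of the segment from the upper to the lower edge in the plane of the polygon
  have hx : (1 - κ) • b2 + κ • c ∈ convexHull ℝ (range q) := by
    have hv : range v = {v 0, v 1} := by ext w; simp [Fin.exists_fin_two, eq_comm]
    have hu : range u = {u 0, u 1} := by ext w; simp [Fin.exists_fin_two, eq_comm]
    rw [hv, convexHull_pair] at hb2
    rw [hu, convexHull_pair] at hc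
    obtain ⟨a0, a1, ha0, ha1, ha, rfl⟩ := hb2
    obtain ⟨c0, c1, hc0, hc1, hc, rfl⟩ := hc
    have e : (1 - κ) • (a0 • v 0 + a1 • v 1) + κ • (c0 • u 0 + c1 • u 1) =
        a0 • (c0 • crossPt κ v u 0 0 + c1 • crossPt κ v u 0 1) +
        a1 • (c0 • crossPt κ v u 1 0 + c1 • crossPt κ v u 1 1) := by
      simp only [crossPt]
      obtain rfl : a0 = 1 - a1 := by linarith
      obtain rfl : c0 = 1 - c1 := by linarith
      module
    rw [e]
    have hcv := convex_convexHull ℝ (range q)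
    exact hcv (hcv (h.cross_mem 0 0) (h.cross_mem 0 1) hc0 hc1 hc)
      (hcv (h.cross_mem 1 0) (h.cross_mem 1 1) hc0 hc1 hc) ha0 ha1 ha
  set x := (1 - κ) • b2 + κ • c with hxdef
  have hb1Z : Z b1 = 0 := le_antisymm
    (affine_convexHull_le Z (by rintro _ ⟨k, rfl⟩; exact (h.qZ k).le) hb1)
    (affine_le_convexHull Z (by rintro _ ⟨k, rfl⟩; exact (h.qZ k).ge) hb1)
  have hb2Z : Z b2 = Z (v 0) := le_antisymm
    (affine_convexHull_le Z (by rintro _ ⟨k, rfl⟩; exact (h.vZ' k).le) hb2)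
    (affine_le_convexHull Z (by rintro _ ⟨k, rfl⟩; exact (h.vZ' k).ge) hb2)
  have hcZ : Z c = Z (u 0) := le_antisymm
    (affine_convexHull_le Z (by rintro _ ⟨k, rfl⟩; exact (h.uZ' k).le) hc)
    (affine_le_convexHull Z (by rintro _ ⟨k, rfl⟩; exact (h.uZ' k).ge) hc)
  rw [affine_comb₂ _ _ _ hμs, affine_comb₂ _ _ _ hνt, hb1Z, hb2Z, hcZ] at hZ
  have hκZ := h.κZ
  have hcoef : 0 ≤ μ * t - s * (1 - κ) / κ := by
    have : (μ * t - s * (1 - κ) / κ) * Z (v 0) = μ * (ν * 0 + t * Z (v 0)) + s * Z (u 0) := by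
      field_simp
      linear_combination (-s) * hκZ
    rw [← this] at hZ
    exact nonneg_of_mul_nonneg_left hZ h.vZ_pos
  have e : μ • (ν • b1 + t • b2) + s • c =
      (μ * ν) • b1 + (s / κ) • x + (μ * t - s * (1 - κ) / κ) • b2 := by
    have hs : s • c = (s / κ) • (κ • c) := by rw [smul_smul, div_mul_cancel₀ _ hκ0.ne']
    rw [hs, hxdef]
    module
  rw [e]
  have hq := convexHull_mono (𝕜 := ℝ) (subset_union_left (s := range q) (t := range v))
  have hv := convexHull_mono (𝕜 := ℝ) (subset_union_right (s := range q) (t := range v))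
  have h3 := (convex_convexHull ℝ (range q ∪ range v)).sum_mem (t := Finset.univ)
    (w := ![μ * ν, s / κ, μ * t - s * (1 - κ) / κ]) (z := ![b1, x, b2])
    (by
      intro i _
      fin_cases i
      exacts [mul_nonneg hμ hν, div_nonneg hs hκ0.le, hcoef])
    (by
      simp only [Fin.sum_univ_three, Matrix.cons_val]
      have : s / κ - s * (1 - κ) / κ = s := by field_simp; ring
      linear_combination this + μ * hνt + hμs)
    (by
      intro i _
      fin_cases i
      exacts [hq hb1, hq hx, hv hb2])
  simpa [Fin.sum_univ_three] using h3

/-- The two half dissections together form a dissection; it is mismatching because a chord of one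
zigzag crosses a chord of the other. -/
lemma exists_mismatching (h : Frame m q v u X Y Z r φ κ) :
    ∃ D : Finset (Finset (Euc 3)),
      IsMismatchingDissection (vertexFinset q v u : Set (Euc 3)) D ∧ D.card = 4 * m - 6 := by
  classical
  have hm := h.four_le
  obtain ⟨ε, ε', α, α', p, p', hε, hz, hz', hrel⟩ := h.exists_zigzags
  have hε' : ε' = 1 ∨ ε' = -1 := by
    rcases hrel with ⟨_, rfl, _⟩ | ⟨_, rfl, _⟩
    · exact hε
    · rcases hε with rfl | rfl <;> simp
  obtain ⟨D, hcard, hfull, hdis, hcov, hchord⟩ := h.exists_half hε hz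
  obtain ⟨D', hcard', hfull', hdis', hcov', hchord'⟩ := h.swap.exists_half hε' hz'
  rw [vertexFinset_swap] at hfull'
  have hDD : ∀ σ ∈ D, ∀ τ ∈ D', Disjoint (interior (convexHull ℝ (σ : Set (Euc 3))))
      (interior (convexHull ℝ (τ : Set (Euc 3)))) := by
    intro σ hσ τ hτ
    refine (disjoint_interior_of_separated Z (a := v 0) (b := q ⟨0, by omega⟩) (fun w hw => ?_)
      (fun w hw => (hfull σ hσ).2 w hw) ?_).symm
    · have := (hfull' τ hτ).2 w hw
      simpa using this
    · rw [h.qZ]; exact h.vZ_pos.ne'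
  have hdisj : Disjoint D D' := Finset.disjoint_left.2 fun σ h1 h2 =>
    (hfull σ h1).1.ne_of_disjoint (hDD σ h1 σ h2) rfl
  have hdiss : IsDissection (vertexFinset q v u : Set (Euc 3)) (D ∪ D') := by
    refine ⟨fun σ hσ => ?_, fun σ hσ τ hτ hne => ?_, ?_⟩
    · rcases Finset.mem_union.1 hσ with h1 | h1
      · exact (hfull σ h1).1
      · exact (hfull' σ h1).1
    · rcases Finset.mem_union.1 hσ with h1 | h1 <;> rcases Finset.mem_union.1 hτ with h2 | h2
      · exact hdis σ h1 τ h2 hne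
      · exact hDD σ h1 τ h2
      · exact (hDD τ h2 σ h1).symm
      · exact hdis' σ h1 τ h2 hne
    · apply Subset.antisymm
      · refine iUnion₂_subset fun σ hσ => convexHull_mono ?_
        rcases Finset.mem_union.1 hσ with h1 | h1
        · exact (hfull σ h1).1.subset
        · exact (hfull' σ h1).1.subset
      · intro a ha
        rw [mem_iUnion₂]
        rcases le_total 0 (Z a) with h1 | h1
        · obtain ⟨σ, hσ, h2⟩ := hcov a (h.mem_upper ha h1)
          exact ⟨σ, Finset.mem_union_left _ hσ, h2⟩
        · obtain ⟨σ, hσ, h2⟩ := hcov' a (h.swap.mem_upper (by rwa [vertexFinset_swap])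
            (by simpa using h1))
          exact ⟨σ, Finset.mem_union_right _ hσ, h2⟩
  refine ⟨D ∪ D', ⟨hdiss, fun hT => ?_⟩, ?_⟩
  · obtain ⟨k, hk⟩ := h.even
    have hk2 : m / 2 = k := by omega
    -- two perpendicular chords at or next to the centre
    obtain ⟨t', ht', hpar, hlt⟩ : ∃ t', t' + 1 < m ∧ Even (k - 1 + t' + m / 2) ∧
        |2 * ((k - 1 + 1 : ℕ) : ℤ) - m| + |2 * ((t' + 1 : ℕ) : ℤ) - m| < m := by
      have h0 : |2 * ((k - 1 + 1 : ℕ) : ℤ) - m| = 0 := by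
        rw [abs_eq_zero]; omega
      rw [h0, hk2]
      rcases Nat.even_or_odd k with he | he
      · refine ⟨k - 1, by omega, ?_, ?_⟩
        · obtain ⟨l, hl⟩ := he
          exact ⟨k - 1 + l, by omega⟩
        · rw [h0]; omega
      · refine ⟨k, by omega, ?_, ?_⟩
        · obtain ⟨l, hl⟩ := he
          exact ⟨k + l, by omega⟩
        · have : (2 * ((k + 1 : ℕ) : ℤ) - m) = 2 := by omega
          rw [this]; norm_num; omega
    obtain ⟨⟨s, hs, hs'⟩, hne1, hne2⟩ := h.exists_cross hε hz hz' hrel (t := k - 1) (by omega) ht'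
      hpar hlt
    obtain ⟨σ, hσ, h1, h2, h3⟩ := hchord (k - 1) (by omega)
    obtain ⟨τ, hτ, h4, h5, _⟩ := hchord' t' ht'
    have hsσ : s ∈ convexHull ℝ (σ : Set (Euc 3)) :=
      (convex_convexHull ℝ _).segment_subset (subset_convexHull ℝ _ h1)
        (subset_convexHull ℝ _ h2) (openSegment_subset_segment ℝ _ _ hs)
    have h6 := (hT.mem_of_openSegment (Finset.mem_union_right _ hτ)
      (Finset.mem_union_left _ hσ) h4 h5 hs' hsσ).1
    rcases h3 _ h6 (h.qZ _) with h7 | h7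
    · exact hne1 (h.q_inj h7)
    · exact hne2 (h.q_inj h7)
  · rw [Finset.card_union_of_disjoint hdisj, hcard, hcard']; omega

end Frame

/-! ### Counting triangles in the plane -/

/-- The three points are not collinear. -/
def NonCol (a b c : Euc 3) : Prop :=
  ∀ x y z : ℝ, x + y + z = 0 → x • a + y • b + z • c = 0 → x = 0 ∧ y = 0 ∧ z = 0

/-- The relative interior of a triangle. -/
def OTri (a b c : Euc 3) : Set (Euc 3) :=
  {p | ∃ x y z : ℝ, 0 < x ∧ 0 < y ∧ 0 < z ∧ x + y + z = 1 ∧ x • a + y • b + z • c = p}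

/-- `P` contains the relative interior of the nondegenerate triangle `a b c`. -/
structure TriIn (P : Set (Euc 3)) (a b c : Euc 3) : Prop where
  nonCol : NonCol a b c
  subset : OTri a b c ⊆ P

lemma TriIn.swap₁₂ {P : Set (Euc 3)} {a b c : Euc 3} (h : TriIn P a b c) : TriIn P b a c := by
  refine ⟨fun x y z h0 h1 => ?_, ?_⟩
  · obtain ⟨h2, h3, h4⟩ := h.nonCol y x z (by linarith) (by rw [← h1]; module)
    exact ⟨h3, h2, h4⟩
  · rintro _ ⟨x, y, z, hx, hy, hz, h1, rfl⟩
    exact h.subset ⟨y, x, z, hy, hx, hz, by linarith, by module⟩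

lemma TriIn.swap₂₃ {P : Set (Euc 3)} {a b c : Euc 3} (h : TriIn P a b c) : TriIn P a c b := by
  refine ⟨fun x y z h0 h1 => ?_, ?_⟩
  · obtain ⟨h2, h3, h4⟩ := h.nonCol x z y (by linarith) (by rw [← h1]; module)
    exact ⟨h2, h4, h3⟩
  · rintro _ ⟨x, y, z, hx, hy, hz, h1, rfl⟩
    exact h.subset ⟨x, z, y, hx, hz, hy, by linarith, by module⟩

lemma TriIn.mono {P P' : Set (Euc 3)} {a b c : Euc 3} (h : TriIn P a b c) (hP : P ⊆ P') :
    TriIn P' a b c := ⟨h.nonCol, h.subset.trans hP⟩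

/-- The vertices of a triangle can be sorted by the values of a function. -/
lemma TriIn.sorted {P : Set (Euc 3)} {a b c : Euc 3} (h : TriIn P a b c) (f : Euc 3 → ℝ)
    (hab : f a ≠ f b) (hac : f a ≠ f c) (hbc : f b ≠ f c) (C : Euc 3 → Prop) (ha : C a)
    (hb : C b) (hc : C c) :
    ∃ a' b' c', TriIn P a' b' c' ∧ f a' < f b' ∧ f b' < f c' ∧ C a' ∧ C b' ∧ C c' := by
  rcases lt_or_gt_of_ne hab with h1 | h1 <;> rcases lt_or_gt_of_ne hac with h2 | h2 <;>
    rcases lt_or_gt_of_ne hbc with h3 | h3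
  · exact ⟨a, b, c, h, h1, h3, ha, hb, hc⟩
  · exact ⟨a, c, b, h.swap₂₃, h2, h3, ha, hc, hb⟩
  · exact absurd (h1.trans h3) h2.not_gt
  · exact ⟨c, a, b, h.swap₂₃.swap₁₂, h2, h1, hc, ha, hb⟩
  · exact ⟨b, a, c, h.swap₁₂, h1, h2, hb, ha, hc⟩
  · exact absurd (h3.trans h1) h2.not_gt
  · exact ⟨b, c, a, h.swap₁₂.swap₂₃, h3, h2, hb, hc, ha⟩
  · exact ⟨c, b, a, h.swap₁₂.swap₂₃.swap₁₂, h3, h1, hc, hb, ha⟩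

/-- Coordinates `f`, `g`, `z` of space together with the direction `e` of the `g`-axis. -/
structure PlaneCoord (f g z : Euc 3 →ᵃ[ℝ] ℝ) (e : Euc 3) : Prop where
  inj : ∀ p p', f p = f p' → g p = g p' → z p = z p' → p = p'
  f_dir : f.linear e = 0
  g_dir : g.linear e = 1
  z_dir : z.linear e = 0

lemma exists_planeCoord {f g z : Euc 3 →ᵃ[ℝ] ℝ}
    (hinj : ∀ p p', f p = f p' → g p = g p' → z p = z p' → p = p') :
    ∃ e, PlaneCoord f g z e := by
  let L : Euc 3 →ₗ[ℝ] (Fin 3 → ℝ) := LinearMap.pi ![f.linear, g.linear, z.linear]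
  have hL : Function.Injective L := by
    rw [← LinearMap.ker_eq_bot, LinearMap.ker_eq_bot']
    intro w hw
    have h0 := congrFun hw 0
    have h1 := congrFun hw 1
    have h2 := congrFun hw 2
    simp only [L, LinearMap.pi_apply, Matrix.cons_val, Pi.zero_apply] at h0 h1 h2
    refine hinj w 0 ?_ ?_ ?_
    · rw [affine_eq_linear_add f w, h0, zero_add]
    · rw [affine_eq_linear_add g w, h1, zero_add]
    · rw [affine_eq_linear_add z w, h2, zero_add]
  have hS : Function.Surjective L :=
    (LinearMap.injective_iff_surjective_of_finrank_eq_finrank (by simp)).1 hL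
  obtain ⟨e, he⟩ := hS ![0, 1, 0]
  have h0 := congrFun he 0
  have h1 := congrFun he 1
  have h2 := congrFun he 2
  simp only [L, LinearMap.pi_apply, Matrix.cons_val] at h0 h1 h2
  exact ⟨e, hinj, h0, h1, h2⟩

/-- At its vertex with the middle value of `f`, a triangle contains the points directly above or
directly below the vertex. -/
lemma PlaneCoord.eventually_mem_oTri {f g z : Euc 3 →ᵃ[ℝ] ℝ} {e : Euc 3}
    (h : PlaneCoord f g z e) {a b c : Euc 3} (hn : NonCol a b c) (ha : z a = z b) (hc : z c = z b)
    (hab : f a < f b) (hbc : f b < f c) :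
    ∃ s : ℝ, (s = 1 ∨ s = -1) ∧ ∀ᶠ t in 𝓝[>] (0 : ℝ), b + t • (s • e) ∈ OTri a b c := by
  have hd : 0 < f c - f a := by linarith
  set θ := (f b - f a) / (f c - f a) with hθ
  have hθ0 : 0 < θ := div_pos (by linarith) hd
  have hθ1 : θ < 1 := (div_lt_one hd).2 (by linarith)
  have hθd : θ * (f c - f a) = f b - f a := by rw [hθ]; field_simp
  set w := (1 - θ) • a + θ • c with hw
  have hfw : f w = f b := by rw [hw, affine_comb₂ _ _ _ (by ring)]; linarith
  have hzw : z w = z b := by rw [hw, affine_comb₂ _ _ _ (by ring), ha, hc]; ring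
  set δ := g w - g b with hδ
  have hwb : w = b + δ • e := by
    refine h.inj _ _ ?_ ?_ ?_
    · rw [affine_add_smul f b, h.f_dir, hfw]; ring
    · rw [affine_add_smul g b, h.g_dir]; ring
    · rw [affine_add_smul z b, h.z_dir, hzw]; ring
  have hδ0 : δ ≠ 0 := by
    intro h0
    rw [h0, zero_smul, add_zero] at hwb
    have := (hn (1 - θ) (-1) θ (by ring) (by
      have : (1 - θ) • a + (-1 : ℝ) • b + θ • c = w - b := by rw [hw]; module
      rw [this, hwb, sub_self])).2.1
    norm_num at this
  have main : ∀ s : ℝ, 0 < s * δ → s * s = 1 →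
      ∀ᶠ t in 𝓝[>] (0 : ℝ), b + t • (s • e) ∈ OTri a b c := by
    intro s hs hss
    filter_upwards [Ioo_mem_nhdsGT hs] with t ht
    have ht' : t / (s * δ) < 1 := (div_lt_one hs).2 ht.2
    have ht0 : 0 < t / (s * δ) := div_pos ht.1 hs
    refine ⟨t / (s * δ) * (1 - θ), 1 - t / (s * δ), t / (s * δ) * θ, mul_pos ht0 (by linarith),
      by linarith, mul_pos ht0 hθ0, by ring, ?_⟩
    have e1 : (t / (s * δ) * (1 - θ)) • a + (1 - t / (s * δ)) • b + (t / (s * δ) * θ) • c =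
        b + (t / (s * δ)) • (w - b) := by rw [hw]; module
    rw [e1, hwb, add_sub_cancel_left, smul_smul, smul_smul]
    congr 2
    have : s ≠ 0 := by rintro rfl; simp at hs
    field_simp
    linear_combination (-t) * hss
  rcases lt_or_gt_of_ne hδ0 with h1 | h1
  · exact ⟨-1, Or.inr rfl, main (-1) (by linarith) (by norm_num)⟩
  · exact ⟨1, Or.inl rfl, main 1 (by linarith) (by norm_num)⟩

/-- Charge each triangle to its vertex with the middle value of `f`. Disjoint triangles charged to
the same vertex are on different sides of it, in the direction of the `g`-axis, so that a vertex
is charged at most twice, and at most once if it is an extreme point of the whole region. -/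
lemma PlaneCoord.card_le {f g z : Euc 3 →ᵃ[ℝ] ℝ} {e : Euc 3} (h : PlaneCoord f g z e) {ι : Type*}
    (I : Finset ι) (P : ι → Set (Euc 3))
    (hP : ∀ i ∈ I, ∀ j ∈ I, ∀ p, p ∈ P i → p ∈ P j → i = j) {S : Set (Euc 3)}
    (hPS : ∀ i ∈ I, P i ⊆ S) (B₁ B₂ : Finset (Euc 3)) (hB₁ : ∀ w ∈ B₁, w ∈ S.extremePoints ℝ)
    (hcell : ∀ i ∈ I, ∃ a b c, TriIn (P i) a b c ∧ z a = z b ∧ z c = z b ∧ f a < f b ∧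
      f b < f c ∧ (b ∈ B₁ ∨ b ∈ B₂)) : I.card ≤ B₁.card + 2 * B₂.card := by
  classical
  have key : ∀ i : I, ∃ ws : Euc 3 × ℝ, (ws.2 = 1 ∨ ws.2 = -1) ∧ (ws.1 ∈ B₁ ∨ ws.1 ∈ B₂) ∧
      ∀ᶠ t in 𝓝[>] (0 : ℝ), ws.1 + t • (ws.2 • e) ∈ P i := by
    rintro ⟨i, hi⟩
    obtain ⟨a, b, c, htri, ha, hc, hab, hbc, hb⟩ := hcell i hi
    obtain ⟨s, hs, hev⟩ := h.eventually_mem_oTri htri.nonCol ha hc hab hbc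
    exact ⟨(b, s), hs, hb, hev.mono fun t ht => htri.subset ht⟩
  choose ws hs hB hev using key
  let F : I → Euc 3 ⊕ (Euc 3 × ℝ) := fun i =>
    if (ws i).1 ∈ B₁ then Sum.inl (ws i).1 else Sum.inr (ws i)
  have hF : Function.Injective F := by
    intro i j hij
    by_contra hne
    have hsame : (ws i).1 = (ws j).1 → (ws i).2 ≠ (ws j).2 := by
      intro h1 h2
      have hj := hev j
      rw [← h1, ← h2] at hj
      obtain ⟨t, ht1, ht2⟩ := ((hev i).and hj).exists
      exact hne (Subtype.ext (hP i i.2 j j.2 _ ht1 ht2))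
    by_cases h1 : (ws i).1 ∈ B₁ <;> by_cases h2 : (ws j).1 ∈ B₁
    · simp only [F, h1, h2, if_true, Sum.inl.injEq] at hij
      have h3 := hsame hij
      have hneg : (ws j).2 = -(ws i).2 := by
        rcases hs i with h4 | h4 <;> rcases hs j with h5 | h5 <;> rw [h4, h5] at h3 ⊢ <;>
          first | exact absurd rfl h3 | norm_num
      have hj := hev j
      rw [← hij, hneg] at hj
      obtain ⟨t, ⟨ht1, ht2⟩, ht0⟩ := (((hev i).and hj).and self_mem_nhdsWithin).exists
      have hext := (hB₁ _ h1).2 (hPS i i.2 ht1) (hPS j j.2 ht2)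
        ⟨1 / 2, 1 / 2, by norm_num, by norm_num, by norm_num, by module⟩
      have h6 : t • ((ws i).2 • e) = 0 := by simpa using hext
      have h7 := congrArg g.linear h6
      simp only [map_smul, map_zero, h.g_dir, smul_eq_mul, mul_one] at h7
      rcases mul_eq_zero.1 h7 with h8 | h8
      · exact (ne_of_gt ht0) h8
      · rcases hs i with h9 | h9 <;> rw [h9] at h8 <;> norm_num at h8
    · simp [F, h1, h2] at hij
    · simp [F, h1, h2] at hij
    · simp only [F, h1, h2, if_false, Sum.inr.injEq] at hij
      exact hsame (by rw [hij]) (by rw [hij])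
  have hmaps : ∀ i ∈ I.attach, F i ∈ B₁.disjSum (B₂ ×ˢ ({1, -1} : Finset ℝ)) := by
    intro i _
    by_cases h1 : (ws i).1 ∈ B₁
    · simp only [F, h1, if_true, Finset.inl_mem_disjSum]
    · simp only [F, h1, if_false, Finset.inr_mem_disjSum, Finset.mem_product, Finset.mem_insert,
        Finset.mem_singleton]
      exact ⟨(hB i).resolve_left h1, hs i⟩
  have := Finset.card_le_card_of_injOn F hmaps hF.injOn
  rw [Finset.card_attach, Finset.card_disjSum, Finset.card_product,
    Finset.card_pair (by norm_num)] at this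
  omega

/-- A small generic perturbation separates finitely many points. -/
lemma eventually_injOn (f g : Euc 3 → ℝ) (B : Finset (Euc 3))
    (h : ∀ w ∈ B, ∀ w' ∈ B, f w = f w' → g w = g w' → w = w') :
    ∀ᶠ t in 𝓝[>] (0 : ℝ), ∀ w ∈ B, ∀ w' ∈ B, f w + t * g w = f w' + t * g w' → w = w' := by
  refine (Finset.eventually_all B).2 fun w hw => (Finset.eventually_all B).2 fun w' hw' => ?_
  by_cases hf : f w = f w'
  · filter_upwards [self_mem_nhdsWithin] with t ht he
    refine h w hw w' hw' hf ?_
    have : t * g w = t * g w' := by linarith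
    exact mul_left_cancel₀ (ne_of_gt ht) this
  · have hc : ContinuousAt (fun t : ℝ => f w + t * g w - (f w' + t * g w')) 0 := by fun_prop
    have := hc.eventually_ne (y := 0) (by simpa [sub_eq_zero] using hf)
    filter_upwards [this.filter_mono nhdsWithin_le_nhds] with t ht he
    exact absurd (sub_eq_zero.2 he) ht

/-- Omitting the smallest and the largest value. -/
lemma card_nonextreme_le {ι : Type*} (s : Finset ι) (f : ι → ℝ) (hf : Set.InjOn f s)
    (hs : 2 ≤ s.card) (s' : Finset ι) (hsub : s' ⊆ s)
    (h : ∀ k ∈ s', (∃ l ∈ s, f l < f k) ∧ ∃ l ∈ s, f k < f l) : s'.card + 2 ≤ s.card := by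
  classical
  have hne : s.Nonempty := Finset.card_pos.1 (by omega)
  obtain ⟨a, ha, hamin⟩ := s.exists_min_image f hne
  obtain ⟨b, hb, hbmax⟩ := s.exists_max_image f hne
  have hab : a ≠ b := by
    rintro rfl
    have : s ⊆ {a} := fun k hk => by
      rw [Finset.mem_singleton]
      exact hf hk ha (le_antisymm (hbmax k hk) (hamin k hk))
    have := Finset.card_le_card this
    simp at this; omega
  have hsub' : s' ⊆ s \ {a, b} := by
    intro k hk
    rw [Finset.mem_sdiff, Finset.mem_insert, Finset.mem_singleton]
    refine ⟨hsub hk, ?_⟩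
    rintro (rfl | rfl)
    · obtain ⟨l, hl, hlt⟩ := (h k hk).1
      exact absurd hlt (hamin l hl).not_gt
    · obtain ⟨l, hl, hlt⟩ := (h k hk).2
      exact absurd hlt (hbmax l hl).not_gt
  have h1 := Finset.card_le_card hsub'
  rw [Finset.card_sdiff_of_subset (by
    intro k hk
    rcases Finset.mem_insert.1 hk with rfl | hk
    · exact ha
    · rw [Finset.mem_singleton.1 hk]; exact hb), Finset.card_pair hab] at h1
  omega

/-! ### Cells of tetrahedra in the plane of the polygon -/

lemma affine_comb₄ {d : ℕ} (f : Euc d →ᵃ[ℝ] ℝ) {x y z t : ℝ} (a b c e : Euc d)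
    (h : x + y + z + t = 1) :
    f (x • a + y • b + z • c + t • e) = x * f a + y * f b + z * f c + t * f e := by
  rw [affine_eq_linear_add f, affine_eq_linear_add f a, affine_eq_linear_add f b,
    affine_eq_linear_add f c, affine_eq_linear_add f e]
  simp only [map_add, map_smul, smul_eq_mul]
  linear_combination (-(f 0)) * h

/-- `σ` consists of the points `a`, `b`, `c`, `d`. -/
def HasVerts (σ : Finset (Euc 3)) (a b c d : Euc 3) : Prop :=
  ∀ w, w ∈ σ ↔ w = a ∨ w = b ∨ w = c ∨ w = d

namespace HasVerts

variable {A : Set (Euc 3)} {σ : Finset (Euc 3)} {a b c d : Euc 3}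

lemma rotate (h : HasVerts σ a b c d) : HasVerts σ b c d a := fun w => by
  rw [h w]; tauto

lemma ne_first (h : HasVerts σ a b c d) (hσ : IsFullSimplexIn A σ) : b ≠ a ∧ c ≠ a ∧ d ≠ a := by
  classical
  have hcard := hσ.card
  have key : ∀ x y z : Euc 3, σ ⊆ {x, y, z} → False := fun x y z hs => by
    have := (Finset.card_le_card hs).trans Finset.card_le_three
    omega
  refine ⟨?_, ?_, ?_⟩ <;> rintro rfl
  · exact key b c d fun w hw => by have := (h w).1 hw; simp; tauto
  · exact key c b d fun w hw => by have := (h w).1 hw; simp; tauto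
  · exact key d b c fun w hw => by have := (h w).1 hw; simp; tauto

lemma mem_first (h : HasVerts σ a b c d) : a ∈ σ := (h a).2 (Or.inl rfl)

lemma bary_first (h : HasVerts σ a b c d) (hσ : IsFullSimplexIn A σ) {lam} (hl : IsBary σ lam) :
    lam a a = 1 ∧ lam a b = 0 ∧ lam a c = 0 ∧ lam a d = 0 := by
  obtain ⟨h1, h2, h3⟩ := h.ne_first hσ
  exact ⟨hl.self a h.mem_first, hl.other a h.mem_first b h.rotate.mem_first h1,
    hl.other a h.mem_first c h.rotate.rotate.mem_first h2,
    hl.other a h.mem_first d h.rotate.rotate.rotate.mem_first h3⟩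

lemma first_eq_zero (h : HasVerts σ a b c d) (hσ : IsFullSimplexIn A σ) {x y z t : ℝ}
    (h0 : x + y + z + t = 0) (h1 : x • a + y • b + z • c + t • d = 0) : x = 0 := by
  obtain ⟨lam, hl⟩ := hσ.exists_bary
  obtain ⟨e1, e2, e3, e4⟩ := h.bary_first hσ hl
  have := affine_comb₄_zero (lam a) h0 h1
  rw [e1, e2, e3, e4] at this
  linarith

lemma indep (h : HasVerts σ a b c d) (hσ : IsFullSimplexIn A σ) {x y z t : ℝ}
    (h0 : x + y + z + t = 0) (h1 : x • a + y • b + z • c + t • d = 0) :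
    x = 0 ∧ y = 0 ∧ z = 0 ∧ t = 0 :=
  ⟨h.first_eq_zero hσ h0 h1,
    h.rotate.first_eq_zero hσ (x := y) (y := z) (z := t) (t := x) (by linarith)
      (by rw [← h1]; module),
    h.rotate.rotate.first_eq_zero hσ (x := z) (y := t) (z := x) (t := y) (by linarith)
      (by rw [← h1]; module),
    h.rotate.rotate.rotate.first_eq_zero hσ (x := t) (y := x) (z := y) (t := z) (by linarith)
      (by rw [← h1]; module)⟩

lemma bary_comb (h : HasVerts σ a b c d) (hσ : IsFullSimplexIn A σ) {lam} (hl : IsBary σ lam)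
    {x y z t : ℝ} (h0 : x + y + z + t = 1) :
    lam a (x • a + y • b + z • c + t • d) = x := by
  obtain ⟨e1, e2, e3, e4⟩ := h.bary_first hσ hl
  rw [affine_comb₄ _ _ _ _ _ h0, e1, e2, e3, e4]; ring

lemma bary_comb' (h : HasVerts σ a b c d) (hσ : IsFullSimplexIn A σ) {lam} (hl : IsBary σ lam)
    {x y z t : ℝ} (h0 : x + y + z + t = 1) :
    lam a (x • a + y • b + z • c + t • d) = x ∧ lam b (x • a + y • b + z • c + t • d) = y ∧
    lam c (x • a + y • b + z • c + t • d) = z ∧ lam d (x • a + y • b + z • c + t • d) = t := by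
  exact ⟨h.bary_comb hσ hl h0,
    (congrArg (lam b) (by module)).trans (h.rotate.bary_comb hσ hl (x := y) (y := z) (z := t)
      (t := x) (by linarith)),
    (congrArg (lam c) (by module)).trans (h.rotate.rotate.bary_comb hσ hl (x := z) (y := t)
      (z := x) (t := y) (by linarith)),
    (congrArg (lam d) (by module)).trans (h.rotate.rotate.rotate.bary_comb hσ hl (x := t)
      (y := x) (z := y) (t := z) (by linarith))⟩

lemma mem_interior (h : HasVerts σ a b c d) (hσ : IsFullSimplexIn A σ) {x y z t : ℝ}
    (hx : 0 < x) (hy : 0 < y) (hz : 0 < z) (ht : 0 < t) (h0 : x + y + z + t = 1) :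
    x • a + y • b + z • c + t • d ∈ interior (convexHull ℝ (σ : Set (Euc 3))) := by
  obtain ⟨lam, hl⟩ := hσ.exists_bary
  obtain ⟨e1, e2, e3, e4⟩ := h.bary_comb' hσ hl h0
  refine (hl.int _).2 fun w hw => ?_
  rcases (h w).1 hw with rfl | rfl | rfl | rfl
  · rwa [e1]
  · rwa [e2]
  · rwa [e3]
  · rwa [e4]

end HasVerts

/-- The points from which one enters the interior of the simplex in the direction `e`. -/
def upSet (e : Euc 3) (σ : Finset (Euc 3)) : Set (Euc 3) :=
  {p | ∀ᶠ t in 𝓝[>] (0 : ℝ), p + t • e ∈ interior (convexHull ℝ (σ : Set (Euc 3)))}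

lemma mem_upSet {e p : Euc 3} {σ : Finset (Euc 3)} : p ∈ upSet e σ ↔
    ∀ᶠ t in 𝓝[>] (0 : ℝ), p + t • e ∈ interior (convexHull ℝ (σ : Set (Euc 3))) := Iff.rfl

lemma interior_subset_upSet (e : Euc 3) (σ : Finset (Euc 3)) :
    interior (convexHull ℝ (σ : Set (Euc 3))) ⊆ upSet e σ := by
  intro p hp
  have hc : ContinuousAt (fun t : ℝ => p + t • e) 0 := by fun_prop
  have := hc.eventually_mem (isOpen_interior.mem_nhds (by simpa using hp))
  exact this.filter_mono nhdsWithin_le_nhds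

lemma upSet_subset (e : Euc 3) {A : Finset (Euc 3)} {σ : Finset (Euc 3)}
    (hσ : (σ : Set (Euc 3)) ⊆ A) : upSet e σ ⊆ convexHull ℝ (A : Set (Euc 3)) := by
  intro p hp
  have hcl : IsClosed (convexHull ℝ (A : Set (Euc 3))) :=
    (A.finite_toSet.isCompact_convexHull (𝕜 := ℝ)).isClosed
  have hc : Tendsto (fun t : ℝ => p + t • e) (𝓝[>] 0) (𝓝 p) := by
    have : ContinuousAt (fun t : ℝ => p + t • e) 0 := by fun_prop
    have h2 := this.tendsto
    simp only [zero_smul, add_zero] at h2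
    exact h2.mono_left nhdsWithin_le_nhds
  exact hcl.mem_of_tendsto hc ((mem_upSet.1 hp).mono fun t ht => convexHull_mono hσ (interior_subset ht))

/-- Two simplices of a dissection cannot be entered from the same point in the same direction. -/
lemma IsDissection.eq_of_mem_upSet {A : Set (Euc 3)} {T : Finset (Finset (Euc 3))}
    (hT : IsDissection A T) {σ τ : Finset (Euc 3)} (hσ : σ ∈ T) (hτ : τ ∈ T) {e p : Euc 3}
    (h1 : p ∈ upSet e σ) (h2 : p ∈ upSet e τ) : σ = τ := by
  by_contra hne
  obtain ⟨t, h3, h4⟩ := ((mem_upSet.1 h1).and (mem_upSet.1 h2)).exists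
  exact Set.disjoint_left.1 (hT.interior_disjoint σ hσ τ hτ hne) h3 h4

namespace HasVerts

variable {A : Set (Euc 3)} {σ : Finset (Euc 3)} {a b c d : Euc 3} {κ : ℝ}

/-- The face of a tetrahedron in the plane `z = 0` is visible from the side of the tetrahedron. -/
lemma triIn_face (h : HasVerts σ a b c d) (hσ : IsFullSimplexIn A σ) {z : Euc 3 →ᵃ[ℝ] ℝ}
    {e : Euc 3} (ha : z a = 0) (hb : z b = 0) (hc : z c = 0) (hd : 0 < z.linear e / z d) :
    TriIn (upSet e σ) a b c := by
  refine ⟨fun x y t h0 h1 => ?_, ?_⟩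
  · obtain ⟨h2, h3, h4, _⟩ := h.indep hσ (x := x) (y := y) (z := t) (t := 0) (by linarith)
      (by rw [← h1]; module)
    exact ⟨h2, h3, h4⟩
  · rintro p ⟨x, y, t, hx, hy, ht, h0, rfl⟩
    obtain ⟨lam, hl⟩ := hσ.exists_bary
    have hp : x • a + y • b + t • c = x • a + y • b + t • c + (0 : ℝ) • d := by module
    obtain ⟨e1, e2, e3, e4⟩ := h.bary_comb' hσ hl (x := x) (y := y) (z := t) (t := 0)
      (by linarith)
    rw [← hp] at e1 e2 e3 e4
    have hzd : z d ≠ 0 := fun h0 => by rw [h0, div_zero] at hd; exact lt_irrefl _ hd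
    have hlam : ∀ p, lam d p = z p / z d := by
      intro p
      rw [eq_div_iff hzd, hl.affine_eq z p, Finset.sum_eq_single_of_mem d
        h.rotate.rotate.rotate.mem_first]
      intro w hw hne
      rcases (h w).1 hw with rfl | rfl | rfl | rfl
      · rw [ha, mul_zero]
      · rw [hb, mul_zero]
      · rw [hc, mul_zero]
      · exact absurd rfl hne
    refine hl.eventually_mem_interior fun w hw => ?_
    rcases (h w).1 hw with rfl | rfl | rfl | rfl
    · left; rwa [e1]
    · left; rwa [e2]
    · left; rwa [e3]
    · right
      refine ⟨e4, ?_⟩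
      have h1 := affine_linear_sub (lam w) (x • a + y • b + t • c + e) (x • a + y • b + t • c)
      rw [add_sub_cancel_left, hlam, hlam] at h1
      have h2 := affine_linear_sub z (x • a + y • b + t • c + e) (x • a + y • b + t • c)
      rw [add_sub_cancel_left] at h2
      rw [h1, ← sub_div, ← h2]
      exact hd

/-- The plane through two vertices `a`, `b` and a point of the opposite edge cuts a tetrahedron in a
triangle. -/
lemma triIn_qq (h : HasVerts σ a b c d) (hσ : IsFullSimplexIn A σ) (hκ0 : 0 < κ) (hκ1 : κ < 1) :
    TriIn (interior (convexHull ℝ (σ : Set (Euc 3)))) a b ((1 - κ) • c + κ • d) := by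
  refine ⟨fun x y t h0 h1 => ?_, ?_⟩
  · obtain ⟨h2, h3, h4, h5⟩ := h.indep hσ (x := x) (y := y) (z := t * (1 - κ)) (t := t * κ)
      (by linarith) (by rw [← h1]; module)
    exact ⟨h2, h3, (mul_eq_zero.1 h5).resolve_right hκ0.ne'⟩
  · rintro p ⟨x, y, t, hx, hy, ht, h0, rfl⟩
    have := h.mem_interior hσ hx hy (mul_pos ht (sub_pos.2 hκ1)) (mul_pos ht hκ0) (by linarith)
    convert this using 1; module

/-- A plane through a vertex `a` that cuts the edges from `d` to `b` and `c` meets the tetrahedron in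
a triangle. -/
lemma triIn_q (h : HasVerts σ a b c d) (hσ : IsFullSimplexIn A σ) (hκ0 : 0 < κ) (hκ1 : κ < 1) :
    TriIn (interior (convexHull ℝ (σ : Set (Euc 3)))) a ((1 - κ) • b + κ • d)
      ((1 - κ) • c + κ • d) := by
  refine ⟨fun x y t h0 h1 => ?_, ?_⟩
  · obtain ⟨h2, h3, h4, h5⟩ := h.indep hσ (x := x) (y := y * (1 - κ)) (z := t * (1 - κ))
      (t := (y + t) * κ) (by linarith) (by rw [← h1]; module)
    exact ⟨h2, (mul_eq_zero.1 h3).resolve_right (sub_pos.2 hκ1).ne',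
      (mul_eq_zero.1 h4).resolve_right (sub_pos.2 hκ1).ne'⟩
  · rintro p ⟨x, y, t, hx, hy, ht, h0, rfl⟩
    have := h.mem_interior hσ hx (mul_pos hy (sub_pos.2 hκ1)) (mul_pos ht (sub_pos.2 hκ1))
      (mul_pos (add_pos hy ht) hκ0) (by linarith)
    convert this using 1; module

/-- A plane that separates the edge `a b` from the edge `c d` meets the tetrahedron in a quadrangle;
this is one of its halves. -/
lemma triIn_cross (h : HasVerts σ a b c d) (hσ : IsFullSimplexIn A σ) (hκ0 : 0 < κ)
    (hκ1 : κ < 1) : TriIn (interior (convexHull ℝ (σ : Set (Euc 3)))) ((1 - κ) • a + κ • c)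
      ((1 - κ) • a + κ • d) ((1 - κ) • b + κ • c) := by
  refine ⟨fun x y t h0 h1 => ?_, ?_⟩
  · obtain ⟨h2, h3, h4, h5⟩ := h.indep hσ (x := (x + y) * (1 - κ)) (y := t * (1 - κ))
      (z := (x + t) * κ) (t := y * κ) (by linarith) (by rw [← h1]; module)
    have hy := (mul_eq_zero.1 h5).resolve_right hκ0.ne'
    have ht := (mul_eq_zero.1 h3).resolve_right (sub_pos.2 hκ1).ne'
    exact ⟨by linarith, hy, ht⟩
  · rintro p ⟨x, y, t, hx, hy, ht, h0, rfl⟩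
    have := h.mem_interior hσ (mul_pos (add_pos hx hy) (sub_pos.2 hκ1))
      (mul_pos ht (sub_pos.2 hκ1)) (mul_pos (add_pos hx ht) hκ0) (mul_pos hy hκ0) (by linarith)
    convert this using 1; module

end HasVerts

section

variable {ι : Type*} {y : ι → Euc 3} {s : Finset (Euc 3)}

lemma exists_of_card_eq_one (hs : ∀ w ∈ s, ∃ i, y i = w) (h : s.card = 1) :
    ∃ a, ∀ w, w ∈ s ↔ w = y a := by
  obtain ⟨x, he⟩ := Finset.card_eq_one.1 h
  obtain ⟨a, rfl⟩ := hs x (by simp [he])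
  exact ⟨a, fun w => by simp [he]⟩

lemma exists_of_card_eq_two (hs : ∀ w ∈ s, ∃ i, y i = w) (h : s.card = 2) :
    ∃ a b, ∀ w, w ∈ s ↔ w = y a ∨ w = y b := by
  classical
  obtain ⟨x, z, _, he⟩ := Finset.card_eq_two.1 h
  obtain ⟨a, rfl⟩ := hs x (by simp [he])
  obtain ⟨b, rfl⟩ := hs z (by simp [he])
  exact ⟨a, b, fun w => by simp [he]⟩

lemma exists_of_card_eq_three (hs : ∀ w ∈ s, ∃ i, y i = w) (h : s.card = 3) :
    ∃ a b c, ∀ w, w ∈ s ↔ w = y a ∨ w = y b ∨ w = y c := by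
  classical
  obtain ⟨x, z, t, _, _, _, he⟩ := Finset.card_eq_three.1 h
  obtain ⟨a, rfl⟩ := hs x (by simp [he])
  obtain ⟨b, rfl⟩ := hs z (by simp [he])
  obtain ⟨c, rfl⟩ := hs t (by simp [he])
  exact ⟨a, b, c, fun w => by simp [he]⟩

lemma subset_pair {y : Fin 2 → Euc 3} (hs : ∀ w ∈ s, ∃ i, y i = w) :
    (s.card = 0 ∧ ∀ w, w ∈ s ↔ False) ∨ (s.card = 1 ∧ ∃ i, ∀ w, w ∈ s ↔ w = y i) ∨
      (s.card = 2 ∧ ∀ w, w ∈ s ↔ w = y 0 ∨ w = y 1) := by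
  classical
  have hsub : s ⊆ {y 0, y 1} := by
    intro w hw
    obtain ⟨i, rfl⟩ := hs w hw
    fin_cases i <;> simp
  have h2 := (Finset.card_le_card hsub).trans Finset.card_le_two
  rcases Nat.lt_or_ge s.card 1 with h3 | h3
  · have : s = ∅ := Finset.card_eq_zero.1 (by omega)
    exact Or.inl ⟨by omega, by simp [this]⟩
  rcases Nat.lt_or_ge s.card 2 with h4 | h4
  · exact Or.inr (Or.inl ⟨by omega, exists_of_card_eq_one hs (by omega)⟩)
  · have : s = {y 0, y 1} :=
      Finset.eq_of_subset_of_card_le hsub (Finset.card_le_two.trans (by omega))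
    exact Or.inr (Or.inr ⟨by omega, fun w => by rw [this]; simp⟩)

end

namespace Frame

variable {m : ℕ} {q : Fin m → Euc 3} {v u : Fin 2 → Euc 3} {X Y Z : Euc 3 →ᵃ[ℝ] ℝ}
  {r φ κ : ℝ} {σ : Finset (Euc 3)}

/-- The possible vertex sets of a tetrahedron. -/
lemma classify (h : Frame m q v u X Y Z r φ κ)
    (hσ : IsFullSimplexIn (vertexFinset q v u : Set (Euc 3)) σ) :
    (∃ a b c i, HasVerts σ (q a) (q b) (q c) (v i)) ∨
    (∃ a b c j, HasVerts σ (q a) (q b) (q c) (u j)) ∨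
    (∃ a b, HasVerts σ (q a) (q b) (v 0) (v 1)) ∨
    (∃ a b, HasVerts σ (q a) (q b) (u 0) (u 1)) ∨
    (∃ a b i j, HasVerts σ (q a) (q b) (v i) (u j)) ∨
    (∃ a j, HasVerts σ (q a) (v 0) (v 1) (u j)) ∨
    (∃ a i, HasVerts σ (q a) (u 0) (u 1) (v i)) ∨
    HasVerts σ (v 0) (v 1) (u 0) (u 1) := by
  classical
  obtain ⟨σq, hσq⟩ : ∃ s, s = σ.filter (fun w => ∃ k, q k = w) := ⟨_, rfl⟩
  obtain ⟨σv, hσv⟩ : ∃ s, s = σ.filter (fun w => ∃ i, v i = w) := ⟨_, rfl⟩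
  obtain ⟨σu, hσu⟩ : ∃ s, s = σ.filter (fun w => ∃ j, u j = w) := ⟨_, rfl⟩
  have hqs : ∀ w ∈ σq, ∃ k, q k = w := fun w hw => by
    rw [hσq] at hw; exact (Finset.mem_filter.1 hw).2
  have hvs : ∀ w ∈ σv, ∃ k, v k = w := fun w hw => by
    rw [hσv] at hw; exact (Finset.mem_filter.1 hw).2
  have hus : ∀ w ∈ σu, ∃ k, u k = w := fun w hw => by
    rw [hσu] at hw; exact (Finset.mem_filter.1 hw).2
  have hmem : ∀ w, w ∈ σ ↔ w ∈ σq ∨ w ∈ σv ∨ w ∈ σu := by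
    intro w
    simp only [hσq, hσv, hσu, Finset.mem_filter]
    refine ⟨fun hw => ?_, by tauto⟩
    have := mem_vertexFinset.1 (hσ.subset hw)
    tauto
  have hqσ : σq ⊆ σ := fun w hw => (hmem w).2 (Or.inl hw)
  clear hσq hσv hσu
  have hun : σ = σq ∪ (σv ∪ σu) := by
    ext w; rw [hmem]; simp only [Finset.mem_union]
  have hcard : σq.card + (σv.card + σu.card) = 4 := by
    rw [← Finset.card_union_of_disjoint, ← Finset.card_union_of_disjoint, ← hun, hσ.card]
    · rw [Finset.disjoint_left]
      intro w hw hw'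
      obtain ⟨k, rfl⟩ := hqs w hw
      rcases Finset.mem_union.1 hw' with h1 | h1
      · obtain ⟨i, hi⟩ := hvs _ h1
        exact h.q_ne_v _ _ hi.symm
      · obtain ⟨i, hi⟩ := hus _ h1
        exact h.q_ne_u _ _ hi.symm
    · rw [Finset.disjoint_left]
      intro w hw hw'
      obtain ⟨i, rfl⟩ := hvs w hw
      obtain ⟨j, hj⟩ := hus _ hw'
      exact h.v_ne_u _ _ hj.symm
  have q3 := exists_of_card_eq_three hqs
  have q2 := exists_of_card_eq_two hqs
  have q1 := exists_of_card_eq_one hqs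
  have q4 : σq.card ≠ 4 := by
    intro h4
    have he : σq = σ := Finset.eq_of_subset_of_card_le hqσ (by rw [h4, hσ.card])
    obtain ⟨lam, hl⟩ := hσ.exists_bary
    have := hl.affine_eq Z (v 0)
    rw [Finset.sum_eq_zero fun w hw => by
      rw [← he] at hw
      obtain ⟨k, rfl⟩ := hqs w hw
      rw [h.qZ, mul_zero]] at this
    exact h.vZ_pos.ne' this
  have close : ∀ {a b c d : Euc 3} {Pq Pv Pu : Euc 3 → Prop}, (∀ w, w ∈ σq ↔ Pq w) →
      (∀ w, w ∈ σv ↔ Pv w) → (∀ w, w ∈ σu ↔ Pu w) →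
      (∀ w, (Pq w ∨ Pv w ∨ Pu w) ↔ (w = a ∨ w = b ∨ w = c ∨ w = d)) → HasVerts σ a b c d :=
    fun h1 h2 h3 h4 w => by rw [hmem, h1, h2, h3, h4]
  rcases subset_pair hvs with ⟨hv, hv'⟩ | ⟨hv2, i, hv⟩ | ⟨hv2, hv⟩ <;>
    rcases subset_pair hus with ⟨hu, hu'⟩ | ⟨hu2, j, hu⟩ | ⟨hu2, hu⟩
  · exact absurd (by omega) q4
  · obtain ⟨a, b, c, hq⟩ := q3 (by omega)
    exact Or.inr (Or.inl ⟨a, b, c, j, close hq hv' hu fun w => by clear * -; tauto⟩)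
  · obtain ⟨a, b, hq⟩ := q2 (by omega)
    exact Or.inr (Or.inr (Or.inr (Or.inl ⟨a, b, close hq hv' hu fun w => by clear * -; tauto⟩)))
  · obtain ⟨a, b, c, hq⟩ := q3 (by omega)
    exact Or.inl ⟨a, b, c, i, close hq hv hu' fun w => by clear * -; tauto⟩
  · obtain ⟨a, b, hq⟩ := q2 (by omega)
    exact Or.inr (Or.inr (Or.inr (Or.inr (Or.inl ⟨a, b, i, j, close hq hv hu fun w => by
      clear * -; tauto⟩))))
  · obtain ⟨a, hq⟩ := q1 (by omega)
    exact Or.inr (Or.inr (Or.inr (Or.inr (Or.inr (Or.inr (Or.inl ⟨a, i, close hq hv hu fun w => by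
      clear * -; tauto⟩))))))
  · obtain ⟨a, b, hq⟩ := q2 (by omega)
    exact Or.inr (Or.inr (Or.inl ⟨a, b, close hq hv hu' fun w => by clear * -; tauto⟩))
  · obtain ⟨a, hq⟩ := q1 (by omega)
    exact Or.inr (Or.inr (Or.inr (Or.inr (Or.inr (Or.inl ⟨a, j, close hq hv hu fun w => by
      clear * -; tauto⟩)))))
  · have h0 : σq = ∅ := Finset.card_eq_zero.1 (by omega)
    exact Or.inr (Or.inr (Or.inr (Or.inr (Or.inr (Or.inr (Or.inr
      (close (Pq := fun _ => False) (by simp [h0]) hv hu fun w => by clear * -; tauto)))))))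

end Frame

/-! ### Counting tetrahedra by their cells -/

section Families

open Classical

/-- The tetrahedra with a vertex on both edges. -/
noncomputable def midTets (T : Finset (Finset (Euc 3))) (v u : Fin 2 → Euc 3) :
    Finset (Finset (Euc 3)) :=
  T.filter fun σ => (∃ i, v i ∈ σ) ∧ ∃ j, u j ∈ σ

/-- The tetrahedra spanned by a triangle in the polygon and one of the points `v 0`, `v 1`. -/
noncomputable def faceTets (T : Finset (Finset (Euc 3))) (v u : Fin 2 → Euc 3) :
    Finset (Finset (Euc 3)) :=
  T.filter fun σ => (∃ i, v i ∈ σ) ∧ (¬ ∃ j, u j ∈ σ) ∧ ¬ (v 0 ∈ σ ∧ v 1 ∈ σ)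

/-- The tetrahedra spanned by the edge `v 0, v 1` and two vertices of the polygon. -/
noncomputable def edgeTets (T : Finset (Finset (Euc 3))) (v u : Fin 2 → Euc 3) :
    Finset (Finset (Euc 3)) :=
  T.filter fun σ => (v 0 ∈ σ ∧ v 1 ∈ σ) ∧ ¬ ∃ j, u j ∈ σ

/-- The index pairs of the points `v i`, `u j` that are joined by an edge. -/
noncomputable def usedPairs (T : Finset (Finset (Euc 3))) (v u : Fin 2 → Euc 3) :
    Finset (Fin 2 × Fin 2) :=
  Finset.univ.filter fun ij => ∃ σ ∈ T, v ij.1 ∈ σ ∧ u ij.2 ∈ σ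

variable {T : Finset (Finset (Euc 3))} {v u : Fin 2 → Euc 3} {σ : Finset (Euc 3)}

lemma mem_midTets : σ ∈ midTets T v u ↔ σ ∈ T ∧ (∃ i, v i ∈ σ) ∧ ∃ j, u j ∈ σ :=
  Finset.mem_filter

lemma mem_faceTets : σ ∈ faceTets T v u ↔
    σ ∈ T ∧ (∃ i, v i ∈ σ) ∧ (¬ ∃ j, u j ∈ σ) ∧ ¬ (v 0 ∈ σ ∧ v 1 ∈ σ) :=
  Finset.mem_filter

lemma mem_edgeTets : σ ∈ edgeTets T v u ↔ σ ∈ T ∧ (v 0 ∈ σ ∧ v 1 ∈ σ) ∧ ¬ ∃ j, u j ∈ σ :=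
  Finset.mem_filter

lemma mem_usedPairs {i j : Fin 2} : (i, j) ∈ usedPairs T v u ↔ ∃ σ ∈ T, v i ∈ σ ∧ u j ∈ σ := by
  simp [usedPairs]

lemma midTets_swap : midTets T u v = midTets T v u := by
  ext σ; rw [mem_midTets, mem_midTets]; tauto

lemma card_usedPairs_swap : (usedPairs T u v).card = (usedPairs T v u).card := by
  have : usedPairs T u v = (usedPairs T v u).image Prod.swap := by
    ext ⟨i, j⟩
    rw [Finset.mem_image]
    constructor
    · intro h
      obtain ⟨σ, h1, h2, h3⟩ := mem_usedPairs.1 h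
      exact ⟨(j, i), mem_usedPairs.2 ⟨σ, h1, h3, h2⟩, rfl⟩
    · rintro ⟨⟨j', i'⟩, h, he⟩
      obtain ⟨σ, h1, h2, h3⟩ := mem_usedPairs.1 h
      simp only [Prod.swap_prod_mk, Prod.mk.injEq] at he
      obtain ⟨rfl, rfl⟩ := he
      exact mem_usedPairs.2 ⟨σ, h1, h3, h2⟩
  rw [this, Finset.card_image_of_injective _ Prod.swap_injective]

end Families

/-- The affine function `a * X + b * Y + t * (a * Y - b * X)`. -/
noncomputable def tilt (X Y : Euc 3 →ᵃ[ℝ] ℝ) (a b t : ℝ) : Euc 3 →ᵃ[ℝ] ℝ :=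
  (a - t * b) • X + (b + t * a) • Y

lemma tilt_apply (X Y : Euc 3 →ᵃ[ℝ] ℝ) (a b t : ℝ) (w : Euc 3) :
    tilt X Y a b t w = a * X w + b * Y w + t * (a * Y w - b * X w) := by
  simp [tilt]; ring

lemma TriIn.ne {P : Set (Euc 3)} {a b c : Euc 3} (h : TriIn P a b c) : a ≠ b ∧ a ≠ c ∧ b ≠ c := by
  refine ⟨?_, ?_, ?_⟩ <;> rintro rfl
  · have := (h.nonCol 1 (-1) 0 (by norm_num) (by module)).1; norm_num at this
  · have := (h.nonCol 1 0 (-1) (by norm_num) (by module)).1; norm_num at this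
  · have := (h.nonCol 0 1 (-1) (by norm_num) (by module)).2.1; norm_num at this

namespace Frame

variable {m : ℕ} {q : Fin m → Euc 3} {v u : Fin 2 → Euc 3} {X Y Z : Euc 3 →ᵃ[ℝ] ℝ}
  {r φ κ : ℝ} {σ τ : Finset (Euc 3)} {T : Finset (Finset (Euc 3))}

/-- A small rotation of the coordinate `a * X + b * Y` of the plane separates the points of `B`. -/
lemma exists_generic (h : Frame m q v u X Y Z r φ κ) {a b : ℝ} (hab : a ^ 2 + b ^ 2 ≠ 0)
    (B : Finset (Euc 3)) (hB : ∀ w ∈ B, Z w = 0) :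
    ∀ᶠ t in 𝓝[>] (0 : ℝ), (∃ g e, PlaneCoord (tilt X Y a b t) g Z e) ∧
      ∀ w ∈ B, ∀ w' ∈ B, tilt X Y a b t w = tilt X Y a b t w' → w = w' := by
  have key : ∀ w w', a * X w + b * Y w = a * X w' + b * Y w' →
      a * Y w - b * X w = a * Y w' - b * X w' → Z w = Z w' → w = w' := by
    intro w w' h1 h2 h3
    refine h.inj w w' ?_ ?_ h3
    · apply mul_left_cancel₀ hab; linear_combination a * h1 - b * h2
    · apply mul_left_cancel₀ hab; linear_combination b * h1 + a * h2
  have h1 := eventually_injOn (fun w => a * X w + b * Y w) (fun w => a * Y w - b * X w) B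
    (fun w hw w' hw' e1 e2 => key w w' e1 e2 (by rw [hB w hw, hB w' hw']))
  filter_upwards [h1] with t ht
  refine ⟨?_, fun w hw w' hw' he => ht w hw w' hw' (by rwa [tilt_apply, tilt_apply] at he)⟩
  obtain ⟨e, he⟩ := exists_planeCoord (f := tilt X Y a b t) (g := (-(b + t * a)) • X + (a - t * b) • Y)
    (z := Z) (by
      intro w w' e1 e2 e3
      rw [tilt_apply, tilt_apply] at e1
      simp only [AffineMap.coe_add, AffineMap.coe_smul, Pi.add_apply, Pi.smul_apply,
        smul_eq_mul] at e2
      have ht : 1 + t ^ 2 ≠ 0 := by positivity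
      refine key w w' ?_ ?_ e3
      · apply mul_left_cancel₀ ht; linear_combination e1 - t * e2
      · apply mul_left_cancel₀ ht; linear_combination e2 + t * e1)
  exact ⟨_, e, he⟩

lemma hull_Z (h : Frame m q v u X Y Z r φ κ) {w : Euc 3} (hw : w ∈ convexHull ℝ (range q)) :
    Z w = 0 := le_antisymm
  (affine_convexHull_le Z (by rintro _ ⟨k, rfl⟩; exact (h.qZ k).le) hw)
  (affine_le_convexHull Z (by rintro _ ⟨k, rfl⟩; exact (h.qZ k).ge) hw)

/-- The charging argument for cells in the polygon spanned by the vertices with index in `S`. -/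
lemma charge (h : Frame m q v u X Y Z r φ κ) {ι : Type*} {I : Finset ι} {P : ι → Set (Euc 3)}
    (hP : ∀ i ∈ I, ∀ j ∈ I, ∀ p, p ∈ P i → p ∈ P j → i = j)
    (hPS : ∀ i ∈ I, P i ⊆ convexHull ℝ (vertexFinset q v u : Set (Euc 3)))
    {f g : Euc 3 →ᵃ[ℝ] ℝ} {e : Euc 3} (hf : PlaneCoord f g Z e) {S : Finset (Fin m)}
    (hS : 2 ≤ S.card) (hinj : ∀ k ∈ S, ∀ l ∈ S, f (q k) = f (q l) → k = l) (B : Finset (Euc 3))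
    (hcell : ∀ i ∈ I, ∃ a b c, TriIn (P i) a b c ∧ f a < f b ∧ f b < f c ∧
      a ∈ convexHull ℝ (q '' S) ∧ b ∈ convexHull ℝ (q '' S) ∧ c ∈ convexHull ℝ (q '' S) ∧
      ((∃ k ∈ S, b = q k) ∨ b ∈ B)) : I.card + 2 ≤ S.card + 2 * B.card := by
  classical
  set S' := S.filter fun k => (∃ l ∈ S, f (q l) < f (q k)) ∧ ∃ l ∈ S, f (q k) < f (q l) with hS'
  have h1 : S'.card + 2 ≤ S.card := card_nonextreme_le S (fun k => f (q k))
    (fun k hk l hl he => hinj k hk l hl he) hS S' (Finset.filter_subset _ _)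
    (fun k hk => (Finset.mem_filter.1 hk).2)
  have hZ : ∀ {w}, w ∈ convexHull ℝ (q '' S) → Z w = 0 := fun hw =>
    h.hull_Z (convexHull_mono (image_subset_range _ _) hw)
  have h2 := hf.card_le I P hP hPS (S'.image q) B (by
    intro w hw
    obtain ⟨k, _, rfl⟩ := Finset.mem_image.1 hw
    exact h.q_mem_extremePoints k) (by
    intro i hi
    obtain ⟨a, b, c, htri, hab, hbc, ha, hb, hc, hb'⟩ := hcell i hi
    refine ⟨a, b, c, htri, by rw [hZ ha, hZ hb], by rw [hZ hc, hZ hb], hab, hbc, ?_⟩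
    rcases hb' with ⟨k, hk, rfl⟩ | hb'
    · left
      refine Finset.mem_image_of_mem q (Finset.mem_filter.2 ⟨hk, ?_, ?_⟩)
      · by_contra hcon
        push Not at hcon
        have := affine_le_convexHull f (by rintro _ ⟨l, hl, rfl⟩; exact hcon l hl) ha
        linarith
      · by_contra hcon
        push Not at hcon
        have := affine_convexHull_le f (by rintro _ ⟨l, hl, rfl⟩; exact hcon l hl) hc
        linarith
    · exact Or.inr hb')
  have h3 := Finset.card_image_le (s := S') (f := q)
  omega

/-- A vertex of the cell of `σ`: a common vertex with the polygon or the intersection of an edge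
with the plane of the polygon. -/
def CellPt (κ : ℝ) (q : Fin m → Euc 3) (v u : Fin 2 → Euc 3) (σ : Finset (Euc 3)) (w : Euc 3) :
    Prop :=
  (∃ k, q k ∈ σ ∧ w = q k) ∨ ∃ i j, v i ∈ σ ∧ u j ∈ σ ∧ w = crossPt κ v u i j

lemma CellPt.mem_hull (h : Frame m q v u X Y Z r φ κ) {w : Euc 3} (hw : CellPt κ q v u σ w) :
    w ∈ convexHull ℝ (range q) := by
  rcases hw with ⟨k, _, rfl⟩ | ⟨i, j, _, _, rfl⟩
  · exact subset_convexHull ℝ _ (mem_range_self k)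
  · exact h.cross_mem i j

lemma CellPt.mem_convexHull (h : Frame m q v u X Y Z r φ κ) {w : Euc 3}
    (hw : CellPt κ q v u σ w) : w ∈ convexHull ℝ (σ : Set (Euc 3)) := by
  rcases hw with ⟨k, hk, rfl⟩ | ⟨i, j, hi, hj, rfl⟩
  · exact subset_convexHull ℝ _ hk
  · exact (convex_convexHull ℝ _) (subset_convexHull ℝ _ hi) (subset_convexHull ℝ _ hj)
      (by linarith [h.κ_lt_one]) h.κ_pos.le (by ring)

lemma cell_of_mem_faceTets (h : Frame m q v u X Y Z r φ κ)
    (hT : IsDissection (vertexFinset q v u : Set (Euc 3)) T) (hσ : σ ∈ faceTets T v u) :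
    ∃ a b c i, HasVerts σ (q a) (q b) (q c) (v i) := by
  obtain ⟨hσT, ⟨i, hi⟩, hu, hv⟩ := mem_faceTets.1 hσ
  rcases h.classify (hT.simplex σ hσT) with h1 | ⟨a, b, c, j, h1⟩ | ⟨a, b, h1⟩ | ⟨a, b, h1⟩ |
    ⟨a, b, i', j, h1⟩ | ⟨a, j, h1⟩ | ⟨a, i', h1⟩ | h1
  · exact h1
  · exact absurd ⟨j, (h1 _).2 (by tauto)⟩ hu
  · exact absurd ⟨(h1 _).2 (by tauto), (h1 _).2 (by tauto)⟩ hv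
  · exact absurd ⟨0, (h1 _).2 (by tauto)⟩ hu
  · exact absurd ⟨j, (h1 _).2 (by tauto)⟩ hu
  · exact absurd ⟨j, (h1 _).2 (by tauto)⟩ hu
  · exact absurd ⟨0, (h1 _).2 (by tauto)⟩ hu
  · exact absurd ⟨0, (h1 _).2 (by tauto)⟩ hu

lemma cell_of_mem_edgeTets (h : Frame m q v u X Y Z r φ κ)
    (hT : IsDissection (vertexFinset q v u : Set (Euc 3)) T) (hσ : σ ∈ edgeTets T v u) :
    ∃ a b, HasVerts σ (q a) (q b) (v 0) (v 1) := by
  obtain ⟨hσT, ⟨h0, h0'⟩, hu⟩ := mem_edgeTets.1 hσ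
  rcases h.classify (hT.simplex σ hσT) with ⟨a, b, c, i, h1⟩ | ⟨a, b, c, j, h1⟩ | h1 | ⟨a, b, h1⟩ |
    ⟨a, b, i', j, h1⟩ | ⟨a, j, h1⟩ | ⟨a, i', h1⟩ | h1
  · rcases (h1 _).1 h0 with h2 | h2 | h2 | h2
    · exact absurd h2.symm (h.q_ne_v _ _)
    · exact absurd h2.symm (h.q_ne_v _ _)
    · exact absurd h2.symm (h.q_ne_v _ _)
    rcases (h1 _).1 h0' with h3 | h3 | h3 | h3
    · exact absurd h3.symm (h.q_ne_v _ _)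
    · exact absurd h3.symm (h.q_ne_v _ _)
    · exact absurd h3.symm (h.q_ne_v _ _)
    · exact absurd (h.v_inj (h2.trans h3.symm)) (by decide)
  · exact absurd ⟨j, (h1 _).2 (by tauto)⟩ hu
  · exact h1
  · exact absurd ⟨0, (h1 _).2 (by tauto)⟩ hu
  · exact absurd ⟨j, (h1 _).2 (by tauto)⟩ hu
  · exact absurd ⟨j, (h1 _).2 (by tauto)⟩ hu
  · exact absurd ⟨0, (h1 _).2 (by tauto)⟩ hu
  · exact absurd ⟨0, (h1 _).2 (by tauto)⟩ hu

/-- A tetrahedron with vertices on both edges contains a triangular cell with a vertex of the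
polygon, unless it is spanned by the two edges. -/
lemma cell_of_mem_midTets (h : Frame m q v u X Y Z r φ κ)
    (hT : IsDissection (vertexFinset q v u : Set (Euc 3)) T) (hσ : σ ∈ midTets T v u) :
    (∃ k b c, q k ∈ σ ∧ TriIn (interior (convexHull ℝ (σ : Set (Euc 3)))) (q k) b c ∧
      CellPt κ q v u σ b ∧ CellPt κ q v u σ c) ∨ HasVerts σ (v 0) (v 1) (u 0) (u 1) := by
  obtain ⟨hσT, ⟨i, hi⟩, ⟨j, hj⟩⟩ := mem_midTets.1 hσ
  have hfull := hT.simplex σ hσT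
  have hκ0 := h.κ_pos
  have hκ1 := h.κ_lt_one
  rcases h.classify hfull with ⟨a, b, c, i, h1⟩ | ⟨a, b, c, j, h1⟩ | ⟨a, b, h1⟩ | ⟨a, b, h1⟩ |
    ⟨a, b, i', j, h1⟩ | ⟨a, j, h1⟩ | ⟨a, i', h1⟩ | h1
  · rcases (h1 _).1 hj with h2 | h2 | h2 | h2
    · exact absurd h2.symm (h.q_ne_u _ _)
    · exact absurd h2.symm (h.q_ne_u _ _)
    · exact absurd h2.symm (h.q_ne_u _ _)
    · exact absurd h2.symm (h.v_ne_u _ _)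
  · rcases (h1 _).1 hi with h2 | h2 | h2 | h2
    · exact absurd h2.symm (h.q_ne_v _ _)
    · exact absurd h2.symm (h.q_ne_v _ _)
    · exact absurd h2.symm (h.q_ne_v _ _)
    · exact absurd h2 (h.v_ne_u _ _)
  · rcases (h1 _).1 hj with h2 | h2 | h2 | h2
    · exact absurd h2.symm (h.q_ne_u _ _)
    · exact absurd h2.symm (h.q_ne_u _ _)
    · exact absurd h2.symm (h.v_ne_u _ _)
    · exact absurd h2.symm (h.v_ne_u _ _)
  · rcases (h1 _).1 hi with h2 | h2 | h2 | h2
    · exact absurd h2.symm (h.q_ne_v _ _)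
    · exact absurd h2.symm (h.q_ne_v _ _)
    · exact absurd h2 (h.v_ne_u _ _)
    · exact absurd h2 (h.v_ne_u _ _)
  · exact Or.inl ⟨a, q b, crossPt κ v u i' j, (h1 _).2 (by tauto), h1.triIn_qq hfull hκ0 hκ1,
      Or.inl ⟨b, (h1 _).2 (by tauto), rfl⟩,
      Or.inr ⟨i', j, (h1 _).2 (by tauto), (h1 _).2 (by tauto), rfl⟩⟩
  · exact Or.inl ⟨a, crossPt κ v u 0 j, crossPt κ v u 1 j, (h1 _).2 (by tauto),
      h1.triIn_q hfull hκ0 hκ1,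
      Or.inr ⟨0, j, (h1 _).2 (by tauto), (h1 _).2 (by tauto), rfl⟩,
      Or.inr ⟨1, j, (h1 _).2 (by tauto), (h1 _).2 (by tauto), rfl⟩⟩
  · have h2 := h1.triIn_q hfull (κ := 1 - κ) (by linarith) (by linarith)
    have e : ∀ j', (1 - (1 - κ)) • u j' + (1 - κ) • v i' = crossPt κ v u i' j' := by
      intro j'; rw [crossPt]; module
    rw [e, e] at h2
    exact Or.inl ⟨a, crossPt κ v u i' 0, crossPt κ v u i' 1, (h1 _).2 (by tauto), h2,
      Or.inr ⟨i', 0, (h1 _).2 (by tauto), (h1 _).2 (by tauto), rfl⟩,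
      Or.inr ⟨i', 1, (h1 _).2 (by tauto), (h1 _).2 (by tauto), rfl⟩⟩
  · exact Or.inr h1

/-- A tetrahedron with vertices on only one of the two edges has one or both ends of this edge as
vertices, and every tetrahedron has a vertex on one of the edges. -/
lemma card_eq (h : Frame m q v u X Y Z r φ κ)
    (hT : IsDissection (vertexFinset q v u : Set (Euc 3)) T) :
    T.card = (midTets T v u).card + (faceTets T v u).card + (edgeTets T v u).card +
      (faceTets T u v).card + (edgeTets T u v).card := by
  classical
  have hV : T.card = (T.filter fun σ => ∃ i, v i ∈ σ).card +
      (T.filter fun σ => ¬ ∃ i, v i ∈ σ).card := (Finset.card_filter_add_card_filter_not _).symm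
  have h1 : (T.filter fun σ => ∃ i, v i ∈ σ).card =
      (midTets T v u).card + (faceTets T v u).card + (edgeTets T v u).card := by
    rw [← Finset.card_filter_add_card_filter_not (s := T.filter fun σ => ∃ i, v i ∈ σ)
      (fun σ => ∃ j, u j ∈ σ), Finset.filter_filter, Finset.filter_filter, add_assoc]
    congr 1
    rw [← Finset.card_filter_add_card_filter_not (s := T.filter fun σ => (∃ i, v i ∈ σ) ∧
      ¬ ∃ j, u j ∈ σ) (fun σ => v 0 ∈ σ ∧ v 1 ∈ σ), Finset.filter_filter, Finset.filter_filter,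
      add_comm]
    congr 2
    · ext σ; rw [mem_faceTets, Finset.mem_filter]; tauto
    · ext σ; rw [mem_edgeTets, Finset.mem_filter]
      have : v 0 ∈ σ → ∃ i, v i ∈ σ := fun h => ⟨0, h⟩
      tauto
  have h2 : (T.filter fun σ => ¬ ∃ i, v i ∈ σ).card =
      (faceTets T u v).card + (edgeTets T u v).card := by
    rw [← Finset.card_filter_add_card_filter_not (s := T.filter fun σ => ¬ ∃ i, v i ∈ σ)
      (fun σ => u 0 ∈ σ ∧ u 1 ∈ σ), Finset.filter_filter, Finset.filter_filter, add_comm]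
    congr 2
    · ext σ
      rw [mem_faceTets, Finset.mem_filter]
      refine ⟨fun ⟨hσ, h3, h4⟩ => ⟨hσ, ?_, h3, h4⟩, by tauto⟩
      rcases h.classify (hT.simplex σ hσ) with ⟨a, b, c, i, h1⟩ | ⟨a, b, c, j, h1⟩ | ⟨a, b, h1⟩ |
        ⟨a, b, h1⟩ | ⟨a, b, i', j, h1⟩ | ⟨a, j, h1⟩ | ⟨a, i', h1⟩ | h1
      · exact absurd ⟨i, (h1 _).2 (by tauto)⟩ h3
      · exact ⟨j, (h1 _).2 (by tauto)⟩
      · exact absurd ⟨0, (h1 _).2 (by tauto)⟩ h3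
      · exact ⟨0, (h1 _).2 (by tauto)⟩
      · exact ⟨j, (h1 _).2 (by tauto)⟩
      · exact ⟨j, (h1 _).2 (by tauto)⟩
      · exact ⟨0, (h1 _).2 (by tauto)⟩
      · exact ⟨0, (h1 _).2 (by tauto)⟩
    · ext σ; rw [mem_edgeTets, Finset.mem_filter]; tauto
  omega

end Frame

/-! ### Bounds from the charging argument -/

namespace Frame

variable {m : ℕ} {q : Fin m → Euc 3} {v u : Fin 2 → Euc 3} {X Y Z : Euc 3 →ᵃ[ℝ] ℝ}
  {r φ κ : ℝ} {σ τ : Finset (Euc 3)} {T : Finset (Finset (Euc 3))}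

/-- Among the middle vertices of the cells, each vertex of the polygon other than the two extreme
ones is charged at most once, and each of the used crossing points at most twice. -/
lemma card_cells_le (h : Frame m q v u X Y Z r φ κ) {ι : Type*} {I : Finset ι}
    {P : ι → Set (Euc 3)} (hP : ∀ i ∈ I, ∀ j ∈ I, ∀ p, p ∈ P i → p ∈ P j → i = j)
    (hPS : ∀ i ∈ I, P i ⊆ convexHull ℝ (vertexFinset q v u : Set (Euc 3)))
    (hcell : ∀ i ∈ I, ∃ σ ∈ T, ∃ a b c, TriIn (P i) a b c ∧ CellPt κ q v u σ a ∧
      CellPt κ q v u σ b ∧ CellPt κ q v u σ c) :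
    I.card + 2 ≤ m + 2 * (usedPairs T v u).card := by
  classical
  have hm := h.four_le
  set B : Finset (Euc 3) := Finset.univ.image q ∪
    Finset.univ.image (fun ij : Fin 2 × Fin 2 => crossPt κ v u ij.1 ij.2) with hB
  have hBmem : ∀ {σ w}, CellPt κ q v u σ w → w ∈ B := by
    rintro σ w (⟨k, _, rfl⟩ | ⟨i, j, _, _, rfl⟩)
    · exact Finset.mem_union_left _ (Finset.mem_image_of_mem _ (Finset.mem_univ _))
    · exact Finset.mem_union_right _ (Finset.mem_image.2 ⟨(i, j), Finset.mem_univ _, rfl⟩)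
  have hBZ : ∀ w ∈ B, Z w = 0 := by
    intro w hw
    rcases Finset.mem_union.1 hw with h1 | h1
    · obtain ⟨k, _, rfl⟩ := Finset.mem_image.1 h1; exact h.qZ k
    · obtain ⟨⟨i, j⟩, _, rfl⟩ := Finset.mem_image.1 h1; exact h.hull_Z (h.cross_mem i j)
  obtain ⟨t, ⟨g, e, hf⟩, hinj⟩ := (h.exists_generic (a := 1) (b := 0) (by norm_num) B hBZ).exists
  have hq : ∀ k, q k ∈ B := fun k =>
    Finset.mem_union_left _ (Finset.mem_image_of_mem _ (Finset.mem_univ _))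
  have h1 := h.charge hP hPS hf (S := Finset.univ) (by rw [Finset.card_fin]; omega)
    (fun k _ l _ he => h.q_inj (hinj _ (hq k) _ (hq l) he))
    ((usedPairs T v u).image fun ij => crossPt κ v u ij.1 ij.2) (by
      intro i hi
      obtain ⟨σ, hσ, a, b, c, htri, ha, hb, hc⟩ := hcell i hi
      obtain ⟨n1, n2, n3⟩ := htri.ne
      obtain ⟨a', b', c', htri', hab, hbc, ha', hb', hc'⟩ := htri.sorted (tilt X Y 1 0 t)
        (fun he => n1 (hinj _ (hBmem ha) _ (hBmem hb) he))
        (fun he => n2 (hinj _ (hBmem ha) _ (hBmem hc) he))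
        (fun he => n3 (hinj _ (hBmem hb) _ (hBmem hc) he)) (CellPt κ q v u σ) ha hb hc
      rw [Finset.coe_univ, image_univ]
      refine ⟨a', b', c', htri', hab, hbc, ha'.mem_hull h, hb'.mem_hull h, hc'.mem_hull h, ?_⟩
      rcases hb' with ⟨k, _, rfl⟩ | ⟨i, j, hi, hj, rfl⟩
      · exact Or.inl ⟨k, Finset.mem_univ _, rfl⟩
      · exact Or.inr (Finset.mem_image.2 ⟨(i, j), mem_usedPairs.2 ⟨σ, hσ, hi, hj⟩, rfl⟩))
  rw [Finset.card_fin] at h1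
  have h2 := Finset.card_image_le (s := usedPairs T v u)
    (f := fun ij : Fin 2 × Fin 2 => crossPt κ v u ij.1 ij.2)
  omega

/-- A direction pointing upwards. -/
lemma exists_up (h : Frame m q v u X Y Z r φ κ) : ∃ e, ∀ i, 0 < Z.linear e / Z (v i) := by
  have hm := h.four_le
  refine ⟨v 0 - q ⟨0, by omega⟩, fun i => ?_⟩
  rw [affine_linear_sub, h.qZ, sub_zero]
  exact div_pos h.vZ_pos (h.vZ_pos' i)

lemma face_cell (h : Frame m q v u X Y Z r φ κ)
    (hT : IsDissection (vertexFinset q v u : Set (Euc 3)) T) {e : Euc 3}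
    (he : ∀ i, 0 < Z.linear e / Z (v i)) (hσ : σ ∈ faceTets T v u) :
    ∃ a b c, q a ∈ σ ∧ q b ∈ σ ∧ q c ∈ σ ∧ TriIn (upSet e σ) (q a) (q b) (q c) := by
  obtain ⟨a, b, c, i, h1⟩ := h.cell_of_mem_faceTets hT hσ
  exact ⟨a, b, c, (h1 _).2 (by tauto), (h1 _).2 (by tauto), (h1 _).2 (by tauto),
    h1.triIn_face (hT.simplex σ (mem_faceTets.1 hσ).1) (h.qZ a) (h.qZ b) (h.qZ c) (he i)⟩

lemma mid_cell (h : Frame m q v u X Y Z r φ κ)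
    (hT : IsDissection (vertexFinset q v u : Set (Euc 3)) T) (hσ : σ ∈ midTets T v u) :
    ∃ a b c, TriIn (interior (convexHull ℝ (σ : Set (Euc 3)))) a b c ∧ CellPt κ q v u σ a ∧
      CellPt κ q v u σ b ∧ CellPt κ q v u σ c := by
  rcases h.cell_of_mem_midTets hT hσ with ⟨k, b, c, hk, htri, hb, hc⟩ | h1
  · exact ⟨q k, b, c, htri, Or.inl ⟨k, hk, rfl⟩, hb, hc⟩
  · exact ⟨_, _, _, h1.triIn_cross (hT.simplex σ (mem_midTets.1 hσ).1) h.κ_pos h.κ_lt_one,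
      Or.inr ⟨0, 0, (h1 _).2 (by tauto), (h1 _).2 (by tauto), rfl⟩,
      Or.inr ⟨0, 1, (h1 _).2 (by tauto), (h1 _).2 (by tauto), rfl⟩,
      Or.inr ⟨1, 0, (h1 _).2 (by tauto), (h1 _).2 (by tauto), rfl⟩⟩

lemma disjoint_mid_face : Disjoint (midTets T v u) (faceTets T v u) :=
  Finset.disjoint_left.2 fun _ h1 h2 => (mem_faceTets.1 h2).2.2.1 (mem_midTets.1 h1).2.2

/-- The cells of the tetrahedra joining the two edges and the faces, in the plane of the polygon, of
the tetrahedra with one vertex on the upper edge do not overlap. -/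
lemma card_mid_add_card_face (h : Frame m q v u X Y Z r φ κ)
    (hT : IsDissection (vertexFinset q v u : Set (Euc 3)) T) :
    (midTets T v u).card + (faceTets T v u).card + 2 ≤ m + 2 * (usedPairs T v u).card := by
  classical
  obtain ⟨e, he⟩ := h.exists_up
  rw [← Finset.card_union_of_disjoint disjoint_mid_face]
  have hsub : ∀ σ ∈ midTets T v u ∪ faceTets T v u, σ ∈ T := fun σ hσ => by
    rcases Finset.mem_union.1 hσ with h1 | h1
    exacts [(mem_midTets.1 h1).1, (mem_faceTets.1 h1).1]
  refine h.card_cells_le (T := T) (P := upSet e)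
    (fun σ hσ τ hτ p h1 h2 => hT.eq_of_mem_upSet (hsub σ hσ) (hsub τ hτ) h1 h2)
    (fun σ hσ => upSet_subset e (hT.simplex σ (hsub σ hσ)).subset) ?_
  intro σ hσ
  refine ⟨σ, hsub σ hσ, ?_⟩
  rcases Finset.mem_union.1 hσ with h1 | h1
  · obtain ⟨a, b, c, htri, hC⟩ := h.mid_cell hT h1
    exact ⟨a, b, c, htri.mono (interior_subset_upSet e σ), hC⟩
  · obtain ⟨a, b, c, ha, hb, hc, htri⟩ := h.face_cell hT he h1
    exact ⟨_, _, _, htri, Or.inl ⟨a, ha, rfl⟩, Or.inl ⟨b, hb, rfl⟩, Or.inl ⟨c, hc, rfl⟩⟩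

/-- The tetrahedron spanned by the two edges has a quadrangular cell, which counts twice. -/
lemma card_mid_add_card_face' (h : Frame m q v u X Y Z r φ κ)
    (hT : IsDissection (vertexFinset q v u : Set (Euc 3)) T) {σ₀ : Finset (Euc 3)} (hσ₀ : σ₀ ∈ T)
    (hv₀ : HasVerts σ₀ (v 0) (v 1) (u 0) (u 1)) :
    (midTets T v u).card + (faceTets T v u).card + 3 ≤ m + 2 * (usedPairs T v u).card := by
  classical
  obtain ⟨e, he⟩ := h.exists_up
  have hfull := hT.simplex σ₀ hσ₀
  have hκ0 := h.κ_pos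
  have hκ1 := h.κ_lt_one
  have hsub : ∀ σ ∈ midTets T v u ∪ faceTets T v u, σ ∈ T := fun σ hσ => by
    rcases Finset.mem_union.1 hσ with h1 | h1
    exacts [(mem_midTets.1 h1).1, (mem_faceTets.1 h1).1]
  have tri1 := hv₀.triIn_cross hfull hκ0 hκ1
  have hv₁ : HasVerts σ₀ (v 1) (v 0) (u 1) (u 0) := fun w => by rw [hv₀ w]; tauto
  have tri2 := hv₁.triIn_cross hfull hκ0 hκ1
  -- the two halves of the quadrangle
  -- the diagonal common to the halves joins the crossing points of `v 0 u 1` and `v 1 u 0`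
  set O₁ := OTri ((1 - κ) • v 0 + κ • u 0) ((1 - κ) • v 0 + κ • u 1) ((1 - κ) • v 1 + κ • u 0)
    with hO₁
  set O₂ := OTri ((1 - κ) • v 1 + κ • u 1) ((1 - κ) • v 1 + κ • u 0) ((1 - κ) • v 0 + κ • u 1)
    with hO₂
  have hO : ∀ p, p ∈ O₁ → p ∈ O₂ → False := by
    rintro p ⟨x, y, z, hx, hy, hz, h1, rfl⟩ ⟨x', y', z', hx', hy', hz', h1', he⟩
    obtain ⟨e1, e2, e3, e4⟩ := hv₀.indep hfull (x := (x + y - z') * (1 - κ))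
      (y := (z - x' - y') * (1 - κ)) (z := (x + z - y') * κ) (t := (y - x' - z') * κ)
      (by linear_combination h1 - h1') (by
        rw [← sub_eq_zero, ← neg_eq_zero] at he
        rw [← he]; module)
    have h2 := (mul_eq_zero.1 e1).resolve_right (sub_pos.2 hκ1).ne'
    have h3 := (mul_eq_zero.1 e4).resolve_right hκ0.ne'
    linarith
  have hO₁' : O₁ ⊆ upSet e σ₀ := tri1.subset.trans (interior_subset_upSet e σ₀)
  have hO₂' : O₂ ⊆ upSet e σ₀ := tri2.subset.trans (interior_subset_upSet e σ₀)
  have hcard : (insert none ((midTets T v u ∪ faceTets T v u).image some)).card =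
      (midTets T v u).card + (faceTets T v u).card + 1 := by
    rw [Finset.card_insert_of_notMem (by simp), Finset.card_image_of_injective _
      (Option.some_injective _), Finset.card_union_of_disjoint disjoint_mid_face]
  have hmem : ∀ σ, some σ ∈ insert none ((midTets T v u ∪ faceTets T v u).image some) →
      σ ∈ midTets T v u ∪ faceTets T v u := by
    intro σ hσ; simpa using hσ
  -- the index `none` stands for the second half of the quadrangle
  let P : Option (Finset (Euc 3)) → Set (Euc 3) := fun o =>
    o.elim O₂ fun σ => if σ = σ₀ then O₁ else upSet e σ
  have hPsome : ∀ σ, P (some σ) = if σ = σ₀ then O₁ else upSet e σ := fun σ => rfl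
  have hPsub : ∀ σ, P (some σ) ⊆ upSet e σ := by
    intro σ
    rw [hPsome]
    split_ifs with h1
    · rw [h1]; exact hO₁'
    · exact le_rfl
  have hnone : ∀ σ ∈ T, ∀ p, p ∈ O₂ → p ∈ P (some σ) → False := by
    intro σ hσ p h1 h2
    have := hT.eq_of_mem_upSet hσ₀ hσ (hO₂' h1) (hPsub σ h2)
    rw [hPsome, if_pos this.symm] at h2
    exact hO p h2 h1
  have := h.card_cells_le (T := T) (P := P)
    (I := insert none ((midTets T v u ∪ faceTets T v u).image some)) (by
      intro o ho o' ho' p h1 h2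
      rcases o with _ | σ <;> rcases o' with _ | σ'
      · rfl
      · exact (hnone σ' (hsub _ (hmem _ ho')) p h1 h2).elim
      · exact (hnone σ (hsub _ (hmem _ ho)) p h2 h1).elim
      · rw [hT.eq_of_mem_upSet (hsub _ (hmem _ ho)) (hsub _ (hmem _ ho')) (hPsub σ h1)
          (hPsub σ' h2)]) (by
      intro o ho
      rcases o with _ | σ
      · exact hO₂'.trans (upSet_subset e hfull.subset)
      · exact (hPsub σ).trans (upSet_subset e (hT.simplex σ (hsub _ (hmem _ ho))).subset)) (by
      intro o ho
      rcases o with _ | σ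
      · exact ⟨σ₀, hσ₀, _, _, _, ⟨tri2.nonCol, le_rfl⟩,
          Or.inr ⟨1, 1, (hv₀ _).2 (by tauto), (hv₀ _).2 (by tauto), rfl⟩,
          Or.inr ⟨1, 0, (hv₀ _).2 (by tauto), (hv₀ _).2 (by tauto), rfl⟩,
          Or.inr ⟨0, 1, (hv₀ _).2 (by tauto), (hv₀ _).2 (by tauto), rfl⟩⟩
      · refine ⟨σ, hsub _ (hmem _ ho), ?_⟩
        rw [hPsome]
        split_ifs with h1
        · subst h1
          exact ⟨_, _, _, ⟨tri1.nonCol, le_rfl⟩,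
            Or.inr ⟨0, 0, (hv₀ _).2 (by tauto), (hv₀ _).2 (by tauto), rfl⟩,
            Or.inr ⟨0, 1, (hv₀ _).2 (by tauto), (hv₀ _).2 (by tauto), rfl⟩,
            Or.inr ⟨1, 0, (hv₀ _).2 (by tauto), (hv₀ _).2 (by tauto), rfl⟩⟩
        · rcases Finset.mem_union.1 (hmem _ ho) with h2 | h2
          · obtain ⟨a, b, c, htri, hC⟩ := h.mid_cell hT h2
            exact ⟨a, b, c, htri.mono (interior_subset_upSet e σ), hC⟩
          · obtain ⟨a, b, c, ha, hb, hc, htri⟩ := h.face_cell hT he h2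
            exact ⟨_, _, _, htri, Or.inl ⟨a, ha, rfl⟩, Or.inl ⟨b, hb, rfl⟩, Or.inl ⟨c, hc, rfl⟩⟩)
  omega

/-- In the plane of the polygon, three points that are not collinear have a nonzero determinant. -/
lemma det_ne_zero (h : Frame m q v u X Y Z r φ κ) {a b c : Euc 3} (hn : NonCol a b c)
    (ha : Z a = 0) (hb : Z b = 0) (hc : Z c = 0) :
    (X b - X a) * (Y c - Y a) - (X c - X a) * (Y b - Y a) ≠ 0 := by
  intro h0
  have key : ∀ s t : ℝ, s * (X b - X a) + t * (X c - X a) = 0 →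
      s * (Y b - Y a) + t * (Y c - Y a) = 0 → s = 0 ∧ t = 0 := by
    intro s t h1 h2
    have e : (1 - s - t) • a + s • b + t • c = a := by
      refine h.inj _ _ ?_ ?_ ?_
      · rw [affine_comb₃ _ _ _ _ (by ring)]; linarith
      · rw [affine_comb₃ _ _ _ _ (by ring)]; linarith
      · rw [affine_comb₃ _ _ _ _ (by ring), ha, hb, hc]; ring
    have := hn (-s - t) s t (by ring) (by
      rw [← sub_eq_zero] at e; rw [← e]; module)
    exact ⟨this.2.1, this.2.2⟩
  obtain ⟨_, h1⟩ := key ((X c - X a) * (X b - X a) + (Y c - Y a) * (Y b - Y a))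
    (-((X b - X a) ^ 2 + (Y b - Y a) ^ 2)) (by linear_combination (Y b - Y a) * h0)
    (by linear_combination (-(X b - X a)) * h0)
  have hx : X b - X a = 0 := by nlinarith [sq_nonneg (X b - X a), sq_nonneg (Y b - Y a)]
  have hy : Y b - Y a = 0 := by nlinarith [sq_nonneg (X b - X a), sq_nonneg (Y b - Y a)]
  have := (key 1 0 (by rw [hx]; ring) (by rw [hy]; ring)).1
  norm_num at this

open Classical in
/-- The tetrahedra over triangles spanned by vertices of the polygon with index in `S`. -/
noncomputable def faceTetsIn (T : Finset (Finset (Euc 3))) (q : Fin m → Euc 3)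
    (v u : Fin 2 → Euc 3) (S : Finset (Fin m)) : Finset (Finset (Euc 3)) :=
  (faceTets T v u).filter fun σ => ∀ k, q k ∈ σ → k ∈ S

lemma mem_faceTetsIn {S : Finset (Fin m)} : σ ∈ faceTetsIn T q v u S ↔
    σ ∈ faceTets T v u ∧ ∀ k, q k ∈ σ → k ∈ S := Finset.mem_filter

lemma exists_generic_q (h : Frame m q v u X Y Z r φ κ) {a b : ℝ} (hab : a ^ 2 + b ^ 2 ≠ 0) :
    ∀ᶠ t in 𝓝[>] (0 : ℝ), (∃ g e, PlaneCoord (tilt X Y a b t) g Z e) ∧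
      ∀ k l, tilt X Y a b t (q k) = tilt X Y a b t (q l) → k = l := by
  classical
  filter_upwards [h.exists_generic hab (Finset.univ.image q) (by
    intro w hw
    obtain ⟨k, _, rfl⟩ := Finset.mem_image.1 hw
    exact h.qZ k)] with t ht
  exact ⟨ht.1, fun k l he => h.q_inj (ht.2 _ (Finset.mem_image_of_mem _ (Finset.mem_univ _)) _
    (Finset.mem_image_of_mem _ (Finset.mem_univ _)) he)⟩

lemma face_cell_sorted (h : Frame m q v u X Y Z r φ κ)
    (hT : IsDissection (vertexFinset q v u : Set (Euc 3)) T) {e : Euc 3}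
    (he : ∀ i, 0 < Z.linear e / Z (v i)) {S : Finset (Fin m)} (hσ : σ ∈ faceTetsIn T q v u S)
    {f : Euc 3 →ᵃ[ℝ] ℝ} (hf : ∀ k l, f (q k) = f (q l) → k = l) :
    ∃ a b c, TriIn (upSet e σ) a b c ∧ f a < f b ∧ f b < f c ∧ a ∈ convexHull ℝ (q '' S) ∧
      b ∈ convexHull ℝ (q '' S) ∧ c ∈ convexHull ℝ (q '' S) ∧
      ((∃ k ∈ S, b = q k) ∨ b ∈ (∅ : Finset (Euc 3))) := by
  obtain ⟨h1, h2⟩ := mem_faceTetsIn.1 hσ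
  obtain ⟨a, b, c, ha, hb, hc, htri⟩ := h.face_cell hT he h1
  obtain ⟨n1, n2, n3⟩ := htri.ne
  obtain ⟨a', b', c', htri', hab, hbc, ⟨ka, ha', rfl⟩, ⟨kb, hb', rfl⟩, ⟨kc, hc', rfl⟩⟩ :=
    htri.sorted f (fun he => n1 (by rw [hf _ _ he])) (fun he => n2 (by rw [hf _ _ he]))
      (fun he => n3 (by rw [hf _ _ he])) (fun w => ∃ k ∈ S, w = q k) ⟨a, h2 a ha, rfl⟩
      ⟨b, h2 b hb, rfl⟩ ⟨c, h2 c hc, rfl⟩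
  have hsub := subset_convexHull ℝ (q '' (S : Set (Fin m)))
  exact ⟨_, _, _, htri', hab, hbc, hsub ⟨ka, ha', rfl⟩, hsub ⟨kb, hb', rfl⟩, hsub ⟨kc, hc', rfl⟩,
    Or.inl ⟨kb, hb', rfl⟩⟩

/-- Nonoverlapping triangles spanned by the vertices of a convex polygon are at most as many as in a
triangulation of this polygon. -/
lemma card_faceTetsIn (h : Frame m q v u X Y Z r φ κ)
    (hT : IsDissection (vertexFinset q v u : Set (Euc 3)) T) {S : Finset (Fin m)}
    (hS : 2 ≤ S.card) : (faceTetsIn T q v u S).card + 2 ≤ S.card := by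
  obtain ⟨e, he⟩ := h.exists_up
  obtain ⟨t, ⟨g, e', hf⟩, hinj⟩ := (h.exists_generic_q (a := 1) (b := 0) (by norm_num)).exists
  have hsub : ∀ σ ∈ faceTetsIn T q v u S, σ ∈ T := fun σ hσ =>
    (mem_faceTets.1 (mem_faceTetsIn.1 hσ).1).1
  have := h.charge (P := upSet e) (I := faceTetsIn T q v u S)
    (fun σ hσ τ hτ p h1 h2 => hT.eq_of_mem_upSet (hsub σ hσ) (hsub τ hτ) h1 h2)
    (fun σ hσ => upSet_subset e (hT.simplex σ (hsub σ hσ)).subset) hf hS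
    (fun k _ l _ he => hinj k l he) ∅ (fun σ hσ => h.face_cell_sorted hT he hσ hinj)
  simpa using this

/-- If a cell in the polygon spanned by `S` belongs to a tetrahedron joining the two edges and has
a vertex in common with the polygon, then a vertex is lost for the triangles in the polygon:
choose the charging direction so that this cell is charged to that vertex. -/
lemma card_faceTetsIn' (h : Frame m q v u X Y Z r φ κ)
    (hT : IsDissection (vertexFinset q v u : Set (Euc 3)) T) {S : Finset (Fin m)}
    (hS : 2 ≤ S.card) (hτ : τ ∈ midTets T v u) {k : Fin m} (hk : k ∈ S) {b c : Euc 3}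
    (htri : TriIn (interior (convexHull ℝ (τ : Set (Euc 3)))) (q k) b c)
    (hb : b ∈ convexHull ℝ (q '' S)) (hc : c ∈ convexHull ℝ (q '' S)) :
    (faceTetsIn T q v u S).card + 3 ≤ S.card := by
  classical
  obtain ⟨e, he⟩ := h.exists_up
  have hZ : ∀ {w}, w ∈ convexHull ℝ (q '' S) → Z w = 0 := fun hw =>
    h.hull_Z (convexHull_mono (image_subset_range _ _) hw)
  have hD := h.det_ne_zero htri.nonCol (h.qZ k) (hZ hb) (hZ hc)
  -- `α * X + β * Y` is constant in the direction from `q k` to the midpoint of the opposite side of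
  -- the cell, so that `q k` is the middle vertex for this function and its small rotations
  set α := (Y b - Y (q k)) + (Y c - Y (q k)) with hα
  set β := -((X b - X (q k)) + (X c - X (q k))) with hβ
  have hab : α ^ 2 + β ^ 2 ≠ 0 := by
    intro h0
    have h1 : α = 0 := by nlinarith [sq_nonneg α, sq_nonneg β]
    have h2 : β = 0 := by nlinarith [sq_nonneg α, sq_nonneg β]
    apply hD
    linear_combination (X b - X (q k)) * h1 - (X b - X (q k)) * hα + (Y b - Y (q k)) * h2 -
      (Y b - Y (q k)) * hβ
  obtain ⟨D, hDdef⟩ : ∃ D, D = (X b - X (q k)) * (Y c - Y (q k)) -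
    (X c - X (q k)) * (Y b - Y (q k)) := ⟨_, rfl⟩
  rw [← hDdef] at hD
  have hfb : ∀ t, tilt X Y α β t b - tilt X Y α β t (q k) =
      D + t * (α * (Y b - Y (q k)) - β * (X b - X (q k))) := by
    intro t; rw [tilt_apply, tilt_apply, hDdef, hα, hβ]; ring
  have hfc : ∀ t, tilt X Y α β t c - tilt X Y α β t (q k) =
      -D + t * (α * (Y c - Y (q k)) - β * (X c - X (q k))) := by
    intro t; rw [tilt_apply, tilt_apply, hDdef, hα, hβ]; ring
  have hpos : ∀ x y : ℝ, 0 < x → ∀ᶠ t in 𝓝[>] (0 : ℝ), 0 < x + t * y := by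
    intro x y hx
    have hcont : ContinuousAt (fun t : ℝ => x + t * y) 0 := by fun_prop
    exact (hcont.eventually_const_lt (u := 0) (by simpa using hx)).filter_mono nhdsWithin_le_nhds
  have hsort : ∀ᶠ t in 𝓝[>] (0 : ℝ), ∃ a' c', TriIn (interior (convexHull ℝ (τ : Set (Euc 3))))
      a' (q k) c' ∧ tilt X Y α β t a' < tilt X Y α β t (q k) ∧
      tilt X Y α β t (q k) < tilt X Y α β t c' ∧ a' ∈ convexHull ℝ (q '' S) ∧
      c' ∈ convexHull ℝ (q '' S) := by
    rcases lt_or_gt_of_ne hD with h1 | h1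
    · filter_upwards [hpos (-D) (-(α * (Y b - Y (q k)) - β * (X b - X (q k)))) (by linarith),
        hpos (-D) (α * (Y c - Y (q k)) - β * (X c - X (q k))) (by linarith)] with t h2 h3
      exact ⟨b, c, htri.swap₁₂, by linarith [hfb t], by linarith [hfc t], hb, hc⟩
    · filter_upwards [hpos D (α * (Y b - Y (q k)) - β * (X b - X (q k))) h1,
        hpos D (-(α * (Y c - Y (q k)) - β * (X c - X (q k)))) h1] with t h2 h3
      exact ⟨c, b, htri.swap₂₃.swap₁₂, by linarith [hfc t], by linarith [hfb t], hc, hb⟩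
  obtain ⟨t, ⟨⟨g, e', hf⟩, hinj⟩, a', c', htri', hlt1, hlt2, ha', hc'⟩ :=
    ((h.exists_generic_q hab).and hsort).exists
  have hτT := (mem_midTets.1 hτ).1
  have hsub : ∀ σ ∈ insert τ (faceTetsIn T q v u S), σ ∈ T := fun σ hσ => by
    rcases Finset.mem_insert.1 hσ with rfl | hσ
    · exact hτT
    · exact (mem_faceTets.1 (mem_faceTetsIn.1 hσ).1).1
  have := h.charge (P := upSet e) (I := insert τ (faceTetsIn T q v u S))
    (fun σ hσ τ hτ p h1 h2 => hT.eq_of_mem_upSet (hsub σ hσ) (hsub τ hτ) h1 h2)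
    (fun σ hσ => upSet_subset e (hT.simplex σ (hsub σ hσ)).subset) hf hS
    (fun k _ l _ he => hinj k l he) ∅ (fun σ hσ => by
      rcases Finset.mem_insert.1 hσ with rfl | hσ
      · exact ⟨a', q k, c', htri'.mono (interior_subset_upSet e _), hlt1, hlt2, ha',
          subset_convexHull ℝ _ ⟨k, hk, rfl⟩, hc', Or.inl ⟨k, hk, rfl⟩⟩
      · exact h.face_cell_sorted hT he hσ hinj)
  rw [Finset.card_insert_of_notMem fun hmem => Finset.disjoint_left.1 disjoint_mid_face hτ
    (mem_faceTetsIn.1 hmem).1] at this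
  simp only [Finset.card_empty, mul_zero, add_zero] at this
  omega

lemma faceTetsIn_univ : faceTetsIn T q v u Finset.univ = faceTets T v u := by
  ext σ; rw [mem_faceTetsIn]; simp

lemma card_faceTets (h : Frame m q v u X Y Z r φ κ)
    (hT : IsDissection (vertexFinset q v u : Set (Euc 3)) T) :
    (faceTets T v u).card + 2 ≤ m := by
  have := h.card_faceTetsIn hT (S := Finset.univ) (by rw [Finset.card_fin]; have := h.four_le; omega)
  rwa [faceTetsIn_univ, Finset.card_fin] at this

/-- If a tetrahedron joining the two edges has a vertex of the polygon, then its cell is missing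
from the triangles on either side of the plane. -/
lemma card_faceTets' (h : Frame m q v u X Y Z r φ κ)
    (hT : IsDissection (vertexFinset q v u : Set (Euc 3)) T) (hτ : τ ∈ midTets T v u)
    {k : Fin m} (hk : q k ∈ τ) : (faceTets T v u).card + 3 ≤ m := by
  rcases h.cell_of_mem_midTets hT hτ with ⟨k, b, c, hk, htri, hb, hc⟩ | h1
  · have := h.card_faceTetsIn' hT (S := Finset.univ)
      (by rw [Finset.card_fin]; have := h.four_le; omega) hτ (Finset.mem_univ k) htri
      (by rw [Finset.coe_univ, image_univ]; exact hb.mem_hull h)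
      (by rw [Finset.coe_univ, image_univ]; exact hc.mem_hull h)
    rwa [faceTetsIn_univ, Finset.card_fin] at this
  · rcases (h1 _).1 hk with h2 | h2 | h2 | h2
    · exact absurd h2 (h.q_ne_v _ _)
    · exact absurd h2 (h.q_ne_v _ _)
    · exact absurd h2 (h.q_ne_u _ _)
    · exact absurd h2 (h.q_ne_u _ _)

end Frame

/-! ### Chords separating crossing points -/

lemma hasVerts_of_mem {A : Set (Euc 3)} {σ : Finset (Euc 3)} (hσ : IsFullSimplexIn A σ)
    {a b c d : Euc 3} (ha : a ∈ σ) (hb : b ∈ σ) (hc : c ∈ σ) (hd : d ∈ σ) (hab : a ≠ b)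
    (hac : a ≠ c) (had : a ≠ d) (hbc : b ≠ c) (hbd : b ≠ d) (hcd : c ≠ d) :
    HasVerts σ a b c d := by
  classical
  have hsub : ({a, b, c, d} : Finset (Euc 3)) ⊆ σ := by
    intro w hw
    simp only [Finset.mem_insert, Finset.mem_singleton] at hw
    rcases hw with rfl | rfl | rfl | rfl <;> assumption
  have hcard : ({a, b, c, d} : Finset (Euc 3)).card = 4 := by
    rw [Finset.card_insert_of_notMem (by simp [hab, hac, had]),
      Finset.card_insert_of_notMem (by simp [hbc, hbd]), Finset.card_pair hcd]
  have := Finset.eq_of_subset_of_card_le hsub (by rw [hcard, hσ.card])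
  intro w
  rw [← this]; simp

/-- The affine function vanishing on the line through `a` and `b`, in the plane. -/
noncomputable def chordFn (X Y : Euc 3 →ᵃ[ℝ] ℝ) (a b : Euc 3) : Euc 3 →ᵃ[ℝ] ℝ :=
  (Y b - Y a) • (X - AffineMap.const ℝ (Euc 3) (X a)) -
    (X b - X a) • (Y - AffineMap.const ℝ (Euc 3) (Y a))

lemma chordFn_apply (X Y : Euc 3 →ᵃ[ℝ] ℝ) (a b w : Euc 3) :
    chordFn X Y a b w = (Y b - Y a) * (X w - X a) - (X b - X a) * (Y w - Y a) := by
  simp [chordFn]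

namespace Frame

variable {m : ℕ} {q : Fin m → Euc 3} {v u : Fin 2 → Euc 3} {X Y Z : Euc 3 →ᵃ[ℝ] ℝ}
  {r φ κ : ℝ} {σ τ ρ : Finset (Euc 3)} {T : Finset (Finset (Euc 3))}

lemma hull_subset (q : Fin m → Euc 3) (v u : Fin 2 → Euc 3) :
    convexHull ℝ (range q) ⊆ convexHull ℝ (vertexFinset q v u : Set (Euc 3)) := by
  apply convexHull_mono
  rintro _ ⟨k, rfl⟩
  exact q_mem k

lemma eq_of_mem_openSegment (h : Frame m q v u X Y Z r φ κ) {k : Fin m} {y z : Euc 3}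
    (hy : y ∈ convexHull ℝ (range q)) (hz : z ∈ convexHull ℝ (range q))
    (hk : q k ∈ openSegment ℝ y z) : y = q k :=
  (h.q_mem_extremePoints k).2 (hull_subset q v u hy) (hull_subset q v u hz) hk

/-- The line through two vertices of the polygon meets it only in the chord between them. -/
lemma mem_segment_of_chordFn (h : Frame m q v u X Y Z r φ κ) {a b : Fin m} (hab : a ≠ b)
    {w : Euc 3} (hw : w ∈ convexHull ℝ (range q)) (h0 : chordFn X Y (q a) (q b) w = 0) :
    w ∈ segment ℝ (q a) (q b) := by
  rw [chordFn_apply] at h0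
  have hqa : q a ∈ convexHull ℝ (range q) := subset_convexHull ℝ _ (mem_range_self a)
  have hqb : q b ∈ convexHull ℝ (range q) := subset_convexHull ℝ _ (mem_range_self b)
  have hne : q a ≠ q b := fun he => hab (h.q_inj he)
  have hx : X (q b) - X (q a) ≠ 0 := sub_ne_zero.2 fun he => hab (h.Xinj he).symm
  set θ := (X w - X (q a)) / (X (q b) - X (q a)) with hθ
  have hθx : θ * (X (q b) - X (q a)) = X w - X (q a) := by rw [hθ]; field_simp
  have hθy : θ * (Y (q b) - Y (q a)) = Y w - Y (q a) := by
    apply mul_left_cancel₀ hx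
    linear_combination (Y (q b) - Y (q a)) * hθx + h0
  have e : w = (1 - θ) • q a + θ • q b := by
    refine h.inj _ _ ?_ ?_ ?_
    · rw [affine_comb₂ _ _ _ (by ring)]; linarith
    · rw [affine_comb₂ _ _ _ (by ring)]; linarith
    · rw [affine_comb₂ _ _ _ (by ring), h.qZ, h.qZ, h.hull_Z hw]; ring
  rcases lt_or_ge θ 0 with h1 | h1
  · have hd : 1 - θ ≠ 0 := by linarith
    have := h.eq_of_mem_openSegment hqb hw (k := a) ⟨-θ / (1 - θ), 1 / (1 - θ),
      div_pos (by linarith) (by linarith), div_pos (by norm_num) (by linarith),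
      by field_simp; ring, by
        rw [e, smul_add, smul_smul, smul_smul, div_mul_cancel₀ _ hd, one_smul]; module⟩
    exact absurd this.symm hne
  rcases lt_or_ge 1 θ with h2 | h2
  · have hd : θ ≠ 0 := by linarith
    have := h.eq_of_mem_openSegment hqa hw (k := b) ⟨(θ - 1) / θ, 1 / θ,
      div_pos (by linarith) (by linarith), div_pos (by norm_num) (by linarith),
      by field_simp; ring, by
        rw [e, smul_add, smul_smul, smul_smul, div_mul_cancel₀ _ hd, one_smul]; module⟩
    exact absurd this hne
  · exact ⟨1 - θ, θ, by linarith, h1, by ring, e.symm⟩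

/-- A tetrahedron of a triangulation that meets the polygon on both sides of a chord which is an
edge of the triangulation contains this chord as an edge. -/
lemma mem_of_cross (h : Frame m q v u X Y Z r φ κ)
    (hT : IsTriangulation (vertexFinset q v u : Set (Euc 3)) T) {a b : Fin m} (hρ : ρ ∈ T)
    (ha : q a ∈ ρ) (hb : q b ∈ ρ) {ℓ : Euc 3 →ᵃ[ℝ] ℝ}
    (hℓ : ∀ w ∈ convexHull ℝ (range q), ℓ w = 0 → w ∈ segment ℝ (q a) (q b))
    (hℓa : ℓ (q a) = 0) (hℓb : ℓ (q b) = 0) (hτ : τ ∈ T) {y z : Euc 3}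
    (hy : y ∈ convexHull ℝ (range q)) (hz : z ∈ convexHull ℝ (range q))
    (hyτ : y ∈ convexHull ℝ (τ : Set (Euc 3))) (hzτ : z ∈ convexHull ℝ (τ : Set (Euc 3)))
    (hy0 : 0 < ℓ y) (hz0 : ℓ z < 0) : q a ∈ τ ∧ q b ∈ τ := by
  obtain ⟨s, hs, hs0⟩ := exists_openSegment_eq ℓ (a := y) (b := z) (c := 0) (Or.inr ⟨hz0, hy0⟩)
  have hseg := openSegment_subset_segment ℝ _ _ hs
  have h1 := hℓ s ((convex_convexHull ℝ _).segment_subset hy hz hseg) hs0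
  have h2 := (convex_convexHull ℝ _).segment_subset hyτ hzτ hseg
  rw [← insert_endpoints_openSegment, mem_insert_iff, mem_insert_iff] at h1
  rcases h1 with rfl | rfl | h1
  · rw [h.eq_of_mem_openSegment hy hz hs, hℓa] at hy0; exact absurd hy0 (lt_irrefl _)
  · rw [h.eq_of_mem_openSegment hy hz hs, hℓb] at hy0; exact absurd hy0 (lt_irrefl _)
  · exact hT.mem_of_openSegment hρ hτ ha hb h1 h2

/-- A chord cuts the polygon into the convex hulls of the vertices on its two sides. -/
lemma mem_hull_side {a b : Fin m} {ℓ : Euc 3 →ᵃ[ℝ] ℝ}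
    (hℓ : ∀ w ∈ convexHull ℝ (range q), ℓ w = 0 → w ∈ segment ℝ (q a) (q b))
    {S : Set (Fin m)} (hS : ∀ k, k ∈ S ↔ 0 ≤ ℓ (q k)) (haS : a ∈ S) (hbS : b ∈ S) {w : Euc 3}
    (hw : w ∈ convexHull ℝ (range q)) (hw0 : 0 ≤ ℓ w) : w ∈ convexHull ℝ (q '' S) := by
  have hcv := convex_convexHull ℝ (q '' S)
  have hline : ∀ w ∈ convexHull ℝ (range q), ℓ w = 0 → w ∈ convexHull ℝ (q '' S) :=
    fun w hw h0 => hcv.segment_subset (subset_convexHull ℝ _ ⟨a, haS, rfl⟩)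
      (subset_convexHull ℝ _ ⟨b, hbS, rfl⟩) (hℓ w hw h0)
  rcases hw0.eq_or_lt with h0 | h0
  · exact hline w hw h0.symm
  have hun : range q = q '' S ∪ q '' Sᶜ := by rw [← image_union, union_compl_self, image_univ]
  rcases Sᶜ.eq_empty_or_nonempty with he | hne
  · rwa [hun, he, image_empty, union_empty] at hw
  have hw' := hw
  rw [hun, convexHull_union (show (q '' S).Nonempty from ⟨q a, a, haS, rfl⟩) (hne.image q), mem_convexJoin] at hw'
  obtain ⟨y, hy, z, hz, α, β, hα, hβ, hαβ, rfl⟩ := hw'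
  have hz' : z ∈ convexHull ℝ (range q) := convexHull_mono (image_subset_range _ _) hz
  have hz0 : ℓ z ≤ 0 := affine_convexHull_le ℓ (by
    rintro _ ⟨k, hk, rfl⟩
    exact (not_le.1 fun hcon => hk ((hS k).2 hcon)).le) hz
  rcases hz0.eq_or_lt with h1 | h1
  · exact hcv hy (hline z hz' h1) hα hβ hαβ
  · obtain ⟨s, ⟨γ, δ, hγ, hδ, hγδ, rfl⟩, hs0⟩ := exists_openSegment_eq ℓ (c := 0)
      (Or.inr ⟨h1, h0⟩)
    have hs := hline _ ((convex_convexHull ℝ _) hw hz' hγ.le hδ.le hγδ) hs0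
    have hd : 0 < δ + β * γ := by have := mul_nonneg hβ hγ.le; linarith
    have := hcv hy hs (a := α * δ / (δ + β * γ)) (b := β / (δ + β * γ))
      (div_nonneg (mul_nonneg hα hδ.le) hd.le) (div_nonneg hβ hd.le) (by
        rw [← add_div, div_eq_one_iff_eq hd.ne']
        linear_combination δ * hαβ - β * hγδ)
    convert this using 1
    obtain rfl : α = 1 - β := by linarith
    obtain rfl : γ = 1 - δ := by linarith
    match_scalars <;> field_simp
    ring

/-- The cell of a tetrahedron with the edge from `v i` to `u j` is on the same side of the chord as
the crossing point of this edge, since it cannot cross the chord; hence it is lost for the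
triangles on this side. -/
lemma card_side (h : Frame m q v u X Y Z r φ κ)
    (hT : IsTriangulation (vertexFinset q v u : Set (Euc 3)) T) {a b : Fin m} (hab : a ≠ b)
    (hρ : ρ ∈ T) (ha : q a ∈ ρ) (hb : q b ∈ ρ) {ℓ : Euc 3 →ᵃ[ℝ] ℝ}
    (hℓ : ∀ w ∈ convexHull ℝ (range q), ℓ w = 0 → w ∈ segment ℝ (q a) (q b))
    (hℓa : ℓ (q a) = 0) (hℓb : ℓ (q b) = 0) {i j i' j' : Fin 2} (hτ : τ ∈ T) (hi : v i ∈ τ)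
    (hj : u j ∈ τ) (hx : 0 < ℓ (crossPt κ v u i j)) (hx' : ℓ (crossPt κ v u i' j') < 0)
    {S : Finset (Fin m)} (hS : ∀ k, k ∈ S ↔ 0 ≤ ℓ (q k)) :
    (faceTetsIn T q v u S).card + 3 ≤ S.card := by
  have haS : a ∈ S := (hS a).2 hℓa.ge
  have hbS : b ∈ S := (hS b).2 hℓb.ge
  have hS2 : 2 ≤ S.card := by
    have := Finset.one_lt_card.2 ⟨a, haS, b, hbS, hab⟩
    omega
  have hqab : q a ≠ q b := fun he => hab (h.q_inj he)
  have hτm : τ ∈ midTets T v u := mem_midTets.2 ⟨hτ, ⟨i, hi⟩, ⟨j, hj⟩⟩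
  have hxC : CellPt κ q v u τ (crossPt κ v u i j) := Or.inr ⟨i, j, hi, hj, rfl⟩
  have hcr : ∀ w, CellPt κ q v u τ w → ℓ w < 0 → q a ∈ τ ∧ q b ∈ τ := fun w hw hw0 =>
    h.mem_of_cross hT hρ ha hb hℓ hℓa hℓb hτ (hxC.mem_hull h) (hw.mem_hull h)
      (hxC.mem_convexHull h) (hw.mem_convexHull h) hx hw0
  -- a vertex of the cell beyond the chord would make the chord an edge of `τ`, and then the cell is
  -- the triangle on the chord and the crossing point
  have hcell : ∀ w, CellPt κ q v u τ w → 0 ≤ ℓ w := by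
    intro w hw
    by_contra hcon
    obtain ⟨haτ, hbτ⟩ := hcr w hw (not_le.1 hcon)
    have hv := hasVerts_of_mem (hT.simplex τ hτ) haτ hbτ hi hj hqab (h.q_ne_v _ _)
      (h.q_ne_u _ _) (h.q_ne_v _ _) (h.q_ne_u _ _) (h.v_ne_u _ _)
    rcases hw with ⟨k, hk, rfl⟩ | ⟨i₁, j₁, hi₁, hj₁, rfl⟩
    · rcases (hv _).1 hk with h1 | h1 | h1 | h1
      · rw [h1] at hcon; exact hcon hℓa.ge
      · rw [h1] at hcon; exact hcon hℓb.ge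
      · exact h.q_ne_v _ _ h1
      · exact h.q_ne_u _ _ h1
    · have e1 : i₁ = i := by
        rcases (hv _).1 hi₁ with h1 | h1 | h1 | h1
        · exact absurd h1.symm (h.q_ne_v _ _)
        · exact absurd h1.symm (h.q_ne_v _ _)
        · exact h.v_inj h1
        · exact absurd h1 (h.v_ne_u _ _)
      have e2 : j₁ = j := by
        rcases (hv _).1 hj₁ with h1 | h1 | h1 | h1
        · exact absurd h1.symm (h.q_ne_u _ _)
        · exact absurd h1.symm (h.q_ne_u _ _)
        · exact absurd h1.symm (h.v_ne_u _ _)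
        · exact h.u_inj h1
      rw [e1, e2] at hcon
      exact hcon hx.le
  have hhull : ∀ w, CellPt κ q v u τ w → w ∈ convexHull ℝ (q '' S) := fun w hw =>
    mem_hull_side hℓ (by simpa using hS) (by simpa using haS) (by simpa using hbS)
      (hw.mem_hull h) (hcell w hw)
  rcases h.cell_of_mem_midTets hT.toIsDissection hτm with ⟨k, y, z, hk, htri, hy, hz⟩ | hv
  · exact h.card_faceTetsIn' hT.toIsDissection hS2 hτm
      ((hS k).2 (hcell _ (Or.inl ⟨k, hk, rfl⟩))) htri (hhull y hy) (hhull z hz)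
  · have hmem : ∀ i, v i ∈ τ := fun i => (hv _).2 (by fin_cases i <;> simp)
    have hmem' : ∀ j, u j ∈ τ := fun j => (hv _).2 (by fin_cases j <;> simp)
    obtain ⟨haτ, _⟩ := hcr _ (Or.inr ⟨i', j', hmem i', hmem' j', rfl⟩) hx'
    rcases (hv _).1 haτ with h1 | h1 | h1 | h1
    · exact absurd h1 (h.q_ne_v _ _)
    · exact absurd h1 (h.q_ne_v _ _)
    · exact absurd h1 (h.q_ne_u _ _)
    · exact absurd h1 (h.q_ne_u _ _)

/-- A chord separating two crossing points of the triangulation splits the polygon, and on both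
sides there is a cell that is not the face of a tetrahedron. -/
lemma card_faceTets_of_chord (h : Frame m q v u X Y Z r φ κ)
    (hT : IsTriangulation (vertexFinset q v u : Set (Euc 3)) T) {a b : Fin m} (hab : a ≠ b)
    (hρ : ρ ∈ T) (ha : q a ∈ ρ) (hb : q b ∈ ρ) {i j i' j' : Fin 2}
    (hij : (i, j) ∈ usedPairs T v u) (hij' : (i', j') ∈ usedPairs T v u)
    (hx : 0 < chordFn X Y (q a) (q b) (crossPt κ v u i j))
    (hx' : chordFn X Y (q a) (q b) (crossPt κ v u i' j') < 0) :
    (faceTets T v u).card + 4 ≤ m := by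
  classical
  obtain ⟨τ, hτ, hi, hj⟩ := mem_usedPairs.1 hij
  obtain ⟨τ', hτ', hi', hj'⟩ := mem_usedPairs.1 hij'
  set ℓ := chordFn X Y (q a) (q b) with hℓdef
  have hℓ : ∀ w ∈ convexHull ℝ (range q), ℓ w = 0 → w ∈ segment ℝ (q a) (q b) := fun w hw h0 =>
    h.mem_segment_of_chordFn hab hw h0
  have hℓa : ℓ (q a) = 0 := by rw [hℓdef, chordFn_apply]; ring
  have hℓb : ℓ (q b) = 0 := by rw [hℓdef, chordFn_apply]; ring
  set S := Finset.univ.filter fun k => 0 ≤ ℓ (q k) with hS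
  set S' := Finset.univ.filter fun k => 0 ≤ (-ℓ) (q k) with hS'
  have h1 := h.card_side hT hab hρ ha hb hℓ hℓa hℓb hτ hi hj hx hx' (S := S) (by simp [hS])
  have h2 := h.card_side hT hab hρ ha hb (ℓ := -ℓ) (fun w hw h0 => hℓ w hw (by simpa using h0))
    (by simpa using hℓa) (by simpa using hℓb) hτ' hi' hj' (i' := i) (j' := j)
    (by simpa using hx') (by simpa using hx) (S := S') (by simp [hS'])
  have hqab : q a ≠ q b := fun he => hab (h.q_inj he)
  -- no triangle crosses the chord, since it would have both its ends as further vertices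
  have hsub : faceTets T v u ⊆ faceTetsIn T q v u S ∪ faceTetsIn T q v u S' := by
    intro σ hσ
    rw [Finset.mem_union, mem_faceTetsIn, mem_faceTetsIn]
    by_contra hcon
    simp only [hσ, true_and, not_or, not_forall, hS, hS', Finset.mem_filter, Finset.mem_univ,
      true_and, not_le, AffineMap.coe_neg, Pi.neg_apply, Left.neg_neg_iff] at hcon
    obtain ⟨⟨k, hk, hk0⟩, ⟨l, hl, hl0⟩⟩ := hcon
    have hσT := (mem_faceTets.1 hσ).1
    obtain ⟨haσ, hbσ⟩ := h.mem_of_cross hT hρ ha hb hℓ hℓa hℓb hσT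
      (subset_convexHull ℝ _ (mem_range_self l)) (subset_convexHull ℝ _ (mem_range_self k))
      (subset_convexHull ℝ _ hl) (subset_convexHull ℝ _ hk) hl0 hk0
    have ne : ∀ {w w' : Euc 3}, ℓ w ≠ ℓ w' → w ≠ w' := fun hne he => hne (by rw [he])
    have hv := hasVerts_of_mem (hT.simplex σ hσT) haσ hbσ hk hl hqab
      (ne (by rw [hℓa]; exact hk0.ne')) (ne (by rw [hℓa]; exact hl0.ne))
      (ne (by rw [hℓb]; exact hk0.ne')) (ne (by rw [hℓb]; exact hl0.ne))
      (ne (hk0.trans hl0).ne)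
    obtain ⟨i₁, hi₁⟩ := (mem_faceTets.1 hσ).2.1
    rcases (hv _).1 hi₁ with h3 | h3 | h3 | h3 <;> exact h.q_ne_v _ _ h3.symm
  have h3 := (Finset.card_le_card hsub).trans (Finset.card_union_le _ _)
  have h4 := Finset.card_union_add_card_inter S S'
  have h5 : (S ∪ S').card ≤ m := by
    simpa using Finset.card_le_univ (S ∪ S')
  have h6 : S ∩ S' ⊆ {a, b} := by
    intro k hk
    simp only [hS, hS', Finset.mem_inter, Finset.mem_filter, Finset.mem_univ, true_and,
      AffineMap.coe_neg, Pi.neg_apply, Left.nonneg_neg_iff] at hk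
    have hseg := hℓ (q k) (subset_convexHull ℝ _ (mem_range_self k)) (le_antisymm hk.2 hk.1)
    rw [← insert_endpoints_openSegment, mem_insert_iff, mem_insert_iff] at hseg
    rw [Finset.mem_insert, Finset.mem_singleton]
    rcases hseg with h7 | h7 | h7
    · exact Or.inl (h.q_inj h7)
    · exact Or.inr (h.q_inj h7)
    · exact Or.inl (h.q_inj (h.eq_of_mem_openSegment (subset_convexHull ℝ _ (mem_range_self a))
        (subset_convexHull ℝ _ (mem_range_self b)) h7).symm)
  have h7 := (Finset.card_le_card h6).trans Finset.card_le_two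
  omega

end Frame

/-! ### Sweeping a half-plane around an edge -/

/-- The affine function vanishing on the line through `v 0` and `v 1` and on the points of the
plane of the polygon at height `t`. -/
noncomputable def sweep (v : Fin 2 → Euc 3) (Y Z : Euc 3 →ᵃ[ℝ] ℝ) (t : ℝ) : Euc 3 →ᵃ[ℝ] ℝ :=
  relTo Z (v 0) (level Y t)

/-- The simplex `σ` has the edge `v 0`, `v 1`, and its dihedral angle at this edge contains, in
its interior, the half-plane through the points of the plane of the polygon at height `t`. -/
structure Wedge (v : Fin 2 → Euc 3) (Y Z : Euc 3 →ᵃ[ℝ] ℝ) (σ : Finset (Euc 3)) (t : ℝ) :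
    Prop where
  mem : ∀ i, v i ∈ σ
  neg : ∃ w ∈ σ, sweep v Y Z t w < 0
  pos : ∃ w ∈ σ, 0 < sweep v Y Z t w

namespace Frame

variable {m : ℕ} {q : Fin m → Euc 3} {v u : Fin 2 → Euc 3} {X Y Z : Euc 3 →ᵃ[ℝ] ℝ}
  {r φ κ : ℝ} {σ τ ρ : Finset (Euc 3)} {T : Finset (Finset (Euc 3))} {t : ℝ}

lemma sweep_of_Z_eq_zero {w : Euc 3} (hw : Z w = 0) : sweep v Y Z t w = Y w - t := by
  rw [sweep, relTo_apply, level_apply, hw]; ring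

lemma sweep_q (h : Frame m q v u X Y Z r φ κ) (k : Fin m) :
    sweep v Y Z t (q k) = Y (q k) - t := sweep_of_Z_eq_zero (h.qZ k)

lemma sweep_v (h : Frame m q v u X Y Z r φ κ) (i : Fin 2) : sweep v Y Z t (v i) = 0 := by
  rw [sweep, relTo_apply, level_apply, level_apply, h.vZ' i, h.vY' i,
    div_mul_cancel₀ _ h.vZ_pos.ne', sub_self]

lemma cross_Z (h : Frame m q v u X Y Z r φ κ) (i j : Fin 2) : Z (crossPt κ v u i j) = 0 :=
  h.hull_Z (h.cross_mem i j)

lemma cross_Y (h : Frame m q v u X Y Z r φ κ) (i j : Fin 2) :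
    Y (crossPt κ v u i j) = Y (crossPt κ v u 0 j) := by
  rw [cross_apply, cross_apply, h.vY']

lemma sweep_u (h : Frame m q v u X Y Z r φ κ) (j : Fin 2) :
    κ * sweep v Y Z t (u j) = Y (crossPt κ v u 0 j) - t := by
  have h1 := cross_apply (v := v) (u := u) (κ := κ) (sweep v Y Z t) 0 j
  rw [h.sweep_v, sweep_of_Z_eq_zero (h.cross_Z 0 j)] at h1
  linarith

lemma sweep_u_neg (h : Frame m q v u X Y Z r φ κ) {j : Fin 2} :
    sweep v Y Z t (u j) < 0 ↔ Y (crossPt κ v u 0 j) < t := by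
  rw [← sub_neg (a := Y _), ← h.sweep_u, mul_neg_iff]
  have := h.κ_pos
  constructor
  · exact fun h1 => Or.inl ⟨this, h1⟩
  · rintro (h1 | h1)
    · exact h1.2
    · exact absurd h1.1 this.not_gt

lemma sweep_u_pos (h : Frame m q v u X Y Z r φ κ) {j : Fin 2} :
    0 < sweep v Y Z t (u j) ↔ t < Y (crossPt κ v u 0 j) := by
  rw [← sub_pos (a := Y _), ← h.sweep_u, mul_pos_iff_of_pos_left h.κ_pos]

lemma Z_lt (h : Frame m q v u X Y Z r φ κ) {w : Euc 3} (hw : w ∈ vertexFinset q v u)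
    (hne : ∀ i, w ≠ v i) : Z w < Z (v 0) := by
  rcases mem_vertexFinset.1 hw with ⟨k, rfl⟩ | ⟨i, rfl⟩ | ⟨j, rfl⟩
  · rw [h.qZ]; exact h.vZ_pos
  · exact absurd rfl (hne i)
  · exact (h.uZ_neg' j).trans h.vZ_pos

/-- The simplex of a wedge is entered from the midpoint of the edge in the direction of the
half-plane. -/
lemma midpoint_mem_upSet (h : Frame m q v u X Y Z r φ κ)
    (hσ : IsFullSimplexIn (vertexFinset q v u : Set (Euc 3)) σ) (hw : Wedge v Y Z σ t) {e : Euc 3}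
    (he : (sweep v Y Z t).linear e = 0) (heZ : Z.linear e < 0) :
    (1 / 2 : ℝ) • v 0 + (1 / 2 : ℝ) • v 1 ∈ upSet e σ := by
  obtain ⟨hv, ⟨a, ha, ha0⟩, ⟨b, hb, hb0⟩⟩ := hw
  have hv01 : v 0 ≠ v 1 := fun he => by simpa using h.v_inj he
  have hav : ∀ i, a ≠ v i := fun i he => by rw [he, h.sweep_v] at ha0; exact lt_irrefl _ ha0
  have hbv : ∀ i, b ≠ v i := fun i he => by rw [he, h.sweep_v] at hb0; exact lt_irrefl _ hb0
  have hab : a ≠ b := fun he => by rw [he] at ha0; linarith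
  have hV := hasVerts_of_mem hσ (hv 0) (hv 1) ha hb hv01 (hav 0).symm (hbv 0).symm (hav 1).symm
    (hbv 1).symm hab
  obtain ⟨lam, hl⟩ := hσ.exists_bary
  -- derivatives in the direction `e` of functions constant on the edge are determined by those of
  -- the barycentric coordinates at `a` and `b`
  have key : ∀ f : Euc 3 →ᵃ[ℝ] ℝ, f (v 1) = f (v 0) → f.linear e =
      (lam a).linear e * (f a - f (v 0)) + (lam b).linear e * (f b - f (v 0)) := by
    intro f hf
    have hd : ∀ g : Euc 3 →ᵃ[ℝ] ℝ, g.linear e = g (v 0 + e) - g (v 0) := fun g => by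
      rw [← affine_linear_sub, add_sub_cancel_left]
    have hsum : ∀ p, lam (v 0) p + lam (v 1) p + lam a p + lam b p = 1 ∧
        lam (v 0) p * f (v 0) + lam (v 1) p * f (v 1) + lam a p * f a + lam b p * f b = f p := by
      intro p
      have hσe : σ = {v 0, v 1, a, b} := by
        ext w; rw [hV w]; simp
      have h1 := hl.sum p
      have h2 := hl.affine_eq f p
      rw [hσe, Finset.sum_insert (by simp [hv01, (hav 0).symm, (hbv 0).symm]),
        Finset.sum_insert (by simp [(hav 1).symm, (hbv 1).symm]), Finset.sum_pair hab] at h1 h2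
      exact ⟨by linarith, by linarith⟩
    obtain ⟨h1, h2⟩ := hsum (v 0 + e)
    obtain ⟨h3, h4⟩ := hsum (v 0)
    rw [hd, hd, hd, ← h2]
    have h5 : lam (v 0) (v 0) = 1 := hl.self _ (hv 0)
    have h6 : lam a (v 0) = 0 := hl.other a ha _ (hv 0) (hav 0).symm
    have h7 : lam b (v 0) = 0 := hl.other b hb _ (hv 0) (hbv 0).symm
    rw [h6, h7, hf]
    linear_combination (f (v 0)) * h1
  have k1 := key (sweep v Y Z t) (by rw [h.sweep_v, h.sweep_v])
  have k2 := key Z h.vZ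
  rw [he, h.sweep_v, sub_zero, sub_zero] at k1
  have hZa := h.Z_lt (hσ.subset ha) hav
  have hZb := h.Z_lt (hσ.subset hb) hbv
  set α := (lam a).linear e
  set β := (lam b).linear e
  -- the half-plane passes between `a` and `b`, and both are below the edge, so that neither
  -- coordinate can decrease
  have hα : 0 < α := by
    by_contra hcon
    have h1 : 0 ≤ α * sweep v Y Z t a := mul_nonneg_of_nonpos_of_nonpos (not_lt.1 hcon) ha0.le
    have h2 : β ≤ 0 := by
      by_contra hc
      have := mul_pos (not_le.1 hc) hb0
      linarith
    have := mul_nonneg_of_nonpos_of_nonpos (not_lt.1 hcon) (sub_neg.2 hZa).le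
    have := mul_nonneg_of_nonpos_of_nonpos h2 (sub_neg.2 hZb).le
    linarith
  have hβ : 0 < β := by
    have := mul_neg_of_pos_of_neg hα ha0
    by_contra hc
    have := mul_nonpos_of_nonpos_of_nonneg (not_lt.1 hc) hb0.le
    linarith
  refine hl.eventually_mem_interior fun w hw => ?_
  have hval : lam w ((1 / 2 : ℝ) • v 0 + (1 / 2 : ℝ) • v 1) =
      1 / 2 * lam w (v 0) + 1 / 2 * lam w (v 1) := affine_comb₂ _ _ _ (by norm_num)
  rcases (hV w).1 hw with rfl | rfl | rfl | rfl
  · left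
    rw [hval, hl.self _ hw, hl.other _ hw _ (hv 1) hv01.symm]; norm_num
  · left
    rw [hval, hl.self _ hw, hl.other _ hw _ (hv 0) hv01]; norm_num
  · right
    exact ⟨by rw [hval, hl.other _ hw _ (hv 0) (hav 0).symm,
      hl.other _ hw _ (hv 1) (hav 1).symm]; norm_num, hα⟩
  · right
    exact ⟨by rw [hval, hl.other _ hw _ (hv 0) (hbv 0).symm,
      hl.other _ hw _ (hv 1) (hbv 1).symm]; norm_num, hβ⟩

/-- Each half-plane at the edge runs inside at most one tetrahedron of a dissection. -/
lemma wedge_unique (h : Frame m q v u X Y Z r φ κ)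
    (hT : IsDissection (vertexFinset q v u : Set (Euc 3)) T) (hσ : σ ∈ T) (hτ : τ ∈ T)
    (hwσ : Wedge v Y Z σ t) (hwτ : Wedge v Y Z τ t) : σ = τ := by
  obtain ⟨a, ha, ha0⟩ := hwσ.neg
  obtain ⟨b, hb, hb0⟩ := hwσ.pos
  have hZ : ∀ w ∈ σ, sweep v Y Z t w ≠ 0 → Z w < Z (v 0) := fun w hw hw0 =>
    h.Z_lt ((hT.simplex σ hσ).subset hw) fun i he => hw0 (by rw [he, h.sweep_v])
  obtain ⟨s, ⟨x, y, hx, hy, hxy, rfl⟩, hs0⟩ :=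
    exists_openSegment_eq (sweep v Y Z t) (a := a) (b := b) (c := 0) (Or.inl ⟨ha0, hb0⟩)
  have he : (sweep v Y Z t).linear (x • a + y • b - v 0) = 0 := by
    rw [affine_linear_sub, hs0, h.sweep_v, sub_zero]
  have heZ : Z.linear (x • a + y • b - v 0) < 0 := by
    rw [affine_linear_sub, affine_comb₂ _ _ _ hxy]
    have h1 := mul_lt_mul_of_pos_left (hZ a ha ha0.ne) hx
    have h2 := mul_lt_mul_of_pos_left (hZ b hb hb0.ne') hy
    have h3 : x * Z (v 0) + y * Z (v 0) = Z (v 0) := by rw [← add_mul, hxy, one_mul]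
    linarith
  exact hT.eq_of_mem_upSet hσ hτ (h.midpoint_mem_upSet (hT.simplex σ hσ) hwσ he heZ)
    (h.midpoint_mem_upSet (hT.simplex τ hτ) hwτ he heZ)

/-- A half-plane at the edge that contains no other vertex runs inside some tetrahedron. The points
of the half-plane near the midpoint of the edge are covered by a tetrahedron, which then contains
the midpoint and so the edge. -/
lemma exists_wedge (h : Frame m q v u X Y Z r φ κ)
    (hT : IsDissection (vertexFinset q v u : Set (Euc 3)) T) {k l : Fin m} (hk : Y (q k) < t)
    (hl : t < Y (q l)) (hq : ∀ k, Y (q k) ≠ t) (hu : ∀ j, Y (crossPt κ v u 0 j) ≠ t) :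
    ∃ σ ∈ T, Wedge v Y Z σ t := by
  classical
  obtain ⟨s, hs, hs0⟩ := exists_openSegment_eq Y (Or.inl ⟨hk, hl⟩)
  have hsQ : s ∈ convexHull ℝ (range q) :=
    (convex_convexHull ℝ _).segment_subset (subset_convexHull ℝ _ (mem_range_self k))
      (subset_convexHull ℝ _ (mem_range_self l)) (openSegment_subset_segment ℝ _ _ hs)
  have hsZ : Z s = 0 := h.hull_Z hsQ
  set c := (1 / 2 : ℝ) • v 0 + (1 / 2 : ℝ) • v 1 with hc
  have hcA : c ∈ convexHull ℝ (vertexFinset q v u : Set (Euc 3)) :=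
    (convex_convexHull ℝ _) (subset_convexHull ℝ _ (v_mem 0)) (subset_convexHull ℝ _ (v_mem 1))
      (by norm_num) (by norm_num) (by norm_num)
  have hcf : ∀ f : Euc 3 →ᵃ[ℝ] ℝ, f c = 1 / 2 * f (v 0) + 1 / 2 * f (v 1) := fun f =>
    affine_comb₂ _ _ _ (by norm_num)
  have hcZ : Z c = Z (v 0) := by rw [hcf, h.vZ]; ring
  have hcL : sweep v Y Z t c = 0 := by rw [hcf, h.sweep_v, h.sweep_v]; ring
  have hev : ∀ᶠ x in 𝓝[>] (0 : ℝ), ∃ σ ∈ T, c + x • (s - c) ∈ convexHull ℝ (σ : Set (Euc 3)) := by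
    filter_upwards [Ioo_mem_nhdsGT (show (0 : ℝ) < 1 by norm_num)] with x hx
    have : c + x • (s - c) ∈ convexHull ℝ (vertexFinset q v u : Set (Euc 3)) := by
      have := (convex_convexHull ℝ _) hcA (hull_subset q v u hsQ) (a := 1 - x) (b := x)
        (by linarith [hx.2]) hx.1.le (by ring)
      convert this using 1; module
    rw [← hT.cover] at this
    simpa using this
  -- one of the finitely many tetrahedra contains points arbitrarily near the midpoint
  have hfr : ∃ σ ∈ T, ∃ᶠ x in 𝓝[>] (0 : ℝ), c + x • (s - c) ∈ convexHull ℝ (σ : Set (Euc 3)) := by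
    by_contra hcon
    push Not at hcon
    have : ∀ᶠ x in 𝓝[>] (0 : ℝ), ∀ σ ∈ T, c + x • (s - c) ∉ convexHull ℝ (σ : Set (Euc 3)) :=
      (Filter.eventually_all_finset T).2 fun σ hσ => hcon σ hσ
    obtain ⟨x, ⟨σ, hσ, hx⟩, hx'⟩ := (hev.and this).exists
    exact hx' σ hσ hx
  obtain ⟨σ, hσ, hx⟩ := hfr
  have hsub := (hT.simplex σ hσ).subset
  have hcσ : c ∈ convexHull ℝ (σ : Set (Euc 3)) := by
    have hcl : IsClosed (convexHull ℝ (σ : Set (Euc 3))) :=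
      (σ.finite_toSet.isCompact_convexHull (𝕜 := ℝ)).isClosed
    have hlim : Tendsto (fun x : ℝ => c + x • (s - c)) (𝓝[>] 0) (𝓝 c) := by
      have : Continuous fun x : ℝ => c + x • (s - c) := by fun_prop
      simpa using (this.tendsto 0).mono_left nhdsWithin_le_nhds
    exact hcl.mem_of_frequently_of_tendsto hx hlim
  -- the midpoint of the edge is in the face of `σ` of maximal height, whose vertices are ends of
  -- the edge
  have hvσ : ∀ i, v i ∈ σ := by
    intro i
    by_contra hi
    have hle : ∀ w ∈ σ, Z w ≤ Z (v 0) := fun w hw => by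
      by_cases hwv : ∃ i, w = v i
      · obtain ⟨i, rfl⟩ := hwv; exact (h.vZ' i).le
      · exact (h.Z_lt (hsub hw) (not_exists.1 hwv)).le
    have hf := mem_convexHull_filter σ Z hle hcσ hcZ
    obtain ⟨i', hi'⟩ : ∃ i', ∀ k, k = i ∨ k = i' := by
      fin_cases i
      · exact ⟨1, fun k => by fin_cases k <;> simp⟩
      · exact ⟨0, fun k => by fin_cases k <;> simp⟩
    have hX : ∀ w ∈ ((σ.filter fun w => Z w = Z (v 0) : Finset (Euc 3)) : Set (Euc 3)),
        X w = X (v i') := by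
      intro w hw
      obtain ⟨hwσ, hwZ⟩ := Finset.mem_filter.1 (Finset.mem_coe.1 hw)
      by_cases hwv : ∃ i, w = v i
      · obtain ⟨k, rfl⟩ := hwv
        rcases hi' k with rfl | rfl
        · exact absurd hwσ hi
        · rfl
      · exact absurd hwZ (h.Z_lt (hsub hwσ) (not_exists.1 hwv)).ne
    have h1 := affine_convexHull_le X (fun w hw => (hX w hw).le) hf
    have h2 := affine_le_convexHull X (fun w hw => (hX w hw).ge) hf
    have h3 := hcf X
    have h4 := h.vX
    rcases hi' 0 with h5 | h5 <;> rcases hi' 1 with h6 | h6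
    · rw [← h6] at h5; simp at h5
    · rw [← h6] at h1 h2; exact h4 (by linarith)
    · rw [← h5] at h1 h2; exact h4 (by linarith)
    · rw [← h6] at h5; simp at h5
  have hL0 : ∀ w ∈ σ, (∀ i, w ≠ v i) → sweep v Y Z t w ≠ 0 := by
    intro w hw hwv
    rcases mem_vertexFinset.1 (hsub hw) with ⟨k, rfl⟩ | ⟨i, rfl⟩ | ⟨j, rfl⟩
    · rw [h.sweep_q]; exact sub_ne_zero.2 (hq k)
    · exact absurd rfl (hwv i)
    · intro h0
      have := h.sweep_u (t := t) j
      rw [h0, mul_zero] at this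
      exact hu j (by linarith)
  obtain ⟨x, hxσ, hx0⟩ := (hx.and_eventually self_mem_nhdsWithin).exists
  obtain ⟨lam, hlam⟩ := (hT.simplex σ hσ).exists_bary
  have hpos := (hlam.hull _).1 hxσ
  have hLp : sweep v Y Z t (c + x • (s - c)) = 0 := by
    rw [affine_add_smul, affine_linear_sub, hcL, sweep_of_Z_eq_zero hsZ, hs0]; ring
  have hZp : Z (c + x • (s - c)) < Z (v 0) := by
    rw [affine_add_smul, affine_linear_sub, hcZ, hsZ]
    have := mul_pos (show (0 : ℝ) < x from hx0) h.vZ_pos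
    linarith
  have hsumL := hlam.affine_eq (sweep v Y Z t) (c + x • (s - c))
  have hsumZ := hlam.affine_eq Z (c + x • (s - c))
  rw [hLp] at hsumL
  -- if all other vertices were on one side of the half-plane, a point of it in `σ` would be on the
  -- edge
  have key : (∀ w ∈ σ, 0 ≤ lam w (c + x • (s - c)) * sweep v Y Z t w) ∨
      (∀ w ∈ σ, lam w (c + x • (s - c)) * sweep v Y Z t w ≤ 0) → False := by
    intro hor
    have hz : ∀ w ∈ σ, lam w (c + x • (s - c)) * sweep v Y Z t w = 0 := by
      rcases hor with h1 | h1
      · exact (Finset.sum_eq_zero_iff_of_nonneg h1).1 hsumL.symm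
      · exact (Finset.sum_eq_zero_iff_of_nonpos h1).1 hsumL.symm
    have hz' : ∀ w ∈ σ, lam w (c + x • (s - c)) * Z w = lam w (c + x • (s - c)) * Z (v 0) := by
      intro w hw
      by_cases hwv : ∃ i, w = v i
      · obtain ⟨i, rfl⟩ := hwv; rw [h.vZ']
      · rw [(mul_eq_zero.1 (hz w hw)).resolve_right (hL0 w hw (not_exists.1 hwv)), zero_mul,
          zero_mul]
    rw [Finset.sum_congr rfl hz', ← Finset.sum_mul, hlam.sum, one_mul] at hsumZ
    exact hZp.ne hsumZ
  refine ⟨σ, hσ, hvσ, ?_, ?_⟩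
  · by_contra hcon
    push Not at hcon
    exact key (Or.inl fun w hw => mul_nonneg (hpos w hw) (hcon w hw))
  · by_contra hcon
    push Not at hcon
    exact key (Or.inr fun w hw => mul_nonpos_of_nonneg_of_nonpos (hpos w hw) (hcon w hw))

/-- A simplex with the edge `v 0`, `v 1` that meets the plane of the polygon at the height of the
crossing points on `u j`, without containing `u j`, does so strictly between these points: the
segments from `u j` to `v 0` and `v 1` are edges of the triangulation and cannot be crossed. -/
lemma mul_neg_of_mem (h : Frame m q v u X Y Z r φ κ)
    (hT : IsTriangulation (vertexFinset q v u : Set (Euc 3)) T) (hσ : σ ∈ T) {i i' j : Fin 2}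
    (hii : i ≠ i') (hi' : v i' ∈ σ) (hj : u j ∉ σ) (hij : (i, j) ∈ usedPairs T v u) {w : Euc 3}
    (hw : w ∈ convexHull ℝ (σ : Set (Euc 3))) (hwZ : Z w = 0)
    (hwY : Y w = Y (crossPt κ v u 0 j)) :
    (X w - X (crossPt κ v u i j)) * (X (v i) - X (v i')) < 0 := by
  by_contra hcon
  obtain ⟨τ, hτ, hiτ, hjτ⟩ := mem_usedPairs.1 hij
  have hD : X (v i) - X (v i') ≠ 0 := by
    refine sub_ne_zero.2 fun he => hii (h.v_inj (h.inj _ _ he ?_ ?_))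
    · rw [h.vY', h.vY' i']
    · rw [h.vZ', h.vZ' i']
  set d := (X w - X (crossPt κ v u i j)) / (X (v i) - X (v i')) with hd
  have hd0 : 0 ≤ d := by
    have : d = (X w - X (crossPt κ v u i j)) * (X (v i) - X (v i')) /
        (X (v i) - X (v i')) ^ 2 := by rw [hd]; field_simp
    rw [this]
    exact div_nonneg (not_lt.1 hcon) (sq_nonneg _)
  have hdX : d * (X (v i) - X (v i')) = X w - X (crossPt κ v u i j) := div_mul_cancel₀ _ hD
  have e : w = crossPt κ v u i j + d • (v i - v i') := by
    refine h.inj _ _ ?_ ?_ ?_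
    · rw [affine_add_smul, affine_linear_sub]; linarith
    · rw [affine_add_smul, affine_linear_sub, hwY, h.cross_Y i, h.vY', h.vY' i']; ring
    · rw [affine_add_smul, affine_linear_sub, hwZ, h.cross_Z, h.vZ', h.vZ' i']; ring
  have hκ := h.κ_pos
  have hκ1 := h.κ_lt_one
  have h1d : 0 < 1 + d := by linarith
  -- beyond the crossing point, the segment from the point `w` to `v i'` would meet the edge from
  -- `v i` to `u j`
  refine hj (hT.mem_of_openSegment hτ hσ hiτ hjτ
    (s := ((1 - κ + d) / (1 + d)) • v i + (κ / (1 + d)) • u j)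
    ⟨_, _, div_pos (by linarith) h1d, div_pos hκ h1d, by field_simp; ring, rfl⟩ ?_).2
  have := (convex_convexHull ℝ _) hw (subset_convexHull ℝ _ hi') (a := 1 / (1 + d))
    (b := d / (1 + d)) (by positivity) (by positivity) (by field_simp)
  convert this using 1
  rw [e, crossPt]
  match_scalars <;> field_simp
  ring

end Frame

/-! ### Counting the tetrahedra at the two edges -/

/-- The gaps between consecutive heights of vertices that lie below some tetrahedron having the
edge `v 0`, `v 1` and two vertices of the polygon. -/
noncomputable def edgeGaps {m : ℕ} (T : Finset (Finset (Euc 3))) (q : Fin m → Euc 3)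
    (v u : Fin 2 → Euc 3) (p : ℕ → Fin m) : Finset ℕ := by
  classical
  exact (Finset.range (m - 1)).filter fun t => ∃ σ ∈ edgeTets T v u, ∃ a b, a ≤ t ∧ t < b ∧
    b < m ∧ q (p a) ∈ σ ∧ q (p b) ∈ σ

/-- The gaps whose ends both belong to one tetrahedron having the edge `v 0`, `v 1` and two
vertices of the polygon. -/
noncomputable def edgeSteps {m : ℕ} (T : Finset (Finset (Euc 3))) (q : Fin m → Euc 3)
    (v u : Fin 2 → Euc 3) (p : ℕ → Fin m) : Finset ℕ := by
  classical
  exact (Finset.range (m - 1)).filter fun t => ∃ σ ∈ edgeTets T v u,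
    q (p t) ∈ σ ∧ q (p (t + 1)) ∈ σ

section

variable {m : ℕ} {q : Fin m → Euc 3} {v u : Fin 2 → Euc 3} {X Y Z x y : Euc 3 →ᵃ[ℝ] ℝ}
  {r φ κ α : ℝ} {p : ℕ → Fin m} {σ : Finset (Euc 3)} {T : Finset (Finset (Euc 3))} {t : ℕ}

lemma mem_edgeGaps : t ∈ edgeGaps T q v u p ↔ t < m - 1 ∧ ∃ σ ∈ edgeTets T v u, ∃ a b, a ≤ t ∧
    t < b ∧ b < m ∧ q (p a) ∈ σ ∧ q (p b) ∈ σ := by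
  simp [edgeGaps]

lemma mem_edgeSteps : t ∈ edgeSteps T q v u p ↔ t < m - 1 ∧ ∃ σ ∈ edgeTets T v u,
    q (p t) ∈ σ ∧ q (p (t + 1)) ∈ σ := by
  simp [edgeSteps]

lemma card_edgeGaps_le : (edgeGaps T q v u p).card ≤ m - 1 := by
  have : edgeGaps T q v u p ⊆ Finset.range (m - 1) := fun t ht =>
    Finset.mem_range.2 (mem_edgeGaps.1 ht).1
  simpa using Finset.card_le_card this

namespace Frame

lemma wedge_of_gap (h : Frame m q v u X Y Z r φ κ) (hz : Zigzag m q x Y r α p)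
    (hv : ∀ i, v i ∈ σ) {a b : ℕ} (ha : q (p a) ∈ σ) (hb : q (p b) ∈ σ) (hat : a ≤ t)
    (htb : t < b) (hbm : b < m) {s : ℝ} (hs : Y (q (p (t + 1))) < s) (hs' : s < Y (q (p t))) :
    Wedge v Y Z σ s := by
  refine ⟨hv, ⟨_, hb, ?_⟩, ⟨_, ha, ?_⟩⟩
  · rw [h.sweep_q]
    rcases (show t + 1 ≤ b from htb).eq_or_lt with rfl | h1
    · linarith
    · linarith [hz.y_lt h.r_pos h1 hbm]
  · rw [h.sweep_q]
    rcases hat.eq_or_lt with rfl | h1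
    · linarith
    · linarith [hz.y_lt h.r_pos h1 (by omega)]

lemma notMem_edgeGaps (h : Frame m q v u X Y Z r φ κ) (hz : Zigzag m q x Y r α p)
    (hT : IsDissection (vertexFinset q v u : Set (Euc 3)) T) (hσ : σ ∈ T) {j : Fin 2}
    (hj : u j ∈ σ) {s : ℝ} (hw : Wedge v Y Z σ s) (hs : Y (q (p (t + 1))) < s)
    (hs' : s < Y (q (p t))) : t ∉ edgeGaps T q v u p := by
  intro ht
  obtain ⟨_, τ, hτ, a, b, hat, htb, hbm, ha, hb⟩ := mem_edgeGaps.1 ht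
  obtain ⟨hτT, ⟨h0, h1⟩, hu⟩ := mem_edgeTets.1 hτ
  have := h.wedge_unique hT hσ hτT hw (h.wedge_of_gap hz (fun i => by fin_cases i <;> assumption)
    ha hb hat htb hbm hs hs')
  exact hu ⟨j, this ▸ hj⟩

/-- A tetrahedron with two vertices of the polygon at the edge lies over at least two gaps, unless
these vertices are consecutive in the zigzag. -/
lemma two_mul_card_edgeTets (h : Frame m q v u X Y Z r φ κ) (hz : Zigzag m q x Y r α p)
    (hT : IsDissection (vertexFinset q v u : Set (Euc 3)) T) :
    2 * (edgeTets T v u).card ≤ (edgeGaps T q v u p).card + (edgeSteps T q v u p).card := by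
  classical
  set G : Finset (Euc 3) → Finset ℕ := fun σ => (Finset.range (m - 1)).filter fun t =>
    ∃ a b, a ≤ t ∧ t < b ∧ b < m ∧ q (p a) ∈ σ ∧ q (p b) ∈ σ with hG
  set S : Finset (Euc 3) → Finset ℕ := fun σ => (Finset.range (m - 1)).filter fun t =>
    q (p t) ∈ σ ∧ q (p (t + 1)) ∈ σ with hS
  have hSG : ∀ σ, S σ ⊆ G σ := by
    intro σ t ht
    simp only [hS, hG, Finset.mem_filter, Finset.mem_range] at ht ⊢
    exact ⟨ht.1, t, t + 1, le_rfl, by omega, by omega, ht.2⟩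
  have hdis : ∀ σ ∈ edgeTets T v u, ∀ τ ∈ edgeTets T v u, σ ≠ τ → Disjoint (G σ) (G τ) := by
    intro σ hσ τ hτ hne
    rw [Finset.disjoint_left]
    intro t h1 h2
    simp only [hG, Finset.mem_filter, Finset.mem_range] at h1 h2
    obtain ⟨htm, a, b, hat, htb, hbm, ha, hb⟩ := h1
    obtain ⟨_, a', b', hat', htb', hbm', ha', hb'⟩ := h2
    obtain ⟨s, hs, hs'⟩ := exists_between (hz.y_lt h.r_pos (Nat.lt_succ_self t) (by omega))
    obtain ⟨hσT, ⟨h0, h1⟩, -⟩ := mem_edgeTets.1 hσ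
    obtain ⟨hτT, ⟨h2, h3⟩, -⟩ := mem_edgeTets.1 hτ
    exact hne (h.wedge_unique hT hσT hτT
      (h.wedge_of_gap hz (fun i => by fin_cases i <;> assumption) ha hb hat htb hbm hs hs')
      (h.wedge_of_gap hz (fun i => by fin_cases i <;> assumption) ha' hb' hat' htb' hbm' hs hs'))
  have h2 : ∀ σ ∈ edgeTets T v u, 2 ≤ (G σ).card + (S σ).card := by
    intro σ hσ
    obtain ⟨c, d, hV⟩ := h.cell_of_mem_edgeTets hT hσ
    obtain ⟨a, ha, rfl⟩ := hz.p_surj h.r_pos c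
    obtain ⟨b, hb, rfl⟩ := hz.p_surj h.r_pos d
    have hab : a ≠ b := by
      rintro rfl
      exact (hV.ne_first (hT.simplex σ (mem_edgeTets.1 hσ).1)).1 rfl
    have key : ∀ a b : ℕ, a < b → b < m → q (p a) ∈ σ → q (p b) ∈ σ →
        2 ≤ (G σ).card + (S σ).card := by
      intro a b hab hb h1 h2
      have hGa : a ∈ G σ := by
        simp only [hG, Finset.mem_filter, Finset.mem_range]
        exact ⟨by omega, a, b, le_rfl, hab, hb, h1, h2⟩
      rcases (show a + 1 ≤ b from hab).eq_or_lt with rfl | h3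
      · have : a ∈ S σ := by
          simp only [hS, Finset.mem_filter, Finset.mem_range]
          exact ⟨by omega, h1, h2⟩
        have := Finset.card_pos.2 ⟨a, this⟩
        have := Finset.card_pos.2 ⟨a, hGa⟩
        omega
      · have : a + 1 ∈ G σ := by
          simp only [hG, Finset.mem_filter, Finset.mem_range]
          exact ⟨by omega, a, b, by omega, h3, hb, h1, h2⟩
        have := Finset.one_lt_card.2 ⟨a, hGa, a + 1, this, by omega⟩
        omega
    have hqa : q (p a) ∈ σ := hV.mem_first
    have hqb : q (p b) ∈ σ := hV.rotate.mem_first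
    rcases lt_or_gt_of_ne hab with h3 | h3
    · exact key a b h3 hb hqa hqb
    · exact key b a h3 ha hqb hqa
  have h3 : (edgeTets T v u).biUnion G ⊆ edgeGaps T q v u p := by
    intro t ht
    simp only [Finset.mem_biUnion, hG, Finset.mem_filter, Finset.mem_range] at ht
    obtain ⟨σ, hσ, h4, h5⟩ := ht
    exact mem_edgeGaps.2 ⟨h4, σ, hσ, h5⟩
  have h4 : (edgeTets T v u).biUnion S ⊆ edgeSteps T q v u p := by
    intro t ht
    simp only [Finset.mem_biUnion, hS, Finset.mem_filter, Finset.mem_range] at ht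
    obtain ⟨σ, hσ, h4, h5⟩ := ht
    exact mem_edgeSteps.2 ⟨h4, σ, hσ, h5⟩
  calc 2 * (edgeTets T v u).card = ∑ σ ∈ edgeTets T v u, 2 := by simp [mul_comm]
    _ ≤ ∑ σ ∈ edgeTets T v u, ((G σ).card + (S σ).card) := Finset.sum_le_sum h2
    _ = ((edgeTets T v u).biUnion G).card + ((edgeTets T v u).biUnion S).card := by
      rw [Finset.sum_add_distrib, Finset.card_biUnion hdis, Finset.card_biUnion
        fun σ hσ τ hτ hne => (hdis σ hσ τ hτ hne).mono (hSG σ) (hSG τ)]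
    _ ≤ _ := add_le_add (Finset.card_le_card h3) (Finset.card_le_card h4)

/-- Perpendicular chords of the two zigzags that cross cannot both be edges of a triangulation. -/
lemma edgeSteps_exclusive {ε ε' α' : ℝ} {p' : ℕ → Fin m} (h : Frame m q v u X Y Z r φ κ)
    (hT : IsTriangulation (vertexFinset q v u : Set (Euc 3)) T) (hε : ε = 1 ∨ ε = -1)
    (hz : Zigzag m q (ε • X) Y r α p) (hz' : Zigzag m q (ε' • Y) (-X) r α' p')
    (hrel : (Even (m / 2) ∧ ε' = ε ∧ α' = α) ∨
      (¬ Even (m / 2) ∧ ε' = -ε ∧ α' = Real.pi / m - α)) {t t' : ℕ}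
    (ht : t ∈ edgeSteps T q v u p) (ht' : t' ∈ edgeSteps T q u v p')
    (hpar : Even (t + t' + m / 2))
    (hlt : |2 * ((t + 1 : ℕ) : ℤ) - m| + |2 * ((t' + 1 : ℕ) : ℤ) - m| < m) : False := by
  obtain ⟨htm, σ, hσ, h1, h2⟩ := mem_edgeSteps.1 ht
  obtain ⟨htm', τ, hτ, h3, h4⟩ := mem_edgeSteps.1 ht'
  obtain ⟨⟨s, hs, hs'⟩, hne, hne'⟩ := h.exists_cross hε hz hz' hrel (by omega) (by omega) hpar hlt
  have hσT := (mem_edgeTets.1 hσ).1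
  have hτT := (mem_edgeTets.1 hτ).1
  have hsσ : s ∈ convexHull ℝ (σ : Set (Euc 3)) :=
    (convex_convexHull ℝ _).segment_subset (subset_convexHull ℝ _ h1) (subset_convexHull ℝ _ h2)
      (openSegment_subset_segment ℝ _ _ hs)
  have h5 := (hT.mem_of_openSegment hτT hσT h3 h4 hs' hsσ).1
  obtain ⟨c, d, hV⟩ := h.cell_of_mem_edgeTets hT.toIsDissection hσ
  have hcd : ∀ k, q k ∈ σ → k = c ∨ k = d := fun k hk => by
    rcases (hV _).1 hk with h6 | h6 | h6 | h6
    · exact Or.inl (h.q_inj h6)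
    · exact Or.inr (h.q_inj h6)
    · exact absurd h6 (h.q_ne_v _ _)
    · exact absurd h6 (h.q_ne_v _ _)
  have hpp : p t ≠ p (t + 1) := fun he => by
    have := hz.p_inj h.r_pos (by omega) (by omega) he
    omega
  rcases hcd _ h1 with h6 | h6 <;> rcases hcd _ h2 with h7 | h7 <;> rcases hcd _ h5 with h8 | h8
  all_goals
    first
      | exact hpp (h6.trans h7.symm)
      | exact hne (h8.trans h6.symm)
      | exact hne' (h8.trans h7.symm)

end Frame

end

/-! ### A matching argument -/

/-- Two sets of integers of absolute value less than `n`, such that `|a| + |b|` is at least `n`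
whenever `a` is in the first set, `b` in the second, and `a + b + n` is even. -/
structure Excl (n : ℤ) (A B : Finset ℤ) : Prop where
  bound : ∀ a ∈ A, |a| < n
  bound' : ∀ b ∈ B, |b| < n
  excl : ∀ a ∈ A, ∀ b ∈ B, Even (a + b + n) → n ≤ |a| + |b|

namespace Excl

variable {n : ℤ} {A B : Finset ℤ}

lemma neg (h : Excl n A B) : Excl n (A.image Neg.neg) B := by
  refine ⟨?_, h.bound', ?_⟩
  · simp only [Finset.mem_image]
    rintro _ ⟨a, ha, rfl⟩
    rw [abs_neg]; exact h.bound a ha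
  · simp only [Finset.mem_image]
    rintro _ ⟨a, ha, rfl⟩ b hb he
    rw [abs_neg]
    refine h.excl a ha b hb ?_
    rw [show a + b + n = -a + b + n + 2 * a by ring]
    exact he.add (even_two_mul a)

/-- Matching `a` with `a + (n - 2)` or `a - (n - 2)`, of opposite sign, shows that `A` and `B`
cannot both be large. -/
lemma card_add_card_le (h : Excl n A B) (hn : 2 ≤ n) :
    ((A.card + B.card : ℕ) : ℤ) ≤ 2 * n + 2 ∧
      (((A.card + B.card : ℕ) : ℤ) = 2 * n + 2 → n - 2 ∈ B ∧ 2 - n ∈ A ∧ 1 - n ∈ A ∧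
        ∀ a, 2 - n < a → a ≤ n - 2 → (if a < 0 then a + (n - 2) else a - (n - 2)) ∉ B →
          a ∈ A) := by
  -- `a + f a + n` is even and `|a| + |f a| = n - 2`, so that `a` and `f a` exclude each other;
  -- at most three elements of each set are not taken into account by this matching
  set f : ℤ → ℤ := fun a => if a < 0 then a + (n - 2) else a - (n - 2) with hf
  set I := Finset.Ioc (2 - n) (n - 2) with hI
  set J := Finset.Ico (2 - n) (n - 2) with hJ
  have hfJ : ∀ a ∈ I, f a ∈ J := by
    intro a ha
    simp only [hI, hJ, hf, Finset.mem_Ioc, Finset.mem_Ico] at ha ⊢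
    split_ifs <;> omega
  have hfi : Set.InjOn f I := by
    intro a ha b hb hab
    simp only [hI, hf, Finset.coe_Ioc, Set.mem_Ioc] at ha hb hab
    split_ifs at hab <;> omega
  have hdis : Disjoint ((A ∩ I).image f) (B ∩ J) := by
    rw [Finset.disjoint_left]
    intro b hb hb'
    obtain ⟨a, ha, rfl⟩ := Finset.mem_image.1 hb
    obtain ⟨haA, haI⟩ := Finset.mem_inter.1 ha
    have hbB := (Finset.mem_inter.1 hb').1
    simp only [hI, Finset.mem_Ioc] at haI
    have key : Even (a + f a + n) ∧ |a| + |f a| = n - 2 := by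
      simp only [hf]
      split_ifs with h0
      · rw [abs_of_neg h0, abs_of_nonneg (by omega)]
        exact ⟨⟨a + n - 1, by ring⟩, by ring⟩
      · rw [abs_of_nonneg (by omega), abs_of_nonpos (by omega)]
        exact ⟨⟨a + 1, by ring⟩, by ring⟩
    have := h.excl a haA _ hbB key.1
    omega
  have hsub : (A ∩ I).image f ∪ (B ∩ J) ⊆ J := by
    apply Finset.union_subset
    · intro b hb
      obtain ⟨a, ha, rfl⟩ := Finset.mem_image.1 hb
      exact hfJ a (Finset.mem_inter.1 ha).2
    · exact Finset.inter_subset_right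
  have hcard : ((A ∩ I).image f ∪ (B ∩ J)).card = (A ∩ I).card + (B ∩ J).card := by
    rw [Finset.card_union_of_disjoint hdis, Finset.card_image_of_injOn
      (hfi.mono (by simp))]
  have hJc : (J.card : ℤ) = 2 * n - 4 := by
    rw [hJ, Int.card_Ico_of_le _ _ (by omega)]; ring
  have hle := Finset.card_le_card hsub
  rw [hcard] at hle
  have hA : A \ I ⊆ {1 - n, 2 - n, n - 1} := by
    intro a ha
    obtain ⟨h1, h2⟩ := Finset.mem_sdiff.1 ha
    have := abs_lt.1 (h.bound a h1)
    simp only [hI, Finset.mem_Ioc, Finset.mem_insert, Finset.mem_singleton] at h2 ⊢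
    omega
  have hB : B \ J ⊆ {1 - n, n - 2, n - 1} := by
    intro a ha
    obtain ⟨h1, h2⟩ := Finset.mem_sdiff.1 ha
    have := abs_lt.1 (h.bound' a h1)
    simp only [hJ, Finset.mem_Ico, Finset.mem_insert, Finset.mem_singleton] at h2 ⊢
    omega
  have hA3 := Finset.card_le_card hA
  have hB3 := Finset.card_le_card hB
  have h3A : ({1 - n, 2 - n, n - 1} : Finset ℤ).card ≤ 3 := Finset.card_le_three
  have h3B : ({1 - n, n - 2, n - 1} : Finset ℤ).card ≤ 3 := Finset.card_le_three
  have eA := Finset.card_inter_add_card_sdiff A I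
  have eB := Finset.card_inter_add_card_sdiff B J
  refine ⟨by push_cast; omega, fun heq => ?_⟩
  push_cast at heq
  have hAe := Finset.eq_of_subset_of_card_le hA (by omega)
  have hBe := Finset.eq_of_subset_of_card_le hB (by omega)
  have hJe := Finset.eq_of_subset_of_card_le hsub (by omega)
  refine ⟨?_, ?_, ?_, ?_⟩
  · have : n - 2 ∈ B \ J := by rw [hBe]; simp
    exact (Finset.mem_sdiff.1 this).1
  · have : 2 - n ∈ A \ I := by rw [hAe]; simp
    exact (Finset.mem_sdiff.1 this).1
  · have : 1 - n ∈ A \ I := by rw [hAe]; simp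
    exact (Finset.mem_sdiff.1 this).1
  · intro a h1 h2 h3
    have haI : a ∈ I := Finset.mem_Ioc.2 ⟨h1, h2⟩
    have := hfJ a haI
    rw [← hJe, Finset.mem_union, Finset.mem_image] at this
    rcases this with ⟨b, hb, hba⟩ | hb
    · obtain ⟨hbA, hbI⟩ := Finset.mem_inter.1 hb
      rwa [← hfi hbI haI hba]
    · exact absurd (Finset.mem_inter.1 hb).1 h3

/-- In the case of equality `A` is symmetric about zero and does not contain zero. -/
lemma even_card (h : Excl n A B) (hn : 2 ≤ n)
    (heq : ((A.card + B.card : ℕ) : ℤ) = 2 * n + 2) : Even A.card := by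
  have hci : ∀ C : Finset ℤ, (C.image Neg.neg).card = C.card := fun C =>
    Finset.card_image_of_injective _ neg_injective
  have hmi : ∀ (C : Finset ℤ) (a : ℤ), a ∈ C.image Neg.neg ↔ -a ∈ C := fun C a => by
    simp only [Finset.mem_image]
    exact ⟨by rintro ⟨b, hb, rfl⟩; rwa [neg_neg], fun ha => ⟨-a, ha, neg_neg a⟩⟩
  obtain ⟨hB, hA, hA1, hA2⟩ := (h.card_add_card_le hn).2 heq
  obtain ⟨-, hA', hA1', hA2'⟩ := (h.neg.card_add_card_le hn).2 (by rw [hci]; exact heq)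
  rw [hmi] at hA' hA1'
  have h0 : (0 : ℤ) ∉ A := fun h0 => by
    have := h.excl 0 h0 _ hB ⟨n - 1, by ring⟩
    rw [abs_zero, abs_of_nonneg (by omega)] at this
    omega
  have hsymm : ∀ a ∈ A, -a ∈ A := by
    intro a ha
    have hb := abs_lt.1 (h.bound a ha)
    by_cases h1 : 2 - n < a ∧ a ≤ n - 2
    · rw [← hmi]
      refine hA2' a h1.1 h1.2 fun hcon => ?_
      split_ifs at hcon with h2
      · have := h.excl a ha _ hcon ⟨a + n - 1, by ring⟩
        rw [abs_of_neg h2, abs_of_nonneg (by omega)] at this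
        omega
      · have := h.excl a ha _ hcon ⟨a + 1, by ring⟩
        rw [abs_of_nonneg (by omega), abs_of_nonpos (by omega)] at this
        omega
    · rcases (show a = 2 - n ∨ a = 1 - n ∨ a = n - 1 by omega) with rfl | rfl | rfl
      · exact hA'
      · exact hA1'
      · rwa [show -(n - 1) = 1 - n by ring]
  have hneg : (A.filter (0 < ·)).image Neg.neg = A.filter (¬ 0 < ·) := by
    ext a
    rw [hmi, Finset.mem_filter, Finset.mem_filter]
    constructor
    · rintro ⟨h1, h2⟩
      exact ⟨by simpa using hsymm _ h1, by omega⟩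
    · rintro ⟨h1, h2⟩
      have : a ≠ 0 := fun he => h0 (he ▸ h1)
      exact ⟨hsymm _ h1, by omega⟩
  have h1 := Finset.card_filter_add_card_filter_not (s := A) (fun a => 0 < a)
  rw [← hneg, hci] at h1
  exact ⟨_, h1.symm⟩

end Excl

namespace Frame

variable {m : ℕ} {q : Fin m → Euc 3} {v u : Fin 2 → Euc 3} {X Y Z : Euc 3 →ᵃ[ℝ] ℝ}
  {r φ κ ε ε' α α' : ℝ} {p p' : ℕ → Fin m} {T : Finset (Finset (Euc 3))}

/-- The `t`-th chord of a zigzag has the signed distance `t + 1 - m / 2` from the central chord,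
counted in steps; chords of the two zigzags exclude each other in terms of these distances. -/
lemma card_edgeSteps (h : Frame m q v u X Y Z r φ κ)
    (hT : IsTriangulation (vertexFinset q v u : Set (Euc 3)) T) (hε : ε = 1 ∨ ε = -1)
    (hz : Zigzag m q (ε • X) Y r α p) (hz' : Zigzag m q (ε' • Y) (-X) r α' p')
    (hrel : (Even (m / 2) ∧ ε' = ε ∧ α' = α) ∨
      (¬ Even (m / 2) ∧ ε' = -ε ∧ α' = Real.pi / m - α)) :
    (edgeSteps T q v u p).card + (edgeSteps T q u v p').card ≤ m + 2 ∧
      ((edgeSteps T q v u p).card + (edgeSteps T q u v p').card = m + 2 →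
        Even (edgeSteps T q v u p).card) := by
  have hm4 := h.four_le
  obtain ⟨n, hn⟩ := h.even
  have hmn : m / 2 = n := by omega
  set s : ℕ → ℤ := fun t => t + 1 - n with hs
  have hsi : Function.Injective s := fun a b hab => by simp only [hs] at hab; omega
  have hb : ∀ {w w' : Fin 2 → Euc 3} {p : ℕ → Fin m}, ∀ a ∈ (edgeSteps T q w w' p).image s,
      |a| < n := by
    intro w w' p a ha
    obtain ⟨t, ht, rfl⟩ := Finset.mem_image.1 ha
    have := (mem_edgeSteps.1 ht).1
    rw [abs_lt]
    simp only [hs]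
    omega
  have hE : Excl n ((edgeSteps T q v u p).image s) ((edgeSteps T q u v p').image s) := by
    refine ⟨hb, hb, fun a ha b hb he => ?_⟩
    obtain ⟨t, ht, rfl⟩ := Finset.mem_image.1 ha
    obtain ⟨t', ht', rfl⟩ := Finset.mem_image.1 hb
    by_contra hcon
    refine h.edgeSteps_exclusive hT hε hz hz' hrel ht ht' ?_ ?_
    · rw [hmn, ← Int.even_coe_nat]
      push_cast
      rw [show (t : ℤ) + t' + n = s t + s t' + n + 2 * (n - 1) by simp only [hs]; ring]
      exact he.add (even_two_mul _)
    · have e : ∀ t : ℕ, |2 * ((t + 1 : ℕ) : ℤ) - m| = 2 * |s t| := fun t => by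
        rw [show (2 : ℤ) * |s t| = |2 * s t| by rw [abs_mul, abs_two]]
        congr 1
        simp only [hs, hn]
        push_cast; ring
      rw [e, e]
      omega
  have h1 := hE.card_add_card_le (by omega)
  have h2 := hE.even_card (by omega)
  rw [Finset.card_image_of_injective _ hsi, Finset.card_image_of_injective _ hsi] at h1 h2
  push_cast at h1 h2
  exact ⟨by omega, fun heq => h2 (by omega)⟩

/-- Every gap that lies below no tetrahedron with two vertices of the polygon saves half a
tetrahedron. -/
lemma card_edgeTets_add (h : Frame m q v u X Y Z r φ κ)
    (hT : IsTriangulation (vertexFinset q v u : Set (Euc 3)) T) (hε : ε = 1 ∨ ε = -1)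
    (hz : Zigzag m q (ε • X) Y r α p) (hz' : Zigzag m q (ε' • Y) (-X) r α' p')
    (hrel : (Even (m / 2) ∧ ε' = ε ∧ α' = α) ∨
      (¬ Even (m / 2) ∧ ε' = -ε ∧ α' = Real.pi / m - α)) :
    2 * ((edgeTets T v u).card + (edgeTets T u v).card) ≤
      (edgeGaps T q v u p).card + (edgeGaps T q u v p').card + m + 2 := by
  have h1 := h.two_mul_card_edgeTets hz hT.toIsDissection
  have h2 := h.swap.two_mul_card_edgeTets hz' (by rw [vertexFinset_swap]; exact hT.toIsDissection)
  have h3 := (h.card_edgeSteps hT hε hz hz' hrel).1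
  omega

/-- The estimate with at most `m - 1` gaps at each edge would give `3 * m`. In the extremal case the
numbers of steps are even while `m - 1` is odd, so that the bounds for both edges are rounded
down. -/
lemma card_edgeTets_le (h : Frame m q v u X Y Z r φ κ)
    (hT : IsTriangulation (vertexFinset q v u : Set (Euc 3)) T) :
    2 * ((edgeTets T v u).card + (edgeTets T u v).card) + 2 ≤ 3 * m := by
  obtain ⟨ε, ε', α, α', p, p', hε, hz, hz', hrel⟩ := h.exists_zigzags
  have h1 := h.two_mul_card_edgeTets hz hT.toIsDissection
  have h2 := h.swap.two_mul_card_edgeTets hz' (by rw [vertexFinset_swap]; exact hT.toIsDissection)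
  obtain ⟨h3, h4⟩ := h.card_edgeSteps hT hε hz hz' hrel
  have h5 : (edgeGaps T q v u p).card ≤ m - 1 := card_edgeGaps_le
  have h6 : (edgeGaps T q u v p').card ≤ m - 1 := card_edgeGaps_le
  have hm4 := h.four_le
  obtain ⟨n, hn⟩ := h.even
  by_cases heq : (edgeSteps T q v u p).card + (edgeSteps T q u v p').card = m + 2
  · obtain ⟨k, hk⟩ := h4 heq
    omega
  · omega

end Frame

/-! ### Triangulations in which all four crossing points are used -/

/-- The critical case of the bound: all four segments from a `v i` to a `u j` are edges of `T`, no
chord of the polygon that is an edge of `T` separates two crossing points, and the tetrahedron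
spanned by the two edges does not belong to `T`. -/
structure Crowded {m : ℕ} (T : Finset (Finset (Euc 3))) (q : Fin m → Euc 3) (v u : Fin 2 → Euc 3)
    (X Y : Euc 3 →ᵃ[ℝ] ℝ) (κ : ℝ) : Prop where
  used : ∀ i j, (i, j) ∈ usedPairs T v u
  noChord : ∀ ρ ∈ T, ∀ a b, q a ∈ ρ → q b ∈ ρ → ∀ i j i' j',
    0 < chordFn X Y (q a) (q b) (crossPt κ v u i j) →
      ¬ chordFn X Y (q a) (q b) (crossPt κ v u i' j') < 0
  noMid : ∀ σ ∈ T, (∀ i, v i ∈ σ) → ¬ ∀ j, u j ∈ σ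

/-- Some tetrahedron of `T` with vertices `v 0`, `v 1`, `u j` and a vertex of the polygon reaches
from the height of `u j` to that of the other end of the edge `u`, or beyond. -/
def Passes {m : ℕ} (T : Finset (Finset (Euc 3))) (q : Fin m → Euc 3) (v u : Fin 2 → Euc 3)
    (Y : Euc 3 →ᵃ[ℝ] ℝ) (κ : ℝ) : Prop :=
  ∃ σ ∈ T, ∃ c j j', j ≠ j' ∧ (∀ i, v i ∈ σ) ∧ u j ∈ σ ∧ q c ∈ σ ∧ ∃ ρ : ℝ, 0 < ρ ∧ ρ ≤ 1 ∧
    ρ * (Y (q c) - Y (crossPt κ v u 0 j)) = Y (crossPt κ v u 0 j') - Y (crossPt κ v u 0 j)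

lemma Fin.eq_or_eq_of_ne {j j' : Fin 2} (h : j ≠ j') (k : Fin 2) : k = j ∨ k = j' := by
  omega

section

variable {m : ℕ} {q : Fin m → Euc 3} {v u : Fin 2 → Euc 3} {X Y Z x : Euc 3 →ᵃ[ℝ] ℝ}
  {r φ κ α : ℝ} {p : ℕ → Fin m} {σ : Finset (Euc 3)} {T : Finset (Finset (Euc 3))} {t : ℝ}

lemma Crowded.swap (h : Crowded T q v u X Y κ) : Crowded T q u v Y (-X) (1 - κ) where
  used i j := by
    obtain ⟨σ, hσ, h1, h2⟩ := mem_usedPairs.1 (h.used j i)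
    exact mem_usedPairs.2 ⟨σ, hσ, h2, h1⟩
  noChord ρ hρ a b ha hb i j i' j' := by
    have e : ∀ w, chordFn Y (-X) (q a) (q b) w = chordFn X Y (q a) (q b) w := fun w => by
      rw [chordFn_apply, chordFn_apply]
      simp only [AffineMap.coe_neg, Pi.neg_apply]; ring
    rw [e, e, crossPt_swap, crossPt_swap]
    exact h.noChord ρ hρ a b ha hb j i j' i'
  noMid σ hσ h1 h2 := h.noMid σ hσ h2 h1

namespace Frame

lemma exists_Y_lt (h : Frame m q v u X Y Z r φ κ) (j : Fin 2) :
    (∃ k, Y (q k) < Y (crossPt κ v u 0 j)) ∧ ∃ k, Y (crossPt κ v u 0 j) < Y (q k) := by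
  have hm := h.four_le
  have hne : (⟨0, by omega⟩ : Fin m) ≠ ⟨1, by omega⟩ := by simp
  have hY : Y (q ⟨0, by omega⟩) ≠ Y (q ⟨1, by omega⟩) := fun he => hne (h.Yinj he)
  constructor
  · by_contra hcon
    push Not at hcon
    exact lt_irrefl _ (h.cross_lt 0 j (-Y) (-Y (crossPt κ v u 0 j))
      (fun k => by simpa using hcon k) ⟨_, _, by simpa using hY⟩)
  · by_contra hcon
    push Not at hcon
    exact lt_irrefl _ (h.cross_lt 0 j Y (Y (crossPt κ v u 0 j)) hcon ⟨_, _, hY⟩)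

lemma cross_Y_ne (h : Frame m q v u X Y Z r φ κ) {j j' : Fin 2} (hj : j ≠ j') :
    Y (crossPt κ v u 0 j) ≠ Y (crossPt κ v u 0 j') := by
  intro he
  rw [cross_apply, cross_apply] at he
  have hκ := h.κ_pos
  have hY : Y (u j) = Y (u j') := mul_left_cancel₀ hκ.ne' (by linarith)
  exact hj (h.u_inj (h.inj _ _ (by rw [h.uX' j, h.uX' j']) hY (by rw [h.uZ' j, h.uZ' j'])))

/-- A chord at the edge `v 0`, `v 1` that passes the height of `u j` separates the two crossing
points at this height. -/
lemma false_of_chord (h : Frame m q v u X Y Z r φ κ) (hc : Crowded T q v u X Y κ)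
    (hT : IsTriangulation (vertexFinset q v u : Set (Euc 3)) T) (hσ : σ ∈ T)
    (hv : ∀ i, v i ∈ σ) {j : Fin 2} (hj : u j ∉ σ) {a b : Fin m} (ha : q a ∈ σ) (hb : q b ∈ σ)
    (hab : Y (q a) < Y (q b)) (haj : Y (q a) ≤ Y (crossPt κ v u 0 j))
    (hbj : Y (crossPt κ v u 0 j) ≤ Y (q b)) : False := by
  set y := Y (crossPt κ v u 0 j) with hy
  have hd : 0 < Y (q b) - Y (q a) := sub_pos.2 hab
  set θ := (y - Y (q a)) / (Y (q b) - Y (q a)) with hθ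
  have hθe : θ * (Y (q b) - Y (q a)) = y - Y (q a) := div_mul_cancel₀ _ hd.ne'
  have h0 : 0 ≤ θ := div_nonneg (by linarith) hd.le
  have h1 : θ ≤ 1 := (div_le_one hd).2 (by linarith)
  set w := (1 - θ) • q a + θ • q b with hw
  have hwσ : w ∈ convexHull ℝ (σ : Set (Euc 3)) :=
    (convex_convexHull ℝ _) (subset_convexHull ℝ _ ha) (subset_convexHull ℝ _ hb) (by linarith)
      h0 (by ring)
  have hwf : ∀ f : Euc 3 →ᵃ[ℝ] ℝ, f w = (1 - θ) * f (q a) + θ * f (q b) := fun f =>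
    affine_comb₂ _ _ _ (by ring)
  have hwY : Y w = y := by rw [hwf]; linarith
  have hwZ : Z w = 0 := by rw [hwf, h.qZ, h.qZ]; ring
  have hch : ∀ i, chordFn X Y (q a) (q b) (crossPt κ v u i j) =
      -((Y (q b) - Y (q a)) * (X w - X (crossPt κ v u i j))) := by
    intro i
    have hX := hwf X
    rw [chordFn_apply, h.cross_Y i j, ← hy]
    linear_combination (Y (q b) - Y (q a)) * hX + (X (q b) - X (q a)) * hθe
  have h2 := h.mul_neg_of_mem hT hσ (show (0 : Fin 2) ≠ 1 by simp) (hv 1) hj (hc.used 0 j) hwσ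
    hwZ hwY
  have h3 := h.mul_neg_of_mem hT hσ (show (1 : Fin 2) ≠ 0 by simp) (hv 0) hj (hc.used 1 j) hwσ
    hwZ hwY
  have hpos : ∀ i, X w < X (crossPt κ v u i j) →
      0 < chordFn X Y (q a) (q b) (crossPt κ v u i j) := fun i hi => by
    rw [hch]; have := mul_pos hd (sub_pos.2 hi); linarith
  have hneg : ∀ i, X (crossPt κ v u i j) < X w →
      chordFn X Y (q a) (q b) (crossPt κ v u i j) < 0 := fun i hi => by
    rw [hch]; have := mul_pos hd (sub_pos.2 hi); linarith
  rcases mul_neg_iff.1 h2 with ⟨h4, h5⟩ | ⟨h4, h5⟩ <;>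
    rcases mul_neg_iff.1 h3 with ⟨h6, h7⟩ | ⟨h6, h7⟩
  · linarith
  · exact hc.noChord σ hσ a b ha hb 1 j 0 j (hpos 1 (by linarith)) (hneg 0 (by linarith))
  · exact hc.noChord σ hσ a b ha hb 0 j 1 j (hpos 0 (by linarith)) (hneg 1 (by linarith))
  · linarith

/-- Just beside the height of `u j`, on the side of `u j'`, the tetrahedron at the edge `v 0`,
`v 1` has one vertex on the polygon and one on the other edge. -/
lemma exists_mem_of_crowded (h : Frame m q v u X Y Z r φ κ) (hc : Crowded T q v u X Y κ)
    (hT : IsTriangulation (vertexFinset q v u : Set (Euc 3)) T) (hσ : σ ∈ T)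
    (hw : Wedge v Y Z σ t) {j j' : Fin 2} (hjj : j ≠ j')
    (hq : ∀ k, (Y (q k) - Y (crossPt κ v u 0 j)) * (t - Y (crossPt κ v u 0 j)) ≤ 0 ∨
      0 < (Y (q k) - t) * (t - Y (crossPt κ v u 0 j)))
    (hj' : 0 < (Y (crossPt κ v u 0 j') - t) * (t - Y (crossPt κ v u 0 j))) :
    ∃ c, q c ∈ σ ∧ ((u j ∈ σ ∧ 0 < (Y (q c) - t) * (t - Y (crossPt κ v u 0 j))) ∨
      (u j' ∈ σ ∧ (Y (q c) - Y (crossPt κ v u 0 j)) * (t - Y (crossPt κ v u 0 j)) ≤ 0)) := by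
  obtain ⟨hv, ⟨a, ha, ha0⟩, ⟨b, hb, hb0⟩⟩ := hw
  have hσf := hT.simplex σ hσ
  have hty : t ≠ Y (crossPt κ v u 0 j) := fun he => by rw [he] at hj'; simp at hj'
  have hsq : 0 < (t - Y (crossPt κ v u 0 j)) * (t - Y (crossPt κ v u 0 j)) :=
    mul_self_pos.2 (sub_ne_zero.2 hty)
  have hv01 : v 0 ≠ v 1 := fun he => by simpa using h.v_inj he
  -- a vertex of the polygon and one of the edge `u`, on different sides of the half-plane
  have key : ∀ c k, q c ∈ σ → u k ∈ σ →
      (Y (q c) - t) * (Y (crossPt κ v u 0 k) - t) < 0 →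
      ∃ c, q c ∈ σ ∧ ((u j ∈ σ ∧ 0 < (Y (q c) - t) * (t - Y (crossPt κ v u 0 j))) ∨
      (u j' ∈ σ ∧ (Y (q c) - Y (crossPt κ v u 0 j)) * (t - Y (crossPt κ v u 0 j)) ≤ 0)) := by
    intro c k hcσ hk hlt
    refine ⟨c, hcσ, ?_⟩
    rcases Fin.eq_or_eq_of_ne hjj k with rfl | rfl
    · exact Or.inl ⟨hk, by linarith⟩
    · refine Or.inr ⟨hk, (hq c).resolve_right fun h1 => ?_⟩
      have h2 := mul_pos h1 hj'
      have h3 := mul_neg_of_neg_of_pos hlt hsq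
      linarith
  rcases mem_vertexFinset.1 (hσf.subset ha) with ⟨k, rfl⟩ | ⟨i, rfl⟩ | ⟨k, rfl⟩
  · rw [h.sweep_q] at ha0
    rcases mem_vertexFinset.1 (hσf.subset hb) with ⟨l, rfl⟩ | ⟨i, rfl⟩ | ⟨l, rfl⟩
    · rw [h.sweep_q] at hb0
      exfalso
      have hkl : Y (q k) < Y (q l) := by linarith
      have hV := hasVerts_of_mem hσf (hv 0) (hv 1) ha hb hv01 (h.q_ne_v _ _).symm
        (h.q_ne_v _ _).symm (h.q_ne_v _ _).symm (h.q_ne_v _ _).symm fun he => by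
          rw [he] at hkl; exact lt_irrefl _ hkl
      have hju : u j ∉ σ := fun hju => by
        rcases (hV _).1 hju with h1 | h1 | h1 | h1
        · exact h.v_ne_u _ _ h1.symm
        · exact h.v_ne_u _ _ h1.symm
        · exact h.q_ne_u _ _ h1.symm
        · exact h.q_ne_u _ _ h1.symm
      refine h.false_of_chord hc hT hσ hv hju ha hb hkl ?_ ?_
      · rcases lt_or_gt_of_ne hty with h1 | h1
        · linarith
        · rcases hq k with h2 | h2
          · by_contra h3
            have := mul_pos (sub_pos.2 (not_le.1 h3)) (sub_pos.2 h1)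
            linarith
          · have := mul_neg_of_neg_of_pos ha0 (sub_pos.2 h1)
            linarith
      · rcases lt_or_gt_of_ne hty with h1 | h1
        · rcases hq l with h2 | h2
          · by_contra h3
            have := mul_pos_of_neg_of_neg (sub_neg.2 (not_le.1 h3)) (sub_neg.2 h1)
            linarith
          · have := mul_neg_of_pos_of_neg hb0 (sub_neg.2 h1)
            linarith
        · linarith
    · rw [h.sweep_v] at hb0; exact absurd hb0 (lt_irrefl _)
    · rw [h.sweep_u_pos] at hb0
      exact key k l ha hb (mul_neg_of_neg_of_pos ha0 (sub_pos.2 hb0))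
  · rw [h.sweep_v] at ha0; exact absurd ha0 (lt_irrefl _)
  · rw [h.sweep_u_neg] at ha0
    rcases mem_vertexFinset.1 (hσf.subset hb) with ⟨l, rfl⟩ | ⟨i, rfl⟩ | ⟨l, rfl⟩
    · rw [h.sweep_q] at hb0
      exact key l k hb ha (mul_neg_of_pos_of_neg hb0 (sub_neg.2 ha0))
    · rw [h.sweep_v] at hb0; exact absurd hb0 (lt_irrefl _)
    · rw [h.sweep_u_pos] at hb0
      exfalso
      have hkl : k ≠ l := by rintro rfl; linarith
      refine hc.noMid σ hσ hv fun n => ?_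
      rcases Fin.eq_or_eq_of_ne hkl n with rfl | rfl <;> assumption

/-- The gap just above a vertex `q c` that is below the height of `u j` is covered by a tetrahedron
with the vertices `q c`, `u j`. -/
lemma exists_gap_above (h : Frame m q v u X Y Z r φ κ) (hz : Zigzag m q x Y r α p)
    (hT : IsDissection (vertexFinset q v u : Set (Euc 3)) T) (hσ : σ ∈ T) (hv : ∀ i, v i ∈ σ)
    {j : Fin 2} (hj : u j ∈ σ) {c : Fin m} (hc : q c ∈ σ)
    (hlt : Y (q c) < Y (crossPt κ v u 0 j)) :
    ∃ s, s + 1 < m ∧ p (s + 1) = c ∧ s ∉ edgeGaps T q v u p := by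
  obtain ⟨k, hk⟩ := (h.exists_Y_lt j).2
  obtain ⟨s, hs, rfl⟩ := hz.p_surj h.r_pos c
  obtain ⟨s', hs', rfl⟩ := hz.p_surj h.r_pos k
  have h1 : s' < s := (hz.y_lt_iff h.r_pos hs' hs).1 (hlt.trans hk)
  obtain ⟨s, rfl⟩ : ∃ n, s = n + 1 := ⟨s - 1, by omega⟩
  obtain ⟨t, ht, ht'⟩ := exists_between (lt_min hlt (hz.y_lt h.r_pos (Nat.lt_succ_self s) hs))
  refine ⟨s, hs, rfl, h.notMem_edgeGaps hz hT hσ hj (s := t) ⟨hv, ⟨_, hc, ?_⟩, ⟨_, hj, ?_⟩⟩ ht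
    (lt_min_iff.1 ht').2⟩
  · rw [h.sweep_q]; linarith
  · exact h.sweep_u_pos.2 (lt_min_iff.1 ht').1

/-- The gap just below a vertex `q c` that is above the height of `u j` is covered by a tetrahedron
with the vertices `q c`, `u j`. -/
lemma exists_gap_below (h : Frame m q v u X Y Z r φ κ) (hz : Zigzag m q x Y r α p)
    (hT : IsDissection (vertexFinset q v u : Set (Euc 3)) T) (hσ : σ ∈ T) (hv : ∀ i, v i ∈ σ)
    {j : Fin 2} (hj : u j ∈ σ) {c : Fin m} (hc : q c ∈ σ)
    (hlt : Y (crossPt κ v u 0 j) < Y (q c)) :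
    ∃ s, s + 1 < m ∧ p s = c ∧ s ∉ edgeGaps T q v u p := by
  obtain ⟨k, hk⟩ := (h.exists_Y_lt j).1
  obtain ⟨s, hs, rfl⟩ := hz.p_surj h.r_pos c
  obtain ⟨s', hs', rfl⟩ := hz.p_surj h.r_pos k
  have h1 : s < s' := (hz.y_lt_iff h.r_pos hs hs').1 (hk.trans hlt)
  obtain ⟨t, ht, ht'⟩ := exists_between (max_lt hlt
    (hz.y_lt h.r_pos (Nat.lt_succ_self s) (by omega)))
  refine ⟨s, by omega, rfl, h.notMem_edgeGaps hz hT hσ hj (s := t)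
    ⟨hv, ⟨_, hj, ?_⟩, ⟨_, hc, ?_⟩⟩ (max_lt_iff.1 ht).2 ht'⟩
  · exact h.sweep_u_neg.2 (max_lt_iff.1 ht).1
  · rw [h.sweep_q]; linarith

lemma card_edgeGaps_of_notMem {s : ℕ} (hs : s + 1 < m) (h : s ∉ edgeGaps T q v u p) :
    (edgeGaps T q v u p).card + 2 ≤ m := by
  have : insert s (edgeGaps T q v u p) ⊆ Finset.range (m - 1) := by
    intro t ht
    rw [Finset.mem_range]
    rcases Finset.mem_insert.1 ht with rfl | ht
    · omega
    · exact (mem_edgeGaps.1 ht).1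
  have := Finset.card_le_card this
  rw [Finset.card_insert_of_notMem h, Finset.card_range] at this
  omega

lemma card_edgeGaps_of_notMem₂ {s s' : ℕ} (hss : s ≠ s') (hs : s + 1 < m) (hs' : s' + 1 < m)
    (h : s ∉ edgeGaps T q v u p) (h' : s' ∉ edgeGaps T q v u p) :
    (edgeGaps T q v u p).card + 3 ≤ m := by
  have : insert s (insert s' (edgeGaps T q v u p)) ⊆ Finset.range (m - 1) := by
    intro t ht
    rw [Finset.mem_range]
    rcases Finset.mem_insert.1 ht with rfl | ht
    · omega
    rcases Finset.mem_insert.1 ht with rfl | ht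
    · omega
    · exact (mem_edgeGaps.1 ht).1
  have := Finset.card_le_card this
  rw [Finset.card_insert_of_notMem (by simp [hss, h]), Finset.card_insert_of_notMem h',
    Finset.card_range] at this
  omega

/-- Near the heights of the two ends of the edge `u` there are tetrahedra at the edge `v` with one
vertex on the polygon and one on the edge `u`. They take up two gaps, unless one of them reaches
from one of these heights to the other. -/
lemma card_edgeGaps_of_crowded (h : Frame m q v u X Y Z r φ κ) (hc : Crowded T q v u X Y κ)
    (hT : IsTriangulation (vertexFinset q v u : Set (Euc 3)) T) (hz : Zigzag m q x Y r α p) :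
    (Passes T q v u Y κ ∧ (edgeGaps T q v u p).card + 2 ≤ m) ∨
      (edgeGaps T q v u p).card + 3 ≤ m := by
  obtain ⟨lo, hi, hne, hlt⟩ : ∃ lo hi : Fin 2, lo ≠ hi ∧
      Y (crossPt κ v u 0 lo) < Y (crossPt κ v u 0 hi) := by
    rcases lt_or_gt_of_ne (h.cross_Y_ne (show (0 : Fin 2) ≠ 1 by simp)) with h1 | h1
    · exact ⟨0, 1, by simp, h1⟩
    · exact ⟨1, 0, by simp, h1⟩
  have hTd := hT.toIsDissection
  obtain ⟨kl, hkl⟩ := (h.exists_Y_lt lo).1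
  obtain ⟨kh, hkh⟩ := (h.exists_Y_lt hi).2
  set yl := Y (crossPt κ v u 0 lo) with hyl
  set yh := Y (crossPt κ v u 0 hi) with hyh
  have hyj : ∀ j, Y (crossPt κ v u 0 j) = yl ∨ Y (crossPt κ v u 0 j) = yh := fun j => by
    rcases Fin.eq_or_eq_of_ne hne j with rfl | rfl
    · exact Or.inl rfl
    · exact Or.inr rfl
  -- a tetrahedron reaching from the upper end down to the lower end
  have pass_down : ∀ σ ∈ T, ∀ c, (∀ i, v i ∈ σ) → u hi ∈ σ → q c ∈ σ → Y (q c) ≤ yl →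
      Passes T q v u Y κ ∧ (edgeGaps T q v u p).card + 2 ≤ m := by
    intro σ hσ c hv hu hcσ hle
    have hd : 0 < yh - Y (q c) := by linarith
    obtain ⟨s, hs, -, hs'⟩ := h.exists_gap_above hz hTd hσ hv hu hcσ (by linarith)
    refine ⟨⟨σ, hσ, c, hi, lo, hne.symm, hv, hu, hcσ, (yh - yl) / (yh - Y (q c)),
      div_pos (by linarith) hd, (div_le_one hd).2 (by linarith), ?_⟩,
      card_edgeGaps_of_notMem hs hs'⟩
    have := div_mul_cancel₀ (yh - yl) hd.ne'
    linarith
  have pass_up : ∀ σ ∈ T, ∀ c, (∀ i, v i ∈ σ) → u lo ∈ σ → q c ∈ σ → yh ≤ Y (q c) →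
      Passes T q v u Y κ ∧ (edgeGaps T q v u p).card + 2 ≤ m := by
    intro σ hσ c hv hu hcσ hle
    have hd : 0 < Y (q c) - yl := by linarith
    obtain ⟨s, hs, -, hs'⟩ := h.exists_gap_below hz hTd hσ hv hu hcσ (by linarith)
    refine ⟨⟨σ, hσ, c, lo, hi, hne, hv, hu, hcσ, (yh - yl) / (Y (q c) - yl),
      div_pos (by linarith) hd, (div_le_one hd).2 (by linarith), ?_⟩,
      card_edgeGaps_of_notMem hs hs'⟩
    exact div_mul_cancel₀ (yh - yl) hd.ne'
  -- a height just above the lower end, and one just below the upper end, so near to it that no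
  -- vertex of the polygon is in between
  obtain ⟨t, ht, htl, hth⟩ : ∃ t, (∀ k, Y (q k) ≤ yl ∨ t < Y (q k)) ∧ yl < t ∧ t < yh := by
    have h1 : ∀ᶠ t in 𝓝[>] yl, ∀ k, Y (q k) ≤ yl ∨ t < Y (q k) := by
      refine Filter.eventually_all.2 fun k => ?_
      by_cases hk : Y (q k) ≤ yl
      · exact Filter.Eventually.of_forall fun _ => Or.inl hk
      · filter_upwards [Ioo_mem_nhdsGT (not_le.1 hk)] with t ht using Or.inr ht.2
    obtain ⟨t, h2, h3⟩ := (h1.and (Ioo_mem_nhdsGT hlt)).exists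
    exact ⟨t, h2, h3⟩
  obtain ⟨t', ht', htl', hth'⟩ : ∃ t, (∀ k, yh ≤ Y (q k) ∨ Y (q k) < t) ∧ yl < t ∧ t < yh := by
    have h1 : ∀ᶠ t in 𝓝[<] yh, ∀ k, yh ≤ Y (q k) ∨ Y (q k) < t := by
      refine Filter.eventually_all.2 fun k => ?_
      by_cases hk : yh ≤ Y (q k)
      · exact Filter.Eventually.of_forall fun _ => Or.inl hk
      · filter_upwards [Ioo_mem_nhdsLT (not_le.1 hk)] with t ht using Or.inr ht.1
    obtain ⟨t, h2, h3⟩ := (h1.and (Ioo_mem_nhdsLT hlt)).exists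
    exact ⟨t, h2, h3⟩
  -- the tetrahedra met by the half-planes at these heights
  obtain ⟨A, hA, hwA⟩ := h.exists_wedge hTd (t := t) (k := kl) (l := kh) (by linarith)
    (by linarith) (fun k he => by rcases ht k with h1 | h1 <;> linarith)
    (fun j he => by rcases hyj j with h1 | h1 <;> linarith)
  obtain ⟨B, hB, hwB⟩ := h.exists_wedge hTd (t := t') (k := kl) (l := kh) (by linarith)
    (by linarith) (fun k he => by rcases ht' k with h1 | h1 <;> linarith)
    (fun j he => by rcases hyj j with h1 | h1 <;> linarith)
  obtain ⟨a, haA, hA'⟩ := h.exists_mem_of_crowded hc hT hA hwA hne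
    (fun k => by
      rcases ht k with h1 | h1
      · exact Or.inl (mul_nonpos_of_nonpos_of_nonneg (by linarith) (by linarith))
      · exact Or.inr (mul_pos (by linarith) (by linarith)))
    (mul_pos (by linarith) (by linarith))
  obtain ⟨b, hbB, hB'⟩ := h.exists_mem_of_crowded hc hT hB hwB hne.symm
    (fun k => by
      rcases ht' k with h1 | h1
      · exact Or.inl (mul_nonpos_of_nonneg_of_nonpos (by linarith) (by linarith))
      · exact Or.inr (mul_pos_of_neg_of_neg (by linarith) (by linarith)))
    (mul_pos_of_neg_of_neg (by linarith) (by linarith))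
  rcases hA' with ⟨huA, h1⟩ | ⟨huA, h1⟩
  swap
  · refine Or.inl (pass_down A hA a hwA.mem huA haA ?_)
    by_contra h2
    have := mul_pos (sub_pos.2 (not_le.1 h2)) (sub_pos.2 htl)
    linarith
  have hat : t < Y (q a) := by
    by_contra h2
    have := mul_nonpos_of_nonpos_of_nonneg (sub_nonpos.2 (not_lt.1 h2)) (sub_pos.2 htl).le
    linarith
  rcases hB' with ⟨huB, h2⟩ | ⟨huB, h2⟩
  swap
  · refine Or.inl (pass_up B hB b hwB.mem huB hbB ?_)
    by_contra h3
    have := mul_pos_of_neg_of_neg (sub_neg.2 (not_le.1 h3)) (sub_neg.2 hth')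
    linarith
  have hbt : Y (q b) < t' := by
    by_contra h3
    have := mul_nonpos_of_nonneg_of_nonpos (sub_nonneg.2 (not_lt.1 h3)) (sub_neg.2 hth').le
    linarith
  rcases le_or_gt yh (Y (q a)) with h3 | h3
  · exact Or.inl (pass_up A hA a hwA.mem huA haA h3)
  rcases le_or_gt (Y (q b)) yl with h4 | h4
  · exact Or.inl (pass_down B hB b hwB.mem huB hbB h4)
  right
  obtain ⟨s, hs, hsa, hs'⟩ := h.exists_gap_below hz hTd hA hwA.mem huA haA (by linarith)
  obtain ⟨s₁, hs₁, hsb, hs₁'⟩ := h.exists_gap_above hz hTd hB hwB.mem huB hbB (by linarith)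
  refine card_edgeGaps_of_notMem₂ ?_ hs hs₁ hs' hs₁'
  -- if the gap were the same, `A` and `B` would be the tetrahedron spanned by the two edges
  rintro rfl
  have hba : Y (q b) < Y (q a) := by
    rw [← hsa, ← hsb]; exact hz.y_lt h.r_pos (Nat.lt_succ_self s) hs
  obtain ⟨z, hz1, hz2⟩ := exists_between hba
  have hAB : A = B := h.wedge_unique hTd hA hB (t := z)
    ⟨hwA.mem, ⟨_, huA, h.sweep_u_neg.2 (by linarith)⟩,
      ⟨_, haA, by rw [h.sweep_q]; linarith⟩⟩
    ⟨hwB.mem, ⟨_, hbB, by rw [h.sweep_q]; linarith⟩,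
      ⟨_, huB, h.sweep_u_pos.2 (by linarith)⟩⟩
  refine hc.noMid A hA hwA.mem fun n => ?_
  rcases Fin.eq_or_eq_of_ne hne n with rfl | rfl
  · exact huA
  · rw [hAB]; exact huB

/-- If a tetrahedron at the edge `v 0`, `v 1` passes from `u j` to `u j'`, then near the crossing
points on `u j` it contains the diagonals of the rectangle of the crossing points. -/
lemma exists_upSet_of_passes (h : Frame m q v u X Y Z r φ κ) (hc : Crowded T q v u X Y κ)
    (hT : IsTriangulation (vertexFinset q v u : Set (Euc 3)) T) (hp : Passes T q v u Y κ) :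
    ∃ σ ∈ T, (∀ i, v i ∈ σ) ∧ ∃ j j', j ≠ j' ∧ ∀ i i', i ≠ i' →
      crossPt κ v u i j ∈ upSet (crossPt κ v u i' j' - crossPt κ v u i j) σ := by
  obtain ⟨σ, hσ, c, j, j', hjj, hv, hj, hcσ, ρ, hρ, hρ1, hρe⟩ := hp
  refine ⟨σ, hσ, hv, j, j', hjj, fun i i' hii => ?_⟩
  have hσf := hT.simplex σ hσ
  have hV := hasVerts_of_mem hσf hcσ (hv i) (hv i') hj (h.q_ne_v _ _) (h.q_ne_v _ _)
    (h.q_ne_u _ _) (fun he => hii (h.v_inj he)) (h.v_ne_u _ _) (h.v_ne_u _ _)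
  have hj' : u j' ∉ σ := fun hj' => hc.noMid σ hσ hv fun n => by
    rcases Fin.eq_or_eq_of_ne hjj n with rfl | rfl <;> assumption
  set a := crossPt κ v u i j with ha
  have haσ : a ∈ convexHull ℝ (σ : Set (Euc 3)) :=
    (convex_convexHull ℝ _) (subset_convexHull ℝ _ (hv i)) (subset_convexHull ℝ _ hj)
      (by linarith [h.κ_lt_one]) h.κ_pos.le (by ring)
  -- the point of the cell at the height of `u j'`, which is between the crossing points there
  set w := (1 - ρ) • a + ρ • q c with hw
  have hwf : ∀ f : Euc 3 →ᵃ[ℝ] ℝ, f w = (1 - ρ) * f a + ρ * f (q c) := fun f =>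
    affine_comb₂ _ _ _ (by ring)
  have hwσ : w ∈ convexHull ℝ (σ : Set (Euc 3)) :=
    (convex_convexHull ℝ _) haσ (subset_convexHull ℝ _ hcσ) (by linarith) hρ.le (by ring)
  have hwZ : Z w = 0 := by rw [hwf, h.qZ, ha, h.cross_Z]; ring
  have hwY : Y w = Y (crossPt κ v u 0 j') := by rw [hwf, ha, h.cross_Y]; linarith
  have h1 := h.mul_neg_of_mem hT hσ hii.symm (hv i) hj' (hc.used i' j') hwσ hwZ hwY
  have hκ := h.κ_pos
  have hκ1 : 0 < 1 - κ := by linarith [h.κ_lt_one]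
  set D := X (v i') - X (v i) with hD
  have hD0 : D ≠ 0 := fun h0 => by rw [h0, mul_zero] at h1; exact lt_irrefl _ h1
  set ν := (X (crossPt κ v u i' j') - X w) / ((1 - κ) * D) with hν
  have hν0 : 0 < ν := by
    have : ν = -((X w - X (crossPt κ v u i' j')) * D) / ((1 - κ) * D ^ 2) := by
      rw [hν]; field_simp; ring
    rw [this]
    exact div_pos (by linarith) (mul_pos hκ1 (by positivity))
  have hνe : ν * ((1 - κ) * D) = X (crossPt κ v u i' j') - X w :=
    div_mul_cancel₀ _ (mul_ne_zero hκ1.ne' hD0)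
  -- hence the diagonal from `a` is in the interior of the angle, at `a`, between `w` and the
  -- crossing point of `v i'` with `u j`
  have e : crossPt κ v u i' j' = w + ν • (crossPt κ v u i' j - a) := by
    refine h.inj _ _ ?_ ?_ ?_
    · rw [affine_add_smul, affine_linear_sub, ha, cross_apply X i' j, cross_apply X i j]
      linear_combination -hνe
    · rw [affine_add_smul, affine_linear_sub, hwY, ha, h.cross_Y i', h.cross_Y i', h.cross_Y i]
      ring
    · rw [affine_add_smul, affine_linear_sub, hwZ, ha, h.cross_Z, h.cross_Z, h.cross_Z]; ring
  rw [mem_upSet]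
  filter_upwards [Ioo_mem_nhdsGT (show (0 : ℝ) < 1 / (1 + ρ + ν) by positivity)] with s hs
  have hs0 : 0 < s := hs.1
  have hs1 : s * (1 + ρ + ν) < 1 := (lt_div_iff₀ (by positivity)).1 hs.2
  have hsρ := mul_pos hs0 hρ
  have hsν := mul_pos hs0 hν0
  have h2 := hV.mem_interior hσf (x := s * ρ) (y := (1 - κ) * (1 - s * ρ - s * ν))
    (z := (1 - κ) * (s * ν)) (t := κ * (1 - s * ρ)) hsρ
    (mul_pos hκ1 (by linarith)) (mul_pos hκ1 hsν) (mul_pos hκ (by linarith)) (by ring)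
  convert h2 using 1
  rw [e, hw, ha, crossPt, crossPt]
  module

/-- Otherwise tetrahedra at both edges could be entered from a common corner of the rectangle of the
crossing points, in the direction of its diagonal, and would coincide. -/
lemma not_passes_both (h : Frame m q v u X Y Z r φ κ) (hc : Crowded T q v u X Y κ)
    (hT : IsTriangulation (vertexFinset q v u : Set (Euc 3)) T) (hp : Passes T q v u Y κ)
    (hp' : Passes T q u v (-X) (1 - κ)) : False := by
  obtain ⟨σ, hσ, hv, j, j', hjj, h1⟩ := h.exists_upSet_of_passes hc hT hp
  obtain ⟨τ, hτ, hu, i, i', hii, h2⟩ := h.swap.exists_upSet_of_passes hc.swap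
    (by rw [vertexFinset_swap]; exact hT) hp'
  have h3 := h1 i i' hii
  have h4 := h2 j j' hjj
  rw [crossPt_swap, crossPt_swap] at h4
  have := hT.toIsDissection.eq_of_mem_upSet hσ hτ h3 h4
  exact hc.noMid σ hσ hv fun n => this ▸ hu n

/-- In the critical case the bound on the tetrahedra at the two edges is not attained. -/
lemma card_edgeTets_of_crowded (h : Frame m q v u X Y Z r φ κ) (hc : Crowded T q v u X Y κ)
    (hT : IsTriangulation (vertexFinset q v u : Set (Euc 3)) T) :
    2 * ((edgeTets T v u).card + (edgeTets T u v).card) + 3 ≤ 3 * m := by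
  obtain ⟨ε, ε', α, α', p, p', hε, hz, hz', hrel⟩ := h.exists_zigzags
  have h1 := h.card_edgeTets_add hT hε hz hz' hrel
  have h2 := h.card_edgeGaps_of_crowded hc hT hz
  have h3 := h.swap.card_edgeGaps_of_crowded hc.swap (by rw [vertexFinset_swap]; exact hT) hz'
  rcases h2 with ⟨h4, h5⟩ | h4 <;> rcases h3 with ⟨h6, h7⟩ | h6
  · exact (h.not_passes_both hc hT h4 h6).elim
  all_goals omega

/-! ### The size of a triangulation -/

/-- A triangulation has at most `7 * m / 2 + 1` tetrahedra. If some tetrahedron joining the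
two edges has a vertex of the polygon, and `k` crossing points are used, the bounds add up to
`7 * m / 2 - 6 + 2 * k`, which suffices unless `k = 4`, when one tetrahedron must be saved. -/
lemma two_mul_card_le (h : Frame m q v u X Y Z r φ κ)
    (hT : IsTriangulation (vertexFinset q v u : Set (Euc 3)) T) : 2 * T.card ≤ 7 * m + 2 := by
  have hTd := hT.toIsDissection
  have hT' : IsTriangulation (vertexFinset q u v : Set (Euc 3)) T := by
    rw [vertexFinset_swap]; exact hT
  have hcard := h.card_eq hTd
  have hm := h.four_le
  have hE := h.card_edgeTets_le hT
  have hF := h.card_faceTets hTd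
  have hF' := h.swap.card_faceTets hT'.toIsDissection
  by_cases hq : ∃ τ ∈ midTets T v u, ∃ k, q k ∈ τ
  swap
  · -- the only possible middle tetrahedron is the one spanned by the two edges
    push Not at hq
    have hone : (midTets T v u).card ≤ 1 := by
      refine Finset.card_le_one.2 fun σ hσ τ hτ => ?_
      have key : ∀ σ ∈ midTets T v u, HasVerts σ (v 0) (v 1) (u 0) (u 1) := fun σ hσ =>
        (h.cell_of_mem_midTets hTd hσ).resolve_left fun ⟨k, _, _, hk, _⟩ => hq σ hσ k hk
      ext w
      rw [key σ hσ w, key τ hτ w]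
    omega
  obtain ⟨τ, hτ, k, hk⟩ := hq
  have hF1 := h.card_faceTets' hTd hτ hk
  have hF1' := h.swap.card_faceTets' hT'.toIsDissection (by rw [midTets_swap]; exact hτ) hk
  have hMF := h.card_mid_add_card_face hTd
  have hMF' := h.swap.card_mid_add_card_face hT'.toIsDissection
  rw [midTets_swap, card_usedPairs_swap] at hMF'
  have hk4 : (usedPairs T v u).card ≤ 4 := by
    simpa using Finset.card_le_univ (usedPairs T v u)
  -- the bounds for the three kinds of tetrahedra suffice if at most three crossing points are used
  by_cases hk3 : (usedPairs T v u).card ≤ 3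
  · omega
  have hused : ∀ i j, (i, j) ∈ usedPairs T v u := by
    have : usedPairs T v u = Finset.univ := by
      rw [← Finset.card_eq_iff_eq_univ]
      simp; omega
    intro i j
    rw [this]; exact Finset.mem_univ _
  by_cases hch : ∀ ρ ∈ T, ∀ a b, q a ∈ ρ → q b ∈ ρ → ∀ i j i' j',
      0 < chordFn X Y (q a) (q b) (crossPt κ v u i j) →
        ¬ chordFn X Y (q a) (q b) (crossPt κ v u i' j') < 0
  swap
  · -- a separating chord costs one more triangle
    push Not at hch
    obtain ⟨ρ, hρ, a, b, ha, hb, i, j, i', j', h1, h2⟩ := hch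
    have hab : a ≠ b := by
      rintro rfl
      rw [chordFn_apply] at h1
      simp at h1
    have := h.card_faceTets_of_chord hT hab hρ ha hb (hused i j) (hused i' j') h1 h2
    omega
  by_cases hmid : ∀ σ ∈ T, (∀ i, v i ∈ σ) → ¬ ∀ j, u j ∈ σ
  · have := h.card_edgeTets_of_crowded ⟨hused, hch, hmid⟩ hT
    obtain ⟨n, hn⟩ := h.even
    omega
  · -- the quadrangular cell of the tetrahedron on both edges counts twice
    push Not at hmid
    obtain ⟨σ, hσ, hv, hu⟩ := hmid
    have hV := hasVerts_of_mem (hT.simplex σ hσ) (hv 0) (hv 1) (hu 0) (hu 1)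
      (fun he => by simpa using h.v_inj he) (h.v_ne_u _ _) (h.v_ne_u _ _) (h.v_ne_u _ _)
      (h.v_ne_u _ _) (fun he => by simpa using h.u_inj he)
    have := h.card_mid_add_card_face' hTd hσ hV
    omega

end Frame

end

/-! ### Existence of the configuration -/

/-- The vertices of a regular `m`-gon inscribed in the unit circle of the plane of the first two
coordinates. -/
noncomputable def stdGon (m : ℕ) (k : Fin m) : Euc 3 :=
  !₂[Real.cos (2 * Real.pi * (k : ℕ) / m), Real.sin (2 * Real.pi * (k : ℕ) / m), 0]

lemma stdGon_isRegularPolygon {m : ℕ} (hm : 3 ≤ m) : IsRegularPolygon m (stdGon m) := by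
  refine ⟨hm, 0, !₂[1, 0, 0], !₂[0, 1, 0], 1, one_pos, ?_, fun k => ?_⟩
  · rw [orthonormal_iff_ite]
    intro i j
    fin_cases i <;> fin_cases j <;>
      simp [PiLp.inner_apply, EuclideanSpace.norm_eq, Fin.sum_univ_three]
  · ext i
    fin_cases i <;> simp [stdGon]

lemma stdGon_direction {m : ℕ} (hm : 3 ≤ m) (x y : ℝ) :
    !₂[x, y, 0] ∈ (affineSpan ℝ (range (stdGon m))).direction := by
  set D := (affineSpan ℝ (range (stdGon m))).direction with hD
  have hsub : ∀ j k, stdGon m j - stdGon m k ∈ D := fun j k => by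
    rw [hD, direction_affineSpan]
    exact vsub_mem_vectorSpan ℝ (mem_range_self j) (mem_range_self k)
  have hmpos : (0 : ℝ) < m := by positivity
  set δ := 2 * Real.pi / m with hδ
  have hδ0 : 0 < δ := by positivity
  have hδπ : δ < Real.pi := by
    rw [hδ, div_lt_iff₀ hmpos]
    have : (3 : ℝ) ≤ m := by exact_mod_cast hm
    nlinarith [Real.pi_pos]
  have hs : Real.sin δ ≠ 0 := (Real.sin_pos_of_pos_of_lt_pi hδ0 hδπ).ne'
  have hc : Real.cos δ < 1 := by
    rw [← Real.cos_zero]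
    exact Real.cos_lt_cos_of_nonneg_of_le_pi le_rfl hδπ.le hδ0
  have h1 := hsub ⟨1, by omega⟩ ⟨0, by omega⟩
  have h2 := hsub ⟨2, by omega⟩ ⟨0, by omega⟩
  -- solve for the coefficients of the two differences
  have hc' : 1 - Real.cos δ ≠ 0 := by linarith
  have := D.add_mem
    (D.smul_mem ((x * (2 * Real.sin δ * Real.cos δ) - y * (2 * Real.cos δ ^ 2 - 2)) /
      (2 * Real.sin δ * (1 - Real.cos δ))) h1)
    (D.smul_mem ((y * (Real.cos δ - 1) - x * Real.sin δ) /
      (2 * Real.sin δ * (1 - Real.cos δ))) h2)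
  convert this using 1
  have e1 : 2 * Real.pi * ((1 : ℕ) : ℝ) / m = δ := by rw [hδ]; push_cast; ring
  have e2 : 2 * Real.pi * ((2 : ℕ) : ℝ) / m = 2 * δ := by rw [hδ]; push_cast; ring
  have e0 : 2 * Real.pi * ((0 : ℕ) : ℝ) / m = 0 := by simp
  have hsc := Real.sin_sq_add_cos_sq δ
  ext i
  simp only [stdGon, e1, e2, e0, Real.cos_two_mul, Real.sin_two_mul, Real.cos_zero, Real.sin_zero]
  fin_cases i
  · simp
    field_simp
    ring
  · simp
    field_simp
    ring
  · simp

lemma stdGon_span {m : ℕ} {w : Euc 3} (hw : w ∈ affineSpan ℝ (range (stdGon m))) : w 2 = 0 := by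
  have hle : affineSpan ℝ (range (stdGon m)) ≤
      (LinearMap.ker (EuclideanSpace.proj (𝕜 := ℝ) (2 : Fin 3)).toLinearMap).toAffineSubspace := by
    rw [affineSpan_le]
    rintro _ ⟨k, rfl⟩
    simp [stdGon]
  simpa using hle hw

/-- Parallelism to an edge or diagonal of `stdGon m` is excluded by a nonzero determinant. -/
lemma not_parallel_stdGon {m : ℕ} {a b : Euc 3} {x y c : ℝ}
    (hab : b - a = c • (!₂[x, y, 0] : Euc 3)) {j k : Fin m}
    (h : (Real.cos (2 * Real.pi * (k : ℕ) / m) - Real.cos (2 * Real.pi * (j : ℕ) / m)) * y ≠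
      (Real.sin (2 * Real.pi * (k : ℕ) / m) - Real.sin (2 * Real.pi * (j : ℕ) / m)) * x) :
    ¬ (affineSpan ℝ {a, b}).Parallel (affineSpan ℝ {stdGon m j, stdGon m k}) := by
  rw [AffineSubspace.affineSpan_pair_parallel_iff_vectorSpan_eq]
  intro he
  have hmem : stdGon m k - stdGon m j ∈ vectorSpan ℝ {a, b} := by
    rw [he]; exact vsub_mem_vectorSpan ℝ (by simp) (by simp)
  rw [vectorSpan_pair_rev, Submodule.mem_span_singleton] at hmem
  obtain ⟨s, hs⟩ := hmem
  rw [vsub_eq_sub, hab] at hs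
  have h0 := congrArg (fun w : Euc 3 => w 0) hs
  have h1 := congrArg (fun w : Euc 3 => w 1) hs
  simp [stdGon] at h0 h1
  rw [← h0, ← h1] at h
  exact h (by ring)

/-- No edge or diagonal of `stdGon m` is parallel to the direction at angle `π / (2 * m)`: its ends
are at different distances from the line through the centre in this direction. -/
lemma sin_sub_ne {m : ℕ} (hm : 0 < m) (he : Even m) {j k : Fin m} (hjk : j ≠ k) :
    Real.sin (Real.pi / (2 * m) - 2 * Real.pi * (k : ℕ) / m) ≠
      Real.sin (Real.pi / (2 * m) - 2 * Real.pi * (j : ℕ) / m) := by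
  have hm' : (m : ℝ) ≠ 0 := by positivity
  have hπ := Real.pi_ne_zero
  rw [Ne, Real.sin_eq_sin_iff]
  rintro ⟨n, h | h⟩
  · have h1 : ((k : ℕ) : ℝ) - (j : ℕ) = n * m := by
      field_simp at h; linarith
    have h2 : ((k : ℕ) : ℤ) - (j : ℕ) = n * m := by exact_mod_cast h1
    have h3 := k.2
    have h4 := j.2
    have h5 : n = 0 := by
      by_contra h0
      rcases lt_or_gt_of_ne h0 with h0 | h0
      · nlinarith
      · nlinarith
    rw [h5] at h2
    exact hjk (Fin.ext (by omega))
  · have h1 : (1 : ℝ) = (2 * n + 1) * m + 2 * ((j : ℕ) + (k : ℕ)) := by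
      field_simp at h; linarith
    have h2 : (1 : ℤ) = (2 * n + 1) * m + 2 * ((j : ℕ) + (k : ℕ)) := by exact_mod_cast h1
    obtain ⟨l, rfl⟩ := he
    have : (2 : ℤ) ∣ 1 := ⟨(2 * n + 1) * l + ((j : ℕ) + (k : ℕ)), by push_cast at h2; linarith⟩
    norm_num at this

/-- No edge or diagonal of `stdGon m` is orthogonal to the direction at angle `π / (2 * m)`. -/
lemma cos_sub_ne {m : ℕ} (hm : 0 < m) {j k : Fin m} (hjk : j ≠ k) :
    Real.cos (Real.pi / (2 * m) - 2 * Real.pi * (k : ℕ) / m) ≠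
      Real.cos (Real.pi / (2 * m) - 2 * Real.pi * (j : ℕ) / m) := by
  have hm' : (m : ℝ) ≠ 0 := by positivity
  have hπ := Real.pi_ne_zero
  rw [Ne, Real.cos_eq_cos_iff]
  rintro ⟨n, h | h⟩
  · have h1 : ((k : ℕ) : ℝ) - (j : ℕ) = n * m := by
      field_simp at h; linarith
    have h2 : ((k : ℕ) : ℤ) - (j : ℕ) = n * m := by exact_mod_cast h1
    have h3 := k.2
    have h4 := j.2
    have h5 : n = 0 := by
      by_contra h0
      rcases lt_or_gt_of_ne h0 with h0 | h0
      · nlinarith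
      · nlinarith
    rw [h5] at h2
    exact hjk (Fin.ext (by omega))
  · have h1 : (1 : ℝ) = 2 * (n * m + ((j : ℕ) + (k : ℕ))) := by
      field_simp at h; linarith
    have h2 : (1 : ℤ) = 2 * (n * m + ((j : ℕ) + (k : ℕ))) := by exact_mod_cast h1
    omega

/-- The edges are short segments centred above and below an interior point of the polygon; the
angle `π / (2m)` avoids the directions of edges and diagonals, which are multiples of `π / m`. -/
theorem exists_isPmConfiguration {m : ℕ} (he : Even m) (hm : 4 ≤ m) :
    ∃ (q : Fin m → Euc 3) (v u : Fin 2 → Euc 3), IsPmConfiguration m q v u := by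
  have : Nonempty (Fin m) := ⟨⟨0, by omega⟩⟩
  have hm0 : 0 < m := by omega
  set K := convexHull ℝ (range (stdGon m)) with hK
  obtain ⟨x, hx⟩ := Set.Nonempty.intrinsicInterior (convex_convexHull ℝ (range (stdGon m)))
    ((range_nonempty _).convexHull)
  have hxP : x ∈ affineSpan ℝ (range (stdGon m)) := by
    rw [← affineSpan_convexHull]
    exact subset_affineSpan ℝ _ (intrinsicInterior_subset hx)
  set β := Real.pi / (2 * m) with hβ
  set a : Euc 3 := !₂[Real.cos β, Real.sin β, 0] with ha
  set b : Euc 3 := !₂[-Real.sin β, Real.cos β, 0] with hb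
  have haD : a ∈ (affineSpan ℝ (range (stdGon m))).direction := stdGon_direction (by omega) _ _
  have hbD : b ∈ (affineSpan ℝ (range (stdGon m))).direction := stdGon_direction (by omega) _ _
  have hsc := Real.sin_sq_add_cos_sq β
  have hab : inner ℝ a b = 0 := by
    simp [ha, hb, PiLp.inner_apply, Fin.sum_univ_three]; ring
  have ha0 : a ≠ 0 := fun h0 => by
    have h1 := congrArg (fun w : Euc 3 => w 0) h0
    have h2 := congrArg (fun w : Euc 3 => w 1) h0
    simp [ha] at h1 h2
    rw [h1, h2] at hsc; norm_num at hsc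
  have hb0 : b ≠ 0 := fun h0 => by
    have h1 := congrArg (fun w : Euc 3 => w 0) h0
    have h2 := congrArg (fun w : Euc 3 => w 1) h0
    simp [hb] at h1 h2
    rw [h1, h2] at hsc; norm_num at hsc
  set s : Fin 2 → ℝ := ![1, -1] with hs
  have hev : ∀ᶠ t in 𝓝 (0 : ℝ), ∀ i j, x + t • (s i • a + s j • b) ∈ intrinsicInterior ℝ K := by
    refine Filter.eventually_all.2 fun i => Filter.eventually_all.2 fun j => ?_
    refine eventually_mem_intrinsicInterior hx ?_
    rw [affineSpan_convexHull]
    exact Submodule.add_mem _ (Submodule.smul_mem _ _ haD) (Submodule.smul_mem _ _ hbD)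
  obtain ⟨t, ht, ht0⟩ := ((hev.filter_mono nhdsWithin_le_nhds).and
    (self_mem_nhdsWithin (s := Ioi (0 : ℝ)))).exists
  have ht0 : 0 < t := ht0
  set e : Euc 3 := !₂[0, 0, 1] with hee
  set v : Fin 2 → Euc 3 := fun i => x + (2 * t * s i) • a + e with hv
  set u : Fin 2 → Euc 3 := fun i => x + (2 * t * s i) • b - e with hu
  have hvs : v 1 - v 0 = (-(4 * t)) • a := by
    simp only [hv, hs, Matrix.cons_val_zero, Matrix.cons_val_one]; module
  have hus : u 1 - u 0 = (-(4 * t)) • b := by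
    simp only [hu, hs, Matrix.cons_val_zero, Matrix.cons_val_one]; module
  have h4t : -(4 * t) ≠ 0 := by linarith
  have hmem : ∀ (y : ℝ) {w : Euc 3}, w ∈ (affineSpan ℝ (range (stdGon m))).direction →
      x + y • w ∈ affineSpan ℝ (range (stdGon m)) := fun y w hw => by
    rw [add_comm]
    exact AffineSubspace.vadd_mem_of_mem_direction (Submodule.smul_mem _ y hw) hxP
  have hx2 := stdGon_span hxP
  refine ⟨stdGon m, v, u, ⟨he, stdGon_isRegularPolygon (by omega), ?_, ?_, ?_, ?_, ?_, ?_, ?_,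
    ?_, ?_⟩⟩
  · intro h0
    rw [h0, sub_self] at hvs
    exact (smul_ne_zero h4t ha0) hvs.symm
  · intro h0
    rw [h0, sub_self] at hus
    exact (smul_ne_zero h4t hb0) hus.symm
  · rw [hvs]; exact Submodule.smul_mem _ _ haD
  · rw [hus]; exact Submodule.smul_mem _ _ hbD
  · rw [hvs, hus, inner_smul_left, inner_smul_right, hab]; simp
  · intro i j
    refine ⟨⟨_, hmem (2 * t * s i) haD, _, hmem (2 * t * s j) hbD, ?_⟩, fun h => ?_, fun h => ?_⟩
    · have e1 : v i -ᵥ (x + (2 * t * s i) • a) = e := by simp only [hv, vsub_eq_sub]; abel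
      have e2 : (x + (2 * t * s j) • b) -ᵥ u j = e := by simp only [hu, vsub_eq_sub]; abel
      rw [e1, e2]
      exact SameRay.rfl
    · have := stdGon_span h
      simp [hv, hx2, ha, hee] at this
    · have := stdGon_span h
      simp [hu, hx2, hb, hee] at this
  · intro i j
    refine ⟨x + t • (s i • a + s j • b), ⟨1 / 2, 1 / 2, by norm_num, by norm_num, by norm_num, ?_⟩,
      ht i j⟩
    simp only [hv, hu]; module
  · intro j k hjk
    refine not_parallel_stdGon hvs fun h => sin_sub_ne hm0 he hjk ?_
    rw [Real.sin_sub, Real.sin_sub]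
    linarith
  · intro j k hjk
    refine not_parallel_stdGon hus fun h => cos_sub_ne hm0 hjk ?_
    rw [Real.cos_sub, Real.cos_sub]
    linarith

/-! ### Maximal sizes -/

lemma exists_isGreatest_card {d : ℕ} (A : Finset (Euc d)) (P : Finset (Finset (Euc d)) → Prop)
    (hP : ∀ D, P D → IsDissection (A : Set (Euc d)) D) (hne : ∃ D, P D) :
    ∃ k, IsGreatest {k | ∃ D, P D ∧ D.card = k} k := by
  refine BddAbove.exists_isGreatest_of_nonempty ⟨A.powerset.card, ?_⟩ ?_
  · rintro _ ⟨D, hD, rfl⟩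
    refine Finset.card_le_card fun σ hσ => Finset.mem_powerset.2 ?_
    exact_mod_cast ((hP D hD).simplex σ hσ).subset
  · obtain ⟨D, hD⟩ := hne
    exact ⟨_, D, hD, rfl⟩

theorem mainTheorem2 :
    -- the construction is possible for every even `m ≥ 4`
    (∀ m : ℕ, Even m → 4 ≤ m →
      ∃ (q : Fin m → Euc 3) (v u : Fin 2 → Euc 3), IsPmConfiguration m q v u) ∧
    -- properties of every polytope `P_m` so constructed
    (∀ (m : ℕ) (q : Fin m → Euc 3) (v u : Fin 2 → Euc 3), IsPmConfiguration m q v u →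
      IsSimplicialPolytope (polytopePm q v u) ∧
      verticesPm q v u = range q ∪ range v ∪ range u ∧
      (verticesPm q v u).ncard = m + 4 ∧
      (∀ T : Finset (Finset (Euc 3)), IsTriangulation (verticesPm q v u) T →
        (T.card : ℝ) ≤ 7 * (m : ℝ) / 2 + 1) ∧
      (∃ D : Finset (Finset (Euc 3)), IsMismatchingDissection (verticesPm q v u) D ∧
        (D.card : ℝ) = 4 * (m : ℝ) - 6) ∧
      (∃ dmax tmax : ℕ,
        IsGreatest (dissectionSizes (verticesPm q v u)) dmax ∧
        IsGreatest (triangulationSizes (verticesPm q v u)) tmax ∧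
        4 * (m : ℝ) - 6 ≤ dmax ∧
        (tmax : ℝ) ≤ 7 * (m : ℝ) / 2 + 1 ∧
        ((verticesPm q v u).ncard : ℝ) / 2 - 9 ≤ (dmax : ℝ) - tmax ∧
        (14 < m → tmax < dmax ∧
          ∀ D : Finset (Finset (Euc 3)), IsDissection (verticesPm q v u) D →
            D.card = dmax → IsMismatchingDissection (verticesPm q v u) D))) := by
  refine ⟨fun m he hm => exists_isPmConfiguration he hm, fun m q v u hconf => ?_⟩
  obtain ⟨X, Y, Z, r, φ, κ, h⟩ := hconf.exists_frame
  have hcard : (verticesPm q v u).ncard = m + 4 := by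
    rw [h.verticesPm_eq, Set.ncard_coe_finset, h.card_vertexFinset]
  have hm : (4 : ℝ) ≤ m := by exact_mod_cast h.four_le
  have htri : ∀ T : Finset (Finset (Euc 3)), IsTriangulation (verticesPm q v u) T →
      (T.card : ℝ) ≤ 7 * (m : ℝ) / 2 + 1 := by
    intro T hT
    rw [h.verticesPm_eq] at hT
    have : ((2 * T.card : ℕ) : ℝ) ≤ ((7 * m + 2 : ℕ) : ℝ) := by exact_mod_cast h.two_mul_card_le hT
    push_cast at this
    linarith
  have hdis : ∃ D : Finset (Finset (Euc 3)), IsMismatchingDissection (verticesPm q v u) D ∧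
      (D.card : ℝ) = 4 * (m : ℝ) - 6 := by
    obtain ⟨D, hD, hDc⟩ := h.exists_mismatching
    refine ⟨D, by rw [h.verticesPm_eq]; exact hD, ?_⟩
    have h6 : 6 ≤ 4 * m := by have := h.four_le; omega
    rw [hDc, Nat.cast_sub h6]
    push_cast; ring
  obtain ⟨dmax, hd⟩ : ∃ k, IsGreatest (dissectionSizes (verticesPm q v u)) k := by
    obtain ⟨D, hD, -⟩ := hdis
    rw [h.verticesPm_eq] at hD ⊢
    exact exists_isGreatest_card _ _ (fun _ => id) ⟨D, hD.1⟩
  obtain ⟨tmax, ht⟩ : ∃ k, IsGreatest (triangulationSizes (verticesPm q v u)) k := by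
    rw [h.verticesPm_eq]
    exact exists_isGreatest_card _ _ (fun _ hT => hT.toIsDissection)
      (exists_isTriangulation _ h.interior_nonempty)
  have hdmax : 4 * (m : ℝ) - 6 ≤ dmax := by
    obtain ⟨D, hD, hDc⟩ := hdis
    rw [← hDc]
    exact_mod_cast hd.2 ⟨D, hD.1, rfl⟩
  have htmax : (tmax : ℝ) ≤ 7 * (m : ℝ) / 2 + 1 := by
    obtain ⟨T, hT, hTc⟩ := ht.1
    rw [← hTc]
    exact htri T hT
  refine ⟨h.isSimplicialPolytope, ?_, hcard, htri, hdis, dmax, tmax, hd, ht, hdmax, htmax, ?_,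
    fun hm14 => ?_⟩
  · rw [h.verticesPm_eq, coe_vertexFinset]
  · rw [hcard]
    push_cast
    linarith
  · have hlt : tmax < dmax := by
      have : (14 : ℝ) < m := by exact_mod_cast hm14
      have : (tmax : ℝ) < dmax := by linarith
      exact_mod_cast this
    refine ⟨hlt, fun D hD hDc => ⟨hD, fun hT => ?_⟩⟩
    have := ht.2 ⟨D, hT, hDc⟩
    omega
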